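/- **Conventions.** Let $\hbar$ be a formal variable. A topologically free $\mathbb C[[\hbar]]$-module is $V=V_0[[\hbar]]$ with $V_0$ a complex vector space; for $U=U_0[[\hbar]]$ put $U\widehat\otimes V=(U_0\otimes V_0)[[\hbar]]$. All maps between such modules are $\mathbb C[[\hbar]]$-linear. $\mathbb C((z))[[\hbar]]$-linear extensions of maps are not written, superscripts indicate the tensor factors on which an operator acts, $\sigma$ permutes tensor factors, and a function of $x\pm y$ is expanded in nonnegative powers of $y$. In $Y(u,z)Y(v,x)$ etc. operators are composed from right to left. **$\hbar$-adic nonlocal vertex algebras.** Such an algebra is a topologically free $V$ with a vacuum vector $\mathbf 1\in V$ and a map $Y(\cdot,z):V\to \mathrm{Hom}_{\mathbb C[[\hbar]]}(V,V_0((z))[[\hbar]])$ such that * $Y(\mathbf 1,z)v=v$, $Y(v,z)\mathbf 1\in V[[z]]$ and $\lim_{z\to0}Y(v,z)\mathbf 1=v$ for $v\in V$; * for all $r,N\ge 0$ and $u_1,\dots,u_r\in V$ there is $m\ge0$ such that $\prod_{i<j}(z_i-z_j)^m\,Y(u_1,z_1)\cdots Y(u_r,z_r)$ maps $W=V/\hbar^NV$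 to $W((z_1,\dots,z_r))$; * for all $u,v\in V$, all $N$ and all $m$ such that $(z_1-z)^mY(u,z_1)Y(v,z)$ maps $W=V/\hbar^NV$ to $W((z_1,z))$, one has $z_0^{-m}\big((z_1-z)^mY(u,z_1)Y(v,z)\big)\big|_{z_1=z+z_0}=Y(Y(u,z_0)v,z)$ on $W$. Put $\partial u=\lim_{z\to0}\frac{d}{dz}Y(u,z)\mathbf 1$. Also write $Y(z)(u\otimes v)=Y(u,z)v$. **$\hbar$-adic $n$-quantum vertex algebras.** Such an object is a pair $((V_i)_{i=1}^n,(S_{ij}(z))_{i,j=1}^n)$, where $(V_i,Y_i,\mathbf 1)$ are $\hbar$-adic nonlocal vertex algebras and $S_{ij}(z):V_i\widehat\otimes V_j\to V_i\widehat\otimes V_j\widehat\otimes\mathbb C((z))[[\hbar]]$ are $\mathbb C[[\hbar]]$-module maps such that for all $1\le i,j,k\le n$: * $S_{ij}(z)(v\otimes\mathbf 1)=v\otimes\mathbf 1$ and $S_{ij}(z)(\mathbf 1\otimes u)=\mathbf 1\otimes u$ for $v\in V_i$, $u\in V_j$; * $[\partial\otimes1,S_{ij}(z)]=-\frac{d}{dz}S_{ij}(z)$,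 $[1\otimes\partial,S_{ij}(z)]=\frac{d}{dz}S_{ij}(z)$, and $S_{ji}^{21}(z)S_{ij}(-z)=1$; * for all $u,v\in V_i$ and $N$ there is $m\ge 0$ such that, as operators on $V_i$ modulo $\hbar^N$, $Y_i(u,z_1)Y_i(v,z_2)$ and $Y_i(z_2)(1\otimes Y_i(z_1))S_{ii}(z_2-z_1)(v\otimes u)$ become equal after multiplication by $(z_1-z_2)^m$; * $S_{ij}(z_1)Y_i^{12}(z_2)=Y_i^{12}(z_2)S_{ij}^{23}(z_1)S_{ij}^{13}(z_1+z_2)$ and $S_{ij}(z_1)Y_j^{23}(z_2)=Y_j^{23}(z_2)S_{ij}^{12}(z_1-z_2)S_{ij}^{13}(z_1)$; * $S_{ij}^{12}(z_1)S_{ik}^{13}(z_1+z_2)S_{jk}^{23}(z_2)=S_{jk}^{23}(z_2)S_{ik}^{13}(z_1+z_2)S_{ij}^{12}(z_1)$. **Twisted tensor products.** Let $((V_i),(S_{ij}(z)))$ be an $\hbar$-adic $n$-quantum vertex algebra. For nonempty $K=\{i_1<\dots<i_p\}$ and $L=\{j_1<\dots<j_q\}$ in $\{1,\dots,n\}$,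 the space $V_K=V_{i_1}\widehat\otimes\cdots\widehat\otimes V_{i_p}$ carries the vacuum vector $\mathbf 1\otimes\cdots\otimes\mathbf 1$, and $$S_{K,L}(z):V_K\widehat\otimes V_L\to V_K\widehat\otimes V_L\widehat\otimes\mathbb C((z))[[\hbar]]$$ is the product of all $S_{i_a,j_b}^{a,p+b}(z)$ ($1\le a\le p$, $1\le b\le q$), ordered from left to right by decreasing $a$ and, for equal $a$, by increasing $b$ (equivalently, by decreasing $a-b$, because factors with different $a$ and different $b$ act on disjoint tensor factors and commute). Equivalently, $S_{K,L}$ is determined by $S_{\{i\},\{j\}}=S_{ij}$, by $S_{\{i\},\{j\}\cup L}=S_{ij}^{12}S_{\{i\},L}^{13}$ for $j<\min L$, and by $S_{\{i\}\cup K,L}=S_{K,L}^{23}S_{\{i\},L}^{13}$ for $i<\min K$. The vertex operator map $Y_K$ of $V_K$ is defined inductively by $Y_{\{i\}}=Y_i$ and, for $i<\min K$, $$Y_{\{i\}\cup K}(z)=(Y_i(z)\otimes Y_K(z))\,S_{\{i\},K}^{23}(-z)\,\sigma^{23},$$ that is, $V_{\{i\}\cup K}=V_i\widehat\otimes_{S_{\{i\},K}}V_K$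 is the twisted tensor product. **Proposition.** Let $((V_i)_{i=1}^n,(S_{ij}(z))_{i,j=1}^n)$ be an $\hbar$-adic $n$-quantum vertex algebra and let $(K_1,\dots,K_k)$ be a partition of $\{1,\dots,n\}$ into nonempty subsets. Then $$\big((V_{K_a})_{a=1}^k,(S_{K_a,K_b}(z))_{a,b=1}^k\big)$$ is an $\hbar$-adic $k$-quantum vertex algebra. -/

import Mathlib

open scoped TensorProduct

universe u

namespace HQVA

noncomputable section

/-! ## Topologically free modules `M[[ħ]]` over `ℂ[[ħ]]` -/

/-- `M[[ħ]]` for a complex vector space `M`: the sequence `f` stands for `∑ ħⁿ f n`. -/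
def HSer (M : Type*) : Type _ := ℕ → M

namespace HSer

instance {M : Type*} [AddCommGroup M] : AddCommGroup (HSer M) :=
  inferInstanceAs (AddCommGroup (ℕ → M))

instance {M : Type*} [AddCommGroup M] [Module ℂ M] : Module ℂ (HSer M) :=
  inferInstanceAs (Module ℂ (ℕ → M))

/-- The `ħ`-bilinear extension of a biadditive operation `β`:
`(∑ ħⁱ f i, ∑ ħʲ g j) ↦ ∑ ħⁱ⁺ʲ β (f i) (g j)`. -/
def conv {A B C : Type*} [AddCommMonoid C] (β : A → B → C) (f : HSer A) (g : HSer B) : HSer C :=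
  fun n => ∑ p ∈ Finset.HasAntidiagonal.antidiagonal n, β (f p.1) (g p.2)

/-- Coefficientwise application of a map. -/
def map {A B : Type*} (φ : A → B) (f : HSer A) : HSer B := fun n => φ (f n)

/-- The constant series `x = x + 0·ħ + 0·ħ² + ⋯`. -/
def const {M : Type*} [Zero M] (x : M) : HSer M := fun n => if n = 0 then x else 0

section PowerSeriesAction

variable {M N : Type*} [AddCommGroup M] [Module ℂ M] [AddCommGroup N] [Module ℂ N]

/-- The action of `ℂ[[ħ]]` on `M[[ħ]]`. -/
instance : SMul (PowerSeries ℂ) (HSer M) :=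
  ⟨fun p f => conv (fun (c : ℂ) (x : M) => c • x) (fun n => PowerSeries.coeff n p) f⟩

theorem powerSeries_smul_apply (p : PowerSeries ℂ) (f : HSer M) (n : ℕ) :
    (p • f) n = ∑ q ∈ Finset.HasAntidiagonal.antidiagonal n, PowerSeries.coeff q.1 p • f q.2 := rfl

theorem add_apply {M : Type*} [AddCommGroup M] (f g : HSer M) (n : ℕ) : (f + g) n = f n + g n := rfl

theorem zero_apply {M : Type*} [AddCommGroup M] (n : ℕ) : (0 : HSer M) n = 0 := rfl

theorem C_smul_apply (c : ℂ) (f : HSer M) (n : ℕ) : (PowerSeries.C c • f) n = c • f n := by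
  rw [powerSeries_smul_apply, Finset.sum_eq_single (0, n)]
  · simp
  · rintro ⟨i, j⟩ hij hne
    rw [Finset.HasAntidiagonal.mem_antidiagonal] at hij
    have hi : i ≠ 0 := by
      rintro rfl
      apply hne
      simp at hij
      simp [hij]
    simp [PowerSeries.coeff_C, hi]
  · intro h
    simp at h

instance : Module (PowerSeries ℂ) (HSer M) where
  one_smul f := by
    funext n
    have := C_smul_apply (1 : ℂ) f n
    simpa using this
  mul_smul p q f := by
    funext n
    simp only [powerSeries_smul_apply, PowerSeries.coeff_mul, Finset.sum_smul, Finset.smul_sum,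
      Finset.sum_sigma', smul_smul]
    apply Finset.sum_nbij' (fun ⟨⟨_i, j⟩, ⟨k, l⟩⟩ ↦ ⟨(k, l + j), (l, j)⟩)
      (fun ⟨⟨i, _j⟩, ⟨k, l⟩⟩ ↦ ⟨(i + k, l), (i, k)⟩) <;>
      simp +contextual [add_comm, add_left_comm]
    grind
  smul_zero p := by
    funext n
    simp [powerSeries_smul_apply, zero_apply]
  smul_add p f g := by
    funext n
    simp [powerSeries_smul_apply, add_apply, Finset.sum_add_distrib]
  add_smul p q f := by
    funext n
    simp [powerSeries_smul_apply, add_apply, add_smul, Finset.sum_add_distrib]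
  zero_smul f := by
    funext n
    simp [powerSeries_smul_apply, zero_apply]

theorem X_pow_smul_apply (k : ℕ) (f : HSer M) (n : ℕ) :
    (((PowerSeries.X : PowerSeries ℂ) ^ k) • f) n = if k ≤ n then f (n - k) else 0 := by
  rw [powerSeries_smul_apply]
  split_ifs with h
  · rw [Finset.sum_eq_single (k, n - k)]
    · simp [PowerSeries.coeff_X_pow]
    · rintro ⟨i, j⟩ hij hne
      rw [Finset.HasAntidiagonal.mem_antidiagonal] at hij
      have hi : i ≠ k := by
        rintro rfl
        apply hne
        simp at hij
        simp [← hij]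
      simp [PowerSeries.coeff_X_pow, hi]
    · intro h'
      exact absurd (Finset.HasAntidiagonal.mem_antidiagonal.2 (by simp; omega)) h'
  · apply Finset.sum_eq_zero
    rintro ⟨i, j⟩ hij
    rw [Finset.HasAntidiagonal.mem_antidiagonal] at hij
    have hi : i ≠ k := by
      simp at hij
      omega
    simp [PowerSeries.coeff_X_pow, hi]

/-- The `ℂ[[ħ]]`-linear map `M[[ħ]] → N[[ħ]]` with the components `T 0, T 1, …`. -/
def toHom (T : HSer (M →ₗ[ℂ] N)) : HSer M →ₗ[PowerSeries ℂ] HSer N where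
  toFun x := conv (fun t m => t m) T x
  map_add' x y := by
    funext n
    simp [conv, add_apply, Finset.sum_add_distrib]
  map_smul' p x := by
    funext n
    simp only [conv, powerSeries_smul_apply, map_sum, map_smul, Finset.smul_sum,
      Finset.sum_sigma', RingHom.id_apply]
    apply Finset.sum_nbij' (fun ⟨⟨i, _j⟩, ⟨k, l⟩⟩ ↦ ⟨(k, i + l), (i, l)⟩)
      (fun ⟨⟨k, _j⟩, ⟨i, l⟩⟩ ↦ ⟨(i, k + l), (k, l)⟩) <;>
      simp +contextual [add_left_comm]

theorem toHom_const (T : HSer (M →ₗ[ℂ] N)) (m : M) (n : ℕ) : toHom T (const m) n = T n m := by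
  change ∑ p ∈ Finset.HasAntidiagonal.antidiagonal n, T p.1 (const m p.2) = _
  rw [Finset.sum_eq_single (n, 0)]
  · simp [const]
  · rintro ⟨i, j⟩ hij hne
    rw [Finset.HasAntidiagonal.mem_antidiagonal] at hij
    have hj : j ≠ 0 := by
      rintro rfl
      apply hne
      simp at hij
      simp [hij]
    simp [const, hj]
  · intro h
    simp at h

theorem hom_ext {T T' : HSer M →ₗ[PowerSeries ℂ] HSer N}
    (h : ∀ m : M, T (const m) = T' (const m)) : T = T' := by
  have key : ∀ (n : ℕ) (x : HSer M), T x n = T' x n := by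
    intro n
    induction n using Nat.strong_induction_on with
    | _ n ih =>
      intro x
      let x' : HSer M := fun k => x (k + 1)
      have hx : x = const (x 0) + ((PowerSeries.X : PowerSeries ℂ) ^ 1) • x' := by
        funext k
        rw [add_apply, X_pow_smul_apply]
        rcases k with _ | k <;> simp [const, x']
      rw [hx, map_add, map_add, map_smul, map_smul, add_apply, add_apply, h, X_pow_smul_apply,
        X_pow_smul_apply]
      split_ifs with hn
      · rw [ih (n - 1) (by omega)]
      · rfl
  ext x
  funext n
  exact key n x

/-- Every `ℂ[[ħ]]`-module map `M[[ħ]] → N[[ħ]]` is given by a unique series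
`∑ ħⁿ T n` of linear maps `T n : M → N`; we always write such module maps as these series. -/
def homEquiv : HSer (M →ₗ[ℂ] N) ≃ (HSer M →ₗ[PowerSeries ℂ] HSer N) where
  toFun := toHom
  invFun T := fun n =>
    { toFun := fun m => T (const m) n
      map_add' := fun a b => by
        have : (const (a + b) : HSer M) = const a + const b := by
          funext k
          by_cases hk : k = 0 <;> simp [const, add_apply, hk]
        rw [this, map_add, add_apply]
      map_smul' := fun c a => by
        have : (const (c • a) : HSer M) = PowerSeries.C c • const a := by
          funext k
          rw [C_smul_apply]
          by_cases hk : k = 0 <;> simp [const, hk]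
        rw [this, map_smul, C_smul_apply, RingHom.id_apply] }
  left_inv T := by
    funext n
    ext m
    exact toHom_const T m n
  right_inv T := by
    apply hom_ext
    intro m
    funext n
    exact toHom_const _ m n

end PowerSeriesAction

/-- Congruence modulo `ħⁿ M[[ħ]]`. -/
def CongMod {M : Type*} (n : ℕ) (f g : HSer M) : Prop := ∀ t < n, f t = g t

end HSer

open HSer

/-! ## Laurent series -/

/-- The commutative `ℂ`-algebra `ℂ((z))`. -/
def Lau : Type := LaurentSeries ℂ

instance : CommRing Lau := inferInstanceAs (CommRing (LaurentSeries ℂ))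

instance : Algebra ℂ Lau := (HahnSeries.instAlgebra : Algebra ℂ (LaurentSeries ℂ))

/-- The elements of `ℂ((z))` as Laurent series. -/
def Lau.equiv : Lau ≃ₗ[ℂ] LaurentSeries ℂ where
  toFun f := f
  invFun f := f
  left_inv _ := rfl
  right_inv _ := rfl
  map_add' _ _ := rfl
  map_smul' _ _ := rfl

/-- The commutative `ℂ`-algebra `ℂ((x))((y))`: Laurent series in the outer variable `y` whose
coefficients are Laurent series in the inner variable `x`. -/
def Lau₂ : Type := LaurentSeries Lau

instance : CommRing Lau₂ := inferInstanceAs (CommRing (LaurentSeries Lau))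

instance : Algebra ℂ Lau₂ := (HahnSeries.instAlgebra : Algebra ℂ (LaurentSeries Lau))

/-- The elements of `ℂ((x))((y))` as Laurent series. -/
def Lau₂.equiv : Lau₂ ≃ₗ[ℂ] LaurentSeries Lau where
  toFun f := f
  invFun f := f
  left_inv _ := rfl
  right_inv _ := rfl
  map_add' _ _ := rfl
  map_smul' _ _ := rfl

section Laurent

variable {M N P : Type*} [AddCommGroup M] [Module ℂ M] [AddCommGroup N] [Module ℂ N]
  [AddCommGroup P] [Module ℂ P]

/-- Coefficientwise application `M((z)) → N((z))` of a linear map `M → N`. -/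
def laurMap (φ : M →ₗ[ℂ] N) : LaurentSeries M →ₗ[ℂ] LaurentSeries N where
  toFun x := x.map φ
  map_add' x y := by ext; simp
  map_smul' c x := by ext; simp

theorem cauchy_support_finite (β : M →ₗ[ℂ] N →ₗ[ℂ] P) (x : LaurentSeries M) (y : LaurentSeries N)
    (n : ℤ) : (Function.support fun i : ℤ => β (x.coeff i) (y.coeff (n - i))).Finite := by
  apply (Set.finite_Icc x.order (n - y.order)).subset
  intro i hi
  rw [Function.mem_support] at hi
  constructor
  · by_contra hlt
    exact hi (by simp [HahnSeries.coeff_eq_zero_of_lt_order (not_le.1 hlt)])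
  · by_contra hlt
    exact hi (by
      rw [HahnSeries.coeff_eq_zero_of_lt_order (x := y) (by linarith [not_le.1 hlt]), map_zero])

/-- The Cauchy product of two Laurent series with respect to `β`: the coefficient of `zⁿ` is
`∑ᵢ β (x i) (y (n - i))`, a finite sum. -/
def cauchyFun (β : M →ₗ[ℂ] N →ₗ[ℂ] P) (x : LaurentSeries M) (y : LaurentSeries N) :
    LaurentSeries P :=
  HahnSeries.ofSuppBddBelow (fun n : ℤ => ∑ᶠ i : ℤ, β (x.coeff i) (y.coeff (n - i))) (by
    refine ⟨x.order + y.order, fun n hn => ?_⟩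
    by_contra hlt
    apply hn
    refine (finsum_congr fun i => ?_).trans finsum_zero
    rcases lt_or_ge i x.order with hi | hi
    · simp [HahnSeries.coeff_eq_zero_of_lt_order hi]
    · rw [HahnSeries.coeff_eq_zero_of_lt_order (x := y) (by linarith [not_le.1 hlt]), map_zero])

theorem cauchyFun_coeff (β : M →ₗ[ℂ] N →ₗ[ℂ] P) (x : LaurentSeries M) (y : LaurentSeries N)
    (n : ℤ) : (cauchyFun β x y).coeff n = ∑ᶠ i : ℤ, β (x.coeff i) (y.coeff (n - i)) := rfl

/-- The Cauchy product as a bilinear map `M((z)) × N((z)) → P((z))`. -/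
def cauchy (β : M →ₗ[ℂ] N →ₗ[ℂ] P) :
    LaurentSeries M →ₗ[ℂ] LaurentSeries N →ₗ[ℂ] LaurentSeries P :=
  LinearMap.mk₂ ℂ (cauchyFun β)
    (by
      intro x x' y
      ext n
      rw [HahnSeries.coeff_add, cauchyFun_coeff, cauchyFun_coeff, cauchyFun_coeff,
        ← finsum_add_distrib (cauchy_support_finite β x y n) (cauchy_support_finite β x' y n)]
      simp)
    (by
      intro c x y
      ext n
      rw [HahnSeries.coeff_smul, cauchyFun_coeff, cauchyFun_coeff,
        smul_finsum' c (cauchy_support_finite β x y n)]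
      simp)
    (by
      intro x y y'
      ext n
      rw [HahnSeries.coeff_add, cauchyFun_coeff, cauchyFun_coeff, cauchyFun_coeff,
        ← finsum_add_distrib (cauchy_support_finite β x y n) (cauchy_support_finite β x y' n)]
      simp)
    (by
      intro c x y
      ext n
      rw [HahnSeries.coeff_smul, cauchyFun_coeff, cauchyFun_coeff,
        smul_finsum' c (cauchy_support_finite β x y n)]
      simp)

/-- The canonical map `M((z)) ⊗ N((z)) → (M ⊗ N)((z))`. -/
def laurTensor : LaurentSeries M ⊗[ℂ] LaurentSeries N →ₗ[ℂ] LaurentSeries (M ⊗[ℂ] N) :=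
  TensorProduct.lift (cauchy (TensorProduct.mk ℂ M N))

/-- The multiplication map `ℂ((z)) ⊗ M((z)) → M((z))`. -/
def laurSMul : Lau ⊗[ℂ] LaurentSeries M →ₗ[ℂ] LaurentSeries M :=
  TensorProduct.lift (cauchy (LinearMap.lsmul ℂ M) ∘ₗ Lau.equiv.toLinearMap)

/-- The multiplication map `ℂ((x))((y)) ⊗ M((x))((y)) → M((x))((y))`. -/
def laurSMul₂ : Lau₂ ⊗[ℂ] LaurentSeries (LaurentSeries M) →ₗ[ℂ] LaurentSeries (LaurentSeries M) :=
  TensorProduct.lift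
    (cauchy (cauchy (LinearMap.lsmul ℂ M) ∘ₗ Lau.equiv.toLinearMap) ∘ₗ Lau₂.equiv.toLinearMap)

/-- The canonical map `ℂ((x))((y)) ⊗ M((y)) → (ℂ((x)) ⊗ M)((y))`. -/
def laurTensor₂ : Lau₂ ⊗[ℂ] LaurentSeries M →ₗ[ℂ] LaurentSeries (Lau ⊗[ℂ] M) :=
  TensorProduct.lift (cauchy (TensorProduct.mk ℂ Lau M) ∘ₗ Lau₂.equiv.toLinearMap)

/-- The canonical map `M ⊗ N((z)) → (M ⊗ N)((z))`. -/
def laurTensorL : M ⊗[ℂ] LaurentSeries N →ₗ[ℂ] LaurentSeries (M ⊗[ℂ] N) :=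
  TensorProduct.lift
    ((cauchy (TensorProduct.mk ℂ M N)) ∘ₗ HahnSeries.single.linearMap (R := ℂ) (0 : ℤ))

/-- The canonical map `M((z)) ⊗ N → (M ⊗ N)((z))`. -/
def laurTensorR : LaurentSeries M ⊗[ℂ] N →ₗ[ℂ] LaurentSeries (M ⊗[ℂ] N) :=
  TensorProduct.lift
    ((cauchy (TensorProduct.mk ℂ M N)).compl₂ (HahnSeries.single.linearMap (R := ℂ) (0 : ℤ)))

end Laurent

/-! ### Substitutions `f(z) ↦ f(-z), f(x), f(y), f(x ± y)` -/

/-- `f(z) ↦ f(-z)`. -/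
def substNegAux : LaurentSeries ℂ →ₗ[ℂ] LaurentSeries ℂ where
  toFun f := HahnSeries.ofSuppBddBelow (fun n : ℤ => (-1 : ℂ) ^ n * f.coeff n) ⟨f.order, by
    intro n hn
    by_contra hlt
    exact hn (by simp [HahnSeries.coeff_eq_zero_of_lt_order (not_le.1 hlt)])⟩
  map_add' f g := by
    ext n
    change (-1 : ℂ) ^ n * (f + g).coeff n = (-1 : ℂ) ^ n * f.coeff n + (-1 : ℂ) ^ n * g.coeff n
    simp [mul_add]
  map_smul' c f := by
    ext n
    change (-1 : ℂ) ^ n * (c • f).coeff n = c * ((-1 : ℂ) ^ n * f.coeff n)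
    simp [mul_left_comm]

/-- `f(z) ↦ f(-z)`. -/
def substNeg : Lau →ₗ[ℂ] Lau :=
  Lau.equiv.symm.toLinearMap ∘ₗ substNegAux ∘ₗ Lau.equiv.toLinearMap

/-- `f(z) ↦ f'(z)`. -/
def lauDeriv : Lau →ₗ[ℂ] Lau :=
  Lau.equiv.symm.toLinearMap ∘ₗ LaurentSeries.derivative ℂ ∘ₗ Lau.equiv.toLinearMap

/-- `f(z) ↦ f⁽ʲ⁾(z) / j!`. -/
def lauHasse (j : ℕ) : Lau →ₗ[ℂ] Lau :=
  Lau.equiv.symm.toLinearMap ∘ₗ LaurentSeries.hasseDeriv ℂ j ∘ₗ Lau.equiv.toLinearMap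

/-- `f(z) ↦ f(x)` with `x` the inner variable of `ℂ((x))((y))`. -/
def substInner : Lau →ₗ[ℂ] Lau₂ :=
  Lau₂.equiv.symm.toLinearMap ∘ₗ HahnSeries.single.linearMap (0 : ℤ)

/-- `f(z) ↦ f(y)` with `y` the outer variable of `ℂ((x))((y))`. -/
def substOuter : Lau →ₗ[ℂ] Lau₂ :=
  Lau₂.equiv.symm.toLinearMap ∘ₗ laurMap (Algebra.linearMap ℂ Lau) ∘ₗ Lau.equiv.toLinearMap

/-- `f(z) ↦ f(x + c y) = ∑_{j ≥ 0} (f⁽ʲ⁾(x) / j!) cʲ yʲ`, expanded in nonnegative powers of the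
outer variable `y`. -/
def substAddAux (c : ℂ) : Lau →ₗ[ℂ] LaurentSeries Lau where
  toFun f := HahnSeries.ofSuppBddBelow
    (fun n : ℤ => if 0 ≤ n then c ^ n.toNat • lauHasse n.toNat f else 0) ⟨0, by
      intro n hn
      by_contra hlt
      exact hn (if_neg hlt)⟩
  map_add' f g := by
    refine HahnSeries.ext (funext fun n => ?_)
    rw [HahnSeries.coeff_add]
    simp only [HahnSeries.ofSuppBddBelow]
    split_ifs <;> simp
  map_smul' a f := by
    refine HahnSeries.ext (funext fun n => ?_)
    rw [RingHom.id_apply, HahnSeries.coeff_smul]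
    simp only [HahnSeries.ofSuppBddBelow]
    split_ifs
    · rw [map_smul, smul_comm]
    · simp

/-- `f(z) ↦ f(x + c y)` in `ℂ((x))((y))`, expanded in nonnegative powers of `y`. -/
def substAdd (c : ℂ) : Lau →ₗ[ℂ] Lau₂ := Lau₂.equiv.symm.toLinearMap ∘ₗ substAddAux c

/-! ## Operators with values in `B ⊗̂ R` -/

/-- For a commutative `ℂ`-algebra `R` such as `ℂ((z))` or `ℂ((x))((y))`, the `ℂ[[ħ]]`-module maps
from `A[[ħ]]` to `(R ⊗ B)[[ħ]]` (scalars are written on the left). -/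
abbrev Op (R : Type) [CommRing R] [Algebra ℂ R] (A B : Type*)
    [AddCommGroup A] [Module ℂ A] [AddCommGroup B] [Module ℂ B] : Type _ :=
  HSer (A →ₗ[ℂ] R ⊗[ℂ] B)

section Op

variable {R : Type} [CommRing R] [Algebra ℂ R]
  {A B C D E F : Type*} [AddCommGroup A] [Module ℂ A] [AddCommGroup B] [Module ℂ B]
  [AddCommGroup C] [Module ℂ C] [AddCommGroup D] [Module ℂ D]
  [AddCommGroup E] [Module ℂ E] [AddCommGroup F] [Module ℂ F]

/-- The composition `S T`, where `S` is extended `R`-linearly. -/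
def Op.comp (S : Op R B C) (T : Op R A B) : Op R A C :=
  conv (fun s t => (LinearMap.liftBaseChange R s).restrictScalars ℂ ∘ₗ t) S T

/-- The identity operator. -/
def Op.one : Op R A A := const (TensorProduct.mk ℂ R A 1)

/-- The operator obtained by applying a linear map `φ : ℂ((z)) → R` (a substitution, say) to the
scalars in `S(z)`. -/
def Op.subst (φ : Lau →ₗ[ℂ] R) (S : Op Lau A B) : Op R A B :=
  S.map fun s => φ.rTensor B ∘ₗ s

/-- `S(-z)`. -/
def Op.atNeg (S : Op Lau A B) : Op Lau A B := Op.subst (R := Lau) substNeg S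

/-- `S(x)`, with values in `ℂ((x))((y))`. -/
def Op.atInner (S : Op Lau A B) : Op Lau₂ A B := Op.subst (R := Lau₂) substInner S

/-- `S(y)`, with values in `ℂ((x))((y))`. -/
def Op.atOuter (S : Op Lau A B) : Op Lau₂ A B := Op.subst (R := Lau₂) substOuter S

/-- `S(x + y)`, expanded in nonnegative powers of `y`. -/
def Op.atSum (S : Op Lau A B) : Op Lau₂ A B := Op.subst (R := Lau₂) (substAdd 1) S

/-- `S(x - y)`, expanded in nonnegative powers of `y`. -/
def Op.atDiff (S : Op Lau A B) : Op Lau₂ A B := Op.subst (R := Lau₂) (substAdd (-1)) S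

/-- `(d/dz) S(z)`. -/
def Op.ddz (S : Op Lau A B) : Op Lau A B :=
  Op.subst (R := Lau) lauDeriv S

/-- The commutator `[d, S]` of an operator `S` on `A` with `d : A[[ħ]] → A[[ħ]]`. -/
def Op.bracket (d : HSer (A →ₗ[ℂ] A)) (S : Op R A A) : Op R A A :=
  conv (fun d s => d.lTensor R ∘ₗ s) d S - conv (fun s d => s ∘ₗ d) S d

/-- Transport of an operator along linear isomorphisms of its source and target. -/
def Op.conj (e : A ≃ₗ[ℂ] C) (e' : B ≃ₗ[ℂ] D) (S : Op R A B) : Op R C D :=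
  S.map fun s => (e'.toLinearMap.lTensor R) ∘ₗ s ∘ₗ e.symm.toLinearMap

/-- `S¹²` on `A ⊗ B ⊗ C`. -/
def Op.leg12 (C : Type*) [AddCommGroup C] [Module ℂ C] (S : Op R (A ⊗[ℂ] B) (A ⊗[ℂ] B)) :
    Op R (A ⊗[ℂ] (B ⊗[ℂ] C)) (A ⊗[ℂ] (B ⊗[ℂ] C)) :=
  Op.conj (TensorProduct.assoc ℂ A B C) (TensorProduct.assoc ℂ A B C)
    (S.map fun s => (TensorProduct.assoc ℂ R (A ⊗[ℂ] B) C).toLinearMap ∘ₗ s.rTensor C)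

/-- `S²³` on `A ⊗ B`, `B` being itself a tensor product on which `S` acts. -/
def Op.leg23 (A : Type*) [AddCommGroup A] [Module ℂ A] (S : Op R B B) :
    Op R (A ⊗[ℂ] B) (A ⊗[ℂ] B) :=
  S.map fun s => (TensorProduct.leftComm ℂ A R B).toLinearMap ∘ₗ s.lTensor A

/-- `S¹³` on `A ⊗ B ⊗ C`. -/
def Op.leg13 (B : Type*) [AddCommGroup B] [Module ℂ B] (S : Op R (A ⊗[ℂ] C) (A ⊗[ℂ] C)) :
    Op R (A ⊗[ℂ] (B ⊗[ℂ] C)) (A ⊗[ℂ] (B ⊗[ℂ] C)) :=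
  Op.conj (TensorProduct.leftComm ℂ B A C) (TensorProduct.leftComm ℂ B A C) (Op.leg23 B S)

/-- `S²¹ = σ S σ` on `A ⊗ B`, where `S` acts on `B ⊗ A` and `σ` is the flip. -/
def Op.flip (S : Op R (B ⊗[ℂ] A) (B ⊗[ℂ] A)) : Op R (A ⊗[ℂ] B) (A ⊗[ℂ] B) :=
  Op.conj (TensorProduct.comm ℂ B A) (TensorProduct.comm ℂ B A) S

end Op

/-! ## `ħ`-adic nonlocal vertex algebras -/

/-- The data of an `ħ`-adic nonlocal vertex algebra on `V = V₀[[ħ]]`: the complex vector space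
`V₀ = carrier`, the vacuum vector `vac ∈ V` and the vertex operator map, a `ℂ[[ħ]]`-module map
`Y(z) : V ⊗̂ V → V₀((z))[[ħ]]`. -/
structure VAData : Type (u + 1) where
  /-- The space `V₀` with `V = V₀[[ħ]]`. -/
  carrier : Type u
  [instAddCommGroup : AddCommGroup carrier]
  [instModule : Module ℂ carrier]
  /-- The vacuum vector. -/
  vac : HSer carrier
  /-- The vertex operator map. -/
  Y : HSer (carrier ⊗[ℂ] carrier →ₗ[ℂ] LaurentSeries carrier)

attribute [instance] VAData.instAddCommGroup VAData.instModule

namespace VAData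

variable (V : VAData.{u})

/-- `Y(u, z) v ∈ V₀((z))[[ħ]]`. -/
def app (u v : HSer V.carrier) : HSer (LaurentSeries V.carrier) :=
  conv (fun y x => y x) V.Y (conv (fun a b => a ⊗ₜ[ℂ] b) u v)

/-- The coefficient of `z^m` in `Y(u, z) v`, an element of `V`. (In the usual notation,
`mode m u v` is `u_{-m-1} v`.) -/
def mode (m : ℤ) (u v : HSer V.carrier) : HSer V.carrier :=
  (V.app u v).map fun f => f.coeff m

/-- The canonical derivation `∂ u = lim_{z → 0} (d/dz) Y(u, z) 𝟙`, that is, the coefficient of `z`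
in `Y(u, z) 𝟙`. -/
def deriv : HSer (V.carrier →ₗ[ℂ] V.carrier) :=
  conv (fun y e => HahnSeries.coeff.linearMap (R := ℂ) (1 : ℤ) ∘ₗ y ∘ₗ
    (TensorProduct.mk ℂ V.carrier V.carrier).flip e) V.Y V.vac

/-- The coefficient of `z₁^{m₁} ⋯ z_r^{m_r}` in `Y(u₁, z₁) ⋯ Y(u_r, z_r) w`. -/
def product {r : ℕ} (u : Fin r → HSer V.carrier) (w : HSer V.carrier) (m : Fin r → ℤ) :
    HSer V.carrier :=
  Fin.foldr r (fun i x => V.mode (m i) (u i) x) w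

end VAData

section Distributions

variable {M : Type*} [AddCommGroup M] [Module ℂ M] {r : ℕ}

/-- The product of a polynomial in `z₁, …, z_r` and a formal distribution
`∑ D(m) z₁^{m₁} ⋯ z_r^{m_r}`. -/
def polyMul (p : MvPolynomial (Fin r) ℂ) (D : (Fin r → ℤ) → M) (m : Fin r → ℤ) : M :=
  ∑ s ∈ p.support, p.coeff s • D fun i => m i - (s i : ℤ)

/-- `∏_{i < j} (z_i - z_j)^k`. -/
def vandermondePow (r k : ℕ) : MvPolynomial (Fin r) ℂ :=
  ∏ i : Fin r, ∏ j ∈ Finset.Ioi i, (MvPolynomial.X i - MvPolynomial.X j) ^ k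

/-- Modulo `ħⁿ`, the formal distribution `D` over `M[[ħ]]` lies in `W((z₁, …, z_r))`, where
`W = M[[ħ]] / ħⁿ M[[ħ]]`: the exponents of all variables are bounded below. -/
def IsLaurentMod (n : ℕ) (D : (Fin r → ℤ) → HSer M) : Prop :=
  ∃ N : ℤ, ∀ m : Fin r → ℤ, (∃ i, m i < N) → CongMod n (D m) 0

/-- For `G(z₁, z) = ∑ G(a, b) z₁^a z^b` in `M((z₁, z))`, the coefficient of `z₀^q z^p` in
`G(z + z₀, z)`, expanded in nonnegative powers of `z₀`. -/
def shiftCoeff (G : (Fin 2 → ℤ) → M) (q p : ℤ) : M :=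
  if 0 ≤ q then ∑ᶠ a : ℤ, (Ring.choose a q.toNat : ℤ) • G ![a, p + q - a] else 0

end Distributions

/-- `ħ`-adic nonlocal vertex algebras. -/
structure VAData.IsNonlocal (V : VAData.{u}) : Prop where
  /-- `Y(𝟙, z) v = v`. -/
  vac_left : ∀ v : HSer V.carrier,
    V.app V.vac v = v.map fun x => HahnSeries.single (0 : ℤ) x
  /-- `Y(v, z) 𝟙 ∈ V[[z]]`. -/
  vac_right_regular : ∀ (v : HSer V.carrier) (m : ℤ), m < 0 → V.mode m v V.vac = 0
  /-- `lim_{z → 0} Y(v, z) 𝟙 = v`. -/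
  vac_right : ∀ v : HSer V.carrier, V.mode 0 v V.vac = v
  /-- The set of all `Y(u, z)` is `ħ`-adically compatible: for each finite sequence
  `u₁, …, u_r` and each `n`, for some `k`,
  `∏_{i<j} (z_i - z_j)^k Y(u₁, z₁) ⋯ Y(u_r, z_r)` maps
  `W = V / ħⁿ V` to `W((z₁, …, z_r))`. -/
  compatible : ∀ (r : ℕ) (u : Fin r → HSer V.carrier) (n : ℕ), ∃ k : ℕ, ∀ w : HSer V.carrier,
    IsLaurentMod n (polyMul (vandermondePow r k) (V.product u w))
  /-- `Y_ℰ(Y(u, z), z₀) Y(v, z) = Y(Y(u, z₀) v, z)`, where, modulo `ħⁿ`, the left side is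
  `z₀^{-k} ((z₁ - z)^k Y(u, z₁) Y(v, z))|_{z₁ = z + z₀}` for any `k` such that
  `(z₁ - z)^k Y(u, z₁) Y(v, z)` maps `W = V / ħⁿ V` to `W((z₁, z))`. -/
  assoc : ∀ (u v : HSer V.carrier) (n k : ℕ),
    (∀ w : HSer V.carrier, IsLaurentMod n (polyMul (vandermondePow 2 k) (V.product ![u, v] w))) →
    ∀ (w : HSer V.carrier) (q p : ℤ), ∀ t < n,
      shiftCoeff (fun m => polyMul (vandermondePow 2 k) (V.product ![u, v] w) m t) (q + k) p =
        V.mode p (V.mode q u v) w t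

/-! ## `ħ`-adic quantum vertex algebras with several components -/

section Mixed

variable {A B : Type*} [AddCommGroup A] [Module ℂ A] [AddCommGroup B] [Module ℂ B]

/-- `Y¹²(y) : A ⊗ A ⊗ B → (A ⊗ B)((y))`. -/
def Y12 (Y : A ⊗[ℂ] A →ₗ[ℂ] LaurentSeries A) :
    A ⊗[ℂ] (A ⊗[ℂ] B) →ₗ[ℂ] LaurentSeries (A ⊗[ℂ] B) :=
  laurTensorR ∘ₗ Y.rTensor B ∘ₗ (TensorProduct.assoc ℂ A A B).symm.toLinearMap

/-- `Y²³(y) : A ⊗ B ⊗ B → (A ⊗ B)((y))`. -/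
def Y23 (Y : B ⊗[ℂ] B →ₗ[ℂ] LaurentSeries B) :
    A ⊗[ℂ] (B ⊗[ℂ] B) →ₗ[ℂ] LaurentSeries (A ⊗[ℂ] B) :=
  laurTensorL ∘ₗ Y.lTensor A

/-- `S(x) Z(y)`, where `Z(y) : A → B((y))` and `S(x) : B → ℂ((x)) ⊗ B`. -/
def opAfter (S : Op Lau B B) (Z : HSer (A →ₗ[ℂ] LaurentSeries B)) :
    HSer (A →ₗ[ℂ] LaurentSeries (Lau ⊗[ℂ] B)) :=
  conv (fun s z => laurMap s ∘ₗ z) S Z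

/-- `Z(y) T(x, y)`, where `T(x, y) : A → ℂ((x))((y)) ⊗ A` and `Z(y) : A → B((y))`. -/
def opBefore (Z : HSer (A →ₗ[ℂ] LaurentSeries B)) (T : Op Lau₂ A A) :
    HSer (A →ₗ[ℂ] LaurentSeries (Lau ⊗[ℂ] B)) :=
  conv (fun z t => laurTensor₂ ∘ₗ z.lTensor Lau₂ ∘ₗ t) Z T

end Mixed

/-- `Y(z₂)(1 ⊗ Y(z₁)) S(z₂ - z₁)(v ⊗ u ⊗ w)`, an element of `V₀((z₂))((z₁))[[ħ]]`; here
`S(z₂ - z₁)` is expanded in nonnegative powers of `z₁`. -/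
def oppositeProduct (V : VAData.{u})
    (S : Op Lau (V.carrier ⊗[ℂ] V.carrier) (V.carrier ⊗[ℂ] V.carrier))
    (v u w : HSer V.carrier) : HSer (LaurentSeries (LaurentSeries V.carrier)) :=
  conv (fun z x => z x)
    (conv (fun yy s => laurSMul₂ ∘ₗ yy.lTensor Lau₂ ∘ₗ s)
      (conv (fun y y' => laurMap y ∘ₗ Y23 (A := V.carrier) y') V.Y V.Y)
      (Op.leg12 V.carrier S.atDiff))
    (conv (fun a b => a ⊗ₜ[ℂ] b) v (conv (fun a b => a ⊗ₜ[ℂ] b) u w))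

/-- `S`-locality: for all `u`, `v` in `V`,
`Y(u, z₁) Y(v, z₂) ∼ Y(z₂)(1 ⊗ Y(z₁)) S(z₂ - z₁)(v ⊗ u)`, where `∼` means that for each `n` the two
sides agree modulo `ħⁿ`, as operators on `V`, after multiplication by some `(z₁ - z₂)^k`. -/
def SLocal (V : VAData.{u})
    (S : Op Lau (V.carrier ⊗[ℂ] V.carrier) (V.carrier ⊗[ℂ] V.carrier)) : Prop :=
  ∀ (u v : HSer V.carrier) (n : ℕ), ∃ k : ℕ, ∀ (w : HSer V.carrier) (m : Fin 2 → ℤ),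
    CongMod n
      (polyMul (vandermondePow 2 k) (V.product ![u, v] w) m)
      (polyMul (vandermondePow 2 k)
        (fun a => (oppositeProduct V S v u w).map fun f => (f.coeff (a 0)).coeff (a 1)) m)

/-- A family of operators `S_{ij}(z) : V_i ⊗̂ V_j → V_i ⊗̂ V_j ⊗̂ ℂ((z))[[ħ]]`. -/
abbrev OpFamily {ι : Type*} (V : ι → VAData.{u}) : Type _ :=
  ∀ i j : ι, Op Lau ((V i).carrier ⊗[ℂ] (V j).carrier) ((V i).carrier ⊗[ℂ] (V j).carrier)

/-- `((V_i), (S_{ij}(z)))` is an `ħ`-adic `n`-quantum vertex algebra (the index set is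
`{1, …, n}` in the theorem). -/
structure IsQuantumVA {ι : Type*} (V : ι → VAData.{u}) (S : OpFamily V) : Prop where
  nonlocal : ∀ i, (V i).IsNonlocal
  /-- `S_{ij}(z)(v ⊗ 𝟙) = v ⊗ 𝟙`. -/
  vac_right : ∀ (i j : ι) (v : HSer (V i).carrier),
    conv (fun s x => s x) (S i j) (conv (fun a b => a ⊗ₜ[ℂ] b) v (V j).vac) =
      (conv (fun a b => a ⊗ₜ[ℂ] b) v (V j).vac).map fun x => (1 : Lau) ⊗ₜ[ℂ] x
  /-- `S_{ij}(z)(𝟙 ⊗ u) = 𝟙 ⊗ u`. -/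
  vac_left : ∀ (i j : ι) (u : HSer (V j).carrier),
    conv (fun s x => s x) (S i j) (conv (fun a b => a ⊗ₜ[ℂ] b) (V i).vac u) =
      (conv (fun a b => a ⊗ₜ[ℂ] b) (V i).vac u).map fun x => (1 : Lau) ⊗ₜ[ℂ] x
  /-- `[∂ ⊗ 1, S_{ij}(z)] = -(d/dz) S_{ij}(z)`. -/
  shift_left : ∀ i j : ι,
    (S i j).bracket ((V i).deriv.map fun d => d.rTensor (V j).carrier) = -(S i j).ddz
  /-- `[1 ⊗ ∂, S_{ij}(z)] = (d/dz) S_{ij}(z)`. -/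
  shift_right : ∀ i j : ι,
    (S i j).bracket ((V j).deriv.map fun d => d.lTensor (V i).carrier) = (S i j).ddz
  /-- `S_{ji}²¹(z) S_{ij}(-z) = 1`. -/
  unitarity : ∀ i j : ι, (Op.flip (S j i)).comp (S i j).atNeg = Op.one
  /-- `S_{ii}`-locality of `Y_i`. -/
  locality : ∀ i : ι, SLocal (V i) (S i i)
  /-- `S_{ij}(z₁) Y_i¹²(z₂) = Y_i¹²(z₂) S_{ij}²³(z₁) S_{ij}¹³(z₁ + z₂)`. -/
  hexagon_left : ∀ i j : ι,
    opAfter (S i j) ((V i).Y.map Y12) =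
      opBefore ((V i).Y.map Y12)
        ((Op.leg23 (V i).carrier (S i j).atInner).comp
          (Op.leg13 (V i).carrier (S i j).atSum))
  /-- `S_{ij}(z₁) Y_j²³(z₂) = Y_j²³(z₂) S_{ij}¹²(z₁ - z₂) S_{ij}¹³(z₁)`. -/
  hexagon_right : ∀ i j : ι,
    opAfter (S i j) ((V j).Y.map Y23) =
      opBefore ((V j).Y.map Y23)
        ((Op.leg12 (V j).carrier (S i j).atDiff).comp
          (Op.leg13 (V j).carrier (S i j).atInner))
  /-- `S_{ij}¹²(z₁) S_{ik}¹³(z₁ + z₂) S_{jk}²³(z₂) = S_{jk}²³(z₂) S_{ik}¹³(z₁ + z₂) S_{ij}¹²(z₁)`. -/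
  yangBaxter : ∀ i j k : ι,
    (Op.leg12 (V k).carrier (S i j).atInner).comp
        ((Op.leg13 (V j).carrier (S i k).atSum).comp
          (Op.leg23 (V i).carrier (S j k).atOuter)) =
      (Op.leg23 (V i).carrier (S j k).atOuter).comp
        ((Op.leg13 (V j).carrier (S i k).atSum).comp
          (Op.leg12 (V k).carrier (S i j).atInner))

/-! ## Twisted tensor products -/

section Twisted

variable {A B C : Type*} [AddCommGroup A] [Module ℂ A] [AddCommGroup B] [Module ℂ B]
  [AddCommGroup C] [Module ℂ C]

/-- `(Y₁(z) ⊗ Y₂(z)) T`, where `y = Y₁(z) ⊗ Y₂(z)` and `T` is an operator on `A ⊗ A ⊗ B ⊗ B`. -/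
def evalYY (y : (A ⊗[ℂ] A) ⊗[ℂ] (B ⊗[ℂ] B) →ₗ[ℂ] LaurentSeries A ⊗[ℂ] LaurentSeries B)
    (t : A ⊗[ℂ] (A ⊗[ℂ] (B ⊗[ℂ] B)) →ₗ[ℂ] Lau ⊗[ℂ] (A ⊗[ℂ] (A ⊗[ℂ] (B ⊗[ℂ] B)))) :
    A ⊗[ℂ] (A ⊗[ℂ] (B ⊗[ℂ] B)) →ₗ[ℂ] LaurentSeries (A ⊗[ℂ] B) :=
  laurSMul ∘ₗ
    (laurTensor ∘ₗ y ∘ₗ (TensorProduct.assoc ℂ A A (B ⊗[ℂ] B)).symm.toLinearMap).lTensor Lau ∘ₗ t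

/-- `σ²³ : (A ⊗ B) ⊗ (A ⊗ B) → A ⊗ A ⊗ B ⊗ B`, `a ⊗ b ⊗ a' ⊗ b' ↦ a ⊗ a' ⊗ b ⊗ b'`. -/
def flip23 : (A ⊗[ℂ] B) ⊗[ℂ] (A ⊗[ℂ] B) →ₗ[ℂ] A ⊗[ℂ] (A ⊗[ℂ] (B ⊗[ℂ] B)) :=
  (TensorProduct.assoc ℂ A A (B ⊗[ℂ] B)).toLinearMap ∘ₗ
    (TensorProduct.tensorTensorTensorComm ℂ A B A B).toLinearMap

/-- `S_{A ⊗ B, C}(z) = S_{B,C}²³(z) S_{A,C}¹³(z)` on `(A ⊗ B) ⊗ C`. -/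
def Op.mergeLeft (SAC : Op Lau (A ⊗[ℂ] C) (A ⊗[ℂ] C)) (SBC : Op Lau (B ⊗[ℂ] C) (B ⊗[ℂ] C)) :
    Op Lau ((A ⊗[ℂ] B) ⊗[ℂ] C) ((A ⊗[ℂ] B) ⊗[ℂ] C) :=
  Op.conj (TensorProduct.assoc ℂ A B C).symm (TensorProduct.assoc ℂ A B C).symm
    ((Op.leg23 A SBC).comp (Op.leg13 B SAC))

/-- `S_{A, B ⊗ C}(z) = S_{A,B}¹²(z) S_{A,C}¹³(z)` on `A ⊗ (B ⊗ C)`. -/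
def Op.mergeRight (SAB : Op Lau (A ⊗[ℂ] B) (A ⊗[ℂ] B)) (SAC : Op Lau (A ⊗[ℂ] C) (A ⊗[ℂ] C)) :
    Op Lau (A ⊗[ℂ] (B ⊗[ℂ] C)) (A ⊗[ℂ] (B ⊗[ℂ] C)) :=
  (Op.leg12 C SAB).comp (Op.leg13 B SAC)

end Twisted

/-- The twisted tensor product `V₁ ⊗̂_S V₂`, with vacuum vector `𝟙 ⊗ 𝟙` and
`Y_S(z) = (Y₁(z) ⊗ Y₂(z)) S²³(-z) σ²³`. -/
def twistedTensor (V₁ V₂ : VAData.{u})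
    (S : Op Lau (V₁.carrier ⊗[ℂ] V₂.carrier) (V₁.carrier ⊗[ℂ] V₂.carrier)) : VAData.{u} where
  carrier := V₁.carrier ⊗[ℂ] V₂.carrier
  vac := conv (fun a b => a ⊗ₜ[ℂ] b) V₁.vac V₂.vac
  Y := conv (fun y t => evalYY y t ∘ₗ flip23)
    (conv (fun y₁ y₂ => TensorProduct.map y₁ y₂) V₁.Y V₂.Y)
    (Op.leg23 V₁.carrier (Op.leg12 V₂.carrier S.atNeg))

section Blocks

variable {ι : Type*}

/-- The twisted tensor product of the members of a nonempty list, together with the operators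
`S_{l,L}(z)` between a single `V_l` and it. -/
structure Block (V : ι → VAData.{u}) where
  /-- The twisted tensor product `V_L`. -/
  toVA : VAData.{u}
  /-- The operators `S_{l,L}(z)`. -/
  op : ∀ l : ι, Op Lau ((V l).carrier ⊗[ℂ] toVA.carrier) ((V l).carrier ⊗[ℂ] toVA.carrier)

/-- For a nonempty list `(i, L)` of indices, `V_{(i)} = V_i`, and
`V_{(i, L)} = V_i ⊗̂_{S_{i,L}} V_L`, `S_{l,(i,L)}(z) = S_{l,i}¹²(z) S_{l,L}¹³(z)` for nonempty `L`. -/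
def block (V : ι → VAData.{u}) (S : OpFamily V) : ι → List ι → Block V
  | i, [] => ⟨V i, fun l => S l i⟩
  | i, j :: L =>
    ⟨twistedTensor (V i) (block V S j L).toVA ((block V S j L).op i),
      fun l => Op.mergeRight (S l i) ((block V S j L).op l)⟩

/-- The operators `S_{K,L}(z)` between the blocks of two nonempty lists `K` and `L`:
`S_{(i,K),L}(z) = S_{K,L}²³(z) S_{i,L}¹³(z)` for nonempty `K`. -/
def blockOp (V : ι → VAData.{u}) (S : OpFamily V) (j : ι) (L : List ι) :
    (i : ι) → (K : List ι) →
      Op Lau ((block V S i K).toVA.carrier ⊗[ℂ] (block V S j L).toVA.carrier)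
        ((block V S i K).toVA.carrier ⊗[ℂ] (block V S j L).toVA.carrier)
  | i, [] => (block V S j L).op i
  | i, i' :: K => Op.mergeLeft ((block V S j L).op i) (blockOp V S j L i' K)

end Blocks

/-- For `K = {i₁ < ⋯ < i_k}` the twisted tensor product
`V_K = V_{i₁} ⊗̂ ⋯ ⊗̂ V_{i_k}`. -/
def blockVA {n : ℕ} (V : Fin n → VAData.{u}) (S : OpFamily V) (K : Finset (Fin n))
    (hK : K.Nonempty) : VAData.{u} :=
  (block V S (K.min' hK) ((K.erase (K.min' hK)).sort (· ≤ ·))).toVA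

/-- The operator `S_{K,L}(z)` on `V_K ⊗̂ V_L`. -/
def blockS {n : ℕ} (V : Fin n → VAData.{u}) (S : OpFamily V) (K L : Finset (Fin n))
    (hK : K.Nonempty) (hL : L.Nonempty) :
    Op Lau ((blockVA V S K hK).carrier ⊗[ℂ] (blockVA V S L hL).carrier)
      ((blockVA V S K hK).carrier ⊗[ℂ] (blockVA V S L hL).carrier) :=
  blockOp V S (L.min' hL) ((L.erase (L.min' hL)).sort (· ≤ ·))
    (K.min' hK) ((K.erase (K.min' hK)).sort (· ≤ ·))

end

end HQVA

/-!
The twisted tensor products of nonempty lists of indices, with the operators between them, form a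
quantum vertex algebra indexed by all nonempty lists; the theorem is the restriction of this to the
lists of the elements of the `K a`. Everything is proved by induction on lists, so that the task is
to pass from `V`, `W` to one twisted tensor product `V ⊗_S W` in each place of an identity.

**Identities between the operators.** An identity between operators on tensor products is tested on
functions on bases: an operator `S(z)` on `A ⊗ B` acts contravariantly on families `f i j` with
values in a `ℂ((z))`-module, leaving further indices alone (`tr`), and a vertex operator map acts by
`lpr`. Operators in different tensor factors then commute visibly, legs `S¹²`, `S¹³`, `S²³` become
the choice of the indices acted on, and the substitutions of variables become algebra
homomorphisms. In this form unitarity, the Yang–Baxter equation, the vacuum and shift properties and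
the hexagon identities of merged operators follow from those of the factors (`Unitary.mergeLeft`,
`YangBaxter.merge_second`, `HexL.mergeLeft`, …).

**Locality and associativity.** A locality relation together with weak associativity says that the
matrix coefficients of `Y(u, z₁) Y(v, z₂) w`, of the opposite product
`Y(z₂)(1 ⊗ Y(z₁)) S(z₂ - z₁)(v ⊗ u ⊗ w)` and of `Y(Y(u, z₀) v, z) w` are, modulo each power of `ħ`,
the expansions in three domains of one element of `ℂ((z₁, z₂))[(z₁ - z₂)⁻¹]`. The triples of such
expansions form a subalgebra `mero` of `ℂ((x))((y))³`, and the condition `MeroCorr` that all triples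
of matrix coefficients lie in `mero` is equivalent to `S`-locality and associativity
(`MeroCorr.of_slocal`, `MeroCorr.slocal`, `MeroCorr.assoc`). In the converse direction, the exponent
of `z₁ - z₂` that is needed has to be independent of `w` and of the matrix coefficient; it is read
off from the pole of `Y(u, z₀) v` at `z₀ = 0` (`triSub_pow_mul_mem`). The matrix coefficients of
`V ⊗_S W` are obtained from the products of those of `V` and `W` by applying `S(z₂ - z₁)`, `S(-z₁)`
and `S(-z₂)`, in each of the three domains (`corr_twistY`, `corrIter_twistY` by the hexagon
identities, `corrOpp_twistY` by unitarity and the Yang–Baxter equation), and the entries of these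
operators are in `mero`. Hence `MeroCorr` passes to twisted tensor products (`MeroCorr.twistY`).

**Compatibility.** The compatibility of arbitrarily many vertex operators is a consequence of
`S`-locality alone (`SLocal.compatible`): it suffices to bound the exponents of one variable, and the
vertex operator with this variable can be moved to the right.
-/

open Module (Basis)

namespace HQVA

noncomputable section

open HSer

/-! ### Convolution of `ħ`-series -/

namespace HSer

section Conv
variable {A B C D E F G : Type*}

theorem conv_apply [AddCommMonoid C] (β : A → B → C) (f : HSer A) (g : HSer B) (n : ℕ) :
    conv β f g n = ∑ p ∈ Finset.HasAntidiagonal.antidiagonal n, β (f p.1) (g p.2) := rfl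

theorem map_apply (φ : A → B) (f : HSer A) (n : ℕ) : HSer.map φ f n = φ (f n) := rfl

theorem conv_swap [AddCommMonoid C] (β : A → B → C) (f : HSer A) (g : HSer B) :
    conv β f g = conv (fun b a => β a b) g f := by
  funext n
  exact Finset.Nat.sum_antidiagonal_swap (n := n) (f := fun p => β (f p.1) (g p.2)) |>.symm

theorem apply_sum_left [AddCommMonoid D] [AddCommMonoid E] {γ : D → C → E}
    (h0 : ∀ c, γ 0 c = 0) (h : ∀ d d' c, γ (d + d') c = γ d c + γ d' c) {ι : Type*}
    (s : Finset ι) (x : ι → D) (c : C) : γ (∑ i ∈ s, x i) c = ∑ i ∈ s, γ (x i) c :=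
  map_sum (⟨⟨fun d => γ d c, h0 c⟩, fun d d' => h d d' c⟩ : D →+ E) x s

theorem conv_assoc [AddCommMonoid D] [AddCommMonoid E] [AddCommMonoid F]
    {β : A → B → D} {γ : D → C → E} {δ : B → C → F} {ε : A → F → E}
    (hγ0 : ∀ c, γ 0 c = 0) (hγ : ∀ d d' c, γ (d + d') c = γ d c + γ d' c)
    (hε0 : ∀ a, ε a 0 = 0) (hε : ∀ a d d', ε a (d + d') = ε a d + ε a d')
    (h : ∀ a b c, γ (β a b) c = ε a (δ b c)) (f : HSer A) (g : HSer B) (k : HSer C) :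
    conv γ (conv β f g) k = conv ε f (conv δ g k) := by
  funext n
  simp only [conv_apply, apply_sum_left hγ0 hγ,
    apply_sum_left (γ := fun x a => ε a x) hε0 (fun d d' a => hε a d d'), h]
  rw [Finset.sum_sigma', Finset.sum_sigma']
  apply Finset.sum_nbij' (fun ⟨⟨_i, j⟩, ⟨k, l⟩⟩ ↦ ⟨(k, l + j), (l, j)⟩)
    (fun ⟨⟨i, _j⟩, ⟨k, l⟩⟩ ↦ ⟨(i + k, l), (i, k)⟩) <;>
    simp +contextual [add_comm, add_left_comm]
  grind

theorem conv_rot [AddCommMonoid D] [AddCommMonoid E] [AddCommMonoid F]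
    {β : A → B → D} {γ : D → C → E} {δ : A → C → F} {ε : B → F → E}
    (hγ0 : ∀ c, γ 0 c = 0) (hγ : ∀ d d' c, γ (d + d') c = γ d c + γ d' c)
    (hε0 : ∀ a, ε a 0 = 0) (hε : ∀ a d d', ε a (d + d') = ε a d + ε a d')
    (h : ∀ a b c, γ (β a b) c = ε b (δ a c)) (f : HSer A) (g : HSer B) (k : HSer C) :
    conv γ (conv β f g) k = conv ε g (conv δ f k) := by
  rw [conv_swap β]
  exact conv_assoc hγ0 hγ hε0 hε (fun a b c => h b a c) g f k

theorem conv_left_comm [AddCommMonoid D] [AddCommMonoid E] [AddCommMonoid F]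
    {β : B → C → D} {γ : A → D → E} {δ : A → C → F} {ε : B → F → E}
    (hγ0 : ∀ a, γ a 0 = 0) (hγ : ∀ a d d', γ a (d + d') = γ a d + γ a d')
    (hε0 : ∀ a, ε a 0 = 0) (hε : ∀ a d d', ε a (d + d') = ε a d + ε a d')
    (h : ∀ a b c, γ a (β b c) = ε b (δ a c)) (f : HSer A) (g : HSer B) (k : HSer C) :
    conv γ f (conv β g k) = conv ε g (conv δ f k) := by
  rw [conv_swap γ, conv_swap δ]
  exact conv_assoc (γ := fun d a => γ a d) hγ0 (fun d d' a => hγ a d d') hε0 hε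
    (fun a b c => h c a b) g k f

theorem conv_const_left [Zero A] [AddCommMonoid C] {β : A → B → C} (h0 : ∀ b, β 0 b = 0) (a : A)
    (g : HSer B) : conv β (const a) g = g.map (β a) := by
  funext n
  rw [conv_apply, Finset.sum_eq_single (0, n)]
  · rfl
  · rintro ⟨i, j⟩ hij hne
    rw [Finset.HasAntidiagonal.mem_antidiagonal] at hij
    have hi : i ≠ 0 := by
      rintro rfl
      apply hne
      simp at hij
      simp [hij]
    simp [const, hi, h0]
  · simp

theorem conv_const_right [Zero B] [AddCommMonoid C] {β : A → B → C} (h0 : ∀ a, β a 0 = 0) (b : B)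
    (f : HSer A) : conv β f (const b) = f.map (fun a => β a b) := by
  rw [conv_swap, conv_const_left (β := fun b a => β a b) h0]

theorem map_conv [AddCommMonoid C] [AddCommMonoid D] {L : Type*} [FunLike L C D]
    [AddMonoidHomClass L C D] (ℓ : L) (β : A → B → C) (f : HSer A)
    (g : HSer B) : (conv β f g).map ℓ = conv (fun a b => ℓ (β a b)) f g := by
  funext n
  simp [map_apply, conv_apply, map_sum]

theorem conv_map_left [AddCommMonoid C] (φ : D → A) (β : A → B → C) (f : HSer D)
    (g : HSer B) : conv β (f.map φ) g = conv (fun d b => β (φ d) b) f g := rfl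

theorem conv_map_right [AddCommMonoid C] (φ : D → B) (β : A → B → C) (f : HSer A)
    (g : HSer D) : conv β f (g.map φ) = conv (fun a d => β a (φ d)) f g := rfl

theorem conv_congr [AddCommMonoid C] {β : A → B → C} {β' : D → E → C} {f : HSer A} {g : HSer B}
    {f' : HSer D} {g' : HSer E} (h : ∀ m n, β (f m) (g n) = β' (f' m) (g' n)) :
    conv β f g = conv β' f' g' := by
  funext n
  exact Finset.sum_congr rfl fun p _ => h _ _

theorem conv_add_right [AddCommGroup B] [AddCommGroup C] {β : A → B → C}
    (h : ∀ a b b', β a (b + b') = β a b + β a b') (f : HSer A) (g g' : HSer B) :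
    conv β f (g + g') = conv β f g + conv β f g' := by
  funext n
  simp [conv_apply, HSer.add_apply, h, Finset.sum_add_distrib]

theorem conv_add_left [AddCommGroup A] [AddCommGroup C] {β : A → B → C}
    (h : ∀ a a' b, β (a + a') b = β a b + β a' b) (f f' : HSer A) (g : HSer B) :
    conv β (f + f') g = conv β f g + conv β f' g := by
  funext n
  simp [conv_apply, HSer.add_apply, h, Finset.sum_add_distrib]

theorem neg_apply {M : Type*} [AddCommGroup M] (f : HSer M) (n : ℕ) : (-f) n = -f n := rfl

end Conv
end HSer

/-! ### Test functions on bases -/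

section Pairing

variable {R : Type} [CommRing R] [Algebra ℂ R]
  {A B C : Type*} [AddCommGroup A] [Module ℂ A] [AddCommGroup B] [Module ℂ B]
  [AddCommGroup C] [Module ℂ C]
  {I J K : Type*} (a : Basis I ℂ A) (b : Basis J ℂ B) (c : Basis K ℂ C)
  {N N' : Type*} [AddCommGroup N] [Module ℂ N] [AddCommGroup N'] [Module ℂ N']

/-- The `ħ`-series of linear maps extending a function on a basis. -/
def lin (f : I → HSer N) : HSer (A →ₗ[ℂ] N) := fun t => a.constr ℂ fun i => f i t

theorem lin_basis (f : I → HSer N) (t : ℕ) (i : I) : lin a f t (a i) = f i t := by simp [lin]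

theorem lin_conv {L : Type*} {M : Type*} [AddCommGroup M] [Module ℂ M] {β : L → M → N}
    {β' : L → (A →ₗ[ℂ] M) → (A →ₗ[ℂ] N)} (h : ∀ l g x, β' l g x = β l (g x)) (l : HSer L)
    (f : I → HSer M) : lin a (fun i => conv β l (f i)) = conv β' l (lin a f) := by
  funext t
  refine a.ext fun i => ?_
  rw [lin_basis, conv_apply, conv_apply, LinearMap.sum_apply]
  exact Finset.sum_congr rfl fun p _ => by rw [h, lin_basis]

/-- The `ħ`-linear action of a series of linear maps. -/
def hap {R : Type*} [Semiring R] {N N' : Type*} [AddCommGroup N] [Module R N] [AddCommGroup N']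
    [Module R N'] (L : HSer (N →ₗ[R] N')) (n : HSer N) : HSer N' := conv (fun l n => l n) L n

theorem hap_const {R : Type*} [Semiring R] {N N' : Type*} [AddCommGroup N] [Module R N]
    [AddCommGroup N'] [Module R N'] (ℓ : N →ₗ[R] N') (n : HSer N) :
    hap (const ℓ) n = n.map ℓ :=
  conv_const_left (β := fun (l : N →ₗ[R] N') n => l n) (fun _ => rfl) _ _

/-- The value at `x ∈ A[[ħ]]` of the `ħ`-linear extension of a function `f` on a basis of `A`. -/
def vpr (x : HSer A) (f : I → HSer N) : HSer N := conv (fun x g => g x) x (lin a f)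

/-- The value at `x ∈ (R ⊗ A)[[ħ]]` of the `R`-linear and `ħ`-linear extension of a function `f`
on a basis of `A` with values in an `R`-module. -/
def pr [Module R N] [IsScalarTower ℂ R N] (x : HSer (R ⊗[ℂ] A)) (f : I → HSer N) : HSer N :=
  conv (fun x g => LinearMap.liftBaseChange R g x) x (lin a f)

variable {a b c}

theorem vpr_natural (L : HSer (N →ₗ[ℂ] N')) (x : HSer A) (f : I → HSer N) :
    hap L (vpr a x f) = vpr a x fun i => hap L (f i) := by
  unfold vpr hap
  rw [lin_conv a (β := fun (l : N →ₗ[ℂ] N') n => l n) (β' := fun l g => l ∘ₗ g) (fun _ _ _ => rfl)]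
  exact conv_left_comm (β := fun x (g : A →ₗ[ℂ] N) => g x) (γ := fun (l : N →ₗ[ℂ] N') n => l n)
    (δ := fun l g => l ∘ₗ g) (ε := fun x (g : A →ₗ[ℂ] N') => g x) (fun l => map_zero l)
    (fun l => map_add l) (fun _ => rfl) (fun _ _ _ => rfl) (fun _ _ _ => rfl) _ _ _

theorem vpr_map (ℓ : N →ₗ[ℂ] N') (x : HSer A) (f : I → HSer N) :
    (vpr a x f).map ℓ = vpr a x fun i => (f i).map ℓ := by
  simpa only [hap_const] using vpr_natural (a := a) (const ℓ) x f

theorem vpr_const (i : I) (f : I → HSer N) : vpr a (const (a i)) f = f i := by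
  unfold vpr
  rw [conv_const_left (β := fun x (g : A →ₗ[ℂ] N) => g x) (by simp)]
  funext t
  exact lin_basis a f t i

/-- The `J`-indexed family of `ħ`-series with the value `f`, as one `ħ`-series. -/
def bundle {J : Type*} (f : J → HSer N) : HSer (J → N) := fun t j => f j t

section RPairing
variable [Module R N] [IsScalarTower ℂ R N] [Module R N'] [IsScalarTower ℂ R N']

theorem liftBaseChange_comp (l : N →ₗ[R] N') (g : A →ₗ[ℂ] N) (x : R ⊗[ℂ] A) :
    LinearMap.liftBaseChange R (l.restrictScalars ℂ ∘ₗ g) x = l (LinearMap.liftBaseChange R g x) := by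
  induction x with
  | zero => simp
  | add x y hx hy => simp [hx, hy]
  | tmul r x => simp

theorem liftBaseChange_add (g g' : A →ₗ[ℂ] N) (x : R ⊗[ℂ] A) :
    LinearMap.liftBaseChange R (g + g') x =
      LinearMap.liftBaseChange R g x + LinearMap.liftBaseChange R g' x := by
  induction x with
  | zero => simp
  | add x y hx hy => rw [map_add, hx, hy, map_add, map_add]; abel
  | tmul r x => simp

theorem liftBaseChange_zero (x : R ⊗[ℂ] A) :
    LinearMap.liftBaseChange R (0 : A →ₗ[ℂ] N) x = 0 := by
  simp

theorem pr_natural (L : HSer (N →ₗ[R] N')) (x : HSer (R ⊗[ℂ] A)) (f : I → HSer N) :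
    hap L (pr a x f) = pr a x fun i => hap L (f i) := by
  unfold pr hap
  rw [lin_conv a (β := fun (l : N →ₗ[R] N') n => l n)
    (β' := fun l g => l.restrictScalars ℂ ∘ₗ g) (fun _ _ _ => rfl)]
  exact conv_left_comm (by simp) (by simp) liftBaseChange_zero
    (fun x g g' => liftBaseChange_add g g' x) (fun l x g => (liftBaseChange_comp l g x).symm) _ _ _

theorem pr_map (ℓ : N →ₗ[R] N') (x : HSer (R ⊗[ℂ] A)) (f : I → HSer N) :
    (pr a x f).map ℓ = pr a x fun i => (f i).map ℓ := by
  simpa only [hap_const] using pr_natural (a := a) (const ℓ) x f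

theorem lin_add (f g : I → HSer N) : lin a (fun i => f i + g i) = lin a f + lin a g := by
  funext t
  refine a.ext fun i => ?_
  simp [lin, HSer.add_apply]

theorem pr_add (x : HSer (R ⊗[ℂ] A)) (f g : I → HSer N) :
    pr a x (fun i => f i + g i) = pr a x f + pr a x g := by
  unfold pr
  rw [lin_add]
  exact conv_add_right (fun x g g' => liftBaseChange_add g g' x) _ _ _

theorem pr_add_left (x y : HSer (R ⊗[ℂ] A)) (f : I → HSer N) :
    pr a (x + y) f = pr a x f + pr a y f :=
  conv_add_left (by simp) _ _ _

theorem pr_neg_left (x : HSer (R ⊗[ℂ] A)) (f : I → HSer N) :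
    pr a (-x) f = -pr a x f := by
  funext t
  simp [pr, conv_apply, HSer.neg_apply]

theorem pr_sub_left (x y : HSer (R ⊗[ℂ] A)) (f : I → HSer N) :
    pr a (x - y) f = pr a x f - pr a y f := by
  rw [sub_eq_add_neg, pr_add_left, pr_neg_left, sub_eq_add_neg]

theorem pr_sub (x : HSer (R ⊗[ℂ] A)) (f g : I → HSer N) :
    pr a x (fun i => f i - g i) = pr a x f - pr a x g := by
  rw [eq_sub_iff_add_eq, ← pr_add]
  simp

/-- The pairing of a bundled family, one component at a time. -/
theorem pr_bundle {J : Type*} (x : HSer (R ⊗[ℂ] A)) (f : I → J → HSer N) :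
    pr a x (fun i => bundle (f i)) = bundle fun j => pr a x fun i => f i j := by
  funext t j
  exact congrFun (pr_map (LinearMap.proj j : (J → N) →ₗ[R] N) x fun i => bundle (f i)) t

/-- The evaluation of test functions at `x`, as a series of `R`-linear maps. -/
def prL (a : Basis I ℂ A) (N : Type*) [AddCommGroup N] [Module ℂ N] [Module R N]
    [IsScalarTower ℂ R N] (x : HSer (R ⊗[ℂ] A)) : HSer ((I → N) →ₗ[R] N) := x.map fun x =>
  { toFun := fun g => LinearMap.liftBaseChange R (a.constr ℂ g) x
    map_add' := fun g g' => by rw [map_add, liftBaseChange_add]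
    map_smul' := fun r g => by
      have : a.constr ℂ (r • g) = (LinearMap.lsmul R N r).restrictScalars ℂ ∘ₗ a.constr ℂ g :=
        a.ext fun i => by simp
      rw [this, liftBaseChange_comp]
      rfl }

theorem pr_eq_hap (x : HSer (R ⊗[ℂ] A)) (f : I → HSer N) :
    pr a x f = hap (prL a N x) (bundle f) := rfl

variable (R) in
/-- The evaluation of test functions at `x`, as a series of `R`-linear maps. -/
def vprL (a : Basis I ℂ A) (N : Type*) [AddCommGroup N] [Module ℂ N] [Module R N]
    [IsScalarTower ℂ R N] (x : HSer A) : HSer ((I → N) →ₗ[R] N) := x.map fun x =>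
  { toFun := fun g => a.constr ℂ g x
    map_add' := fun g g' => by rw [map_add]; rfl
    map_smul' := fun r g => by
      have : a.constr ℂ (r • g) = (LinearMap.lsmul R N r).restrictScalars ℂ ∘ₗ a.constr ℂ g :=
        a.ext fun i => by simp
      rw [this]
      rfl }

variable (R) in
theorem vpr_eq_hap (x : HSer A) (f : I → HSer N) :
    vpr a x f = hap (vprL R a N x) (bundle f) := rfl

/-- Pairings in two different variables commute. -/
theorem pr_comm (x : HSer (R ⊗[ℂ] A)) (y : HSer (R ⊗[ℂ] B)) (f : I → J → HSer N) :
    pr a x (fun i => pr b y fun j => f i j) = pr b y fun j => pr a x fun i => f i j := by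
  simp only [pr_eq_hap (a := b) y]
  rw [← pr_natural, pr_bundle]

theorem pr_vpr_comm (x : HSer (R ⊗[ℂ] A)) (y : HSer B) (f : I → J → HSer N) :
    pr a x (fun i => vpr b y fun j => f i j) = vpr b y fun j => pr a x fun i => f i j := by
  simp only [vpr_eq_hap R (a := b) y]
  rw [← pr_natural, pr_bundle]

/-- Elements of `(R ⊗ A)[[ħ]]` are separated by test functions. -/
theorem ext_pr {x y : HSer (R ⊗[ℂ] A)} (h : ∀ f : I → HSer R, pr a x f = pr a y f) : x = y := by
  classical
  funext t
  refine (a.baseChange R).repr.injective (Finsupp.ext fun i => ?_)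
  have key : ∀ z : R ⊗[ℂ] A, LinearMap.liftBaseChange R (a.constr ℂ fun j => if j = i then (1 : R) else 0) z
      = (a.baseChange R).repr z i := by
    intro z
    have : LinearMap.liftBaseChange R (a.constr ℂ fun j => if j = i then (1 : R) else 0) =
        Finsupp.lapply i ∘ₗ (a.baseChange R).repr.toLinearMap := by
      refine (a.baseChange R).ext fun j => ?_
      simp [Finsupp.single_apply]
    rw [this]
    rfl
  have hc : ∀ z : HSer (R ⊗[ℂ] A), pr a z (fun j => const (if j = i then (1 : R) else 0)) =
      z.map fun z => (a.baseChange R).repr z i := by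
    intro z
    have : lin a (fun j => const (if j = i then (1 : R) else 0)) =
        const (a.constr ℂ fun j => if j = i then (1 : R) else 0) := by
      funext t
      refine a.ext fun j => ?_
      rw [lin_basis]
      by_cases ht : t = 0 <;> simp [const, ht]
    unfold pr
    rw [this, conv_const_right liftBaseChange_zero]
    funext t
    exact key _
  have := congrFun (h fun j => const (if j = i then (1 : R) else 0)) t
  rw [hc, hc] at this
  exact this

end RPairing

theorem vpr_comm (x : HSer A) (y : HSer B) (f : I → J → HSer N) :
    vpr a x (fun i => vpr b y fun j => f i j) = vpr b y fun j => vpr a x fun i => f i j := by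
  simp only [vpr_eq_hap ℂ (a := b) y]
  rw [← vpr_natural]
  congr 1
  funext t j
  exact congrFun (vpr_map (LinearMap.proj j : (J → N) →ₗ[ℂ] N) x fun i => bundle (f i)) t

theorem ext_vpr {x y : HSer A} (h : ∀ φ : I → ℂ, vpr a x (fun i => const (φ i)) = vpr a y fun i => const (φ i)) :
    x = y := by
  classical
  funext t
  refine a.repr.injective (Finsupp.ext fun i => ?_)
  have hc : ∀ z : HSer A, vpr a z (fun j => const (if j = i then (1 : ℂ) else 0)) =
      z.map fun z => a.repr z i := by
    intro z
    have : lin a (fun j => const (if j = i then (1 : ℂ) else 0)) =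
        const (Finsupp.lapply i ∘ₗ a.repr.toLinearMap) := by
      funext t
      refine a.ext fun j => ?_
      rw [lin_basis]
      by_cases ht : t = 0 <;> simp [const, ht, Finsupp.single_apply]
    unfold vpr
    rw [this, conv_const_right (by simp)]
    rfl
  have := congrFun (h fun j => if j = i then 1 else 0) t
  rw [hc, hc] at this
  exact this

/-- Pairing with a pure tensor. -/
theorem vpr_tmul (x : HSer A) (y : HSer B) (f : I × J → HSer N) :
    vpr (a.tensorProduct b) (conv (fun a b => a ⊗ₜ[ℂ] b) x y) f =
      vpr a x fun i => vpr b y fun j => f (i, j) := by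
  unfold vpr
  have : lin a (fun i => conv (fun x g => g x) y (lin b fun j => f (i, j))) =
      conv (fun y (g : A ⊗[ℂ] B →ₗ[ℂ] N) => (TensorProduct.curry g).flip y) y
        (lin (a.tensorProduct b) f) := by
    funext t
    refine a.ext fun i => ?_
    rw [lin_basis, conv_apply, conv_apply, LinearMap.sum_apply]
    refine Finset.sum_congr rfl fun p _ => ?_
    have : lin b (fun j => f (i, j)) p.2 =
        TensorProduct.curry (lin (a.tensorProduct b) f p.2) (a i) :=
      b.ext fun j => by
        rw [lin_basis, TensorProduct.curry_apply, ← Module.Basis.tensorProduct_apply, lin_basis]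
    rw [this]
    rfl
  rw [this]
  exact conv_assoc (ε := fun x (g : A →ₗ[ℂ] N) => g x) (fun _ => map_zero _)
    (fun _ _ _ => map_add _ _ _) (fun _ => rfl) (fun _ _ _ => rfl) (fun _ _ _ => rfl) _ _ _

end Pairing

/-! ### Operators acting on test functions -/

section Action

variable {R : Type} [CommRing R] [Algebra ℂ R] {R' : Type} [CommRing R'] [Algebra ℂ R']
  {A B C D : Type*} [AddCommGroup A] [Module ℂ A] [AddCommGroup B] [Module ℂ B]
  [AddCommGroup C] [Module ℂ C] [AddCommGroup D] [Module ℂ D]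
  {I J K L : Type*} (a : Basis I ℂ A) (b : Basis J ℂ B) (c : Basis K ℂ C) (d : Basis L ℂ D)
  {N : Type*} [AddCommGroup N] [Module ℂ N] [Module R N] [IsScalarTower ℂ R N]

/-- The transpose of an operator, acting on test functions. -/
def Op.act (S : Op R A B) (f : J → HSer N) (i : I) : HSer N := pr b (S.map fun s => s (a i)) f

/-- The transpose of an operator on `A ⊗ B`, acting on test functions of two variables. -/
def Op.act2 (S : Op R (A ⊗[ℂ] B) (A ⊗[ℂ] B)) (f : I → J → HSer N) (i : I) (j : J) : HSer N :=
  Op.act (a.tensorProduct b) (a.tensorProduct b) S (fun p => f p.1 p.2) (i, j)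

/-- Application of a linear map to the scalars of an operator. -/
def Op.mapScalars (φ : R →ₗ[ℂ] R') (S : Op R A B) : Op R' A B := S.map fun s => φ.rTensor B ∘ₗ s

variable {a b c d}

theorem lin_act (S : Op R A B) (f : J → HSer N) :
    lin a (Op.act a b S f) = conv (fun s g => (LinearMap.liftBaseChange R g).restrictScalars ℂ ∘ₗ s)
      S (lin b f) := by
  funext t
  refine a.ext fun i => ?_
  rw [lin_basis, conv_apply, LinearMap.sum_apply]
  rfl

theorem pr_conv_op (S : Op R B C) (y : HSer (R ⊗[ℂ] B)) (f : K → HSer N) :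
    pr c (conv (fun s t => LinearMap.liftBaseChange R s t) S y) f = pr b y (Op.act b c S f) := by
  unfold pr
  rw [lin_act]
  refine conv_rot (γ := fun x (g : C →ₗ[ℂ] N) => LinearMap.liftBaseChange R g x)
    (ε := fun x (g : B →ₗ[ℂ] N) => LinearMap.liftBaseChange R g x)
    (fun _ => map_zero _) (fun _ _ _ => map_add _ _ _) liftBaseChange_zero
    (fun x g g' => liftBaseChange_add g g' x) (fun s y g => ?_) _ _ _
  rw [← liftBaseChange_comp]

theorem pr_conv_apply (S : Op R B C) (y : HSer B) (f : K → HSer N) :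
    pr c (conv (fun s t => s t) S y) f = vpr b y (Op.act b c S f) := by
  unfold pr vpr
  rw [lin_act]
  exact conv_rot (γ := fun x (g : C →ₗ[ℂ] N) => LinearMap.liftBaseChange R g x)
    (ε := fun x (g : B →ₗ[ℂ] N) => g x)
    (fun _ => map_zero _) (fun _ _ _ => map_add _ _ _) (fun _ => rfl)
    (fun _ _ _ => rfl) (fun _ _ _ => rfl) _ _ _

theorem act_comp (S : Op R B C) (T : Op R A B) (f : K → HSer N) (i : I) :
    Op.act a c (S.comp T) f i = Op.act a b T (Op.act b c S f) i := by
  rw [Op.act, Op.act, ← pr_conv_op]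
  congr 1
  funext t
  simp [Op.comp, conv_apply, map_apply]

theorem act_ext {S T : Op R A B} (h : ∀ (f : J → HSer R) (i : I), Op.act a b S f i = Op.act a b T f i) :
    S = T := by
  funext t
  refine a.ext fun i => ?_
  exact congrFun (ext_pr (a := b) fun f => h f i) t

theorem act2_ext {S T : Op R (A ⊗[ℂ] B) (A ⊗[ℂ] B)}
    (h : ∀ (f : I → J → HSer R) i j, Op.act2 a b S f i j = Op.act2 a b T f i j) : S = T :=
  act_ext (a := a.tensorProduct b) (b := a.tensorProduct b) fun f p => h (fun i j => f (i, j)) p.1 p.2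

theorem act2_congr {S : Op R (A ⊗[ℂ] B) (A ⊗[ℂ] B)} {f g : I → J → HSer N}
    (h : ∀ i j, f i j = g i j) (i : I) (j : J) : Op.act2 a b S f i j = Op.act2 a b S g i j := by
  rw [show f = g from funext fun i => funext fun j => h i j]

theorem act_const_of (ψ : A →ₗ[ℂ] R ⊗[ℂ] B) (f : J → HSer N) (i : I) {j : J} {r : R}
    (h : ψ (a i) = r ⊗ₜ b j) : Op.act a b (const ψ) f i = (f j).map fun n => r • n := by
  have : (const ψ : HSer (A →ₗ[ℂ] R ⊗[ℂ] B)).map (fun s => s (a i)) = const (r ⊗ₜ b j) := by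
    funext t
    by_cases ht : t = 0 <;> simp [map_apply, const, ht, h]
  rw [Op.act, this]
  unfold pr
  rw [conv_const_left (β := fun x (g : B →ₗ[ℂ] N) => LinearMap.liftBaseChange R g x)
    (fun _ => map_zero _)]
  funext t
  simp [map_apply, lin_basis]

theorem act_one (f : I → HSer N) (i : I) : Op.act a a (Op.one : Op R A A) f i = f i := by
  rw [Op.one, act_const_of (j := i) (r := 1) _ _ _ rfl]
  funext t
  simp [map_apply]

theorem act2_one (f : I → J → HSer N) (i : I) (j : J) :
    Op.act2 a b (Op.one : Op R _ _) f i j = f i j := act_one _ _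

theorem act2_comp (S T : Op R (A ⊗[ℂ] B) (A ⊗[ℂ] B)) (f : I → J → HSer N) (i : I) (j : J) :
    Op.act2 a b (S.comp T) f i j = Op.act2 a b T (fun i j => Op.act2 a b S f i j) i j :=
  act_comp _ _ _ _

/-- Two linear expressions in the value of an operator agree for all operators if they do so for
pure tensors of basis vectors. -/
theorem liftBaseChange_eq_of_basis {E : Type*} [AddCommGroup E] [Module ℂ E]
    (θ : (R ⊗[ℂ] B) →ₗ[ℂ] (R ⊗[ℂ] E)) (g : B →ₗ[ℂ] N) (g' : E →ₗ[ℂ] N)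
    (h : ∀ (r : R) (j : J), LinearMap.liftBaseChange R g' (θ (r ⊗ₜ b j)) = r • g (b j))
    (x : R ⊗[ℂ] B) : LinearMap.liftBaseChange R g' (θ x) = LinearMap.liftBaseChange R g x := by
  induction x with
  | zero => simp
  | add x y hx hy => simp [hx, hy]
  | tmul r x =>
    have : ((LinearMap.liftBaseChange R g').restrictScalars ℂ ∘ₗ θ) ∘ₗ TensorProduct.mk ℂ R B r =
        (LinearMap.lsmul R N r).restrictScalars ℂ ∘ₗ g :=
      b.ext fun j => by simpa using h r j
    simpa using LinearMap.congr_fun this x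

theorem act_of_leg {E : Type*} [AddCommGroup E] [Module ℂ E] {P Q : Type*} {A' : Type*}
    [AddCommGroup A'] [Module ℂ A'] {a' : Basis P ℂ A'} {e : Basis Q ℂ E}
    (S : Op R A B) (T : Op R A' E) (i : I) (p : P) (θ : (R ⊗[ℂ] B) →ₗ[ℂ] (R ⊗[ℂ] E)) (τ : J → Q)
    (hT : ∀ t, T t (a' p) = θ (S t (a i)))
    (hθ : ∀ (r : R) (j : J), θ (r ⊗ₜ b j) = r ⊗ₜ e (τ j)) (f : Q → HSer N) :
    Op.act a' e T f p = Op.act a b S (fun j => f (τ j)) i := by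
  unfold Op.act pr
  refine conv_congr fun m n => ?_
  rw [map_apply, map_apply, hT]
  refine liftBaseChange_eq_of_basis (b := b) θ _ _ (fun r j => ?_) _
  rw [hθ]
  simp [lin_basis]

theorem act_leg12 (S : Op R (A ⊗[ℂ] B) (A ⊗[ℂ] B)) (f : I × J × K → HSer N) (i : I) (j : J) (k : K) :
    Op.act (a.tensorProduct (b.tensorProduct c)) (a.tensorProduct (b.tensorProduct c))
      (Op.leg12 C S) f (i, j, k) = Op.act2 a b S (fun i j => f (i, j, k)) i j :=
  act_of_leg (a := a.tensorProduct b) (b := a.tensorProduct b)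
    (a' := a.tensorProduct (b.tensorProduct c)) (e := a.tensorProduct (b.tensorProduct c))
    S (Op.leg12 C S) (i, j) (i, j, k)
    ((TensorProduct.assoc ℂ A B C).toLinearMap.lTensor R ∘ₗ
      (TensorProduct.assoc ℂ R (A ⊗[ℂ] B) C).toLinearMap ∘ₗ
        (TensorProduct.mk ℂ (R ⊗[ℂ] (A ⊗[ℂ] B)) C).flip (c k)) (fun p => (p.1, p.2, k))
    (fun t => by
      simp only [Op.leg12, Op.conj, map_apply, Module.Basis.tensorProduct_apply]
      rfl)
    (fun r p => by
      simp only [Module.Basis.tensorProduct_apply']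
      rfl) f

theorem act_leg23 (S : Op R B B) (f : I × J → HSer N) (i : I) (j : J) :
    Op.act (a.tensorProduct b) (a.tensorProduct b) (Op.leg23 A S) f (i, j) =
      Op.act b b S (fun j => f (i, j)) j :=
  act_of_leg (a := b) (b := b) (a' := a.tensorProduct b) (e := a.tensorProduct b)
    S (Op.leg23 A S) j (i, j) ((TensorProduct.leftComm ℂ A R B).toLinearMap ∘ₗ
    TensorProduct.mk ℂ A (R ⊗[ℂ] B) (a i)) (fun j => (i, j))
    (fun t => by
      simp only [Op.leg23, map_apply, Module.Basis.tensorProduct_apply]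
      rfl)
    (fun r p => by
      simp only [Module.Basis.tensorProduct_apply']
      rfl) f

theorem act_leg13 (S : Op R (A ⊗[ℂ] C) (A ⊗[ℂ] C)) (f : I × J × K → HSer N) (i : I) (j : J) (k : K) :
    Op.act (a.tensorProduct (b.tensorProduct c)) (a.tensorProduct (b.tensorProduct c))
      (Op.leg13 B S) f (i, j, k) = Op.act2 a c S (fun i k => f (i, j, k)) i k :=
  act_of_leg (a := a.tensorProduct c) (b := a.tensorProduct c)
    (a' := a.tensorProduct (b.tensorProduct c)) (e := a.tensorProduct (b.tensorProduct c))
    S (Op.leg13 B S) (i, k) (i, j, k)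
    ((TensorProduct.leftComm ℂ B A C).toLinearMap.lTensor R ∘ₗ
      (TensorProduct.leftComm ℂ B R (A ⊗[ℂ] C)).toLinearMap ∘ₗ
        TensorProduct.mk ℂ B (R ⊗[ℂ] (A ⊗[ℂ] C)) (b j)) (fun p => (p.1, j, p.2))
    (fun t => by
      simp only [Op.leg13, Op.leg23, Op.conj, map_apply, Module.Basis.tensorProduct_apply]
      rfl)
    (fun r p => by
      simp only [Module.Basis.tensorProduct_apply']
      rfl) f

theorem act_leg23' (S : Op R (B ⊗[ℂ] C) (B ⊗[ℂ] C)) (f : I × J × K → HSer N) (i : I) (j : J) (k : K) :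
    Op.act (a.tensorProduct (b.tensorProduct c)) (a.tensorProduct (b.tensorProduct c))
      (Op.leg23 A S) f (i, j, k) = Op.act2 b c S (fun j k => f (i, j, k)) j k :=
  act_leg23 (b := b.tensorProduct c) S f i (j, k)

theorem act2_flip (S : Op R (B ⊗[ℂ] A) (B ⊗[ℂ] A)) (f : I → J → HSer N) (i : I) (j : J) :
    Op.act2 a b (Op.flip S) f i j = Op.act2 b a S (fun j i => f i j) j i :=
  act_of_leg (a := b.tensorProduct a) (b := b.tensorProduct a)
    (a' := a.tensorProduct b) (e := a.tensorProduct b) S (Op.flip S) (j, i) (i, j)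
    ((TensorProduct.comm ℂ B A).toLinearMap.lTensor R) (fun p => (p.2, p.1))
    (fun t => by
      simp only [Op.flip, Op.conj, map_apply, Module.Basis.tensorProduct_apply]
      rfl)
    (fun r p => by
      simp only [Module.Basis.tensorProduct_apply']
      rfl) _

theorem act_conj_assoc_symm (S : Op R (A ⊗[ℂ] (B ⊗[ℂ] C)) (A ⊗[ℂ] (B ⊗[ℂ] C)))
    (f : (I × J) × K → HSer N) (i : I) (j : J) (k : K) :
    Op.act ((a.tensorProduct b).tensorProduct c) ((a.tensorProduct b).tensorProduct c)
      (Op.conj (TensorProduct.assoc ℂ A B C).symm (TensorProduct.assoc ℂ A B C).symm S) f ((i, j), k) =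
    Op.act (a.tensorProduct (b.tensorProduct c)) (a.tensorProduct (b.tensorProduct c)) S
      (fun p => f ((p.1, p.2.1), p.2.2)) (i, j, k) :=
  act_of_leg (a := a.tensorProduct (b.tensorProduct c)) (b := a.tensorProduct (b.tensorProduct c))
    (a' := (a.tensorProduct b).tensorProduct c) (e := (a.tensorProduct b).tensorProduct c)
    S (Op.conj (TensorProduct.assoc ℂ A B C).symm (TensorProduct.assoc ℂ A B C).symm S)
    (i, j, k) ((i, j), k)
    ((TensorProduct.assoc ℂ A B C).symm.toLinearMap.lTensor R) (fun p => ((p.1, p.2.1), p.2.2))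
    (fun t => by
      simp only [Op.conj, map_apply, Module.Basis.tensorProduct_apply]
      rfl)
    (fun r p => by
      simp only [Module.Basis.tensorProduct_apply']
      rfl) f

/-! ### Change of scalars -/

theorem mapScalars_mapScalars {R'' : Type} [CommRing R''] [Algebra ℂ R''] (φ : R' →ₗ[ℂ] R'')
    (ψ : R →ₗ[ℂ] R') (S : Op R A B) :
    (S.mapScalars ψ).mapScalars φ = S.mapScalars (φ ∘ₗ ψ) := by
  funext t
  ext x
  simp [Op.mapScalars, map_apply, LinearMap.rTensor_comp]

theorem rTensor_liftBaseChange (φ : R →ₐ[ℂ] R') (s : B →ₗ[ℂ] R ⊗[ℂ] C) (x : R ⊗[ℂ] B) :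
    φ.toLinearMap.rTensor C (LinearMap.liftBaseChange R s x) =
      LinearMap.liftBaseChange R' (φ.toLinearMap.rTensor C ∘ₗ s) (φ.toLinearMap.rTensor B x) := by
  induction x with
  | zero => simp
  | add x y hx hy => simp [hx, hy]
  | tmul r x =>
    have : ∀ z : R ⊗[ℂ] C, φ.toLinearMap.rTensor C (r • z) = φ r • φ.toLinearMap.rTensor C z := by
      intro z
      induction z with
      | zero => simp
      | add x y hx hy => simp [hx, hy]
      | tmul r' z => simp [TensorProduct.smul_tmul']
    simp [this]

theorem mapScalars_comp (φ : R →ₐ[ℂ] R') (S : Op R B C) (T : Op R A B) :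
    (S.comp T).mapScalars φ.toLinearMap =
      (S.mapScalars φ.toLinearMap).comp (T.mapScalars φ.toLinearMap) := by
  funext t
  refine LinearMap.ext fun x => ?_
  simp [Op.mapScalars, Op.comp, map_apply, conv_apply, rTensor_liftBaseChange]

theorem mapScalars_one (φ : R →ₐ[ℂ] R') :
    (Op.one : Op R A A).mapScalars φ.toLinearMap = Op.one := by
  funext t
  refine LinearMap.ext fun x => ?_
  by_cases ht : t = 0 <;> simp [Op.mapScalars, Op.one, map_apply, const, ht]

theorem mapScalars_conj (φ : R →ₗ[ℂ] R') (e : A ≃ₗ[ℂ] C) (e' : B ≃ₗ[ℂ] D) (S : Op R A B) :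
    (Op.conj e e' S).mapScalars φ = Op.conj e e' (S.mapScalars φ) := by
  funext t
  refine LinearMap.ext fun x => ?_
  simp only [Op.mapScalars, Op.conj, map_apply, LinearMap.comp_apply]
  generalize (S t) _ = y
  induction y with
  | zero => simp
  | add x y hx hy => simp [hx, hy]
  | tmul r x => simp

theorem mapScalars_leg12 (φ : R →ₗ[ℂ] R') (S : Op R (A ⊗[ℂ] B) (A ⊗[ℂ] B)) :
    (Op.leg12 C S).mapScalars φ = Op.leg12 C (S.mapScalars φ) := by
  rw [Op.leg12, mapScalars_conj]
  unfold Op.leg12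
  congr 1
  funext t
  refine TensorProduct.ext' fun x z => ?_
  simp only [Op.mapScalars, map_apply, LinearMap.comp_apply, LinearMap.rTensor_tmul,
    LinearEquiv.coe_coe]
  generalize (S t) _ = y
  induction y with
  | zero => simp
  | add x y hx hy => simp [hx, hy, TensorProduct.add_tmul]
  | tmul r x => simp

theorem mapScalars_leg23 (φ : R →ₗ[ℂ] R') (S : Op R B B) :
    (Op.leg23 A S).mapScalars φ = Op.leg23 A (S.mapScalars φ) := by
  funext t
  refine TensorProduct.ext' fun x z => ?_
  simp only [Op.mapScalars, Op.leg23, map_apply, LinearMap.comp_apply, LinearMap.lTensor_tmul,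
    LinearEquiv.coe_coe]
  generalize (S t) _ = y
  induction y with
  | zero => simp
  | add x y hx hy => simp [hx, hy, TensorProduct.tmul_add]
  | tmul r x => simp

theorem mapScalars_leg13 (φ : R →ₗ[ℂ] R') (S : Op R (A ⊗[ℂ] C) (A ⊗[ℂ] C)) :
    (Op.leg13 B S).mapScalars φ = Op.leg13 B (S.mapScalars φ) := by
  rw [Op.leg13, mapScalars_conj, mapScalars_leg23]
  rfl

theorem mapScalars_flip (φ : R →ₗ[ℂ] R') (S : Op R (B ⊗[ℂ] A) (B ⊗[ℂ] A)) :
    (Op.flip S).mapScalars φ = Op.flip (S.mapScalars φ) := mapScalars_conj _ _ _ _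

/-! ### Merged operators -/

section Merge

theorem act2_mergeLeft (φ : Lau →ₐ[ℂ] R) (SAC : Op Lau (A ⊗[ℂ] C) (A ⊗[ℂ] C))
    (SBC : Op Lau (B ⊗[ℂ] C) (B ⊗[ℂ] C)) (f : I × J → K → HSer N) (i : I) (j : J) (k : K) :
    Op.act2 (a.tensorProduct b) c ((Op.mergeLeft SAC SBC).mapScalars φ.toLinearMap) f (i, j) k =
      Op.act2 a c (SAC.mapScalars φ.toLinearMap) (fun i k =>
        Op.act2 b c (SBC.mapScalars φ.toLinearMap) (fun j k => f (i, j) k) j k) i k := by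
  rw [Op.mergeLeft, mapScalars_conj, mapScalars_comp, mapScalars_leg23, mapScalars_leg13,
    Op.act2, act_conj_assoc_symm, act_comp (b := a.tensorProduct (b.tensorProduct c)), act_leg13]
  exact act2_congr (fun i k => act_leg23' _ _ _ _ _) _ _

theorem act2_mergeRight (φ : Lau →ₐ[ℂ] R) (SAB : Op Lau (A ⊗[ℂ] B) (A ⊗[ℂ] B))
    (SAC : Op Lau (A ⊗[ℂ] C) (A ⊗[ℂ] C)) (f : I → J × K → HSer N) (i : I) (j : J) (k : K) :
    Op.act2 a (b.tensorProduct c) ((Op.mergeRight SAB SAC).mapScalars φ.toLinearMap) f i (j, k) =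
      Op.act2 a c (SAC.mapScalars φ.toLinearMap) (fun i k =>
        Op.act2 a b (SAB.mapScalars φ.toLinearMap) (fun i j => f i (j, k)) i j) i k := by
  rw [Op.mergeRight, mapScalars_comp, mapScalars_leg12, mapScalars_leg13,
    Op.act2, act_comp (b := a.tensorProduct (b.tensorProduct c)), act_leg13]
  exact act2_congr (fun i k => act_leg12 _ _ _ _ _) _ _

theorem mapScalars_id (S : Op R A B) : S.mapScalars (AlgHom.id ℂ R).toLinearMap = S := by
  funext t
  refine LinearMap.ext fun x => ?_
  have : (AlgHom.id ℂ R).toLinearMap = LinearMap.id := rfl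
  simp [Op.mapScalars, map_apply, this]

end Merge

/-- Operators on disjoint pairs of tensor factors commute. -/
theorem act2_comm (S : Op R (A ⊗[ℂ] B) (A ⊗[ℂ] B)) (T : Op R (C ⊗[ℂ] D) (C ⊗[ℂ] D))
    (f : I → J → K → L → HSer N) (i : I) (j : J) (k : K) (l : L) :
    Op.act2 a b S (fun i j => Op.act2 c d T (fun k l => f i j k l) k l) i j =
      Op.act2 c d T (fun k l => Op.act2 a b S (fun i j => f i j k l) i j) k l :=
  pr_comm _ _ fun (p : I × J) (q : K × L) => f p.1 p.2 q.1 q.2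

end Action

/-! ### Cauchy products of Laurent series -/

section Cauchy

variable {A B C D E F : Type*} [AddCommGroup A] [Module ℂ A] [AddCommGroup B] [Module ℂ B]
  [AddCommGroup C] [Module ℂ C] [AddCommGroup D] [Module ℂ D] [AddCommGroup E] [Module ℂ E]
  [AddCommGroup F] [Module ℂ F]

theorem exists_lower_bound {M : Type*} [Zero M] (x : LaurentSeries M) :
    ∃ L : ℤ, ∀ i < L, x.coeff i = 0 :=
  ⟨x.order, fun _ hi => HahnSeries.coeff_eq_zero_of_lt_order hi⟩

theorem laurMap_coeff (φ : A →ₗ[ℂ] B) (x : LaurentSeries A) (n : ℤ) :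
    (laurMap φ x).coeff n = φ (x.coeff n) := rfl

theorem cauchy_coeff (β : A →ₗ[ℂ] B →ₗ[ℂ] C) (x : LaurentSeries A) (y : LaurentSeries B) (n : ℤ) :
    (cauchy β x y).coeff n = ∑ᶠ i : ℤ, β (x.coeff i) (y.coeff (n - i)) := rfl

theorem cauchy_coeff_Icc (β : A →ₗ[ℂ] B →ₗ[ℂ] C) {x : LaurentSeries A} {y : LaurentSeries B}
    {L L' : ℤ} (hx : ∀ i < L, x.coeff i = 0) (hy : ∀ i < L', y.coeff i = 0) (n : ℤ) :
    (cauchy β x y).coeff n = ∑ i ∈ Finset.Icc L (n - L'), β (x.coeff i) (y.coeff (n - i)) := by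
  rw [cauchy_coeff]
  apply finsum_eq_finsetSum_of_support_subset
  intro i hi
  rw [Function.mem_support] at hi
  rw [Finset.coe_Icc, Set.mem_Icc]
  constructor
  · by_contra h
    exact hi (by rw [hx i (not_le.1 h)]; simp)
  · by_contra h
    exact hi (by rw [hy (n - i) (by linarith [not_le.1 h]), map_zero])

theorem cauchy_lower_bound (β : A →ₗ[ℂ] B →ₗ[ℂ] C) {x : LaurentSeries A} {y : LaurentSeries B}
    {L L' : ℤ} (hx : ∀ i < L, x.coeff i = 0) (hy : ∀ i < L', y.coeff i = 0) :
    ∀ n < L + L', (cauchy β x y).coeff n = 0 := by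
  intro n hn
  rw [cauchy_coeff_Icc β hx hy, Finset.Icc_eq_empty (by linarith), Finset.sum_empty]

theorem cauchy_assoc {β : A →ₗ[ℂ] B →ₗ[ℂ] D} {γ : D →ₗ[ℂ] C →ₗ[ℂ] E} {δ : B →ₗ[ℂ] C →ₗ[ℂ] F}
    {ε : A →ₗ[ℂ] F →ₗ[ℂ] E} (h : ∀ a b c, γ (β a b) c = ε a (δ b c)) (x : LaurentSeries A)
    (y : LaurentSeries B) (z : LaurentSeries C) :
    cauchy γ (cauchy β x y) z = cauchy ε x (cauchy δ y z) := by
  obtain ⟨L, hL⟩ := exists_lower_bound x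
  obtain ⟨M, hM⟩ := exists_lower_bound y
  obtain ⟨K, hK⟩ := exists_lower_bound z
  refine HahnSeries.ext (funext fun n => ?_)
  rw [cauchy_coeff_Icc γ (cauchy_lower_bound β hL hM) hK,
    cauchy_coeff_Icc ε hL (cauchy_lower_bound δ hM hK)]
  simp only [cauchy_coeff_Icc β hL hM, cauchy_coeff_Icc δ hM hK, map_sum, LinearMap.sum_apply, h]
  rw [Finset.sum_sigma', Finset.sum_sigma']
  apply Finset.sum_nbij' (fun p ↦ ⟨p.2, p.1 - p.2⟩) (fun p ↦ ⟨p.1 + p.2, p.1⟩)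
  · simp only [Finset.mem_sigma, Finset.mem_Icc]
    omega
  · simp only [Finset.mem_sigma, Finset.mem_Icc]
    omega
  · rintro ⟨i, j⟩ _
    simp
  · rintro ⟨i, j⟩ _
    simp
  · rintro ⟨i, j⟩ _
    simp

theorem cauchy_swap (β : A →ₗ[ℂ] B →ₗ[ℂ] C) (x : LaurentSeries A) (y : LaurentSeries B) :
    cauchy β x y = cauchy β.flip y x := by
  obtain ⟨L, hL⟩ := exists_lower_bound x
  obtain ⟨M, hM⟩ := exists_lower_bound y
  refine HahnSeries.ext (funext fun n => ?_)
  rw [cauchy_coeff_Icc β hL hM, cauchy_coeff_Icc β.flip hM hL]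
  apply Finset.sum_nbij' (fun i => n - i) (fun i => n - i)
  · simp only [Finset.mem_Icc]; omega
  · simp only [Finset.mem_Icc]; omega
  · simp
  · simp
  · simp

theorem laurMap_cauchy (φ : C →ₗ[ℂ] D) (β : A →ₗ[ℂ] B →ₗ[ℂ] C) (x : LaurentSeries A)
    (y : LaurentSeries B) : laurMap φ (cauchy β x y) = cauchy (β.compr₂ φ) x y := by
  obtain ⟨L, hL⟩ := exists_lower_bound x
  obtain ⟨M, hM⟩ := exists_lower_bound y
  refine HahnSeries.ext (funext fun n => ?_)
  rw [laurMap_coeff, cauchy_coeff_Icc β hL hM, cauchy_coeff_Icc _ hL hM, map_sum]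
  rfl

theorem cauchy_laurMap (φ : A →ₗ[ℂ] D) (ψ : B →ₗ[ℂ] E) (β : D →ₗ[ℂ] E →ₗ[ℂ] C)
    (x : LaurentSeries A) (y : LaurentSeries B) :
    cauchy β (laurMap φ x) (laurMap ψ y) = cauchy (β.compl₁₂ φ ψ) x y := rfl

theorem cauchy_single_right (β : A →ₗ[ℂ] B →ₗ[ℂ] C) (x : LaurentSeries A) (b : B) :
    cauchy β x (HahnSeries.single (0 : ℤ) b) = laurMap (β.flip b) x := by
  refine HahnSeries.ext (funext fun n => ?_)
  rw [cauchy_coeff, finsum_eq_single _ n, laurMap_coeff]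
  · simp
  · intro i hi
    rw [HahnSeries.coeff_single_of_ne (by omega), map_zero]

theorem cauchy_single_left (β : A →ₗ[ℂ] B →ₗ[ℂ] C) (a : A) (y : LaurentSeries B) :
    cauchy β (HahnSeries.single (0 : ℤ) a) y = laurMap (β a) y := by
  rw [cauchy_swap, cauchy_single_right]
  rfl

theorem laurMap_single (φ : A →ₗ[ℂ] B) (n : ℤ) (x : A) :
    laurMap φ (HahnSeries.single n x) = HahnSeries.single n (φ x) := by
  refine HahnSeries.ext (funext fun m => ?_)
  rw [laurMap_coeff]
  by_cases h : m = n
  · subst h; simp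
  · simp [HahnSeries.coeff_single_of_ne h]

theorem laurMap_comp (φ : B →ₗ[ℂ] C) (ψ : A →ₗ[ℂ] B) (x : LaurentSeries A) :
    laurMap φ (laurMap ψ x) = laurMap (φ ∘ₗ ψ) x := rfl

theorem laurMap_zero_left (x : LaurentSeries A) : laurMap (0 : A →ₗ[ℂ] B) x = 0 := by
  refine HahnSeries.ext (funext fun n => ?_)
  rw [laurMap_coeff]
  rfl

theorem laurMap_add_left (φ ψ : A →ₗ[ℂ] B) (x : LaurentSeries A) :
    laurMap (φ + ψ) x = laurMap φ x + laurMap ψ x := by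
  refine HahnSeries.ext (funext fun n => ?_)
  rw [HahnSeries.coeff_add, laurMap_coeff, laurMap_coeff, laurMap_coeff]
  rfl

theorem mul_eq_cauchy {R : Type*} [CommRing R] [Algebra ℂ R] (x y : LaurentSeries R) :
    x * y = cauchy (LinearMap.mul ℂ R) x y := by
  obtain ⟨L, hL⟩ := exists_lower_bound x
  obtain ⟨M, hM⟩ := exists_lower_bound y
  refine HahnSeries.ext (funext fun n => ?_)
  rw [cauchy_coeff_Icc _ hL hM, HahnSeries.coeff_mul]
  symm
  refine Finset.sum_bij_ne_zero (fun i _ _ => (i, n - i)) ?_ ?_ ?_ ?_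
  · intro i _ hi
    rw [Finset.mem_antidiagonal]
    refine ⟨?_, ?_, by simp⟩
    · intro h
      exact hi (by rw [h]; simp)
    · intro h
      exact hi (by rw [h]; simp)
  · intro i _ _ j _ _ h
    exact (Prod.ext_iff.1 h).1
  · rintro ⟨i, j⟩ hij hne
    rw [Finset.mem_antidiagonal] at hij
    obtain ⟨hi, hj, h⟩ := hij
    have hn : n - i = j := by simp only at h; omega
    refine ⟨i, ?_, ?_, by simp [hn]⟩
    · rw [Finset.mem_Icc]
      constructor
      · by_contra h'
        exact hi (hL i (not_le.1 h'))
      · by_contra h'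
        exact hj (hM j (by simp only at h; omega))
    · simpa [hn] using hne
  · intro i _ _
    rfl

theorem mul_coeff_Icc {R : Type*} [CommRing R] [Algebra ℂ R] {x y : LaurentSeries R}
    {L L' : ℤ} (hx : ∀ i < L, x.coeff i = 0) (hy : ∀ i < L', y.coeff i = 0) (n : ℤ) :
    (x * y).coeff n = ∑ i ∈ Finset.Icc L (n - L'), x.coeff i * y.coeff (n - i) := by
  rw [mul_eq_cauchy, cauchy_coeff_Icc _ hx hy]
  rfl

end Cauchy

section LaurentModule

variable {N N' : Type*} [AddCommGroup N] [Module ℂ N] [Module Lau N] [IsScalarTower ℂ Lau N]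
  [AddCommGroup N'] [Module ℂ N'] [Module Lau N'] [IsScalarTower ℂ Lau N']

variable (N) in
/-- The action of `ℂ((x))` on a module, as a `ℂ`-bilinear map. -/
def lauAct : Lau →ₗ[ℂ] N →ₗ[ℂ] N := (Algebra.lsmul ℂ ℂ N).toLinearMap

theorem lauAct_apply (r : Lau) (n : N) : lauAct N r n = r • n := rfl

theorem Lau₂.mul_def (r s : Lau₂) :
    Lau₂.equiv (r * s) = cauchy (LinearMap.mul ℂ Lau) (Lau₂.equiv r) (Lau₂.equiv s) :=
  mul_eq_cauchy (R := Lau) (Lau₂.equiv r) (Lau₂.equiv s)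

theorem Lau₂.one_def : Lau₂.equiv 1 = HahnSeries.single (0 : ℤ) (1 : Lau) := rfl

/-- If `N` is a module over `ℂ((x))`, then `N((y))` is a module over `ℂ((x))((y))`. -/
instance instModuleLau₂ : Module Lau₂ (LaurentSeries N) where
  smul r X := cauchy (lauAct N) (Lau₂.equiv r) X
  one_smul X := by
    change cauchy (lauAct N) (Lau₂.equiv 1) X = X
    rw [Lau₂.one_def, cauchy_single_left]
    refine HahnSeries.ext (funext fun n => ?_)
    rw [laurMap_coeff, lauAct_apply, one_smul]
  mul_smul r s X := by
    change cauchy (lauAct N) (Lau₂.equiv (r * s)) X =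
      cauchy (lauAct N) (Lau₂.equiv r) (cauchy (lauAct N) (Lau₂.equiv s) X)
    rw [Lau₂.mul_def]
    exact cauchy_assoc (fun a b c => mul_smul a b c) _ _ _
  smul_zero r := map_zero _
  smul_add r := map_add _
  add_smul r s X := by
    change cauchy (lauAct N) (Lau₂.equiv (r + s)) X = _
    rw [map_add, map_add]
    rfl
  zero_smul X := by
    change cauchy (lauAct N) (Lau₂.equiv 0) X = _
    rw [map_zero, map_zero]
    rfl

theorem lau₂_smul_def (r : Lau₂) (X : LaurentSeries N) :
    r • X = cauchy (lauAct N) (Lau₂.equiv r) X := rfl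

instance : IsScalarTower ℂ Lau₂ (LaurentSeries N) where
  smul_assoc c r X := by
    rw [lau₂_smul_def, lau₂_smul_def, map_smul, map_smul]
    rfl

theorem lau₂_smul_eq_mul (r : Lau₂) (X : LaurentSeries Lau) :
    r • X = Lau₂.equiv (r * Lau₂.equiv.symm X) := by
  rw [lau₂_smul_def, Lau₂.mul_def]
  rfl

/-- A bilinear map that is `ℂ((x))`-linear in its first argument induces on Laurent series a
`ℂ((x))((y))`-linear map. -/
def cauchyLeft {B : Type*} [AddCommGroup B] [Module ℂ B] (β : N →ₗ[ℂ] B →ₗ[ℂ] N')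
    (hβ : ∀ (r : Lau) n b, β (r • n) b = r • β n b) (z : LaurentSeries B) :
    LaurentSeries N →ₗ[Lau₂] LaurentSeries N' where
  toFun X := cauchy β X z
  map_add' X X' := by rw [map_add]; rfl
  map_smul' r X := by
    rw [lau₂_smul_def, RingHom.id_apply, lau₂_smul_def]
    exact cauchy_assoc (fun r n b => hβ r n b) _ _ _

end LaurentModule

/-! ### Substitutions are algebra homomorphisms -/

section Substitutions

theorem Lau.mul_def (f g : Lau) :
    Lau.equiv (f * g) = cauchy (LinearMap.mul ℂ ℂ) (Lau.equiv f) (Lau.equiv g) :=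
  mul_eq_cauchy (R := ℂ) (Lau.equiv f) (Lau.equiv g)

/-- The coefficient of `zⁿ`. -/
def Lau.coeff (f : Lau) (n : ℤ) : ℂ := (Lau.equiv f).coeff n

/-- The coefficient of `xᵐ yⁿ`, where `x` is the inner and `y` the outer variable. -/
def Lau₂.coeff (f : Lau₂) (n m : ℤ) : ℂ := ((Lau₂.equiv f).coeff n).coeff m

theorem Lau.ext {f g : Lau} (h : ∀ n, f.coeff n = g.coeff n) : f = g :=
  Lau.equiv.injective (HahnSeries.ext (funext h))

theorem Lau₂.ext {f g : Lau₂} (h : ∀ n m, f.coeff n m = g.coeff n m) : f = g :=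
  Lau₂.equiv.injective (HahnSeries.ext (funext fun n => Lau.ext (h n)))

theorem Lau.coeff_smul (c : ℂ) (f : Lau) (n : ℤ) : (c • f).coeff n = c * f.coeff n := rfl

theorem Lau.coeff_zero (n : ℤ) : (0 : Lau).coeff n = 0 := rfl

theorem Lau.coeff_sum {ι : Type*} (s : Finset ι) (f : ι → Lau) (n : ℤ) :
    (∑ i ∈ s, f i).coeff n = ∑ i ∈ s, (f i).coeff n :=
  map_sum (⟨⟨fun f : Lau => f.coeff n, rfl⟩, fun _ _ => rfl⟩ : Lau →+ ℂ) f s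

theorem Lau.exists_bound (f : Lau) : ∃ L : ℤ, ∀ i < L, f.coeff i = 0 := exists_lower_bound _

theorem Lau₂.exists_bound (f : Lau₂) : ∃ L : ℤ, ∀ i < L, (Lau₂.equiv f).coeff i = 0 :=
  exists_lower_bound _

theorem Lau.coeff_mul_Icc {f g : Lau} {L L' : ℤ} (hf : ∀ i < L, f.coeff i = 0)
    (hg : ∀ i < L', g.coeff i = 0) (n : ℤ) :
    (f * g).coeff n = ∑ i ∈ Finset.Icc L (n - L'), f.coeff i * g.coeff (n - i) :=
  mul_coeff_Icc (R := ℂ) hf hg n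

theorem Lau₂.coeff_mul_Icc {f g : Lau₂} {L L' : ℤ} (hf : ∀ i < L, (Lau₂.equiv f).coeff i = 0)
    (hg : ∀ i < L', (Lau₂.equiv g).coeff i = 0) (n : ℤ) :
    (Lau₂.equiv (f * g)).coeff n =
      ∑ i ∈ Finset.Icc L (n - L'), (Lau₂.equiv f).coeff i * (Lau₂.equiv g).coeff (n - i) :=
  mul_coeff_Icc (R := Lau) hf hg n

theorem substNeg_coeff (f : Lau) (n : ℤ) : (substNeg f).coeff n = (-1) ^ n * f.coeff n := rfl

theorem lauHasse_coeff (j : ℕ) (f : Lau) (n : ℤ) :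
    (lauHasse j f).coeff n = (Ring.choose (n + j) j : ℤ) * f.coeff (n + j) := by
  change (LaurentSeries.hasseDeriv ℂ j (Lau.equiv f)).coeff n = _
  rw [LaurentSeries.hasseDeriv_coeff, zsmul_eq_mul]
  rfl

theorem substAdd_coeff (c : ℂ) (f : Lau) (n : ℤ) : (Lau₂.equiv (substAdd c f)).coeff n =
    if 0 ≤ n then c ^ n.toNat • lauHasse n.toNat f else 0 := rfl

theorem substAdd_coeff₂ (c : ℂ) (f : Lau) (n m : ℤ) : (substAdd c f).coeff n m =
    if 0 ≤ n then c ^ n.toNat * ((Ring.choose (m + n) n.toNat : ℤ) * f.coeff (m + n)) else 0 := by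
  rw [Lau₂.coeff, substAdd_coeff]
  split_ifs with h
  · change c ^ n.toNat * (lauHasse n.toNat f).coeff m = _
    rw [lauHasse_coeff, Int.toNat_of_nonneg h]
  · rfl

/-- Leibniz' rule for divided derivatives. -/
theorem lauHasse_mul (n : ℕ) (f g : Lau) :
    lauHasse n (f * g) = ∑ i ∈ Finset.range (n + 1), lauHasse i f * lauHasse (n - i) g := by
  obtain ⟨L, hL⟩ := f.exists_bound
  obtain ⟨M, hM⟩ := g.exists_bound
  have hb : ∀ (h : Lau) (L : ℤ), (∀ i < L, h.coeff i = 0) → ∀ (j : ℕ), ∀ i < L - j,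
      (lauHasse j h).coeff i = 0 := by
    intro h L hL j i hi
    rw [lauHasse_coeff, hL _ (by linarith), mul_zero]
  refine Lau.ext fun m => ?_
  rw [lauHasse_coeff, Lau.coeff_mul_Icc hL hM, Lau.coeff_sum, Finset.mul_sum]
  have : ∀ i ∈ Finset.range (n + 1), (lauHasse i f * lauHasse (n - i) g).coeff m =
      ∑ k ∈ Finset.Icc L (m + n - M), ((Ring.choose k i * Ring.choose (m + n - k) (n - i) : ℤ) : ℂ) *
        (f.coeff k * g.coeff (m + n - k)) := by
    intro i hi
    have hin : ((n - i : ℕ) : ℤ) = n - i := by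
      rw [Finset.mem_range] at hi
      omega
    rw [Lau.coeff_mul_Icc (hb f L hL i) (hb g M hM (n - i))]
    apply Finset.sum_nbij' (fun k : ℤ => k + (i : ℤ)) (fun k : ℤ => k - (i : ℤ))
    · simp only [Finset.mem_Icc]; omega
    · simp only [Finset.mem_Icc]; omega
    · simp
    · simp
    · intro k _
      rw [lauHasse_coeff, lauHasse_coeff, hin, show m - k + ((n : ℤ) - i) = m + n - (k + i) by ring]
      push_cast
      ring
  rw [Finset.sum_congr rfl this, Finset.sum_comm]
  refine Finset.sum_congr rfl fun k _ => ?_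
  rw [← Finset.sum_mul]
  congr 1
  have := Ring.add_choose_eq n (Commute.all k (m + n - k))
  rw [add_sub_cancel] at this
  rw [this, Finset.Nat.sum_antidiagonal_eq_sum_range_succ_mk]
  push_cast
  rfl

theorem substAdd_mul (c : ℂ) (f g : Lau) : substAdd c (f * g) = substAdd c f * substAdd c g := by
  have h0 : ∀ h : Lau, ∀ i < (0 : ℤ), (Lau₂.equiv (substAdd c h)).coeff i = 0 := by
    intro h i hi
    rw [substAdd_coeff, if_neg (by omega)]
  refine Lau₂.equiv.injective (HahnSeries.ext (funext fun n => ?_))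
  rw [Lau₂.coeff_mul_Icc (h0 f) (h0 g), substAdd_coeff]
  split_ifs with hn
  · rw [lauHasse_mul, Finset.smul_sum]
    apply Finset.sum_nbij' (fun i : ℕ => (i : ℤ)) (fun i : ℤ => i.toNat)
    · intro i hi
      simp only [Finset.mem_Icc, Finset.mem_range] at *
      omega
    · intro i hi
      simp only [Finset.mem_Icc, Finset.mem_range] at *
      omega
    · simp
    · intro i hi
      simp only [Finset.mem_Icc] at hi
      exact Int.toNat_of_nonneg hi.1
    · intro i hi
      rw [Finset.mem_range] at hi
      rw [substAdd_coeff, substAdd_coeff, if_pos (by omega), if_pos (by omega), smul_mul_smul_comm,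
        ← pow_add]
      have h1 : (i : ℤ).toNat = i := by simp
      have h2 : (n - i : ℤ).toNat = n.toNat - i := by omega
      have h3 : i + (n.toNat - i) = n.toNat := by omega
      rw [h1, h2, h3]
  · rw [Finset.Icc_eq_empty (by omega), Finset.sum_empty]

theorem lau_one_coeff (n : ℤ) : (1 : Lau).coeff n = if n = 0 then 1 else 0 := by
  change (HahnSeries.single (0 : ℤ) (1 : ℂ)).coeff n = _
  rw [HahnSeries.coeff_single]
  split_ifs <;> rfl

theorem lau₂_one_coeff (n m : ℤ) : (1 : Lau₂).coeff n m = if n = 0 ∧ m = 0 then 1 else 0 := by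
  change Lau.coeff ((HahnSeries.single (0 : ℤ) (1 : Lau)).coeff n) m = _
  rw [HahnSeries.coeff_single]
  by_cases h : n = 0
  · simp [h, lau_one_coeff]
  · simp [h, Lau.coeff_zero]

theorem substAdd_one (c : ℂ) : substAdd c 1 = 1 := by
  refine Lau₂.ext fun n m => ?_
  rw [substAdd_coeff₂, lau₂_one_coeff, lau_one_coeff]
  by_cases h : 0 ≤ n
  · rw [if_pos h]
    by_cases hmn : m + n = 0
    · rw [if_pos hmn, hmn]
      by_cases hn : n = 0
      · have : m = 0 := by omega
        simp [hn, this]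
      · have : n.toNat ≠ 0 := by omega
        rw [if_neg (by omega), Ring.choose_zero_pos ℤ (Nat.pos_of_ne_zero this)]
        simp
    · rw [if_neg hmn, if_neg (by omega)]
      simp
  · rw [if_neg h, if_neg (by omega)]

/-- `f(z) ↦ f(x + c y)`, expanded in nonnegative powers of `y`, as an algebra homomorphism. -/
def addHom (c : ℂ) : Lau →ₐ[ℂ] Lau₂ := AlgHom.ofLinearMap (substAdd c) (substAdd_one c) (substAdd_mul c)

theorem substNeg_mul (f g : Lau) : substNeg (f * g) = substNeg f * substNeg g := by
  obtain ⟨L, hL⟩ := f.exists_bound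
  obtain ⟨M, hM⟩ := g.exists_bound
  have hb : ∀ (h : Lau) (L : ℤ), (∀ i < L, h.coeff i = 0) → ∀ i < L, (substNeg h).coeff i = 0 := by
    intro h L hL i hi
    rw [substNeg_coeff, hL i hi, mul_zero]
  refine Lau.ext fun n => ?_
  rw [substNeg_coeff, Lau.coeff_mul_Icc hL hM, Lau.coeff_mul_Icc (hb f L hL) (hb g M hM),
    Finset.mul_sum]
  refine Finset.sum_congr rfl fun i _ => ?_
  rw [substNeg_coeff, substNeg_coeff]
  have : (-1 : ℂ) ^ n = (-1) ^ i * (-1) ^ (n - i) := by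
    rw [← zpow_add₀ (by norm_num)]
    congr 1
    ring
  rw [this]
  ring

/-- `f(z) ↦ f(-z)`, as an algebra homomorphism. -/
def negHom : Lau →ₐ[ℂ] Lau := AlgHom.ofLinearMap substNeg (Lau.ext fun n => by
  rw [substNeg_coeff, lau_one_coeff]
  by_cases h : n = 0 <;> simp [h]) substNeg_mul

theorem substInner_eq : substInner = substAdd 0 := by
  refine LinearMap.ext fun f => Lau₂.equiv.injective (HahnSeries.ext (funext fun n => ?_))
  rw [substAdd_coeff]
  change (HahnSeries.single (0 : ℤ) f).coeff n = _
  by_cases hn : n = 0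
  · subst hn
    refine Lau.ext fun m => ?_
    simp only [HahnSeries.coeff_single_same, le_refl, if_true, Int.toNat_zero, pow_zero, one_smul]
    rw [lauHasse_coeff]
    simp
  · rw [HahnSeries.coeff_single_of_ne hn]
    split_ifs with h
    · rw [zero_pow (by omega), zero_smul]
    · rfl

theorem substInner_coeff (f : Lau) (n : ℤ) :
    (Lau₂.equiv (substInner f)).coeff n = if n = 0 then f else 0 := by
  change (HahnSeries.single (0 : ℤ) f).coeff n = _
  rw [HahnSeries.coeff_single]
  split_ifs <;> rfl

theorem substOuter_coeff (f : Lau) (n m : ℤ) :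
    (substOuter f).coeff n m = if m = 0 then f.coeff n else 0 := by
  change ((HahnSeries.single (0 : ℤ) (f.coeff n)).coeff m) = _
  rw [HahnSeries.coeff_single]
  split_ifs <;> rfl

/-- Coefficientwise application of an algebra homomorphism, in the outer variable. -/
def mapHom (ρ : Lau →ₐ[ℂ] Lau) : Lau₂ →ₐ[ℂ] Lau₂ :=
  AlgHom.ofLinearMap (Lau₂.equiv.symm.toLinearMap ∘ₗ laurMap ρ.toLinearMap ∘ₗ Lau₂.equiv.toLinearMap)
    (by
      refine Lau₂.equiv.injective ?_
      change laurMap ρ.toLinearMap (HahnSeries.single (0 : ℤ) (1 : Lau)) = _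
      rw [laurMap_single, AlgHom.toLinearMap_apply, map_one]
      rfl)
    (fun f g => by
      refine Lau₂.equiv.injective ?_
      change laurMap ρ.toLinearMap (Lau₂.equiv (f * g)) = _
      rw [Lau₂.mul_def, Lau₂.mul_def, laurMap_cauchy]
      change _ = cauchy (LinearMap.mul ℂ Lau) (laurMap ρ.toLinearMap (Lau₂.equiv f))
        (laurMap ρ.toLinearMap (Lau₂.equiv g))
      rw [cauchy_laurMap]
      exact congrArg (fun β => cauchy β (Lau₂.equiv f) (Lau₂.equiv g))
        (LinearMap.ext fun a : Lau => LinearMap.ext fun b : Lau => map_mul ρ a b))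

/-- `f(z) ↦ f(x)`, as an algebra homomorphism. -/
def innerHom : Lau →ₐ[ℂ] Lau₂ := AlgHom.ofLinearMap substInner
  (by rw [substInner_eq, substAdd_one]) (by rw [substInner_eq]; exact substAdd_mul 0)

/-- `f(z) ↦ f(y)`, as an algebra homomorphism. -/
def outerHom : Lau →ₐ[ℂ] Lau₂ := AlgHom.ofLinearMap substOuter
  (Lau₂.ext fun n m => by
    rw [substOuter_coeff, lau₂_one_coeff, lau_one_coeff]
    by_cases hn : n = 0 <;> by_cases hm : m = 0 <;> simp [hn, hm])
  (fun f g => by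
    refine Lau₂.equiv.injective ?_
    rw [Lau₂.mul_def]
    change laurMap (Algebra.linearMap ℂ Lau) (Lau.equiv (f * g)) =
      cauchy (LinearMap.mul ℂ Lau) (laurMap (Algebra.linearMap ℂ Lau) (Lau.equiv f))
        (laurMap (Algebra.linearMap ℂ Lau) (Lau.equiv g))
    rw [Lau.mul_def, laurMap_cauchy, cauchy_laurMap]
    exact congrArg (fun β => cauchy β (Lau.equiv f) (Lau.equiv g))
      (LinearMap.ext fun a : ℂ => LinearMap.ext fun b : ℂ => map_mul (algebraMap ℂ Lau) a b))

end Substitutions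

/-! ### Vertex operators acting on test functions -/

theorem HSer.conv_interchange {A B C D E F G H X : Type*} [AddCommMonoid E] [AddCommMonoid F]
    [AddCommMonoid G] [AddCommMonoid H] [AddCommMonoid X] {β : A → B → E} {δ : C → D → F}
    {γ : E → F → X} {β' : A → C → G} {δ' : B → D → H} {ε : G → H → X}
    (hγ0 : ∀ c, γ 0 c = 0) (hγ : ∀ d d' c, γ (d + d') c = γ d c + γ d' c)
    (hγ0' : ∀ c, γ c 0 = 0) (hγ' : ∀ c d d', γ c (d + d') = γ c d + γ c d')
    (hε0 : ∀ c, ε 0 c = 0) (hε : ∀ d d' c, ε (d + d') c = ε d c + ε d' c)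
    (hε0' : ∀ c, ε c 0 = 0) (hε' : ∀ c d d', ε c (d + d') = ε c d + ε c d')
    (h : ∀ a b c d, γ (β a b) (δ c d) = ε (β' a c) (δ' b d))
    (x : HSer A) (y : HSer B) (z : HSer C) (w : HSer D) :
    conv γ (conv β x y) (conv δ z w) = conv ε (conv β' x z) (conv δ' y w) := by
  funext n
  simp only [conv_apply, apply_sum_left hγ0 hγ, apply_sum_left hε0 hε,
    apply_sum_left (γ := fun x a => γ a x) hγ0' (fun d d' a => hγ' a d d'),
    apply_sum_left (γ := fun x a => ε a x) hε0' (fun d d' a => hε' a d d'), h]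
  simp only [Finset.sum_sigma']
  apply Finset.sum_nbij' (fun ⟨_, ⟨⟨i, j⟩, ⟨k, l⟩⟩⟩ ↦ ⟨(i + k, j + l), ⟨(i, k), (j, l)⟩⟩)
    (fun ⟨_, ⟨⟨i, k⟩, ⟨j, l⟩⟩⟩ ↦ ⟨(i + j, k + l), ⟨(i, j), (k, l)⟩⟩)
  · rintro ⟨⟨p, q⟩, ⟨⟨i, j⟩, ⟨k, l⟩⟩⟩
    simp only [Finset.mem_sigma, Finset.HasAntidiagonal.mem_antidiagonal]
    rintro ⟨h1, h2, h3⟩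
    exact ⟨by omega, trivial, trivial⟩
  · rintro ⟨⟨p, q⟩, ⟨⟨i, j⟩, ⟨k, l⟩⟩⟩
    simp only [Finset.mem_sigma, Finset.HasAntidiagonal.mem_antidiagonal]
    rintro ⟨h1, h2, h3⟩
    exact ⟨by omega, trivial, trivial⟩
  · rintro ⟨⟨p, q⟩, ⟨⟨i, j⟩, ⟨k, l⟩⟩⟩
    simp only [Finset.mem_sigma, Finset.HasAntidiagonal.mem_antidiagonal]
    rintro ⟨h1, h2, h3⟩
    subst h2 h3
    rfl
  · rintro ⟨⟨p, q⟩, ⟨⟨i, j⟩, ⟨k, l⟩⟩⟩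
    simp only [Finset.mem_sigma, Finset.HasAntidiagonal.mem_antidiagonal]
    rintro ⟨h1, h2, h3⟩
    subst h2 h3
    rfl
  · rintro ⟨⟨p, q⟩, ⟨⟨i, j⟩, ⟨k, l⟩⟩⟩ _
    rfl

section LaurentPairing

variable {A B C : Type*} [AddCommGroup A] [Module ℂ A] [AddCommGroup B] [Module ℂ B]
  [AddCommGroup C] [Module ℂ C]
  {I J K : Type*} (a : Basis I ℂ A) (b : Basis J ℂ B) (c : Basis K ℂ C)
  {N N' : Type*} [AddCommGroup N] [Module ℂ N] [AddCommGroup N'] [Module ℂ N']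

/-- The value at `x ∈ A((z))[[ħ]]` of the extension of a function on a basis of `A`. -/
def lpr (x : HSer (LaurentSeries A)) (f : I → HSer N) : HSer (LaurentSeries N) :=
  conv (fun x g => laurMap g x) x (lin a f)

/-- The value of `Y(z)` at a pair of basis vectors. -/
def yAt (Y : HSer (A ⊗[ℂ] A →ₗ[ℂ] LaurentSeries A)) (i i' : I) : HSer (LaurentSeries A) :=
  Y.map fun y => y (a i ⊗ₜ a i')

variable {a b c}

theorem laurMap_lin_zero (x : LaurentSeries A) : laurMap (0 : A →ₗ[ℂ] N) x = 0 :=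
  laurMap_zero_left x

theorem lpr_coeff (x : HSer (LaurentSeries A)) (f : I → HSer N) (n : ℤ) :
    (lpr a x f).map (fun X => X.coeff n) = vpr a (x.map fun X => X.coeff n) f := by
  funext t
  rw [map_apply, lpr, vpr, conv_apply, conv_apply, HahnSeries.coeff_sum]
  rfl

theorem hser_laurent_ext {A : Type*} [AddCommGroup A] {x y : HSer (LaurentSeries A)}
    (h : ∀ n : ℤ, x.map (fun X => X.coeff n) = y.map fun X => X.coeff n) : x = y := by
  funext t
  exact HahnSeries.ext (funext fun n => congrFun (h n) t)

/-- The action of `laurTensor (x ⊗ z)` on test functions of two variables. -/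
def YYpr (a : Basis I ℂ A) (b : Basis J ℂ B) (x : HSer (LaurentSeries A))
    (z : HSer (LaurentSeries B)) (f : I → J → HSer N) : HSer (LaurentSeries N) :=
  lpr (a.tensorProduct b) (conv (fun x z => laurTensor (x ⊗ₜ[ℂ] z)) x z) fun p => f p.1 p.2

theorem laurTensor_tmul (x : LaurentSeries A) (z : LaurentSeries B) :
    laurTensor (x ⊗ₜ[ℂ] z) = cauchy (TensorProduct.mk ℂ A B) x z := rfl

theorem YYpr_conv {N₁ N₂ : Type*} [AddCommGroup N₁] [Module ℂ N₁] [AddCommGroup N₂] [Module ℂ N₂]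
    (β : N₁ →ₗ[ℂ] N₂ →ₗ[ℂ] N) (x : HSer (LaurentSeries A)) (z : HSer (LaurentSeries B))
    (f : I → HSer N₁) (g : J → HSer N₂) :
    YYpr a b x z (fun i j => conv (fun m n => β m n) (f i) (g j)) =
      conv (fun X Z => cauchy β X Z) (lpr a x f) (lpr b z g) := by
  have : lin (a.tensorProduct b) (fun p => conv (fun m n => β m n) (f p.1) (g p.2)) =
      conv (fun u v => TensorProduct.lift (β.compl₁₂ u v)) (lin a f) (lin b g) := by
    funext t
    refine (a.tensorProduct b).ext fun p => ?_
    rw [lin_basis, conv_apply, conv_apply, LinearMap.sum_apply]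
    refine Finset.sum_congr rfl fun q _ => ?_
    simp [Module.Basis.tensorProduct_apply', lin_basis]
  unfold YYpr lpr
  rw [this]
  refine conv_interchange (γ := fun w (g : A ⊗[ℂ] B →ₗ[ℂ] N) => laurMap g w)
    (ε := fun X Z => cauchy β X Z)
    (fun _ => map_zero _) (fun _ _ _ => map_add _ _ _) (fun _ => laurMap_zero_left _)
    (fun _ _ _ => laurMap_add_left _ _ _) (fun _ => by rw [map_zero]; rfl)
    (fun _ _ _ => by rw [map_add]; rfl) (fun _ => map_zero _) (fun _ _ _ => map_add _ _ _) ?_ _ _ _ _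
  intro x z u v
  rw [laurTensor_tmul, laurMap_cauchy, cauchy_laurMap]
  rfl

theorem constr_smul {R : Type*} [CommRing R] [Algebra ℂ R] [Module R N] [IsScalarTower ℂ R N]
    (r : R) (g : J → N) (y : B) : b.constr ℂ (r • g) y = r • b.constr ℂ g y := by
  have : b.constr ℂ (r • g) = (Algebra.lsmul ℂ ℂ N r) ∘ₗ b.constr ℂ g :=
    b.ext fun i => by simp
  rw [this]
  rfl

variable [Module Lau N] [IsScalarTower ℂ Lau N]

/-- Pairing the coefficients of a family of Laurent series with a Laurent series of vectors. -/
def specL (b : Basis J ℂ B) (N : Type*) [AddCommGroup N] [Module ℂ N] [Module Lau N]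
    [IsScalarTower ℂ Lau N] (z : HSer (LaurentSeries B)) :
    HSer (LaurentSeries (J → N) →ₗ[Lau₂] LaurentSeries N) :=
  z.map (cauchyLeft (N := J → N) (N' := N) (b.constr ℂ).toLinearMap constr_smul)

theorem YYpr_left (x : HSer (LaurentSeries A)) (z : HSer (LaurentSeries B)) (f : I → J → HSer N) :
    YYpr a b x z f = hap (specL b N z) (lpr a x fun i => bundle (f i)) := by
  have : lin a (fun i => bundle (f i)) = (lin (a.tensorProduct b) fun p => f p.1 p.2).map fun g =>
      (LinearMap.pi fun j => g ∘ₗ (TensorProduct.mk ℂ A B).flip (b j)) := by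
    funext t
    refine a.ext fun i => ?_
    rw [lin_basis, map_apply]
    funext j
    rw [LinearMap.pi_apply]
    change f i j t = lin (a.tensorProduct b) (fun p => f p.1 p.2) t (a i ⊗ₜ b j)
    rw [← Module.Basis.tensorProduct_apply, lin_basis]
  unfold YYpr lpr hap
  rw [this, conv_map_right, specL, conv_map_left]
  refine conv_rot (γ := fun w (g : A ⊗[ℂ] B →ₗ[ℂ] N) => laurMap g w)
    (ε := fun z X => cauchyLeft (N := J → N) (N' := N) (b.constr ℂ).toLinearMap constr_smul z X)
    (fun _ => map_zero _) (fun _ _ _ => map_add _ _ _) (fun _ => map_zero _)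
    (fun _ _ _ => map_add _ _ _) ?_ _ _ _
  intro x z g
  rw [laurTensor_tmul, laurMap_cauchy]
  change _ = cauchy ((b.constr ℂ).toLinearMap : (J → N) →ₗ[ℂ] B →ₗ[ℂ] N) (laurMap _ x) (laurMap LinearMap.id z)
  rw [cauchy_laurMap]
  refine congrArg (fun β => cauchy β x z) (LinearMap.ext fun u => b.ext fun j => ?_)
  simp

theorem YYpr_right (x : HSer (LaurentSeries A)) (z : HSer (LaurentSeries B)) (f : I → J → HSer N) :
    YYpr a b x z f = hap (specL a N x) (lpr b z fun j => bundle fun i => f i j) := by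
  have : lin b (fun j => bundle fun i => f i j) =
      (lin (a.tensorProduct b) fun p => f p.1 p.2).map fun g =>
      (LinearMap.pi fun i => g ∘ₗ (TensorProduct.mk ℂ A B) (a i)) := by
    funext t
    refine b.ext fun j => ?_
    rw [lin_basis, map_apply]
    funext i
    rw [LinearMap.pi_apply]
    change f i j t = lin (a.tensorProduct b) (fun p => f p.1 p.2) t (a i ⊗ₜ b j)
    rw [← Module.Basis.tensorProduct_apply, lin_basis]
  unfold YYpr lpr hap
  rw [this, conv_map_right, specL, conv_map_left]
  refine conv_assoc (γ := fun w (g : A ⊗[ℂ] B →ₗ[ℂ] N) => laurMap g w)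
    (ε := fun z X => cauchyLeft (N := I → N) (N' := N) (a.constr ℂ).toLinearMap constr_smul z X)
    (fun _ => map_zero _) (fun _ _ _ => map_add _ _ _) (fun _ => map_zero _)
    (fun _ _ _ => map_add _ _ _) ?_ _ _ _
  intro x z g
  rw [laurTensor_tmul, laurMap_cauchy, cauchy_swap]
  change _ = cauchy ((a.constr ℂ).toLinearMap : (I → N) →ₗ[ℂ] A →ₗ[ℂ] N) (laurMap _ z) (laurMap LinearMap.id x)
  rw [cauchy_laurMap]
  refine congrArg (fun β => cauchy β z x) (LinearMap.ext fun u => a.ext fun j => ?_)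
  simp

end LaurentPairing

/-! ### The hexagon identities on test functions -/

section Hexagon

variable {A B P Q : Type*} [AddCommGroup A] [Module ℂ A] [AddCommGroup B] [Module ℂ B]
  [AddCommGroup P] [Module ℂ P] [AddCommGroup Q] [Module ℂ Q]
  {I J X Z : Type*} {a : Basis I ℂ A} {b : Basis J ℂ B} {p : Basis X ℂ P} {q : Basis Z ℂ Q}
  {N : Type*} [AddCommGroup N] [Module ℂ N] [Module Lau N] [IsScalarTower ℂ Lau N]

/-- The `ρ`-semilinear extension of a linear map with values in a `ℂ((x))`-module. -/
def twLift (ρ : Lau →ₐ[ℂ] Lau) (g : Q →ₗ[ℂ] N) : Lau ⊗[ℂ] Q →ₗ[ℂ] N :=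
  (LinearMap.liftBaseChange Lau g).restrictScalars ℂ ∘ₗ ρ.toLinearMap.rTensor Q

/-- The value at `x ∈ (ℂ((x)) ⊗ Q)((y))[[ħ]]` of the `ρ`-semilinear extension of a function on a
basis of `Q`. -/
def lprT (q : Basis Z ℂ Q) (ρ : Lau →ₐ[ℂ] Lau) (x : HSer (LaurentSeries (Lau ⊗[ℂ] Q)))
    (f : Z → HSer N) : HSer (LaurentSeries N) :=
  conv (fun x g => laurMap (twLift ρ g) x) x (lin q f)

theorem lprT_opAfter (ρ : Lau →ₐ[ℂ] Lau) (S : Op Lau Q Q) (T : HSer (P →ₗ[ℂ] LaurentSeries Q))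
    (v : P) (f : Z → HSer N) :
    lprT q ρ ((opAfter S T).map fun t => t v) f =
      lpr q (T.map fun t => t v) (Op.act q q (S.mapScalars ρ.toLinearMap) f) := by
  have h : (opAfter S T).map (fun t => t v) =
      conv (fun s x => laurMap s x) S (T.map fun t => t v) := by
    funext t
    simp [opAfter, map_apply, conv_apply]
  rw [h]
  unfold lprT lpr
  rw [lin_act]
  exact conv_rot (γ := fun x (g : Q →ₗ[ℂ] N) => laurMap (twLift ρ g) x)
    (ε := fun x (g : Q →ₗ[ℂ] N) => laurMap g x) (δ := fun s g => twLift ρ g ∘ₗ s)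
    (fun _ => map_zero _) (fun _ _ _ => map_add _ _ _) (fun _ => laurMap_zero_left _)
    (fun _ _ _ => laurMap_add_left _ _ _) (fun _ _ _ => rfl) _ _ _

theorem laurMap_twLift_laurTensor₂ (ρ : Lau →ₐ[ℂ] Lau) (g : Q →ₗ[ℂ] N)
    (z : P →ₗ[ℂ] LaurentSeries Q) (x : Lau₂ ⊗[ℂ] P) :
    laurMap (twLift ρ g) (laurTensor₂ (z.lTensor Lau₂ x)) =
      LinearMap.liftBaseChange Lau₂ (laurMap g ∘ₗ z) ((mapHom ρ).toLinearMap.rTensor P x) := by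
  induction x with
  | zero => simp
  | add x y hx hy => simp only [map_add, hx, hy]
  | tmul r v =>
    rw [LinearMap.lTensor_tmul, LinearMap.rTensor_tmul, LinearMap.liftBaseChange_tmul,
      lau₂_smul_def]
    change laurMap (twLift ρ g) (cauchy (TensorProduct.mk ℂ Lau Q) (Lau₂.equiv r) (z v)) =
      cauchy (lauAct N) (laurMap ρ.toLinearMap (Lau₂.equiv r)) (laurMap g (z v))
    rw [laurMap_cauchy, cauchy_laurMap]
    refine congrArg (fun β => cauchy β (Lau₂.equiv r) (z v))
      (LinearMap.ext fun s : Lau => LinearMap.ext fun w => ?_)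
    simp [twLift, lauAct_apply]

theorem lprT_opBefore (ρ : Lau →ₐ[ℂ] Lau) (T : HSer (P →ₗ[ℂ] LaurentSeries Q)) (U : Op Lau₂ P P)
    (i : X) (f : Z → HSer N) :
    lprT q ρ ((opBefore T U).map fun t => t (p i)) f =
      Op.act p p (U.mapScalars (mapHom ρ).toLinearMap)
        (fun i => lpr q (T.map fun t => t (p i)) f) i := by
  have h : (opBefore T U).map (fun t => t (p i)) =
      conv (fun z x => laurTensor₂ (z.lTensor Lau₂ x)) T (U.map fun t => t (p i)) := by
    funext t
    simp [opBefore, map_apply, conv_apply]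
  have h2 : lin p (fun i => lpr q (T.map fun t => t (p i)) f) =
      conv (fun z g => laurMap g ∘ₗ z) T (lin q f) := by
    funext t
    refine p.ext fun i => ?_
    rw [lin_basis, conv_apply, LinearMap.sum_apply]
    rfl
  rw [h]
  unfold lprT Op.act pr
  rw [h2]
  exact conv_rot (γ := fun x (g : Q →ₗ[ℂ] N) => laurMap (twLift ρ g) x)
    (ε := fun x (g : P →ₗ[ℂ] LaurentSeries N) =>
      LinearMap.liftBaseChange Lau₂ g ((mapHom ρ).toLinearMap.rTensor P x))
    (δ := fun z g => laurMap g ∘ₗ z)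
    (fun _ => map_zero _) (fun _ _ _ => map_add _ _ _) (fun _ => liftBaseChange_zero _)
    (fun _ _ _ => liftBaseChange_add _ _ _)
    (fun z x g => laurMap_twLift_laurTensor₂ ρ g z x) _ _ _

/-- An identity of the form `S(x) T(y) = T(y) U(x, y)` holds if it does so on test functions. -/
theorem opAfter_eq_opBefore {S : Op Lau Q Q} {T : HSer (P →ₗ[ℂ] LaurentSeries Q)} {U : Op Lau₂ P P}
    (h : ∀ (f : Z → HSer Lau) (i : X), lpr q (T.map fun t => t (p i)) (Op.act q q S f) =
      Op.act p p U (fun i => lpr q (T.map fun t => t (p i)) f) i) :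
    opAfter S T = opBefore T U := by
  have hid : ∀ V : Op Lau₂ P P, V.mapScalars (mapHom (AlgHom.id ℂ Lau)).toLinearMap = V := by
    intro V
    have : mapHom (AlgHom.id ℂ Lau) = AlgHom.id ℂ Lau₂ := rfl
    rw [this, mapScalars_id]
  funext t
  refine p.ext fun i => HahnSeries.ext (funext fun n => ?_)
  have key : (opAfter S T).map (fun t => (t (p i)).coeff n) =
      (opBefore T U).map fun t => (t (p i)).coeff n := by
    refine ext_pr (a := q) fun f => ?_
    have h1 := lprT_opAfter (q := q) (AlgHom.id ℂ Lau) S T (p i) f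
    have h2 := lprT_opBefore (p := p) (q := q) (AlgHom.id ℂ Lau) T U i f
    rw [mapScalars_id] at h1
    rw [hid] at h2
    have h3 := congrArg (fun x => x.map fun (X : LaurentSeries Lau) => X.coeff n)
      (h1.trans ((h f i).trans h2.symm))
    have h4 : ∀ W : HSer (P →ₗ[ℂ] LaurentSeries (Lau ⊗[ℂ] Q)),
        (lprT q (AlgHom.id ℂ Lau) (W.map fun t => t (p i)) f).map (fun X => X.coeff n) =
        pr q (W.map fun t => (t (p i)).coeff n) f := by
      intro W
      funext s
      rw [map_apply, lprT, pr, conv_apply, conv_apply, HahnSeries.coeff_sum]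
      refine Finset.sum_congr rfl fun r _ => ?_
      rw [laurMap_coeff, twLift]
      have : (AlgHom.id ℂ Lau).toLinearMap = LinearMap.id := rfl
      rw [this]
      simp [map_apply]
    simp only [h4] at h3
    exact h3
  exact congrFun key t

theorem lpr_Y12 {N : Type*} [AddCommGroup N] [Module ℂ N]
    (Y : HSer (A ⊗[ℂ] A →ₗ[ℂ] LaurentSeries A)) (f : I × J → HSer N)
    (i i' : I) (j : J) :
    lpr (a.tensorProduct b) ((Y.map (Y12 (B := B))).map fun t =>
      t ((a.tensorProduct (a.tensorProduct b)) (i, i', j))) f =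
      lpr a (yAt a Y i i') fun k => f (k, j) := by
  unfold lpr
  refine conv_congr fun m n => ?_
  simp only [map_apply, Module.Basis.tensorProduct_apply, yAt, Y12, LinearMap.comp_apply,
    LinearEquiv.coe_coe, TensorProduct.assoc_symm_tmul, LinearMap.rTensor_tmul]
  change laurMap _ (cauchy (TensorProduct.mk ℂ A B) (Y m (a i ⊗ₜ a i'))
    (HahnSeries.single (0 : ℤ) (b j))) = _
  rw [cauchy_single_right, laurMap_comp]
  refine congrArg (fun g => laurMap g (Y m (a i ⊗ₜ a i'))) (a.ext fun k => ?_)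
  simp only [LinearMap.comp_apply, LinearMap.flip_apply, TensorProduct.mk_apply, lin_basis]
  rw [← Module.Basis.tensorProduct_apply, lin_basis]

theorem lpr_Y23 {N : Type*} [AddCommGroup N] [Module ℂ N]
    (Y : HSer (B ⊗[ℂ] B →ₗ[ℂ] LaurentSeries B)) (f : I × J → HSer N)
    (i : I) (j j' : J) :
    lpr (a.tensorProduct b) ((Y.map (Y23 (A := A))).map fun t =>
      t ((a.tensorProduct (b.tensorProduct b)) (i, j, j'))) f =
      lpr b (yAt b Y j j') fun l => f (i, l) := by
  unfold lpr
  refine conv_congr fun m n => ?_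
  simp only [map_apply, Module.Basis.tensorProduct_apply, yAt, Y23, LinearMap.comp_apply,
    LinearMap.lTensor_tmul]
  change laurMap _ (cauchy (TensorProduct.mk ℂ A B) (HahnSeries.single (0 : ℤ) (a i))
    (Y m (b j ⊗ₜ b j'))) = _
  rw [cauchy_single_left, laurMap_comp]
  refine congrArg (fun g => laurMap g (Y m (b j ⊗ₜ b j'))) (b.ext fun k => ?_)
  simp only [LinearMap.comp_apply, TensorProduct.mk_apply, lin_basis]
  rw [← Module.Basis.tensorProduct_apply, lin_basis]

/-- The identity `S(z₁) Y¹²(z₂) = Y¹²(z₂) S²³(z₁) S¹³(z₁ + z₂)`. -/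
def HexL (Y : HSer (A ⊗[ℂ] A →ₗ[ℂ] LaurentSeries A)) (S : Op Lau (A ⊗[ℂ] B) (A ⊗[ℂ] B)) : Prop :=
  opAfter S (Y.map (Y12 (B := B))) = opBefore (Y.map (Y12 (B := B)))
    ((Op.leg23 A S.atInner).comp (Op.leg13 A S.atSum))

/-- The identity `S(z₁) Y²³(z₂) = Y²³(z₂) S¹²(z₁ - z₂) S¹³(z₁)`. -/
def HexR (Y : HSer (B ⊗[ℂ] B →ₗ[ℂ] LaurentSeries B)) (S : Op Lau (A ⊗[ℂ] B) (A ⊗[ℂ] B)) : Prop :=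
  opAfter S (Y.map (Y23 (A := A))) = opBefore (Y.map (Y23 (A := A)))
    ((Op.leg12 B S.atDiff).comp (Op.leg13 B S.atInner))

theorem mapScalars_atInner {R : Type} [CommRing R] [Algebra ℂ R] (φ : Lau₂ →ₐ[ℂ] R) (S : Op Lau A B) :
    S.atInner.mapScalars φ.toLinearMap = S.mapScalars (φ.comp innerHom).toLinearMap :=
  mapScalars_mapScalars _ _ _

theorem mapScalars_atOuter {R : Type} [CommRing R] [Algebra ℂ R] (φ : Lau₂ →ₐ[ℂ] R) (S : Op Lau A B) :
    S.atOuter.mapScalars φ.toLinearMap = S.mapScalars (φ.comp outerHom).toLinearMap :=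
  mapScalars_mapScalars _ _ _

theorem mapScalars_atSum {R : Type} [CommRing R] [Algebra ℂ R] (φ : Lau₂ →ₐ[ℂ] R) (S : Op Lau A B) :
    S.atSum.mapScalars φ.toLinearMap = S.mapScalars (φ.comp (addHom 1)).toLinearMap :=
  mapScalars_mapScalars _ _ _

theorem mapScalars_atDiff {R : Type} [CommRing R] [Algebra ℂ R] (φ : Lau₂ →ₐ[ℂ] R) (S : Op Lau A B) :
    S.atDiff.mapScalars φ.toLinearMap = S.mapScalars (φ.comp (addHom (-1))).toLinearMap :=
  mapScalars_mapScalars _ _ _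

theorem hexL_test {Y : HSer (A ⊗[ℂ] A →ₗ[ℂ] LaurentSeries A)} {S : Op Lau (A ⊗[ℂ] B) (A ⊗[ℂ] B)}
    (h : HexL Y S) (ρ : Lau →ₐ[ℂ] Lau) (f : I → J → HSer N) (i i' : I) (j : J) :
    lpr a (yAt a Y i i') (fun k => Op.act2 a b (S.mapScalars ρ.toLinearMap) f k j) =
      Op.act2 a b (S.mapScalars ((mapHom ρ).comp (addHom 1)).toLinearMap) (fun i j =>
        Op.act2 a b (S.mapScalars ((mapHom ρ).comp innerHom).toLinearMap) (fun i' j =>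
          lpr a (yAt a Y i i') fun k => f k j) i' j) i j := by
  have h1 := lprT_opAfter (q := a.tensorProduct b) ρ S (Y.map (Y12 (B := B)))
    ((a.tensorProduct (a.tensorProduct b)) (i, i', j)) (fun p => f p.1 p.2)
  rw [lpr_Y12 (a := a) (b := b)] at h1
  refine h1.symm.trans ?_
  rw [(h : opAfter S (Y.map (Y12 (B := B))) = _),
    lprT_opBefore (p := a.tensorProduct (a.tensorProduct b)) (q := a.tensorProduct b),
    mapScalars_comp, mapScalars_leg23, mapScalars_leg13, mapScalars_atInner, mapScalars_atSum,
    act_comp (a := a.tensorProduct (a.tensorProduct b)) (b := a.tensorProduct (a.tensorProduct b))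
      (c := a.tensorProduct (a.tensorProduct b)), act_leg13 (a := a) (b := a) (c := b)]
  refine act2_congr (fun i j => ?_) _ _
  rw [act_leg23' (a := a) (b := a) (c := b)]
  refine act2_congr (fun i' j => ?_) _ _
  exact lpr_Y12 (a := a) (b := b) Y _ i i' j

theorem hexL_of_test {Y : HSer (A ⊗[ℂ] A →ₗ[ℂ] LaurentSeries A)} {S : Op Lau (A ⊗[ℂ] B) (A ⊗[ℂ] B)}
    (h : ∀ (f : I → J → HSer Lau) (i i' : I) (j : J),
      lpr a (yAt a Y i i') (fun k => Op.act2 a b S f k j) =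
      Op.act2 a b (S.mapScalars (addHom 1).toLinearMap) (fun i j =>
        Op.act2 a b (S.mapScalars innerHom.toLinearMap) (fun i' j =>
          lpr a (yAt a Y i i') fun k => f k j) i' j) i j) : HexL Y S := by
  refine opAfter_eq_opBefore (q := a.tensorProduct b)
    (p := a.tensorProduct (a.tensorProduct b)) fun f => ?_
  rintro ⟨i, i', j⟩
  rw [lpr_Y12 (a := a) (b := b), act_comp (a := a.tensorProduct (a.tensorProduct b))
    (b := a.tensorProduct (a.tensorProduct b)) (c := a.tensorProduct (a.tensorProduct b)),
    act_leg13 (a := a) (b := a) (c := b)]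
  refine (h (fun i j => f (i, j)) i i' j).trans ?_
  refine act2_congr (fun i j => ?_) _ _
  rw [act_leg23' (a := a) (b := a) (c := b)]
  refine act2_congr (fun i' j => ?_) _ _
  exact (lpr_Y12 (a := a) (b := b) Y _ i i' j).symm

theorem hexR_test {Y : HSer (B ⊗[ℂ] B →ₗ[ℂ] LaurentSeries B)} {S : Op Lau (A ⊗[ℂ] B) (A ⊗[ℂ] B)}
    (h : HexR Y S) (ρ : Lau →ₐ[ℂ] Lau) (f : I → J → HSer N) (i : I) (j j' : J) :
    lpr b (yAt b Y j j') (fun l => Op.act2 a b (S.mapScalars ρ.toLinearMap) f i l) =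
      Op.act2 a b (S.mapScalars ((mapHom ρ).comp innerHom).toLinearMap) (fun i j' =>
        Op.act2 a b (S.mapScalars ((mapHom ρ).comp (addHom (-1))).toLinearMap) (fun i j =>
          lpr b (yAt b Y j j') fun l => f i l) i j) i j' := by
  have h1 := lprT_opAfter (q := a.tensorProduct b) ρ S (Y.map (Y23 (A := A)))
    ((a.tensorProduct (b.tensorProduct b)) (i, j, j')) (fun p => f p.1 p.2)
  rw [lpr_Y23 (a := a) (b := b)] at h1
  refine h1.symm.trans ?_
  rw [(h : opAfter S (Y.map (Y23 (A := A))) = _),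
    lprT_opBefore (p := a.tensorProduct (b.tensorProduct b)) (q := a.tensorProduct b),
    mapScalars_comp, mapScalars_leg12, mapScalars_leg13, mapScalars_atInner, mapScalars_atDiff,
    act_comp (a := a.tensorProduct (b.tensorProduct b)) (b := a.tensorProduct (b.tensorProduct b))
      (c := a.tensorProduct (b.tensorProduct b)), act_leg13 (a := a) (b := b) (c := b)]
  refine act2_congr (fun i j' => ?_) _ _
  rw [act_leg12 (a := a) (b := b) (c := b)]
  refine act2_congr (fun i j => ?_) _ _
  exact lpr_Y23 (a := a) (b := b) Y _ i j j'

theorem hexR_of_test {Y : HSer (B ⊗[ℂ] B →ₗ[ℂ] LaurentSeries B)} {S : Op Lau (A ⊗[ℂ] B) (A ⊗[ℂ] B)}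
    (h : ∀ (f : I → J → HSer Lau) (i : I) (j j' : J),
      lpr b (yAt b Y j j') (fun l => Op.act2 a b S f i l) =
      Op.act2 a b (S.mapScalars innerHom.toLinearMap) (fun i j' =>
        Op.act2 a b (S.mapScalars (addHom (-1)).toLinearMap) (fun i j =>
          lpr b (yAt b Y j j') fun l => f i l) i j) i j') : HexR Y S := by
  refine opAfter_eq_opBefore (q := a.tensorProduct b)
    (p := a.tensorProduct (b.tensorProduct b)) fun f => ?_
  rintro ⟨i, j, j'⟩
  rw [lpr_Y23 (a := a) (b := b), act_comp (a := a.tensorProduct (b.tensorProduct b))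
    (b := a.tensorProduct (b.tensorProduct b)) (c := a.tensorProduct (b.tensorProduct b)),
    act_leg13 (a := a) (b := b) (c := b)]
  refine (h (fun i j => f (i, j)) i j j').trans ?_
  refine act2_congr (fun i j' => ?_) _ _
  rw [act_leg12 (a := a) (b := b) (c := b)]
  refine act2_congr (fun i j => ?_) _ _
  exact (lpr_Y23 (a := a) (b := b) Y _ i j j').symm

end Hexagon

/-! ### The vertex operator map of a twisted tensor product on test functions -/

section TwistedRule

variable {A B : Type*} [AddCommGroup A] [Module ℂ A] [AddCommGroup B] [Module ℂ B]
  {I J : Type*} {a : Basis I ℂ A} {b : Basis J ℂ B}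
  {N : Type*} [AddCommGroup N] [Module ℂ N]

/-- The vertex operator map `(Y₁(z) ⊗ Y₂(z)) S²³(-z) σ²³`. -/
def twistY (Y₁ : HSer (A ⊗[ℂ] A →ₗ[ℂ] LaurentSeries A)) (Y₂ : HSer (B ⊗[ℂ] B →ₗ[ℂ] LaurentSeries B))
    (S : Op Lau (A ⊗[ℂ] B) (A ⊗[ℂ] B)) :
    HSer ((A ⊗[ℂ] B) ⊗[ℂ] (A ⊗[ℂ] B) →ₗ[ℂ] LaurentSeries (A ⊗[ℂ] B)) :=
  conv (fun y t => evalYY y t ∘ₗ flip23) (conv (fun y₁ y₂ => TensorProduct.map y₁ y₂) Y₁ Y₂)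
    (Op.leg23 A (Op.leg12 B S.atNeg))

/-- The map `r ⊗ (x ⊗ y) ↦ r ⊗ (u ⊗ (x ⊗ (y ⊗ v)))`. -/
def insertOuter (u : A) (v : B) :
    Lau ⊗[ℂ] (A ⊗[ℂ] B) →ₗ[ℂ] Lau ⊗[ℂ] (A ⊗[ℂ] (A ⊗[ℂ] (B ⊗[ℂ] B))) :=
  ((TensorProduct.mk ℂ A (A ⊗[ℂ] (B ⊗[ℂ] B)) u) ∘ₗ
    ((TensorProduct.mk ℂ B B).flip v).lTensor A).lTensor Lau

theorem leg23_leg12_apply (S : Op Lau (A ⊗[ℂ] B) (A ⊗[ℂ] B)) (t : ℕ) (u u' : A) (v v' : B) :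
    Op.leg23 A (Op.leg12 B S) t (u ⊗ₜ (u' ⊗ₜ (v ⊗ₜ v'))) = insertOuter u v' (S t (u' ⊗ₜ v)) := by
  simp only [Op.leg23, Op.leg12, Op.conj, map_apply, LinearMap.comp_apply, LinearMap.lTensor_tmul,
    LinearEquiv.coe_coe, TensorProduct.assoc_symm_tmul, LinearMap.rTensor_tmul]
  generalize (S t) _ = y
  induction y with
  | zero => simp
  | add x y hx hy => simp only [map_add, TensorProduct.tmul_add, TensorProduct.add_tmul, hx, hy]
  | tmul r x =>
    induction x with
    | zero => simp
    | add x y hx hy => simp only [map_add, TensorProduct.tmul_add, TensorProduct.add_tmul, hx, hy]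
    | tmul x y => simp [insertOuter]

theorem conv_yAt (Y₁ : HSer (A ⊗[ℂ] A →ₗ[ℂ] LaurentSeries A))
    (Y₂ : HSer (B ⊗[ℂ] B →ₗ[ℂ] LaurentSeries B)) (i i' : I) (j j' : J) :
    conv (fun x z => laurTensor (x ⊗ₜ[ℂ] z)) (yAt a Y₁ i i') (yAt b Y₂ j j') =
      (conv (fun y₁ y₂ => TensorProduct.map y₁ y₂) Y₁ Y₂).map fun y =>
        laurTensor (y ((a i ⊗ₜ a i') ⊗ₜ (b j ⊗ₜ b j'))) := by
  funext t
  rw [conv_apply, map_apply, conv_apply, LinearMap.sum_apply, map_sum]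
  rfl

theorem lpr_twistY {R' : Type} [CommRing R'] [Algebra ℂ R'] {Q : Type*} [AddCommGroup Q]
    [Module ℂ Q] [Module R' Q] [IsScalarTower ℂ R' Q] (ρ : Lau →ₐ[ℂ] R')
    (e : LaurentSeries N →ₗ[ℂ] Q)
    (he : ∀ (r : Lau) (X : LaurentSeries N),
      e (cauchy (LinearMap.lsmul ℂ N) (Lau.equiv r) X) = ρ r • e X)
    (Y₁ : HSer (A ⊗[ℂ] A →ₗ[ℂ] LaurentSeries A)) (Y₂ : HSer (B ⊗[ℂ] B →ₗ[ℂ] LaurentSeries B))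
    (S : Op Lau (A ⊗[ℂ] B) (A ⊗[ℂ] B)) (f : I × J → HSer N) (i i' : I) (j j' : J) :
    (lpr (a.tensorProduct b) (yAt (a.tensorProduct b) (twistY Y₁ Y₂ S) (i, j) (i', j')) f).map e =
      Op.act2 a b (S.mapScalars (ρ.comp negHom).toLinearMap) (fun i' j =>
        (YYpr a b (yAt a Y₁ i i') (yAt b Y₂ j j') fun k l => f (k, l)).map e) i' j := by
  set YY := conv (fun y₁ y₂ => TensorProduct.map y₁ y₂) Y₁ Y₂ with hYY
  have h1 : yAt (a.tensorProduct b) (twistY Y₁ Y₂ S) (i, j) (i', j') =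
      conv (fun y s => laurSMul
        ((laurTensor ∘ₗ y ∘ₗ (TensorProduct.assoc ℂ A A (B ⊗[ℂ] B)).symm.toLinearMap).lTensor Lau
          (insertOuter (a i) (b j') s))) YY (S.atNeg.map fun s => s (a i' ⊗ₜ b j)) := by
    funext t
    simp only [yAt, twistY, map_apply, conv_apply, LinearMap.sum_apply, evalYY,
      LinearMap.comp_apply, Module.Basis.tensorProduct_apply, ← leg23_leg12_apply]
    rfl
  let δ : ((A ⊗[ℂ] A) ⊗[ℂ] (B ⊗[ℂ] B) →ₗ[ℂ] LaurentSeries A ⊗[ℂ] LaurentSeries B) →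
      (A ⊗[ℂ] B →ₗ[ℂ] N) → (A ⊗[ℂ] B →ₗ[ℂ] Q) := fun y h =>
    e ∘ₗ laurMap h ∘ₗ laurTensor ∘ₗ y ∘ₗ TensorProduct.map (TensorProduct.mk ℂ A A (a i))
      ((TensorProduct.mk ℂ B B).flip (b j'))
  have h2 : lin (a.tensorProduct b) (fun p => (YYpr a b (yAt a Y₁ i p.1) (yAt b Y₂ p.2 j')
      fun k l => f (k, l)).map e) = conv δ YY (lin (a.tensorProduct b) f) := by
    funext t
    refine (a.tensorProduct b).ext fun p => ?_
    rw [lin_basis, map_apply, YYpr, conv_yAt, lpr, conv_map_left, conv_apply, conv_apply, map_sum,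
      LinearMap.sum_apply]
    refine Finset.sum_congr rfl fun q _ => ?_
    simp [δ, Module.Basis.tensorProduct_apply', hYY]
  have h3 : (lpr (a.tensorProduct b) (yAt (a.tensorProduct b) (twistY Y₁ Y₂ S) (i, j) (i', j'))
      f).map e = conv (fun x g => e (laurMap g x))
      (yAt (a.tensorProduct b) (twistY Y₁ Y₂ S) (i, j) (i', j')) (lin (a.tensorProduct b) f) := by
    funext t
    rw [map_apply, lpr, conv_apply, conv_apply, map_sum]
  rw [h3, h1]
  unfold Op.act2 Op.act pr
  rw [h2]
  have h4 : (S.mapScalars (ρ.comp negHom).toLinearMap).map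
      (fun s => s ((a.tensorProduct b) (i', j))) =
      (S.atNeg.map fun s => s (a i' ⊗ₜ b j)).map (ρ.toLinearMap.rTensor (A ⊗[ℂ] B)) := by
    funext t
    rw [Module.Basis.tensorProduct_apply]
    exact LinearMap.rTensor_comp_apply _ ρ.toLinearMap negHom.toLinearMap _
  rw [h4, conv_map_left]
  refine conv_rot (γ := fun x (g : A ⊗[ℂ] B →ₗ[ℂ] N) => e (laurMap g x))
    (ε := fun x (g : A ⊗[ℂ] B →ₗ[ℂ] Q) =>
      LinearMap.liftBaseChange R' g (ρ.toLinearMap.rTensor (A ⊗[ℂ] B) x)) (δ := δ)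
    (fun _ => by rw [map_zero, map_zero]) (fun _ _ _ => by rw [map_add, map_add])
    (fun _ => liftBaseChange_zero _) (fun _ _ _ => liftBaseChange_add _ _ _) (fun y s h => ?_) _ _ _
  induction s with
  | zero => simp
  | add x y hx hy => simp only [map_add, hx, hy]
  | tmul r x =>
    rw [LinearMap.rTensor_tmul, LinearMap.liftBaseChange_tmul, insertOuter, LinearMap.lTensor_tmul,
      LinearMap.lTensor_tmul]
    change e (laurMap h (cauchy (LinearMap.lsmul ℂ _) (Lau.equiv r) _)) = ρ r • _
    rw [laurMap_cauchy]
    have : ∀ X : LaurentSeries (A ⊗[ℂ] B),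
        cauchy ((LinearMap.lsmul ℂ (A ⊗[ℂ] B)).compr₂ h) (Lau.equiv r) X =
          cauchy (LinearMap.lsmul ℂ N) (Lau.equiv r) (laurMap h X) := by
      intro X
      change _ = cauchy (LinearMap.lsmul ℂ N) (laurMap LinearMap.id (Lau.equiv r)) (laurMap h X)
      rw [cauchy_laurMap]
      refine congrArg (fun β => cauchy β (Lau.equiv r) X) (LinearMap.ext fun c => LinearMap.ext fun u => ?_)
      simp
    rw [this, he]
    congr 2
    simp only [LinearMap.comp_apply, LinearEquiv.coe_coe]
    induction x with
    | zero => simp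
    | add x y hx hy => simp only [map_add, hx, hy]
    | tmul x y => simp [δ]

end TwistedRule

/-! ### Changes of sign of the variables -/

/-- `f(x, y) ↦ f(x, -y)` on `ℂ((x))((y))`. -/
def outNegHom : Lau₂ →ₐ[ℂ] Lau₂ :=
  AlgHom.ofLinearMap (R := ℂ) (A := Lau₂) (B := Lau₂)
    { toFun := fun f => Lau₂.equiv.symm
        (HahnSeries.ofSuppBddBelow (fun n : ℤ => (-1 : ℂ) ^ n • (Lau₂.equiv f).coeff n)
        ⟨(Lau₂.equiv f).order, by
          intro n hn
          by_contra hlt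
          exact hn (by simp [HahnSeries.coeff_eq_zero_of_lt_order (not_le.1 hlt)])⟩)
      map_add' := fun f g => Lau₂.ext fun n m => by
        change ((-1 : ℂ) ^ n • ((Lau₂.equiv f).coeff n + (Lau₂.equiv g).coeff n : Lau)).coeff m = ((-1 : ℂ) ^ n •
          (Lau₂.equiv f).coeff n + (-1 : ℂ) ^ n • (Lau₂.equiv g).coeff n : Lau).coeff m
        rw [← smul_add]
      map_smul' := fun c f => Lau₂.ext fun n m => by
        change ((-1 : ℂ) ^ n • (c • (Lau₂.equiv f).coeff n)).coeff m =
          (c • ((-1 : ℂ) ^ n • (Lau₂.equiv f).coeff n) : Lau).coeff m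
        rw [smul_comm] }
    (Lau₂.ext fun n m => by
      change ((-1 : ℂ) ^ n • (Lau₂.equiv 1).coeff n).coeff m = _
      rw [Lau.coeff_smul]
      change (-1 : ℂ) ^ n * (1 : Lau₂).coeff n m = _
      rw [lau₂_one_coeff]
      by_cases hn : n = 0 <;> simp [hn])
    (fun f g => by
      obtain ⟨L, hL⟩ := f.exists_bound
      obtain ⟨M, hM⟩ := g.exists_bound
      refine Lau₂.equiv.injective (HahnSeries.ext (funext fun n => ?_))
      rw [Lau₂.coeff_mul_Icc (L := L) (L' := M)
        (fun i hi => by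
          change (-1 : ℂ) ^ i • (Lau₂.equiv f).coeff i = 0
          rw [hL i hi, smul_zero])
        (fun i hi => by
          change (-1 : ℂ) ^ i • (Lau₂.equiv g).coeff i = 0
          rw [hM i hi, smul_zero])]
      change (-1 : ℂ) ^ n • (Lau₂.equiv (f * g)).coeff n = ∑ i ∈ Finset.Icc L (n - M),
        ((-1 : ℂ) ^ i • (Lau₂.equiv f).coeff i) * ((-1 : ℂ) ^ (n - i) • (Lau₂.equiv g).coeff (n - i))
      rw [Lau₂.coeff_mul_Icc hL hM, Finset.smul_sum]
      refine Finset.sum_congr rfl fun i _ => ?_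
      rw [smul_mul_smul_comm, ← zpow_add₀ (by norm_num), add_sub_cancel])

theorem outNegHom_coeff (f : Lau₂) (n m : ℤ) :
    (outNegHom f).coeff n m = (-1) ^ n * f.coeff n m := rfl

/-- `f(x, y) ↦ f(-x, y)` on `ℂ((x))((y))`. -/
abbrev inNegHom : Lau₂ →ₐ[ℂ] Lau₂ := mapHom negHom

theorem inNegHom_coeff (f : Lau₂) (n m : ℤ) :
    (inNegHom f).coeff n m = (-1) ^ m * f.coeff n m := rfl

theorem addHom_coeff (c : ℂ) (f : Lau) (n m : ℤ) : (addHom c f).coeff n m =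
    if 0 ≤ n then c ^ n.toNat * ((Ring.choose (m + n) n.toNat : ℤ) * f.coeff (m + n)) else 0 :=
  substAdd_coeff₂ c f n m

theorem innerHom_coeff (f : Lau) (n m : ℤ) :
    (innerHom f).coeff n m = if n = 0 then f.coeff m else 0 := by
  change ((Lau₂.equiv (substInner f)).coeff n).coeff m = _
  rw [substInner_coeff]
  split_ifs <;> rfl

theorem outerHom_coeff (f : Lau) (n m : ℤ) :
    (outerHom f).coeff n m = if m = 0 then f.coeff n else 0 := substOuter_coeff f n m

theorem negHom_coeff (f : Lau) (n : ℤ) : (negHom f).coeff n = (-1) ^ n * f.coeff n := rfl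

theorem neg_one_zpow_mul_self (n : ℤ) : (-1 : ℂ) ^ n * (-1) ^ n = 1 := by
  rw [← mul_zpow]; simp

theorem negHom_negHom : negHom.comp negHom = AlgHom.id ℂ Lau := by
  refine AlgHom.ext fun f => Lau.ext fun n => ?_
  change (-1) ^ n * ((-1) ^ n * f.coeff n) = f.coeff n
  rw [← mul_assoc, neg_one_zpow_mul_self, one_mul]

theorem outNegHom_inner : outNegHom.comp innerHom = innerHom := by
  refine AlgHom.ext fun f => Lau₂.ext fun n m => ?_
  rw [AlgHom.comp_apply, outNegHom_coeff, innerHom_coeff]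
  split_ifs with h <;> simp [h]

theorem outNegHom_outer : outNegHom.comp outerHom = outerHom.comp negHom := by
  refine AlgHom.ext fun f => Lau₂.ext fun n m => ?_
  rw [AlgHom.comp_apply, AlgHom.comp_apply, outNegHom_coeff, outerHom_coeff, outerHom_coeff]
  split_ifs with h
  · rfl
  · simp

theorem neg_one_zpow_of_nonneg {n : ℤ} (h : 0 ≤ n) : (-1 : ℂ) ^ n = (-1) ^ n.toNat := by
  conv_lhs => rw [← Int.toNat_of_nonneg h]
  rw [zpow_natCast]

theorem outNegHom_add (c : ℂ) : outNegHom.comp (addHom c) = addHom (-c) := by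
  refine AlgHom.ext fun f => Lau₂.ext fun n m => ?_
  rw [AlgHom.comp_apply, outNegHom_coeff, addHom_coeff, addHom_coeff]
  split_ifs with h
  · rw [neg_pow c, neg_one_zpow_of_nonneg h]
    ring
  · simp

theorem inNegHom_inner : inNegHom.comp innerHom = innerHom.comp negHom := by
  refine AlgHom.ext fun f => Lau₂.ext fun n m => ?_
  rw [AlgHom.comp_apply, AlgHom.comp_apply, inNegHom_coeff, innerHom_coeff, innerHom_coeff]
  split_ifs with h
  · rfl
  · simp

theorem inNegHom_outer : inNegHom.comp outerHom = outerHom := by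
  refine AlgHom.ext fun f => Lau₂.ext fun n m => ?_
  rw [AlgHom.comp_apply, inNegHom_coeff, outerHom_coeff]
  split_ifs with h <;> simp [h]

theorem inNegHom_add (c : ℂ) : inNegHom.comp (addHom c) = (addHom (-c)).comp negHom := by
  refine AlgHom.ext fun f => Lau₂.ext fun n m => ?_
  rw [AlgHom.comp_apply, AlgHom.comp_apply, inNegHom_coeff, addHom_coeff, addHom_coeff,
    negHom_coeff]
  split_ifs with h
  · rw [neg_pow c, zpow_add₀ (by norm_num : (-1 : ℂ) ≠ 0), neg_one_zpow_of_nonneg h]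
    have h2 : (-1 : ℂ) ^ n.toNat * (-1) ^ n.toNat = 1 := by rw [← mul_pow]; simp
    linear_combination (-(-1) ^ m * c ^ n.toNat * (Ring.choose (m + n) n.toNat : ℤ) *
      f.coeff (m + n)) * h2
  · simp

/-! ### Exchange relations on test functions -/

section Exchange

variable {R : Type} [CommRing R] [Algebra ℂ R]
  {A B C D : Type*} [AddCommGroup A] [Module ℂ A] [AddCommGroup B] [Module ℂ B]
  [AddCommGroup C] [Module ℂ C] [AddCommGroup D] [Module ℂ D]
  {I J K L : Type*} (a : Basis I ℂ A) (b : Basis J ℂ B) (c : Basis K ℂ C) (d : Basis L ℂ D)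
  {N N' : Type*} [AddCommGroup N] [Module ℂ N] [Module R N] [IsScalarTower ℂ R N]
  [AddCommGroup N'] [Module ℂ N'] [Module R N'] [IsScalarTower ℂ R N']

/-- The transpose of `S` after a change of scalars, acting on test functions of two variables. -/
def tr (φ : Lau →ₐ[ℂ] R) (S : Op Lau (A ⊗[ℂ] B) (A ⊗[ℂ] B)) (f : I → J → HSer N) (i : I) (j : J) :
    HSer N :=
  Op.act2 a b (S.mapScalars φ.toLinearMap) f i j

variable {a b c d}

theorem tr_congr {φ : Lau →ₐ[ℂ] R} {S : Op Lau (A ⊗[ℂ] B) (A ⊗[ℂ] B)} {f g : I → J → HSer N}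
    (h : ∀ i j, f i j = g i j) (i : I) (j : J) : tr a b φ S f i j = tr a b φ S g i j :=
  act2_congr h i j

theorem tr_comm (φ ψ : Lau →ₐ[ℂ] R) (S : Op Lau (A ⊗[ℂ] B) (A ⊗[ℂ] B))
    (T : Op Lau (C ⊗[ℂ] D) (C ⊗[ℂ] D)) (f : I → J → K → L → HSer N) (i : I) (j : J) (k : K) (l : L) :
    tr a b φ S (fun i j => tr c d ψ T (fun k l => f i j k l) k l) i j =
      tr c d ψ T (fun k l => tr a b φ S (fun i j => f i j k l) i j) k l :=
  act2_comm _ _ f i j k l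

theorem tr_natural (ℓ : HSer (N →ₗ[R] N')) (φ : Lau →ₐ[ℂ] R) (S : Op Lau (A ⊗[ℂ] B) (A ⊗[ℂ] B))
    (f : I → J → HSer N) (i : I) (j : J) :
    hap ℓ (tr a b φ S f i j) = tr a b φ S (fun i j => hap ℓ (f i j)) i j :=
  pr_natural ℓ _ _

theorem tr_bundle {X : Type*} (φ : Lau →ₐ[ℂ] R) (S : Op Lau (A ⊗[ℂ] B) (A ⊗[ℂ] B))
    (f : X → I → J → HSer N) (i : I) (j : J) :
    bundle (fun x => tr a b φ S (f x) i j) =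
      tr a b φ S (fun i j => bundle fun x => f x i j) i j :=
  (pr_bundle _ fun (p : I × J) x => f x p.1 p.2).symm

theorem tr_mergeLeft (φ : Lau →ₐ[ℂ] R) (SAC : Op Lau (A ⊗[ℂ] C) (A ⊗[ℂ] C))
    (SBC : Op Lau (B ⊗[ℂ] C) (B ⊗[ℂ] C)) (f : I × J → K → HSer N) (i : I) (j : J) (k : K) :
    tr (a.tensorProduct b) c φ (Op.mergeLeft SAC SBC) f (i, j) k =
      tr a c φ SAC (fun i k => tr b c φ SBC (fun j k => f (i, j) k) j k) i k :=
  act2_mergeLeft φ SAC SBC f i j k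

theorem tr_mergeRight (φ : Lau →ₐ[ℂ] R) (SAB : Op Lau (A ⊗[ℂ] B) (A ⊗[ℂ] B))
    (SAC : Op Lau (A ⊗[ℂ] C) (A ⊗[ℂ] C)) (f : I → J × K → HSer N) (i : I) (j : J) (k : K) :
    tr a (b.tensorProduct c) φ (Op.mergeRight SAB SAC) f i (j, k) =
      tr a c φ SAC (fun i k => tr a b φ SAB (fun i j => f i (j, k)) i j) i k :=
  act2_mergeRight φ SAB SAC f i j k

theorem tr_ext {S T : Op Lau (A ⊗[ℂ] B) (A ⊗[ℂ] B)}
    (h : ∀ (f : I → J → HSer Lau) i j,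
      tr a b (AlgHom.id ℂ Lau) S f i j = tr a b (AlgHom.id ℂ Lau) T f i j) : S = T := by
  refine act2_ext (a := a) (b := b) fun f i j => ?_
  have := h f i j
  unfold tr at this
  rwa [mapScalars_id, mapScalars_id] at this

/-! ### Unitarity -/

/-- `S'²¹(z) S(-z) = 1`. -/
def Unitary (S : Op Lau (A ⊗[ℂ] B) (A ⊗[ℂ] B)) (S' : Op Lau (B ⊗[ℂ] A) (B ⊗[ℂ] A)) : Prop :=
  (Op.flip S').comp S.atNeg = Op.one

theorem Unitary.test_neg {S : Op Lau (A ⊗[ℂ] B) (A ⊗[ℂ] B)} {S' : Op Lau (B ⊗[ℂ] A) (B ⊗[ℂ] A)}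
    (h : Unitary S S') (φ : Lau →ₐ[ℂ] R) (f : I → J → HSer N) (i : I) (j : J) :
    tr a b (φ.comp negHom) S (fun i j => tr b a φ S' (fun j i => f i j) j i) i j = f i j := by
  have h1 := congrArg (fun S => Op.act2 a b (S.mapScalars φ.toLinearMap) f i j)
    (h : (Op.flip S').comp S.atNeg = Op.one)
  rw [mapScalars_one, act2_one, mapScalars_comp, mapScalars_flip, act2_comp] at h1
  refine Eq.trans ?_ h1
  rw [show S.atNeg.mapScalars φ.toLinearMap = S.mapScalars (φ.comp negHom).toLinearMap from
    mapScalars_mapScalars _ _ _]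
  exact act2_congr (fun i j => (act2_flip _ _ _ _).symm) _ _

theorem Unitary.test {S : Op Lau (A ⊗[ℂ] B) (A ⊗[ℂ] B)} {S' : Op Lau (B ⊗[ℂ] A) (B ⊗[ℂ] A)}
    (h : Unitary S S') (φ : Lau →ₐ[ℂ] R) (f : I → J → HSer N) (i : I) (j : J) :
    tr a b φ S (fun i j => tr b a (φ.comp negHom) S' (fun j i => f i j) j i) i j = f i j := by
  have := h.test_neg (a := a) (b := b) (φ.comp negHom) f i j
  rwa [AlgHom.comp_assoc, negHom_negHom, AlgHom.comp_id] at this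

theorem Unitary.of_tr {S : Op Lau (A ⊗[ℂ] B) (A ⊗[ℂ] B)} {S' : Op Lau (B ⊗[ℂ] A) (B ⊗[ℂ] A)}
    (h : ∀ (f : I → J → HSer Lau) i j, tr a b negHom S (fun i j =>
      tr b a (AlgHom.id ℂ Lau) S' (fun j i => f i j) j i) i j = f i j) : Unitary S S' := by
  refine act2_ext (a := a) (b := b) fun f i j => ?_
  rw [act2_one, act2_comp]
  refine Eq.trans ?_ (h f i j)
  refine act2_congr (fun i j => (act2_flip _ _ _ _).trans ?_) _ _
  unfold HQVA.tr
  rw [mapScalars_id]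

theorem Unitary.mergeLeft {SAC : Op Lau (A ⊗[ℂ] C) (A ⊗[ℂ] C)} {SCA : Op Lau (C ⊗[ℂ] A) (C ⊗[ℂ] A)}
    {SBC : Op Lau (B ⊗[ℂ] C) (B ⊗[ℂ] C)} {SCB : Op Lau (C ⊗[ℂ] B) (C ⊗[ℂ] B)}
    (hA : Unitary SAC SCA) (hB : Unitary SBC SCB) :
    Unitary (Op.mergeLeft SAC SBC) (Op.mergeRight SCA SCB) := by
  let a := Basis.ofVectorSpace ℂ A
  let b := Basis.ofVectorSpace ℂ B
  let c := Basis.ofVectorSpace ℂ C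
  refine Unitary.of_tr (a := a.tensorProduct b) (b := c) fun f p l => ?_
  obtain ⟨i, j⟩ := p
  rw [tr_mergeLeft]
  have h1 : ∀ i j l, tr c (a.tensorProduct b) (AlgHom.id ℂ Lau) (Op.mergeRight SCA SCB)
      (fun l p => f p l) l (i, j) = tr c b (AlgHom.id ℂ Lau) SCB (fun l j =>
        tr c a (AlgHom.id ℂ Lau) SCA (fun l i => f (i, j) l) l i) l j :=
    fun i j l => tr_mergeRight _ _ _ _ _ _ _
  simp only [h1]
  have h2 := fun i => hB.test_neg (a := b) (b := c) (AlgHom.id ℂ Lau)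
    (fun j l => tr c a (AlgHom.id ℂ Lau) SCA (fun l i => f (i, j) l) l i)
  simp only [AlgHom.id_comp] at h2
  simp only [h2]
  exact hA.test_neg (a := a) (b := c) (AlgHom.id ℂ Lau) (fun i l => f (i, j) l) i l

theorem Unitary.mergeRight {SAC : Op Lau (A ⊗[ℂ] C) (A ⊗[ℂ] C)} {SCA : Op Lau (C ⊗[ℂ] A) (C ⊗[ℂ] A)}
    {SBC : Op Lau (B ⊗[ℂ] C) (B ⊗[ℂ] C)} {SCB : Op Lau (C ⊗[ℂ] B) (C ⊗[ℂ] B)}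
    (hA : Unitary SCA SAC) (hB : Unitary SCB SBC) :
    Unitary (Op.mergeRight SCA SCB) (Op.mergeLeft SAC SBC) := by
  let a := Basis.ofVectorSpace ℂ A
  let b := Basis.ofVectorSpace ℂ B
  let c := Basis.ofVectorSpace ℂ C
  refine Unitary.of_tr (a := c) (b := a.tensorProduct b) fun f l p => ?_
  obtain ⟨i, j⟩ := p
  rw [tr_mergeRight]
  have h1 : ∀ i j l, tr (a.tensorProduct b) c (AlgHom.id ℂ Lau) (Op.mergeLeft SAC SBC)
      (fun p l => f l p) (i, j) l = tr a c (AlgHom.id ℂ Lau) SAC (fun i l =>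
        tr b c (AlgHom.id ℂ Lau) SBC (fun j l => f l (i, j)) j l) i l :=
    fun i j l => tr_mergeLeft _ _ _ _ _ _ _
  simp only [h1]
  have h2 := fun j => hA.test_neg (a := c) (b := a) (AlgHom.id ℂ Lau)
    (fun l i => tr b c (AlgHom.id ℂ Lau) SBC (fun j l => f l (i, j)) j l)
  simp only [AlgHom.id_comp] at h2
  simp only [h2]
  exact hB.test_neg (a := c) (b := b) (AlgHom.id ℂ Lau) (fun l j => f l (i, j)) l j

/-! ### The Yang–Baxter equation -/

/-- `S_{AB}¹²(z₁) S_{AC}¹³(z₁ + z₂) S_{BC}²³(z₂) = S_{BC}²³(z₂) S_{AC}¹³(z₁ + z₂) S_{AB}¹²(z₁)`. -/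
def YangBaxter (SAB : Op Lau (A ⊗[ℂ] B) (A ⊗[ℂ] B)) (SAC : Op Lau (A ⊗[ℂ] C) (A ⊗[ℂ] C))
    (SBC : Op Lau (B ⊗[ℂ] C) (B ⊗[ℂ] C)) : Prop :=
  (Op.leg12 C SAB.atInner).comp ((Op.leg13 B SAC.atSum).comp (Op.leg23 A SBC.atOuter)) =
    (Op.leg23 A SBC.atOuter).comp ((Op.leg13 B SAC.atSum).comp (Op.leg12 C SAB.atInner))

theorem act_yangBaxter_left (φ : Lau₂ →ₐ[ℂ] R) (SAB : Op Lau (A ⊗[ℂ] B) (A ⊗[ℂ] B))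
    (SAC : Op Lau (A ⊗[ℂ] C) (A ⊗[ℂ] C)) (SBC : Op Lau (B ⊗[ℂ] C) (B ⊗[ℂ] C))
    (f : I → J → K → HSer N) (i : I) (j : J) (k : K) :
    Op.act (a.tensorProduct (b.tensorProduct c)) (a.tensorProduct (b.tensorProduct c))
      (((Op.leg12 C SAB.atInner).comp ((Op.leg13 B SAC.atSum).comp
        (Op.leg23 A SBC.atOuter))).mapScalars φ.toLinearMap) (fun p => f p.1 p.2.1 p.2.2) (i, j, k) =
      tr b c (φ.comp outerHom) SBC (fun j k => tr a c (φ.comp (addHom 1)) SAC (fun i k =>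
        tr a b (φ.comp innerHom) SAB (fun i j => f i j k) i j) i k) j k := by
  rw [mapScalars_comp, mapScalars_comp, mapScalars_leg12, mapScalars_leg13, mapScalars_leg23,
    mapScalars_atInner, mapScalars_atOuter, mapScalars_atSum,
    act_comp (a := a.tensorProduct (b.tensorProduct c)) (b := a.tensorProduct (b.tensorProduct c))
      (c := a.tensorProduct (b.tensorProduct c)),
    act_comp (a := a.tensorProduct (b.tensorProduct c)) (b := a.tensorProduct (b.tensorProduct c))
      (c := a.tensorProduct (b.tensorProduct c)), act_leg23' (a := a) (b := b) (c := c)]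
  refine act2_congr (fun j k => ?_) _ _
  rw [act_leg13 (a := a) (b := b) (c := c)]
  refine act2_congr (fun i k => ?_) _ _
  exact act_leg12 (a := a) (b := b) (c := c) (SAB.mapScalars (φ.comp innerHom).toLinearMap)
    (fun p => f p.1 p.2.1 p.2.2) i j k

theorem act_yangBaxter_right (φ : Lau₂ →ₐ[ℂ] R) (SAB : Op Lau (A ⊗[ℂ] B) (A ⊗[ℂ] B))
    (SAC : Op Lau (A ⊗[ℂ] C) (A ⊗[ℂ] C)) (SBC : Op Lau (B ⊗[ℂ] C) (B ⊗[ℂ] C))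
    (f : I → J → K → HSer N) (i : I) (j : J) (k : K) :
    Op.act (a.tensorProduct (b.tensorProduct c)) (a.tensorProduct (b.tensorProduct c))
      (((Op.leg23 A SBC.atOuter).comp ((Op.leg13 B SAC.atSum).comp
        (Op.leg12 C SAB.atInner))).mapScalars φ.toLinearMap) (fun p => f p.1 p.2.1 p.2.2) (i, j, k) =
      tr a b (φ.comp innerHom) SAB (fun i j => tr a c (φ.comp (addHom 1)) SAC (fun i k =>
        tr b c (φ.comp outerHom) SBC (fun j k => f i j k) j k) i k) i j := by
  rw [mapScalars_comp, mapScalars_comp, mapScalars_leg12, mapScalars_leg13, mapScalars_leg23,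
    mapScalars_atInner, mapScalars_atOuter, mapScalars_atSum,
    act_comp (a := a.tensorProduct (b.tensorProduct c)) (b := a.tensorProduct (b.tensorProduct c))
      (c := a.tensorProduct (b.tensorProduct c)),
    act_comp (a := a.tensorProduct (b.tensorProduct c)) (b := a.tensorProduct (b.tensorProduct c))
      (c := a.tensorProduct (b.tensorProduct c)), act_leg12 (a := a) (b := b) (c := c)]
  refine act2_congr (fun i j => ?_) _ _
  rw [act_leg13 (a := a) (b := b) (c := c)]
  refine act2_congr (fun i k => ?_) _ _
  exact act_leg23' (a := a) (b := b) (c := c) (SBC.mapScalars (φ.comp outerHom).toLinearMap)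
    (fun p => f p.1 p.2.1 p.2.2) i j k

theorem YangBaxter.test {SAB : Op Lau (A ⊗[ℂ] B) (A ⊗[ℂ] B)} {SAC : Op Lau (A ⊗[ℂ] C) (A ⊗[ℂ] C)}
    {SBC : Op Lau (B ⊗[ℂ] C) (B ⊗[ℂ] C)} (h : YangBaxter SAB SAC SBC) (φ : Lau₂ →ₐ[ℂ] R)
    (f : I → J → K → HSer N) (i : I) (j : J) (k : K) :
    tr b c (φ.comp outerHom) SBC (fun j k => tr a c (φ.comp (addHom 1)) SAC (fun i k =>
        tr a b (φ.comp innerHom) SAB (fun i j => f i j k) i j) i k) j k =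
      tr a b (φ.comp innerHom) SAB (fun i j => tr a c (φ.comp (addHom 1)) SAC (fun i k =>
        tr b c (φ.comp outerHom) SBC (fun j k => f i j k) j k) i k) i j := by
  rw [← act_yangBaxter_left, ← act_yangBaxter_right,
    (h : (Op.leg12 C SAB.atInner).comp ((Op.leg13 B SAC.atSum).comp (Op.leg23 A SBC.atOuter)) = _)]

theorem YangBaxter.of_tr {SAB : Op Lau (A ⊗[ℂ] B) (A ⊗[ℂ] B)} {SAC : Op Lau (A ⊗[ℂ] C) (A ⊗[ℂ] C)}
    {SBC : Op Lau (B ⊗[ℂ] C) (B ⊗[ℂ] C)}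
    (h : ∀ (f : I → J → K → HSer Lau₂) (i : I) (j : J) (k : K),
      tr b c outerHom SBC (fun j k => tr a c (addHom 1) SAC (fun i k =>
        tr a b innerHom SAB (fun i j => f i j k) i j) i k) j k =
      tr a b innerHom SAB (fun i j => tr a c (addHom 1) SAC (fun i k =>
        tr b c outerHom SBC (fun j k => f i j k) j k) i k) i j) : YangBaxter SAB SAC SBC := by
  refine act_ext (a := a.tensorProduct (b.tensorProduct c))
    (b := a.tensorProduct (b.tensorProduct c)) fun f p => ?_
  obtain ⟨i, j, k⟩ := p
  have h1 := act_yangBaxter_left (a := a) (b := b) (c := c) (AlgHom.id ℂ Lau₂) SAB SAC SBC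
    (fun i j k => f (i, j, k)) i j k
  have h2 := act_yangBaxter_right (a := a) (b := b) (c := c) (AlgHom.id ℂ Lau₂) SAB SAC SBC
    (fun i j k => f (i, j, k)) i j k
  rw [mapScalars_id] at h1 h2
  exact h1.trans ((h _ i j k).trans h2.symm)

end Exchange

/-! ### Operators between twisted tensor products -/

section MergeExchange

variable {A B C D : Type*} [AddCommGroup A] [Module ℂ A] [AddCommGroup B] [Module ℂ B]
  [AddCommGroup C] [Module ℂ C] [AddCommGroup D] [Module ℂ D]

theorem mergeLeft_mergeRight (SAC : Op Lau (A ⊗[ℂ] C) (A ⊗[ℂ] C)) (SAD : Op Lau (A ⊗[ℂ] D) (A ⊗[ℂ] D))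
    (SBC : Op Lau (B ⊗[ℂ] C) (B ⊗[ℂ] C)) (SBD : Op Lau (B ⊗[ℂ] D) (B ⊗[ℂ] D)) :
    Op.mergeLeft (Op.mergeRight SAC SAD) (Op.mergeRight SBC SBD) =
      Op.mergeRight (Op.mergeLeft SAC SBC) (Op.mergeLeft SAD SBD) := by
  let a := Basis.ofVectorSpace ℂ A
  let b := Basis.ofVectorSpace ℂ B
  let c := Basis.ofVectorSpace ℂ C
  let d := Basis.ofVectorSpace ℂ D
  refine tr_ext (a := a.tensorProduct b) (b := c.tensorProduct d) fun f p q => ?_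
  obtain ⟨i, j⟩ := p
  obtain ⟨k, l⟩ := q
  rw [tr_mergeLeft, tr_mergeRight, tr_mergeRight, tr_mergeLeft]
  refine tr_congr (fun i l => ?_) _ _
  refine (tr_congr (fun i k => tr_mergeRight _ _ _ _ _ _ _) _ _).trans ?_
  refine Eq.trans ?_ (tr_congr (fun j l => (tr_mergeLeft _ _ _ (fun p k => f p (k, l)) _ _ _).symm)
    _ _)
  exact tr_comm (a := a) (b := c) (c := b) (d := d) _ _ _ _
    (fun i k j l => tr b c (AlgHom.id ℂ Lau) SBC (fun j k => f (i, j) (k, l)) j k) i k j l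

section YB

variable {SAB : Op Lau (A ⊗[ℂ] B) (A ⊗[ℂ] B)} {SAC : Op Lau (A ⊗[ℂ] C) (A ⊗[ℂ] C)}
  {SAD : Op Lau (A ⊗[ℂ] D) (A ⊗[ℂ] D)} {SBC : Op Lau (B ⊗[ℂ] C) (B ⊗[ℂ] C)}
  {SBD : Op Lau (B ⊗[ℂ] D) (B ⊗[ℂ] D)} {SCD : Op Lau (C ⊗[ℂ] D) (C ⊗[ℂ] D)}

theorem YangBaxter.merge_first (hA : YangBaxter SAC SAD SCD) (hB : YangBaxter SBC SBD SCD) :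
    YangBaxter (Op.mergeLeft SAC SBC) (Op.mergeLeft SAD SBD) SCD := by
  let a := Basis.ofVectorSpace ℂ A
  let b := Basis.ofVectorSpace ℂ B
  let c := Basis.ofVectorSpace ℂ C
  let d := Basis.ofVectorSpace ℂ D
  refine YangBaxter.of_tr (a := a.tensorProduct b) (b := c) (c := d) fun f p k l => ?_
  obtain ⟨i, j⟩ := p
  have hA' := fun f i k l => hA.test (a := a) (b := c) (c := d) (N := Lau₂) (AlgHom.id ℂ Lau₂) f i k l
  have hB' := fun f j k l => hB.test (a := b) (b := c) (c := d) (N := Lau₂) (AlgHom.id ℂ Lau₂) f j k l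
  simp only [AlgHom.id_comp] at hA' hB'
  simp only [tr_mergeLeft]
  -- the operators on functions of four indices
  let F := Basis.ofVectorSpaceIndex ℂ A → Basis.ofVectorSpaceIndex ℂ B →
    Basis.ofVectorSpaceIndex ℂ C → Basis.ofVectorSpaceIndex ℂ D → HSer Lau₂
  let AC : F → F := fun g i j k l =>
    tr a c innerHom SAC (fun i k => g i j k l) i k
  let BC : F → F := fun g i j k l =>
    tr b c innerHom SBC (fun j k => g i j k l) j k
  let AD : F → F := fun g i j k l =>
    tr a d (addHom 1) SAD (fun i l => g i j k l) i l
  let BD : F → F := fun g i j k l =>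
    tr b d (addHom 1) SBD (fun j l => g i j k l) j l
  let CD : F → F := fun g i j k l => tr c d outerHom SCD (fun k l => g i j k l) k l
  have h1 : ∀ g, BD (AC g) = AC (BD g) := fun g => by
    funext i j k l
    exact tr_comm _ _ _ _ (fun j l i k => g i j k l) j l i k
  have h2 : ∀ g, AD (BC g) = BC (AD g) := fun g => by
    funext i j k l
    exact tr_comm _ _ _ _ (fun i l j k => g i j k l) i l j k
  have h3 : ∀ g, CD (AD (AC g)) = AC (AD (CD g)) := fun g => by
    funext i j k l
    exact hA' (fun i k l => g i j k l) i k l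
  have h4 : ∀ g, CD (BD (BC g)) = BC (BD (CD g)) := fun g => by
    funext i j k l
    exact hB' (fun j k l => g i j k l) j k l
  have := fun g => congrFun (congrFun (congrFun (congrFun (calc
    CD (AD (BD (AC (BC g)))) = CD (AD (AC (BD (BC g)))) := by rw [h1]
    _ = AC (AD (BC (BD (CD g)))) := by rw [h3, h4]
    _ = AC (BC (AD (BD (CD g)))) := by rw [h2]) i) j) k) l
  exact this fun i j k l => f (i, j) k l

theorem YangBaxter.merge_second {SAB : Op Lau (A ⊗[ℂ] B) (A ⊗[ℂ] B)} (hB : YangBaxter SAB SAD SBD)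
    (hC : YangBaxter SAC SAD SCD) :
    YangBaxter (Op.mergeRight SAB SAC) SAD (Op.mergeLeft SBD SCD) := by
  let a := Basis.ofVectorSpace ℂ A
  let b := Basis.ofVectorSpace ℂ B
  let c := Basis.ofVectorSpace ℂ C
  let d := Basis.ofVectorSpace ℂ D
  refine YangBaxter.of_tr (a := a) (b := b.tensorProduct c) (c := d) fun f i p l => ?_
  obtain ⟨j, k⟩ := p
  have hB' := fun f i j l => hB.test (a := a) (b := b) (c := d) (N := Lau₂) (AlgHom.id ℂ Lau₂) f i j l
  have hC' := fun f i k l => hC.test (a := a) (b := c) (c := d) (N := Lau₂) (AlgHom.id ℂ Lau₂) f i k l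
  simp only [AlgHom.id_comp] at hB' hC'
  simp only [tr_mergeLeft, tr_mergeRight]
  let F := Basis.ofVectorSpaceIndex ℂ A → Basis.ofVectorSpaceIndex ℂ B →
    Basis.ofVectorSpaceIndex ℂ C → Basis.ofVectorSpaceIndex ℂ D → HSer Lau₂
  let AB : F → F := fun g i j k l =>
    tr a b innerHom SAB (fun i j => g i j k l) i j
  let AC : F → F := fun g i j k l =>
    tr a c innerHom SAC (fun i k => g i j k l) i k
  let AD : F → F := fun g i j k l => tr a d (addHom 1) SAD (fun i l => g i j k l) i l
  let BD : F → F := fun g i j k l =>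
    tr b d outerHom SBD (fun j l => g i j k l) j l
  let CD : F → F := fun g i j k l =>
    tr c d outerHom SCD (fun k l => g i j k l) k l
  have h1 : ∀ g, BD (AC g) = AC (BD g) := fun g => by
    funext i j k l
    exact tr_comm _ _ _ _ (fun j l i k => g i j k l) j l i k
  have h2 : ∀ g, CD (AB g) = AB (CD g) := fun g => by
    funext i j k l
    exact tr_comm _ _ _ _ (fun k l i j => g i j k l) k l i j
  have h3 : ∀ g, BD (AD (AB g)) = AB (AD (BD g)) := fun g => by
    funext i j k l
    exact hB' (fun i j l => g i j k l) i j l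
  have h4 : ∀ g, CD (AD (AC g)) = AC (AD (CD g)) := fun g => by
    funext i j k l
    exact hC' (fun i k l => g i j k l) i k l
  have := fun g => congrFun (congrFun (congrFun (congrFun (calc
    BD (CD (AD (AC (AB g)))) = BD (AC (AD (CD (AB g)))) := by rw [h4]
    _ = AC (BD (AD (AB (CD g)))) := by rw [h1, h2]
    _ = AC (AB (AD (BD (CD g)))) := by rw [h3]) i) j) k) l
  exact this fun i j k l => f i (j, k) l

theorem YangBaxter.merge_third (hC : YangBaxter SAB SAC SBC) (hD : YangBaxter SAB SAD SBD) :
    YangBaxter SAB (Op.mergeRight SAC SAD) (Op.mergeRight SBC SBD) := by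
  let a := Basis.ofVectorSpace ℂ A
  let b := Basis.ofVectorSpace ℂ B
  let c := Basis.ofVectorSpace ℂ C
  let d := Basis.ofVectorSpace ℂ D
  refine YangBaxter.of_tr (a := a) (b := b) (c := c.tensorProduct d) fun f i j p => ?_
  obtain ⟨k, l⟩ := p
  have hC' := fun f i j k => hC.test (a := a) (b := b) (c := c) (N := Lau₂) (AlgHom.id ℂ Lau₂) f i j k
  have hD' := fun f i j l => hD.test (a := a) (b := b) (c := d) (N := Lau₂) (AlgHom.id ℂ Lau₂) f i j l
  simp only [AlgHom.id_comp] at hC' hD'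
  simp only [tr_mergeRight]
  let F := Basis.ofVectorSpaceIndex ℂ A → Basis.ofVectorSpaceIndex ℂ B →
    Basis.ofVectorSpaceIndex ℂ C → Basis.ofVectorSpaceIndex ℂ D → HSer Lau₂
  let AB : F → F := fun g i j k l => tr a b innerHom SAB (fun i j => g i j k l) i j
  let AC : F → F := fun g i j k l =>
    tr a c (addHom 1) SAC (fun i k => g i j k l) i k
  let AD : F → F := fun g i j k l =>
    tr a d (addHom 1) SAD (fun i l => g i j k l) i l
  let BC : F → F := fun g i j k l =>
    tr b c outerHom SBC (fun j k => g i j k l) j k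
  let BD : F → F := fun g i j k l =>
    tr b d outerHom SBD (fun j l => g i j k l) j l
  have h1 : ∀ g, BC (AD g) = AD (BC g) := fun g => by
    funext i j k l
    exact tr_comm _ _ _ _ (fun j k i l => g i j k l) j k i l
  have h2 : ∀ g, BD (AC g) = AC (BD g) := fun g => by
    funext i j k l
    exact tr_comm _ _ _ _ (fun j l i k => g i j k l) j l i k
  have h3 : ∀ g, BC (AC (AB g)) = AB (AC (BC g)) := fun g => by
    funext i j k l
    exact hC' (fun i j k => g i j k l) i j k
  have h4 : ∀ g, BD (AD (AB g)) = AB (AD (BD g)) := fun g => by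
    funext i j k l
    exact hD' (fun i j l => g i j k l) i j l
  have := fun g => congrFun (congrFun (congrFun (congrFun (calc
    BD (BC (AD (AC (AB g)))) = BD (AD (BC (AC (AB g)))) := by rw [h1]
    _ = AB (AD (BD (AC (BC g)))) := by rw [h3, h4]
    _ = AB (AD (AC (BD (BC g)))) := by rw [h2]) i) j) k) l
  exact this fun i j k l => f i j (k, l)

end YB

/-! ### The hexagon identities and twisted tensor products -/

section Spectator

variable {I J K : Type*} {a : Basis I ℂ A} {b : Basis J ℂ B} {c : Basis K ℂ C}
  {N : Type*} [AddCommGroup N] [Module ℂ N] [Module Lau N] [IsScalarTower ℂ Lau N]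
  {YA : HSer (A ⊗[ℂ] A →ₗ[ℂ] LaurentSeries A)} {YB : HSer (B ⊗[ℂ] B →ₗ[ℂ] LaurentSeries B)}
  {SAC : Op Lau (A ⊗[ℂ] C) (A ⊗[ℂ] C)} {SBC : Op Lau (B ⊗[ℂ] C) (B ⊗[ℂ] C)}
  {SCA : Op Lau (C ⊗[ℂ] A) (C ⊗[ℂ] A)} {SCB : Op Lau (C ⊗[ℂ] B) (C ⊗[ℂ] B)}

theorem HexL.YYpr_left (h : HexL YA SAC) (ρ : Lau →ₐ[ℂ] Lau) (z : HSer (LaurentSeries B))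
    (F : I → J → K → HSer N) (i i' : I) (k : K) :
    YYpr a b (yAt a YA i i') z (fun m n => tr a c ρ SAC (fun m k => F m n k) m k) =
      tr a c ((mapHom ρ).comp (addHom 1)) SAC (fun i k =>
        tr a c ((mapHom ρ).comp innerHom) SAC (fun i' k =>
          YYpr a b (yAt a YA i i') z fun m n => F m n k) i' k) i k := by
  rw [HQVA.YYpr_left]
  simp only [tr_bundle]
  refine (congrArg (hap (specL b N z)) (hexL_test h ρ
    (fun m k => bundle fun n => F m n k) i i' k)).trans ?_
  refine (tr_natural _ _ _ _ _ _).trans (tr_congr (fun i k => ?_) _ _)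
  refine (tr_natural _ _ _ _ _ _).trans (tr_congr (fun i' k => ?_) _ _)
  rw [HQVA.YYpr_left]

theorem HexL.YYpr_right (h : HexL YB SBC) (ρ : Lau →ₐ[ℂ] Lau) (x : HSer (LaurentSeries A))
    (F : I → J → K → HSer N) (j j' : J) (k : K) :
    YYpr a b x (yAt b YB j j') (fun m n => tr b c ρ SBC (fun n k => F m n k) n k) =
      tr b c ((mapHom ρ).comp (addHom 1)) SBC (fun j k =>
        tr b c ((mapHom ρ).comp innerHom) SBC (fun j' k =>
          YYpr a b x (yAt b YB j j') fun m n => F m n k) j' k) j k := by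
  rw [HQVA.YYpr_right]
  simp only [tr_bundle]
  refine (congrArg (hap (specL a N x)) (hexL_test h ρ
    (fun n k => bundle fun m => F m n k) j j' k)).trans ?_
  refine (tr_natural _ _ _ _ _ _).trans (tr_congr (fun j k => ?_) _ _)
  refine (tr_natural _ _ _ _ _ _).trans (tr_congr (fun j' k => ?_) _ _)
  rw [HQVA.YYpr_right]

theorem HexR.YYpr_left (h : HexR YA SCA) (ρ : Lau →ₐ[ℂ] Lau) (z : HSer (LaurentSeries B))
    (F : I → J → K → HSer N) (i i' : I) (k : K) :
    YYpr a b (yAt a YA i i') z (fun m n => tr c a ρ SCA (fun k m => F m n k) k m) =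
      tr c a ((mapHom ρ).comp innerHom) SCA (fun k i' =>
        tr c a ((mapHom ρ).comp (addHom (-1))) SCA (fun k i =>
          YYpr a b (yAt a YA i i') z fun m n => F m n k) k i) k i' := by
  rw [HQVA.YYpr_left]
  simp only [tr_bundle]
  refine (congrArg (hap (specL b N z)) (hexR_test h ρ
    (fun k m => bundle fun n => F m n k) k i i')).trans ?_
  refine (tr_natural _ _ _ _ _ _).trans (tr_congr (fun k i' => ?_) _ _)
  refine (tr_natural _ _ _ _ _ _).trans (tr_congr (fun k i => ?_) _ _)
  rw [HQVA.YYpr_left]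

theorem HexR.YYpr_right (h : HexR YB SCB) (ρ : Lau →ₐ[ℂ] Lau) (x : HSer (LaurentSeries A))
    (F : I → J → K → HSer N) (j j' : J) (k : K) :
    YYpr a b x (yAt b YB j j') (fun m n => tr c b ρ SCB (fun k n => F m n k) k n) =
      tr c b ((mapHom ρ).comp innerHom) SCB (fun k j' =>
        tr c b ((mapHom ρ).comp (addHom (-1))) SCB (fun k j =>
          YYpr a b x (yAt b YB j j') fun m n => F m n k) k j) k j' := by
  rw [HQVA.YYpr_right]
  simp only [tr_bundle]
  refine (congrArg (hap (specL a N x)) (hexR_test h ρ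
    (fun k n => bundle fun m => F m n k) k j j')).trans ?_
  refine (tr_natural _ _ _ _ _ _).trans (tr_congr (fun k j' => ?_) _ _)
  refine (tr_natural _ _ _ _ _ _).trans (tr_congr (fun k j => ?_) _ _)
  rw [HQVA.YYpr_right]

/-- The vertex operator map of a twisted tensor product on test functions with values in a
`ℂ((x))`-module. -/
theorem lpr_twistY_outer (S : Op Lau (A ⊗[ℂ] B) (A ⊗[ℂ] B)) (f : I × J → HSer N)
    (i i' : I) (j j' : J) :
    lpr (a.tensorProduct b) (yAt (a.tensorProduct b) (twistY YA YB S) (i, j) (i', j')) f =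
      tr a b (outerHom.comp negHom) S (fun i' j =>
        YYpr a b (yAt a YA i i') (yAt b YB j j') fun k l => f (k, l)) i' j := by
  refine lpr_twistY outerHom (LinearMap.id : LaurentSeries N →ₗ[ℂ] LaurentSeries N)
    (fun r X => ?_) YA YB S f i i' j j'
  rw [LinearMap.id_apply, LinearMap.id_apply, lau₂_smul_def]
  change _ = cauchy (lauAct N) (laurMap (Algebra.linearMap ℂ Lau) (Lau.equiv r)) (laurMap LinearMap.id X)
  rw [cauchy_laurMap]
  refine congrArg (fun β => cauchy β (Lau.equiv r) X) (LinearMap.ext fun c => LinearMap.ext fun n => ?_)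
  simp [lauAct_apply]

end Spectator

section Hexagons

variable {YA : HSer (A ⊗[ℂ] A →ₗ[ℂ] LaurentSeries A)} {YB : HSer (B ⊗[ℂ] B →ₗ[ℂ] LaurentSeries B)}
  {SAB : Op Lau (A ⊗[ℂ] B) (A ⊗[ℂ] B)} {SAC : Op Lau (A ⊗[ℂ] C) (A ⊗[ℂ] C)}
  {SBC : Op Lau (B ⊗[ℂ] C) (B ⊗[ℂ] C)}
  {SCA : Op Lau (C ⊗[ℂ] A) (C ⊗[ℂ] A)} {SCB : Op Lau (C ⊗[ℂ] B) (C ⊗[ℂ] B)}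

theorem mapHom_id : mapHom (AlgHom.id ℂ Lau) = AlgHom.id ℂ Lau₂ := rfl

theorem HexL.tr_id {I J : Type*} {a : Basis I ℂ A} {b : Basis J ℂ B} (h : HexL YA SAB)
    (f : I → J → HSer Lau) (i i' : I) (j : J) :
    lpr a (yAt a YA i i') (fun k => tr a b (AlgHom.id ℂ Lau) SAB f k j) =
      tr a b (addHom 1) SAB (fun i j => tr a b innerHom SAB (fun i' j =>
        lpr a (yAt a YA i i') fun k => f k j) i' j) i j :=
  hexL_test h (AlgHom.id ℂ Lau) f i i' j

theorem HexR.tr_id {I J : Type*} {a : Basis I ℂ A} {b : Basis J ℂ B} (h : HexR YB SAB)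
    (f : I → J → HSer Lau) (i : I) (j j' : J) :
    lpr b (yAt b YB j j') (fun l => tr a b (AlgHom.id ℂ Lau) SAB f i l) =
      tr a b innerHom SAB (fun i j' => tr a b (addHom (-1)) SAB (fun i j =>
        lpr b (yAt b YB j j') fun l => f i l) i j) i j' :=
  hexR_test h (AlgHom.id ℂ Lau) f i j j'

theorem HexL.of_tr {I J : Type*} {a : Basis I ℂ A} {b : Basis J ℂ B}
    (h : ∀ (f : I → J → HSer Lau) (i i' : I) (j : J),
      lpr a (yAt a YA i i') (fun k => tr a b (AlgHom.id ℂ Lau) SAB f k j) =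
      tr a b (addHom 1) SAB (fun i j => tr a b innerHom SAB (fun i' j =>
        lpr a (yAt a YA i i') fun k => f k j) i' j) i j) : HexL YA SAB := by
  refine hexL_of_test (a := a) (b := b) fun f i i' j => ?_
  have := h f i i' j
  unfold tr at this
  rwa [mapScalars_id] at this

theorem HexR.of_tr {I J : Type*} {a : Basis I ℂ A} {b : Basis J ℂ B}
    (h : ∀ (f : I → J → HSer Lau) (i : I) (j j' : J),
      lpr b (yAt b YB j j') (fun l => tr a b (AlgHom.id ℂ Lau) SAB f i l) =
      tr a b innerHom SAB (fun i j' => tr a b (addHom (-1)) SAB (fun i j =>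
        lpr b (yAt b YB j j') fun l => f i l) i j) i j') : HexR YB SAB := by
  refine hexR_of_test (a := a) (b := b) fun f i j j' => ?_
  have := h f i j j'
  unfold tr at this
  rwa [mapScalars_id] at this

theorem HexL.mergeRight (hB : HexL YA SAB) (hC : HexL YA SAC) :
    HexL YA (Op.mergeRight SAB SAC) := by
  let a := Basis.ofVectorSpace ℂ A
  let b := Basis.ofVectorSpace ℂ B
  let c := Basis.ofVectorSpace ℂ C
  refine HexL.of_tr (a := a) (b := b.tensorProduct c) fun f i i' p => ?_
  obtain ⟨j, k⟩ := p
  simp only [tr_mergeRight]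
  rw [hC.tr_id (a := a) (b := c) fun i k => tr a b (AlgHom.id ℂ Lau) SAB (fun i j => f i (j, k)) i j]
  refine tr_congr (fun i k => ?_) _ _
  refine Eq.trans ?_ (tr_comm _ _ SAC SAB (fun i' k i j => tr a b innerHom SAB (fun i' j =>
    lpr a (yAt a YA i i') fun m => f m (j, k)) i' j) i' k i j)
  exact tr_congr (fun i' k => hB.tr_id (a := a) (b := b) (fun i j => f i (j, k)) i i' j) _ _

theorem HexR.mergeLeft {YC : HSer (C ⊗[ℂ] C →ₗ[ℂ] LaurentSeries C)}
    (hA : HexR YC SAC) (hB : HexR YC SBC) : HexR YC (Op.mergeLeft SAC SBC) := by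
  let a := Basis.ofVectorSpace ℂ A
  let b := Basis.ofVectorSpace ℂ B
  let c := Basis.ofVectorSpace ℂ C
  refine HexR.of_tr (a := a.tensorProduct b) (b := c) fun f p k k' => ?_
  obtain ⟨i, j⟩ := p
  simp only [tr_mergeLeft]
  rw [hA.tr_id (a := a) (b := c) fun i k => tr b c (AlgHom.id ℂ Lau) SBC (fun j k => f (i, j) k) j k]
  refine tr_congr (fun i k' => ?_) _ _
  refine Eq.trans ?_ (tr_comm _ _ SAC SBC (fun i k j k' => tr b c (addHom (-1)) SBC (fun j k =>
    lpr c (yAt c YC k k') fun m => f (i, j) m) j k) i k j k')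
  exact tr_congr (fun i k => hB.tr_id (a := b) (b := c) (fun j k => f (i, j) k) j k k') _ _

/-- Since `Y_T(z) = (Y_A(z) ⊗ Y_B(z)) S_{AB}²³(-z) σ²³`, the hexagon identity for `T` requires
to move `S_{AB}(-y)` through `S_{AC}(x)` and `S_{BC}(x + y)`. By unitarity, this is the Yang–Baxter
equation for `C`, `A`, `B` at `(-x, -y)`. -/
theorem HexL.mergeLeft (hA : HexL YA SAC) (hB : HexL YB SBC) (hAC : Unitary SAC SCA)
    (hCA : Unitary SCA SAC) (hBC : Unitary SBC SCB) (hCB : Unitary SCB SBC)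
    (hYB : YangBaxter SCA SCB SAB) :
    HexL (twistY YA YB SAB) (Op.mergeLeft SAC SBC) := by
  let a := Basis.ofVectorSpace ℂ A
  let b := Basis.ofVectorSpace ℂ B
  let c := Basis.ofVectorSpace ℂ C
  refine HexL.of_tr (a := a.tensorProduct b) (b := c) fun f p p' k => ?_
  obtain ⟨i, j⟩ := p
  obtain ⟨i', j'⟩ := p'
  have hAL := fun z (F : _ → _ → _ → HSer Lau) => hA.YYpr_left (a := a) (b := b) (c := c)
    (AlgHom.id ℂ Lau) z F
  have hBR := fun x (F : _ → _ → _ → HSer Lau) => hB.YYpr_right (a := a) (b := b) (c := c)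
    (AlgHom.id ℂ Lau) x F
  rw [mapHom_id] at hAL hBR
  simp only [AlgHom.id_comp] at hAL hBR
  simp only [lpr_twistY_outer, tr_mergeLeft, hAL, hBR]
  -- the operators on functions of the indices `i`, `i'`, `j`, `j'`, `k`
  let F := Basis.ofVectorSpaceIndex ℂ A → Basis.ofVectorSpaceIndex ℂ A →
    Basis.ofVectorSpaceIndex ℂ B → Basis.ofVectorSpaceIndex ℂ B → Basis.ofVectorSpaceIndex ℂ C →
    HSer (LaurentSeries Lau)
  let P : F → F := fun g i i' j j' k =>
    tr a b (outerHom.comp negHom) SAB (fun i' j => g i i' j j' k) i' j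
  let A₁ : F → F := fun g i i' j j' k => tr a c (addHom 1) SAC (fun i k => g i i' j j' k) i k
  let A₂ : F → F := fun g i i' j j' k => tr a c innerHom SAC (fun i' k => g i i' j j' k) i' k
  let B₁ : F → F := fun g i i' j j' k => tr b c (addHom 1) SBC (fun j k => g i i' j j' k) j k
  let B₂ : F → F := fun g i i' j j' k => tr b c innerHom SBC (fun j' k => g i i' j j' k) j' k
  let Q : F → F := fun g i i' j j' k =>
    tr c b ((addHom 1).comp negHom) SCB (fun k j => g i i' j j' k) k j
  let R : F → F := fun g i i' j j' k =>
    tr c a (innerHom.comp negHom) SCA (fun k i' => g i i' j j' k) k i'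
  have h1 : ∀ g, P (A₁ g) = A₁ (P g) := fun g => by
    funext i i' j j' k
    exact tr_comm _ _ _ _ (fun i' j i k => g i i' j j' k) i' j i k
  have h2 : ∀ g, P (B₂ g) = B₂ (P g) := fun g => by
    funext i i' j j' k
    exact tr_comm _ _ _ _ (fun i' j j' k => g i i' j j' k) i' j j' k
  have hQ : ∀ g, B₁ (Q g) = g := fun g => by
    funext i i' j j' k
    exact hBC.test (a := b) (b := c) (addHom 1) (fun j k => g i i' j j' k) j k
  have hQ' : ∀ g, Q (B₁ g) = g := fun g => by
    funext i i' j j' k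
    exact hCB.test_neg (a := c) (b := b) (addHom 1) (fun k j => g i i' j j' k) k j
  have hR : ∀ g, A₂ (R g) = g := fun g => by
    funext i i' j j' k
    exact hAC.test (a := a) (b := c) innerHom (fun i' k => g i i' j j' k) i' k
  have hR' : ∀ g, R (A₂ g) = g := fun g => by
    funext i i' j j' k
    exact hCA.test_neg (a := c) (b := a) innerHom (fun k i' => g i i' j j' k) k i'
  have hyb : ∀ g, P (Q (R g)) = R (Q (P g)) := fun g => by
    funext i i' j j' k
    have := hYB.test (a := c) (b := a) (c := b) (N := LaurentSeries Lau) (outNegHom.comp inNegHom)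
      (fun k i' j => g i i' j j' k) k i' j
    rw [AlgHom.comp_assoc, AlgHom.comp_assoc, AlgHom.comp_assoc, inNegHom_outer, outNegHom_outer,
      inNegHom_inner, inNegHom_add, ← AlgHom.comp_assoc, ← AlgHom.comp_assoc, outNegHom_inner,
      outNegHom_add, neg_neg] at this
    exact this
  have key : ∀ g, P (A₂ (B₁ g)) = B₁ (A₂ (P g)) := fun g => by
    have := hyb (A₂ (B₁ g))
    rw [hR', hQ'] at this
    rw [this, hR, hQ]
  have := fun g => congrFun (congrFun (congrFun (congrFun (congrFun (calc
    P (A₁ (A₂ (B₁ (B₂ g)))) = A₁ (B₁ (A₂ (P (B₂ g)))) := by rw [h1, key]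
    _ = A₁ (B₁ (A₂ (B₂ (P g)))) := by rw [h2]) i) i') j) j') k
  exact this fun i i' j j' k =>
    YYpr a b (yAt a YA i i') (yAt b YB j j') fun m n => f (m, n) k

/-- Here the Yang–Baxter equation for `C`, `A`, `B` at `(x, -y)` is used. -/
theorem HexR.mergeRight (hA : HexR YA SCA) (hB : HexR YB SCB) (hYB : YangBaxter SCA SCB SAB) :
    HexR (twistY YA YB SAB) (Op.mergeRight SCA SCB) := by
  let a := Basis.ofVectorSpace ℂ A
  let b := Basis.ofVectorSpace ℂ B
  let c := Basis.ofVectorSpace ℂ C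
  refine HexR.of_tr (a := c) (b := a.tensorProduct b) fun f k p p' => ?_
  obtain ⟨i, j⟩ := p
  obtain ⟨i', j'⟩ := p'
  have hAL := fun z (F : _ → _ → _ → HSer Lau) => hA.YYpr_left (a := a) (b := b) (c := c)
    (AlgHom.id ℂ Lau) z F
  have hBR := fun x (F : _ → _ → _ → HSer Lau) => hB.YYpr_right (a := a) (b := b) (c := c)
    (AlgHom.id ℂ Lau) x F
  rw [mapHom_id] at hAL hBR
  simp only [AlgHom.id_comp] at hAL hBR
  simp only [lpr_twistY_outer, tr_mergeRight, hAL, hBR]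
  let F := Basis.ofVectorSpaceIndex ℂ A → Basis.ofVectorSpaceIndex ℂ A →
    Basis.ofVectorSpaceIndex ℂ B → Basis.ofVectorSpaceIndex ℂ B → Basis.ofVectorSpaceIndex ℂ C →
    HSer (LaurentSeries Lau)
  let P : F → F := fun g i i' j j' k =>
    tr a b (outerHom.comp negHom) SAB (fun i' j => g i i' j j' k) i' j
  let A₁ : F → F := fun g i i' j j' k => tr c a (addHom (-1)) SCA (fun k i => g i i' j j' k) k i
  let A₂ : F → F := fun g i i' j j' k => tr c a innerHom SCA (fun k i' => g i i' j j' k) k i'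
  let B₁ : F → F := fun g i i' j j' k => tr c b (addHom (-1)) SCB (fun k j => g i i' j j' k) k j
  let B₂ : F → F := fun g i i' j j' k => tr c b innerHom SCB (fun k j' => g i i' j j' k) k j'
  have h1 : ∀ g, P (A₁ g) = A₁ (P g) := fun g => by
    funext i i' j j' k
    exact tr_comm _ _ _ _ (fun i' j k i => g i i' j j' k) i' j k i
  have h2 : ∀ g, P (B₂ g) = B₂ (P g) := fun g => by
    funext i i' j j' k
    exact tr_comm _ _ _ _ (fun i' j k j' => g i i' j j' k) i' j k j'
  have hyb : ∀ g, P (B₁ (A₂ g)) = A₂ (B₁ (P g)) := fun g => by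
    funext i i' j j' k
    have := hYB.test (a := c) (b := a) (c := b) (N := LaurentSeries Lau) outNegHom
      (fun k i' j => g i i' j j' k) k i' j
    rw [outNegHom_outer, outNegHom_inner, outNegHom_add] at this
    exact this
  have := fun g => congrFun (congrFun (congrFun (congrFun (congrFun (calc
    P (B₂ (B₁ (A₂ (A₁ g)))) = B₂ (A₂ (B₁ (P (A₁ g)))) := by rw [h2, hyb]
    _ = B₂ (A₂ (B₁ (A₁ (P g)))) := by rw [h1]) i) i') j) j') k
  exact this fun i i' j j' k =>
    YYpr a b (yAt a YA i i') (yAt b YB j j') fun m n => f k (m, n)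

end Hexagons

end MergeExchange

/-! ### Vacuum vectors -/

section Vacuum

variable {R : Type} [CommRing R] [Algebra ℂ R]
  {A B C : Type*} [AddCommGroup A] [Module ℂ A] [AddCommGroup B] [Module ℂ B]
  [AddCommGroup C] [Module ℂ C]
  {I J K : Type*} {a : Basis I ℂ A} {b : Basis J ℂ B} {c : Basis K ℂ C}
  {N : Type*} [AddCommGroup N] [Module ℂ N] [Module R N] [IsScalarTower ℂ R N]

/-- `S(z)(v ⊗ e) = v ⊗ e` for all `v`. -/
def VacRight (S : Op Lau (A ⊗[ℂ] B) (A ⊗[ℂ] B)) (e : HSer B) : Prop :=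
  ∀ v : HSer A, conv (fun s x => s x) S (conv (fun a b => a ⊗ₜ[ℂ] b) v e) =
    (conv (fun a b => a ⊗ₜ[ℂ] b) v e).map fun x => (1 : Lau) ⊗ₜ[ℂ] x

/-- `S(z)(e ⊗ u) = e ⊗ u` for all `u`. -/
def VacLeft (S : Op Lau (A ⊗[ℂ] B) (A ⊗[ℂ] B)) (e : HSer A) : Prop :=
  ∀ u : HSer B, conv (fun s x => s x) S (conv (fun a b => a ⊗ₜ[ℂ] b) e u) =
    (conv (fun a b => a ⊗ₜ[ℂ] b) e u).map fun x => (1 : Lau) ⊗ₜ[ℂ] x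

theorem pr_one_tmul (y : HSer A) (f : I → HSer N) :
    pr a (y.map fun x => (1 : R) ⊗ₜ[ℂ] x) f = vpr a y f := by
  unfold pr vpr
  rw [conv_map_left]
  refine conv_congr fun m n => ?_
  simp

theorem vpr_act_of_fixed {S : Op Lau A A} {y : HSer A}
    (h : conv (fun s x => s x) S y = y.map fun x => (1 : Lau) ⊗ₜ[ℂ] x) (φ : Lau →ₐ[ℂ] R)
    (f : I → HSer N) : vpr a y (Op.act a a (S.mapScalars φ.toLinearMap) f) = vpr a y f := by
  have h1 : conv (fun s x => s x) (S.mapScalars φ.toLinearMap) y =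
      y.map fun x => (1 : R) ⊗ₜ[ℂ] x := by
    have : conv (fun s x => s x) (S.mapScalars φ.toLinearMap) y =
        (conv (fun s x => s x) S y).map (φ.toLinearMap.rTensor A) := by
      rw [map_conv]
      rfl
    rw [this, h]
    funext t
    simp [map_apply]
  rw [← pr_conv_apply, h1, pr_one_tmul]

theorem VacRight.test {S : Op Lau (A ⊗[ℂ] B) (A ⊗[ℂ] B)} {e : HSer B} (h : VacRight S e)
    (φ : Lau →ₐ[ℂ] R) (f : I → J → HSer N) (i : I) :
    vpr b e (fun j => tr a b φ S f i j) = vpr b e fun j => f i j := by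
  have := vpr_act_of_fixed (a := a.tensorProduct b) (h (const (a i))) φ fun p => f p.1 p.2
  rwa [vpr_tmul, vpr_tmul, vpr_const, vpr_const] at this

theorem VacLeft.test {S : Op Lau (A ⊗[ℂ] B) (A ⊗[ℂ] B)} {e : HSer A} (h : VacLeft S e)
    (φ : Lau →ₐ[ℂ] R) (f : I → J → HSer N) (j : J) :
    vpr a e (fun i => tr a b φ S f i j) = vpr a e fun i => f i j := by
  have := vpr_act_of_fixed (a := a.tensorProduct b) (h (const (b j))) φ fun p => f p.1 p.2
  rw [vpr_tmul, vpr_tmul] at this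
  simp only [vpr_const] at this
  exact this

theorem VacRight.of_test {S : Op Lau (A ⊗[ℂ] B) (A ⊗[ℂ] B)} {e : HSer B}
    (h : ∀ (f : I → J → HSer Lau) (i : I),
      vpr b e (fun j => tr a b (AlgHom.id ℂ Lau) S f i j) = vpr b e fun j => f i j) :
    VacRight S e := by
  intro v
  refine ext_pr (a := a.tensorProduct b) fun f => ?_
  rw [pr_one_tmul, pr_conv_apply (b := a.tensorProduct b), vpr_tmul, vpr_tmul]
  have := fun i => h (fun i j => f (i, j)) i
  unfold tr Op.act2 at this
  simp only [mapScalars_id] at this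
  exact congrArg (vpr a v) (funext this)

theorem VacLeft.of_test {S : Op Lau (A ⊗[ℂ] B) (A ⊗[ℂ] B)} {e : HSer A}
    (h : ∀ (f : I → J → HSer Lau) (j : J),
      vpr a e (fun i => tr a b (AlgHom.id ℂ Lau) S f i j) = vpr a e fun i => f i j) :
    VacLeft S e := by
  intro v
  refine ext_pr (a := a.tensorProduct b) fun f => ?_
  rw [pr_one_tmul, pr_conv_apply (b := a.tensorProduct b), vpr_tmul, vpr_tmul, vpr_comm,
    vpr_comm (a := a)]
  have := fun j => h (fun i j => f (i, j)) j
  unfold tr Op.act2 at this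
  simp only [mapScalars_id] at this
  exact congrArg (vpr b v) (funext this)

variable {SAB : Op Lau (A ⊗[ℂ] B) (A ⊗[ℂ] B)} {SAC : Op Lau (A ⊗[ℂ] C) (A ⊗[ℂ] C)}
  {SBC : Op Lau (B ⊗[ℂ] C) (B ⊗[ℂ] C)} {eA : HSer A} {eB : HSer B} {eC : HSer C}

theorem VacRight.mergeLeft (hA : VacRight SAC eC) (hB : VacRight SBC eC) :
    VacRight (Op.mergeLeft SAC SBC) eC := by
  refine VacRight.of_test (a := (Basis.ofVectorSpace ℂ A).tensorProduct (Basis.ofVectorSpace ℂ B))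
    (b := Basis.ofVectorSpace ℂ C) fun f p => ?_
  obtain ⟨i, j⟩ := p
  simp only [tr_mergeLeft]
  rw [hA.test (N := Lau) (AlgHom.id ℂ Lau) (fun i k => tr _ _ _ SBC (fun j k => f (i, j) k) j k)]
  exact hB.test (N := Lau) (AlgHom.id ℂ Lau) (fun j k => f (i, j) k) j

theorem VacLeft.mergeLeft (hA : VacLeft SAC eA) (hB : VacLeft SBC eB) :
    VacLeft (Op.mergeLeft SAC SBC) (conv (fun a b => a ⊗ₜ[ℂ] b) eA eB) := by
  let a := Basis.ofVectorSpace ℂ A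
  let b := Basis.ofVectorSpace ℂ B
  let c := Basis.ofVectorSpace ℂ C
  refine VacLeft.of_test (a := a.tensorProduct b) (b := c) fun f k => ?_
  rw [vpr_tmul, vpr_tmul]
  simp only [tr_mergeLeft]
  rw [vpr_comm, ← vpr_comm]
  rw [vpr_comm]
  have h1 := fun j => hA.test (a := a) (b := c) (N := Lau) (AlgHom.id ℂ Lau) (fun i k =>
    tr b c (AlgHom.id ℂ Lau) SBC (fun j k => f (i, j) k) j k) k
  simp only [h1]
  rw [vpr_comm]
  have h2 := fun i => hB.test (a := b) (b := c) (N := Lau) (AlgHom.id ℂ Lau)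
    (fun j k => f (i, j) k) k
  simp only [h2]

theorem VacRight.mergeRight (hB : VacRight SAB eB) (hC : VacRight SAC eC) :
    VacRight (Op.mergeRight SAB SAC) (conv (fun a b => a ⊗ₜ[ℂ] b) eB eC) := by
  let a := Basis.ofVectorSpace ℂ A
  let b := Basis.ofVectorSpace ℂ B
  let c := Basis.ofVectorSpace ℂ C
  refine VacRight.of_test (a := a) (b := b.tensorProduct c) fun f i => ?_
  rw [vpr_tmul, vpr_tmul]
  simp only [tr_mergeRight]
  have h1 := fun j => hC.test (a := a) (b := c) (N := Lau) (AlgHom.id ℂ Lau) (fun i k =>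
    tr a b (AlgHom.id ℂ Lau) SAB (fun i j => f i (j, k)) i j) i
  simp only [h1]
  rw [vpr_comm]
  have h2 := fun k => hB.test (a := a) (b := b) (N := Lau) (AlgHom.id ℂ Lau)
    (fun i j => f i (j, k)) i
  simp only [h2]
  rw [vpr_comm]

theorem VacLeft.mergeRight (hB : VacLeft SAB eA) (hC : VacLeft SAC eA) :
    VacLeft (Op.mergeRight SAB SAC) eA := by
  let a := Basis.ofVectorSpace ℂ A
  let b := Basis.ofVectorSpace ℂ B
  let c := Basis.ofVectorSpace ℂ C
  refine VacLeft.of_test (a := a) (b := b.tensorProduct c) fun f p => ?_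
  obtain ⟨j, k⟩ := p
  simp only [tr_mergeRight]
  rw [hC.test (a := a) (b := c) (N := Lau) (AlgHom.id ℂ Lau)
    (fun i k => tr a b (AlgHom.id ℂ Lau) SAB (fun i j => f i (j, k)) i j)]
  exact hB.test (a := a) (b := b) (N := Lau) (AlgHom.id ℂ Lau) (fun i j => f i (j, k)) j

end Vacuum

/-! ### Derivations -/

section Shift

variable {A B C : Type*} [AddCommGroup A] [Module ℂ A] [AddCommGroup B] [Module ℂ B]
  [AddCommGroup C] [Module ℂ C]
  {I J K : Type*} (a : Basis I ℂ A) (b : Basis J ℂ B) (c : Basis K ℂ C)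
  {N : Type*} [AddCommGroup N] [Module ℂ N]

/-- The transpose of `d : A[[ħ]] → A[[ħ]]`, acting on test functions. -/
def dpr (d : HSer (A →ₗ[ℂ] A)) (f : I → HSer N) (i : I) : HSer N :=
  vpr a (d.map fun d => d (a i)) f

/-- Coefficientwise differentiation. -/
def ddz (x : HSer Lau) : HSer Lau := x.map lauDeriv

variable {a b c}

theorem vpr_add_left (x y : HSer A) (f : I → HSer N) : vpr a (x + y) f = vpr a x f + vpr a y f :=
  conv_add_left (fun _ _ _ => map_add _ _ _) _ _ _

theorem dpr_add (d d' : HSer (A →ₗ[ℂ] A)) (f : I → HSer N) (i : I) :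
    dpr a (d + d') f i = dpr a d f i + dpr a d' f i := vpr_add_left _ _ _

theorem dpr_rTensor (d : HSer (A →ₗ[ℂ] A)) (f : I → J → HSer N) (i : I) (j : J) :
    dpr (a.tensorProduct b) (d.map fun d => d.rTensor B) (fun p => f p.1 p.2) (i, j) =
      dpr a d (fun i => f i j) i := by
  have : (d.map fun d => d.rTensor B).map (fun d => d ((a.tensorProduct b) (i, j))) =
      conv (fun a b => a ⊗ₜ[ℂ] b) (d.map fun d => d (a i)) (const (b j)) := by
    rw [conv_const_right (fun _ => TensorProduct.tmul_zero _ _)]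
    funext t
    simp [map_apply, Module.Basis.tensorProduct_apply]
  rw [dpr, this, vpr_tmul]
  simp only [vpr_const]
  rfl

theorem dpr_lTensor (d : HSer (B →ₗ[ℂ] B)) (f : I → J → HSer N) (i : I) (j : J) :
    dpr (a.tensorProduct b) (d.map fun d => d.lTensor A) (fun p => f p.1 p.2) (i, j) =
      dpr b d (fun j => f i j) j := by
  have : (d.map fun d => d.lTensor A).map (fun d => d ((a.tensorProduct b) (i, j))) =
      conv (fun a b => a ⊗ₜ[ℂ] b) (const (a i)) (d.map fun d => d (b j)) := by
    rw [conv_const_left (fun _ => TensorProduct.zero_tmul _ _)]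
    funext t
    simp [map_apply, Module.Basis.tensorProduct_apply]
  rw [dpr, this, vpr_tmul, vpr_const]
  rfl

theorem tr_dpr (S : Op Lau (A ⊗[ℂ] B) (A ⊗[ℂ] B)) (d : HSer (C →ₗ[ℂ] C))
    (f : I → J → K → HSer Lau) (i : I) (j : J) (k : K) :
    tr a b (AlgHom.id ℂ Lau) S (fun i j => dpr c d (fun k => f i j k) k) i j =
      dpr c d (fun k => tr a b (AlgHom.id ℂ Lau) S (fun i j => f i j k) i j) k :=
  pr_vpr_comm _ _ fun (p : I × J) k => f p.1 p.2 k

theorem tr_add {R : Type} [CommRing R] [Algebra ℂ R] [Module R N] [IsScalarTower ℂ R N]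
    (φ : Lau →ₐ[ℂ] R) (S : Op Lau (A ⊗[ℂ] B) (A ⊗[ℂ] B)) (f g : I → J → HSer N) (i : I) (j : J) :
    tr a b φ S (fun i j => f i j + g i j) i j = tr a b φ S f i j + tr a b φ S g i j :=
  pr_add _ _ _

theorem tr_sub {R : Type} [CommRing R] [Algebra ℂ R] [Module R N] [IsScalarTower ℂ R N]
    (φ : Lau →ₐ[ℂ] R) (S : Op Lau (A ⊗[ℂ] B) (A ⊗[ℂ] B)) (f g : I → J → HSer N) (i : I) (j : J) :
    tr a b φ S (fun i j => f i j - g i j) i j = tr a b φ S f i j - tr a b φ S g i j :=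
  pr_sub _ _ _

theorem lauDeriv_mul (f g : Lau) : lauDeriv (f * g) = f * lauDeriv g + lauDeriv f * g := by
  have h := lauHasse_mul 1 f g
  have h0 : ∀ f, lauHasse 0 f = f := fun f => Lau.ext fun n => by rw [lauHasse_coeff]; simp
  simp only [Finset.sum_range_succ, Finset.sum_range_zero, zero_add, Nat.sub_zero, Nat.sub_self,
    h0] at h
  exact h

theorem act_ddz (S : Op Lau A B) (f : J → HSer Lau) (i : I) :
    Op.act a b S.ddz f i = ddz (Op.act a b S f i) - Op.act a b S (fun j => ddz (f j)) i := by
  have hl : lin b (fun j => ddz (f j)) = (lin b f).map fun g => lauDeriv ∘ₗ g := by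
    funext t
    refine b.ext fun j => ?_
    simp [lin_basis, map_apply, ddz]
  unfold Op.act pr
  rw [hl, conv_map_right, eq_sub_iff_add_eq, ddz, map_conv]
  funext t
  rw [HSer.add_apply, conv_apply, conv_apply, conv_apply, ← Finset.sum_add_distrib]
  refine Finset.sum_congr rfl fun q _ => ?_
  simp only [map_apply, Op.ddz, Op.subst, LinearMap.comp_apply]
  generalize (S q.1) _ = y
  generalize lin b f q.2 = g
  induction y with
  | zero => simp
  | add x y hx hy =>
    simp only [map_add, ← hx, ← hy]
    abel
  | tmul r x =>
    simp only [LinearMap.rTensor_tmul, LinearMap.liftBaseChange_tmul, LinearMap.comp_apply,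
      smul_eq_mul, lauDeriv_mul]
    rw [add_comm]

/-- An endomorphism of `A[[ħ]]` as an operator with constant scalars. -/
def constOp (d : HSer (A →ₗ[ℂ] A)) : Op Lau A A := d.map fun d => TensorProduct.mk ℂ Lau A 1 ∘ₗ d

theorem constOp_comp (d : HSer (A →ₗ[ℂ] A)) (S : Op Lau A A) :
    (constOp d).comp S = conv (fun d s => d.lTensor Lau ∘ₗ s) d S := by
  unfold Op.comp constOp
  rw [conv_map_left]
  refine conv_congr fun m n => LinearMap.ext fun x => ?_
  simp only [LinearMap.comp_apply, LinearMap.restrictScalars_apply]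
  generalize S n x = y
  induction y with
  | zero => simp
  | add x y hx hy => simp only [map_add, hx, hy]
  | tmul r x => simp [TensorProduct.smul_tmul']

theorem comp_constOp (d : HSer (A →ₗ[ℂ] A)) (S : Op Lau A A) :
    S.comp (constOp d) = conv (fun s d => s ∘ₗ d) S d := by
  unfold Op.comp constOp
  rw [conv_map_right]
  refine conv_congr fun m n => LinearMap.ext fun x => ?_
  simp

theorem act_bracket (d : HSer (A →ₗ[ℂ] A)) (S : Op Lau A A) (f : I → HSer Lau) (i : I) :
    Op.act a a (S.bracket d) f i = Op.act a a S (dpr a d f) i - dpr a d (Op.act a a S f) i := by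
  have hD : ∀ (f : I → HSer Lau) i, Op.act a a (constOp d) f i = dpr a d f i := by
    intro f i
    have : (constOp d).map (fun s => s (a i)) =
        (d.map fun d => d (a i)).map fun x => (1 : Lau) ⊗ₜ[ℂ] x := funext fun t => rfl
    rw [Op.act, this, pr_one_tmul, dpr]
  have h2 : Op.act a a ((constOp d).comp S - S.comp (constOp d)) f i =
      Op.act a a ((constOp d).comp S) f i - Op.act a a (S.comp (constOp d)) f i :=
    pr_sub_left _ _ _
  have h3 := act_comp (a := a) (b := a) (c := a) (constOp d) S f i
  have h4 := act_comp (a := a) (b := a) (c := a) S (constOp d) f i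
  rw [funext (hD f)] at h3
  have h5 : S.bracket d = (constOp d).comp S - S.comp (constOp d) := by
    rw [constOp_comp, comp_constOp]
    rfl
  rw [h5, h2, h3, h4, hD]

/-- `[d ⊗ 1, S(z)] = -(d/dz) S(z)`. -/
def ShiftLeft (S : Op Lau (A ⊗[ℂ] B) (A ⊗[ℂ] B)) (d : HSer (A →ₗ[ℂ] A)) : Prop :=
  S.bracket (d.map fun d => d.rTensor B) = -S.ddz

/-- `[1 ⊗ d, S(z)] = (d/dz) S(z)`. -/
def ShiftRight (S : Op Lau (A ⊗[ℂ] B) (A ⊗[ℂ] B)) (d : HSer (B →ₗ[ℂ] B)) : Prop :=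
  S.bracket (d.map fun d => d.lTensor A) = S.ddz

/-- On test functions with values in `ℂ((z))`, the identity `[d ⊗ 1, S(z)] = -(d/dz) S(z)` says
that `S(z)` commutes with `d ⊗ 1 - d/dz`. -/
theorem shiftLeft_iff (S : Op Lau (A ⊗[ℂ] B) (A ⊗[ℂ] B)) (d : HSer (A →ₗ[ℂ] A)) :
    ShiftLeft S d ↔ ∀ (f : I → J → HSer Lau) i j,
      tr a b (AlgHom.id ℂ Lau) S (fun i j => dpr a d (fun i => f i j) i - ddz (f i j)) i j =
        dpr a d (fun i => tr a b (AlgHom.id ℂ Lau) S f i j) i -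
          ddz (tr a b (AlgHom.id ℂ Lau) S f i j) := by
  have hneg : ∀ (T : Op Lau (A ⊗[ℂ] B) (A ⊗[ℂ] B)) f p,
      Op.act (a.tensorProduct b) (a.tensorProduct b) (-T) (N := Lau) f p =
        -Op.act (a.tensorProduct b) (a.tensorProduct b) T f p := fun T f p => pr_neg_left _ _
  have key : ∀ (f : I → J → HSer Lau) i j,
      Op.act (a.tensorProduct b) (a.tensorProduct b) (S.bracket (d.map fun d => d.rTensor B))
        (fun p => f p.1 p.2) (i, j) = Op.act (a.tensorProduct b) (a.tensorProduct b) (-S.ddz)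
          (fun p => f p.1 p.2) (i, j) ↔
      tr a b (AlgHom.id ℂ Lau) S (fun i j => dpr a d (fun i => f i j) i - ddz (f i j)) i j =
        dpr a d (fun i => tr a b (AlgHom.id ℂ Lau) S f i j) i -
          ddz (tr a b (AlgHom.id ℂ Lau) S f i j) := by
    intro f i j
    rw [tr_sub, act_bracket, hneg, act_ddz]
    unfold tr
    rw [mapScalars_id]
    have h1 : (dpr (a.tensorProduct b) (d.map fun d => d.rTensor B) fun p => f p.1 p.2) =
        fun p : I × J => dpr a d (fun i => f i p.2) p.1 :=
      funext fun p => dpr_rTensor d f p.1 p.2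
    have h2 := dpr_rTensor (a := a) (b := b) d (Op.act2 a b S f) i j
    have h3 : (Op.act (a.tensorProduct b) (a.tensorProduct b) S fun p => f p.1 p.2) =
      fun p : I × J => Op.act2 a b S f p.1 p.2 := rfl
    rw [h1, h3, h2]
    change Op.act2 a b S (fun i j => dpr a d (fun i => f i j) i) i j - _ =
      -(_ - Op.act2 a b S (fun i j => ddz (f i j)) i j) ↔ _
    rw [neg_sub, sub_eq_sub_iff_add_eq_add, sub_eq_sub_iff_add_eq_add, add_comm _ (dpr a _ _ _)]
  constructor
  · intro h f i j
    exact (key f i j).1 (by rw [(h : S.bracket (d.map fun d => d.rTensor B) = -S.ddz)])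
  · intro h
    exact act_ext (a := a.tensorProduct b) (b := a.tensorProduct b) fun f p =>
      (key (fun i j => f (i, j)) p.1 p.2).2 (h _ _ _)

/-- On test functions with values in `ℂ((z))`, the identity `[1 ⊗ d, S(z)] = (d/dz) S(z)` says
that `S(z)` commutes with `1 ⊗ d + d/dz`. -/
theorem shiftRight_iff (S : Op Lau (A ⊗[ℂ] B) (A ⊗[ℂ] B)) (d : HSer (B →ₗ[ℂ] B)) :
    ShiftRight S d ↔ ∀ (f : I → J → HSer Lau) i j,
      tr a b (AlgHom.id ℂ Lau) S (fun i j => dpr b d (fun j => f i j) j + ddz (f i j)) i j =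
        dpr b d (fun j => tr a b (AlgHom.id ℂ Lau) S f i j) j +
          ddz (tr a b (AlgHom.id ℂ Lau) S f i j) := by
  have key : ∀ (f : I → J → HSer Lau) i j,
      Op.act (a.tensorProduct b) (a.tensorProduct b) (S.bracket (d.map fun d => d.lTensor A))
        (fun p => f p.1 p.2) (i, j) = Op.act (a.tensorProduct b) (a.tensorProduct b) S.ddz
          (fun p => f p.1 p.2) (i, j) ↔
      tr a b (AlgHom.id ℂ Lau) S (fun i j => dpr b d (fun j => f i j) j + ddz (f i j)) i j =
        dpr b d (fun j => tr a b (AlgHom.id ℂ Lau) S f i j) j +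
          ddz (tr a b (AlgHom.id ℂ Lau) S f i j) := by
    intro f i j
    rw [tr_add, act_bracket, act_ddz]
    unfold tr
    rw [mapScalars_id]
    have h1 : (dpr (a.tensorProduct b) (d.map fun d => d.lTensor A) fun p => f p.1 p.2) =
        fun p : I × J => dpr b d (fun j => f p.1 j) p.2 :=
      funext fun p => dpr_lTensor d f p.1 p.2
    have h2 := dpr_lTensor (a := a) (b := b) d (Op.act2 a b S f) i j
    have h3 : (Op.act (a.tensorProduct b) (a.tensorProduct b) S fun p => f p.1 p.2) =
      fun p : I × J => Op.act2 a b S f p.1 p.2 := rfl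
    rw [h1, h3, h2]
    change Op.act2 a b S (fun i j => dpr b d (fun j => f i j) j) i j - _ =
      (_ - Op.act2 a b S (fun i j => ddz (f i j)) i j) ↔ _
    rw [sub_eq_sub_iff_add_eq_add, add_comm _ (dpr b _ _ _)]
  constructor
  · intro h f i j
    exact (key f i j).1 (by rw [(h : S.bracket (d.map fun d => d.lTensor A) = S.ddz)])
  · intro h
    exact act_ext (a := a.tensorProduct b) (b := a.tensorProduct b) fun f p =>
      (key (fun i j => f (i, j)) p.1 p.2).2 (h _ _ _)

end Shift

/-! ### Shift properties of merged operators -/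

section ShiftMerge

variable {A B C : Type*} [AddCommGroup A] [Module ℂ A] [AddCommGroup B] [Module ℂ B]
  [AddCommGroup C] [Module ℂ C]
  {SAB : Op Lau (A ⊗[ℂ] B) (A ⊗[ℂ] B)} {SAC : Op Lau (A ⊗[ℂ] C) (A ⊗[ℂ] C)}
  {SBC : Op Lau (B ⊗[ℂ] C) (B ⊗[ℂ] C)}
  {dA : HSer (A →ₗ[ℂ] A)} {dB : HSer (B →ₗ[ℂ] B)} {dC : HSer (C →ₗ[ℂ] C)}

/-- `d ⊗ 1 + 1 ⊗ d'`. -/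
def derivTensor (dA : HSer (A →ₗ[ℂ] A)) (dB : HSer (B →ₗ[ℂ] B)) :
    HSer (A ⊗[ℂ] B →ₗ[ℂ] A ⊗[ℂ] B) :=
  (dA.map fun d => d.rTensor B) + dB.map fun d => d.lTensor A

theorem dpr_derivTensor {I J : Type*} {a : Basis I ℂ A} {b : Basis J ℂ B} {N : Type*}
    [AddCommGroup N] [Module ℂ N] (f : I × J → HSer N) (i : I) (j : J) :
    dpr (a.tensorProduct b) (derivTensor dA dB) f (i, j) =
      dpr a dA (fun i => f (i, j)) i + dpr b dB (fun j => f (i, j)) j := by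
  rw [derivTensor, dpr_add]
  exact congrArg₂ (· + ·) (dpr_rTensor dA (fun i j => f (i, j)) i j)
    (dpr_lTensor dB (fun i j => f (i, j)) i j)

theorem ShiftLeft.mergeLeft (hA : ShiftLeft SAC dA) (hB : ShiftLeft SBC dB) :
    ShiftLeft (Op.mergeLeft SAC SBC) (derivTensor dA dB) := by
  let a := Basis.ofVectorSpace ℂ A
  let b := Basis.ofVectorSpace ℂ B
  let c := Basis.ofVectorSpace ℂ C
  refine (shiftLeft_iff (a := a.tensorProduct b) (b := c) _ _).2 fun f p k => ?_
  obtain ⟨i, j⟩ := p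
  have hA' := (shiftLeft_iff (a := a) (b := c) _ _).1 hA
  have hB' := (shiftLeft_iff (a := b) (b := c) _ _).1 hB
  simp only [dpr_derivTensor, tr_mergeLeft]
  have h1 : ∀ i k, tr b c (AlgHom.id ℂ Lau) SBC (fun j k => dpr a dA (fun i => f (i, j) k) i +
      dpr b dB (fun j => f (i, j) k) j - ddz (f (i, j) k)) j k =
      (dpr a dA (fun i => tr b c (AlgHom.id ℂ Lau) SBC (fun j k => f (i, j) k) j k) i -
        ddz (tr b c (AlgHom.id ℂ Lau) SBC (fun j k => f (i, j) k) j k)) +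
        dpr b dB (fun j => tr b c (AlgHom.id ℂ Lau) SBC (fun j k => f (i, j) k) j k) j := by
    intro i k
    simp only [add_sub_assoc]
    rw [tr_add, hB' fun j k => f (i, j) k, tr_dpr (a := b) (b := c) (c := a) SBC dA
      (fun j k i => f (i, j) k)]
    abel
  rw [tr_congr h1, tr_add, hA' fun i k => tr b c (AlgHom.id ℂ Lau) SBC (fun j k => f (i, j) k) j k,
    tr_dpr (a := a) (b := c) (c := b) SAC dB
      fun i k j => tr b c (AlgHom.id ℂ Lau) SBC (fun j k => f (i, j) k) j k]
  abel

theorem ShiftRight.mergeLeft (hA : ShiftRight SAC dC) (hB : ShiftRight SBC dC) :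
    ShiftRight (Op.mergeLeft SAC SBC) dC := by
  let a := Basis.ofVectorSpace ℂ A
  let b := Basis.ofVectorSpace ℂ B
  let c := Basis.ofVectorSpace ℂ C
  refine (shiftRight_iff (a := a.tensorProduct b) (b := c) _ _).2 fun f p k => ?_
  obtain ⟨i, j⟩ := p
  have hA' := (shiftRight_iff (a := a) (b := c) _ _).1 hA
  have hB' := (shiftRight_iff (a := b) (b := c) _ _).1 hB
  simp only [tr_mergeLeft]
  rw [tr_congr fun i k => hB' (fun j k => f (i, j) k) j k]
  exact hA' (fun i k => tr b c (AlgHom.id ℂ Lau) SBC (fun j k => f (i, j) k) j k) i k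

theorem ShiftLeft.mergeRight (hB : ShiftLeft SAB dA) (hC : ShiftLeft SAC dA) :
    ShiftLeft (Op.mergeRight SAB SAC) dA := by
  let a := Basis.ofVectorSpace ℂ A
  let b := Basis.ofVectorSpace ℂ B
  let c := Basis.ofVectorSpace ℂ C
  refine (shiftLeft_iff (a := a) (b := b.tensorProduct c) _ _).2 fun f i p => ?_
  obtain ⟨j, k⟩ := p
  have hB' := (shiftLeft_iff (a := a) (b := b) _ _).1 hB
  have hC' := (shiftLeft_iff (a := a) (b := c) _ _).1 hC
  simp only [tr_mergeRight]
  rw [tr_congr fun i k => hB' (fun i j => f i (j, k)) i j]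
  exact hC' (fun i k => tr a b (AlgHom.id ℂ Lau) SAB (fun i j => f i (j, k)) i j) i k

theorem ShiftRight.mergeRight (hB : ShiftRight SAB dB) (hC : ShiftRight SAC dC) :
    ShiftRight (Op.mergeRight SAB SAC) (derivTensor dB dC) := by
  let a := Basis.ofVectorSpace ℂ A
  let b := Basis.ofVectorSpace ℂ B
  let c := Basis.ofVectorSpace ℂ C
  refine (shiftRight_iff (a := a) (b := b.tensorProduct c) _ _).2 fun f i p => ?_
  obtain ⟨j, k⟩ := p
  have hB' := (shiftRight_iff (a := a) (b := b) _ _).1 hB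
  have hC' := (shiftRight_iff (a := a) (b := c) _ _).1 hC
  simp only [dpr_derivTensor, tr_mergeRight]
  have h1 : ∀ i k, tr a b (AlgHom.id ℂ Lau) SAB (fun i j => dpr b dB (fun j => f i (j, k)) j +
      dpr c dC (fun k => f i (j, k)) k + ddz (f i (j, k))) i j =
      (dpr c dC (fun k => tr a b (AlgHom.id ℂ Lau) SAB (fun i j => f i (j, k)) i j) k +
        ddz (tr a b (AlgHom.id ℂ Lau) SAB (fun i j => f i (j, k)) i j)) +
        dpr b dB (fun j => tr a b (AlgHom.id ℂ Lau) SAB (fun i j => f i (j, k)) i j) j := by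
    intro i k
    simp only [add_right_comm _ (dpr c _ _ _)]
    rw [tr_add, hB' fun i j => f i (j, k), tr_dpr (a := a) (b := b) (c := c) SAB dC
      (fun i j k => f i (j, k))]
    abel
  rw [tr_congr h1, tr_add, hC' fun i k => tr a b (AlgHom.id ℂ Lau) SAB (fun i j => f i (j, k)) i j,
    tr_dpr (a := a) (b := c) (c := b) SAC dB
      fun i k j => tr a b (AlgHom.id ℂ Lau) SAB (fun i j => f i (j, k)) i j]
  abel

end ShiftMerge

/-! ### Vacuum and derivation of a twisted tensor product -/

section VectorPairing

variable {A B : Type*} [AddCommGroup A] [Module ℂ A] [AddCommGroup B] [Module ℂ B]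
  {I J K : Type*} {a : Basis I ℂ A} {b : Basis J ℂ B}
  {N : Type*} [AddCommGroup N] [Module ℂ N]

theorem vpr_self (x : HSer A) : vpr a x (fun i => const (a i)) = x := by
  have : lin a (fun i => const (a i)) = const LinearMap.id := by
    funext t
    refine a.ext fun i => ?_
    rw [lin_basis]
    by_cases ht : t = 0 <;> simp [const, ht]
  rw [vpr, this, conv_const_right (fun _ => rfl)]
  rfl

theorem vpr_apply_congr {x : HSer A} {f g : I → HSer N} (h : ∀ i, f i = g i) :
    vpr a x f = vpr a x g := by
  rw [funext h]

theorem lpr_vpr (y : HSer B) (x : J → HSer (LaurentSeries A)) (f : I → HSer N) :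
    lpr a (vpr b y x) f = vpr b y fun j => lpr a (x j) f := by
  have h : ∀ x : HSer (LaurentSeries A),
      lpr a x f = hap ((lin a f).map laurMap) x := fun x => conv_swap _ _ _
  simp only [h]
  exact vpr_natural _ _ _

theorem conv_laurTensor_vpr_left (y : HSer A) (x : I → HSer (LaurentSeries A))
    (z : HSer (LaurentSeries B)) :
    conv (fun x z => laurTensor (x ⊗ₜ[ℂ] z)) (vpr a y x) z =
      vpr a y fun i => conv (fun x z => laurTensor (x ⊗ₜ[ℂ] z)) (x i) z := by
  have h : ∀ x : HSer (LaurentSeries A), conv (fun x z => laurTensor (x ⊗ₜ[ℂ] z)) x z =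
      hap (z.map fun z => laurTensor ∘ₗ (TensorProduct.mk ℂ (LaurentSeries A) _).flip z) x :=
    fun x => conv_swap _ _ _
  simp only [h]
  exact vpr_natural _ _ _

theorem conv_laurTensor_vpr_right (y : HSer B) (x : HSer (LaurentSeries A))
    (z : J → HSer (LaurentSeries B)) :
    conv (fun x z => laurTensor (x ⊗ₜ[ℂ] z)) x (vpr b y z) =
      vpr b y fun j => conv (fun x z => laurTensor (x ⊗ₜ[ℂ] z)) x (z j) :=
  vpr_natural (x.map fun x => laurTensor ∘ₗ (TensorProduct.mk ℂ _ (LaurentSeries B)) x) _ _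

theorem lpr_ext {x y : HSer (LaurentSeries A)}
    (h : ∀ φ : I → ℂ, lpr a x (fun i => const (φ i)) = lpr a y fun i => const (φ i)) : x = y := by
  refine hser_laurent_ext fun n => ext_vpr (a := a) fun φ => ?_
  rw [← lpr_coeff, ← lpr_coeff, h]

theorem laurTensor_coeff {L M : ℤ} {x : LaurentSeries A} {z : LaurentSeries B}
    (hx : ∀ i < L, x.coeff i = 0) (hz : ∀ i < M, z.coeff i = 0) (n : ℤ) :
    (laurTensor (x ⊗ₜ[ℂ] z)).coeff n = ∑ i ∈ Finset.Icc L (n - M), x.coeff i ⊗ₜ z.coeff (n - i) :=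
  cauchy_coeff_Icc _ hx hz n

theorem conv_laurTensor_coeff {x : HSer (LaurentSeries A)} {z : HSer (LaurentSeries B)}
    (hx : ∀ n < 0, (x.map fun X => X.coeff n) = 0) (hz : ∀ n < 0, (z.map fun X => X.coeff n) = 0)
    (n : ℤ) :
    (conv (fun x z => laurTensor (x ⊗ₜ[ℂ] z)) x z).map (fun X => X.coeff n) =
      ∑ i ∈ Finset.Icc 0 n, conv (fun a b => a ⊗ₜ[ℂ] b) (x.map fun X => X.coeff i)
        (z.map fun X => X.coeff (n - i)) := by
  funext t
  have : ∀ (s : Finset ℤ) (F : ℤ → HSer (A ⊗[ℂ] B)), (∑ i ∈ s, F i) t = ∑ i ∈ s, F i t :=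
    fun s F => Finset.sum_apply t s F
  rw [this, map_apply, conv_apply, HahnSeries.coeff_sum]
  simp only [conv_apply]
  rw [Finset.sum_comm]
  refine Finset.sum_congr rfl fun q _ => ?_
  rw [laurTensor_coeff (L := 0) (M := 0) (fun i hi => congrFun (hx i hi) q.1)
    (fun i hi => congrFun (hz i hi) q.2), sub_zero]
  rfl

end VectorPairing

section ApplyY

variable {A B : Type*} [AddCommGroup A] [Module ℂ A] [AddCommGroup B] [Module ℂ B]
  {I J : Type*} (a : Basis I ℂ A) {b : Basis J ℂ B}

/-- `Y(u, z) w`, for a bare vertex operator map `Y`. -/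
def applyY (Y : HSer (A ⊗[ℂ] A →ₗ[ℂ] LaurentSeries A)) (u w : HSer A) : HSer (LaurentSeries A) :=
  conv (fun y x => y x) Y (conv (fun a b => a ⊗ₜ[ℂ] b) u w)

theorem applyY_eq_vpr (Y : HSer (A ⊗[ℂ] A →ₗ[ℂ] LaurentSeries A)) (u w : HSer A) :
    applyY Y u w = vpr a u fun i => vpr a w fun i' => yAt a Y i i' := by
  rw [← vpr_tmul (a := a) (b := a) u w fun p => yAt a Y p.1 p.2]
  have : lin (a.tensorProduct a) (fun p => yAt a Y p.1 p.2) = Y := by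
    funext t
    refine (a.tensorProduct a).ext fun p => ?_
    rw [lin_basis, Module.Basis.tensorProduct_apply']
    rfl
  rw [vpr, this, applyY, conv_swap]

theorem lpr_applyY (Y : HSer (A ⊗[ℂ] A →ₗ[ℂ] LaurentSeries A)) (u w : HSer A) {N : Type*}
    [AddCommGroup N] [Module ℂ N] (f : I → HSer N) :
    lpr a (applyY Y u w) f = vpr a u fun i => vpr a w fun i' => lpr a (yAt a Y i i') f := by
  rw [applyY_eq_vpr a, lpr_vpr]
  exact vpr_apply_congr fun i => lpr_vpr _ _ _

variable {a} {S : Op Lau (A ⊗[ℂ] B) (A ⊗[ℂ] B)}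
  {Y₁ : HSer (A ⊗[ℂ] A →ₗ[ℂ] LaurentSeries A)} {Y₂ : HSer (B ⊗[ℂ] B →ₗ[ℂ] LaurentSeries B)}

theorem lpr_twistY_lau (φ : I × J → HSer ℂ) (i i' : I) (j j' : J) :
    (lpr (a.tensorProduct b) (yAt (a.tensorProduct b) (twistY Y₁ Y₂ S) (i, j) (i', j')) φ).map
        Lau.equiv.symm =
      tr a b negHom S (fun i' j => (YYpr a b (yAt a Y₁ i i') (yAt b Y₂ j j')
        fun k l => φ (k, l)).map Lau.equiv.symm) i' j :=
  lpr_twistY (AlgHom.id ℂ Lau) Lau.equiv.symm.toLinearMap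
    (fun r X => by
      refine Lau.equiv.injective ?_
      change cauchy (LinearMap.lsmul ℂ ℂ) (Lau.equiv r) X =
        Lau.equiv (r * Lau.equiv.symm X)
      rw [Lau.mul_def]
      rfl) _ _ _ _ _ _ _ _

theorem map_equiv_injective : Function.Injective
    (fun x : HSer (LaurentSeries ℂ) => x.map Lau.equiv.symm) := fun _ _ h =>
  funext fun t => Lau.equiv.symm.injective (congrFun h t)

theorem vpr_map_equiv (x : HSer A) (f : I → HSer (LaurentSeries ℂ)) :
    (vpr a x f).map Lau.equiv.symm = vpr a x fun i => (f i).map Lau.equiv.symm :=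
  vpr_map Lau.equiv.symm.toLinearMap x f

theorem const_tmul (u : A) (w : B) :
    const (u ⊗ₜ[ℂ] w) = conv (fun a b => a ⊗ₜ[ℂ] b) (const u) (const w) := by
  rw [conv_const_left fun _ => TensorProduct.zero_tmul _ _]
  funext t
  by_cases ht : t = 0 <;> simp [map_apply, const, ht]

theorem vpr_const_tmul {N : Type*} [AddCommGroup N] [Module ℂ N]
    (i : I) (j : J) (f : I × J → HSer N) :
    vpr (a.tensorProduct b) (const (a i ⊗ₜ[ℂ] b j)) f = f (i, j) := by
  rw [const_tmul, vpr_tmul, vpr_const, vpr_const]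

variable {eA : HSer A} {eB : HSer B}

theorem applyY_twistY_vac (h : VacLeft S eA) (i : I) (j : J) :
    applyY (twistY Y₁ Y₂ S) (const (a i ⊗ₜ[ℂ] b j)) (conv (fun a b => a ⊗ₜ[ℂ] b) eA eB) =
      conv (fun x z => laurTensor (x ⊗ₜ[ℂ] z)) (applyY Y₁ (const (a i)) eA)
        (applyY Y₂ (const (b j)) eB) := by
  refine lpr_ext (a := a.tensorProduct b) fun φ => map_equiv_injective ?_
  simp only [lpr_applyY, vpr_const_tmul, vpr_tmul]
  rw [vpr_comm]
  refine (vpr_map Lau.equiv.symm.toLinearMap eB _).trans ?_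
  have h3 : ∀ j', (vpr a eA fun i' => lpr (a.tensorProduct b)
      (yAt (a.tensorProduct b) (twistY Y₁ Y₂ S) (i, j) (i', j')) fun p => const (φ p)).map
        Lau.equiv.symm.toLinearMap =
      vpr a eA fun i' => (YYpr a b (yAt a Y₁ i i') (yAt b Y₂ j j')
        fun k l => const (φ (k, l))).map Lau.equiv.symm := by
    intro j'
    refine (vpr_map Lau.equiv.symm.toLinearMap eA _).trans ?_
    have h4 := h.test (a := a) (b := b) (N := Lau) negHom (fun i' j =>
      (YYpr a b (yAt a Y₁ i i') (yAt b Y₂ j j') fun k l => const (φ (k, l))).map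
        Lau.equiv.symm) j
    refine Eq.trans ?_ h4
    refine congrArg (vpr a eA) (funext fun i' => ?_)
    exact lpr_twistY_lau (fun p => const (φ p)) i i' j j'
  refine (vpr_apply_congr h3).trans ?_
  rw [applyY_eq_vpr a, applyY_eq_vpr b, vpr_const, vpr_const]
  simp only [conv_laurTensor_vpr_left, conv_laurTensor_vpr_right, lpr_vpr]
  simp only [vpr_map_equiv]
  rfl

theorem applyY_twistY_vac_left (h : VacRight S eB) (i' : I) (j' : J) :
    applyY (twistY Y₁ Y₂ S) (conv (fun a b => a ⊗ₜ[ℂ] b) eA eB) (const (a i' ⊗ₜ[ℂ] b j')) =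
      conv (fun x z => laurTensor (x ⊗ₜ[ℂ] z)) (applyY Y₁ eA (const (a i')))
        (applyY Y₂ eB (const (b j'))) := by
  refine lpr_ext (a := a.tensorProduct b) fun φ => map_equiv_injective ?_
  simp only [lpr_applyY, vpr_const_tmul, vpr_tmul]
  refine (vpr_map Lau.equiv.symm.toLinearMap eA _).trans ?_
  have h3 : ∀ i, (vpr b eB fun j => lpr (a.tensorProduct b)
      (yAt (a.tensorProduct b) (twistY Y₁ Y₂ S) (i, j) (i', j')) fun p => const (φ p)).map
        Lau.equiv.symm.toLinearMap =
      vpr b eB fun j => (YYpr a b (yAt a Y₁ i i') (yAt b Y₂ j j')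
        fun k l => const (φ (k, l))).map Lau.equiv.symm := by
    intro i
    refine (vpr_map Lau.equiv.symm.toLinearMap eB _).trans ?_
    have h4 := h.test (a := a) (b := b) (N := Lau) negHom (fun i' j =>
      (YYpr a b (yAt a Y₁ i i') (yAt b Y₂ j j') fun k l => const (φ (k, l))).map
        Lau.equiv.symm) i'
    refine Eq.trans ?_ h4
    refine congrArg (vpr b eB) (funext fun j => ?_)
    exact lpr_twistY_lau (fun p => const (φ p)) i i' j j'
  refine (vpr_apply_congr h3).trans ?_
  rw [applyY_eq_vpr a, applyY_eq_vpr b]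
  simp only [vpr_const, conv_laurTensor_vpr_left, conv_laurTensor_vpr_right, lpr_vpr]
  simp only [vpr_map_equiv]
  exact vpr_comm _ _ _

end ApplyY

section TwistVacuum

variable {A B : Type*} [AddCommGroup A] [Module ℂ A] [AddCommGroup B] [Module ℂ B]
  {I J : Type*} (a : Basis I ℂ A) (b : Basis J ℂ B)

theorem applyY_left (Y : HSer (A ⊗[ℂ] A →ₗ[ℂ] LaurentSeries A)) (u w : HSer A) :
    applyY Y u w = vpr a u fun i => applyY Y (const (a i)) w := by
  simp only [applyY_eq_vpr a, vpr_const]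

theorem applyY_right (Y : HSer (A ⊗[ℂ] A →ₗ[ℂ] LaurentSeries A)) (u w : HSer A) :
    applyY Y u w = vpr a w fun i => applyY Y u (const (a i)) := by
  simp only [applyY_eq_vpr a, vpr_const]
  exact vpr_comm _ _ _

variable {a} {N : Type*} [AddCommGroup N] [Module ℂ N]

theorem vpr_map_coeff (m : ℤ) (x : HSer A) (f : I → HSer (LaurentSeries N)) :
    (vpr a x f).map (fun X => X.coeff m) = vpr a x fun i => (f i).map fun X => X.coeff m :=
  vpr_map (HahnSeries.coeff.linearMap (R := ℂ) m) x f

theorem vpr_zero (x : HSer A) : vpr a x (fun _ => (0 : HSer N)) = 0 := by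
  have : lin a (fun _ => (0 : HSer N)) = 0 := by
    funext t
    refine a.ext fun i => ?_
    rw [lin_basis]
    rfl
  rw [vpr, this]
  funext t
  simp [conv, HSer.zero_apply]

/-- `Y(u, z) 𝟙 ∈ u + z V[[z]]`. -/
structure Creates (Y : HSer (A ⊗[ℂ] A →ₗ[ℂ] LaurentSeries A)) (e : HSer A) : Prop where
  regular : ∀ u, ∀ m < 0, (applyY Y u e).map (fun X => X.coeff m) = 0
  lim : ∀ u, (applyY Y u e).map (fun X => X.coeff 0) = u

/-- `∂ u` as the coefficient of `z` in `Y(u, z) 𝟙`. -/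
def derivOf (Y : HSer (A ⊗[ℂ] A →ₗ[ℂ] LaurentSeries A)) (e : HSer A) : HSer (A →ₗ[ℂ] A) :=
  conv (fun y e => HahnSeries.coeff.linearMap (R := ℂ) (1 : ℤ) ∘ₗ y ∘ₗ
    (TensorProduct.mk ℂ A A).flip e) Y e

theorem derivOf_apply (Y : HSer (A ⊗[ℂ] A →ₗ[ℂ] LaurentSeries A)) (e : HSer A) (u : A) :
    ((derivOf Y e).map fun d => d u) = (applyY Y (const u) e).map fun X => X.coeff 1 := by
  rw [applyY, conv_const_left fun _ => TensorProduct.zero_tmul _ _]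
  funext t
  simp only [map_apply, derivOf, conv_apply, HahnSeries.coeff_sum, LinearMap.sum_apply]
  rfl

variable {S : Op Lau (A ⊗[ℂ] B) (A ⊗[ℂ] B)}
  {Y₁ : HSer (A ⊗[ℂ] A →ₗ[ℂ] LaurentSeries A)} {Y₂ : HSer (B ⊗[ℂ] B →ₗ[ℂ] LaurentSeries B)}
  {eA : HSer A} {eB : HSer B}

theorem Creates.twistY (hA : Creates Y₁ eA) (hB : Creates Y₂ eB) (h : VacLeft S eA) :
    Creates (twistY Y₁ Y₂ S) (conv (fun a b => a ⊗ₜ[ℂ] b) eA eB) := by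
  let a := Basis.ofVectorSpace ℂ A
  let b := Basis.ofVectorSpace ℂ B
  constructor
  · intro u m hm
    rw [applyY_left (a.tensorProduct b), vpr_map_coeff]
    refine Eq.trans (vpr_apply_congr fun p => ?_) (vpr_zero u)
    obtain ⟨i, j⟩ := p
    rw [Module.Basis.tensorProduct_apply, applyY_twistY_vac h,
      conv_laurTensor_coeff (hA.regular _) (hB.regular _), Finset.Icc_eq_empty (by omega)]
    rfl
  · intro u
    rw [applyY_left (a.tensorProduct b), vpr_map_coeff]
    refine Eq.trans (vpr_apply_congr fun p => ?_) (vpr_self u)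
    obtain ⟨i, j⟩ := p
    rw [Module.Basis.tensorProduct_apply, applyY_twistY_vac h,
      conv_laurTensor_coeff (hA.regular _) (hB.regular _), Finset.Icc_self, Finset.sum_singleton,
      hA.lim, sub_zero, hB.lim, const_tmul]

theorem derivOf_twistY (hA : Creates Y₁ eA) (hB : Creates Y₂ eB) (h : VacLeft S eA) :
    derivOf (twistY Y₁ Y₂ S) (conv (fun a b => a ⊗ₜ[ℂ] b) eA eB) =
      derivTensor (derivOf Y₁ eA) (derivOf Y₂ eB) := by
  let a := Basis.ofVectorSpace ℂ A
  let b := Basis.ofVectorSpace ℂ B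
  have key : ∀ i j, ((derivOf (HQVA.twistY Y₁ Y₂ S) (conv (fun a b => a ⊗ₜ[ℂ] b) eA eB)).map
      fun d => d (a i ⊗ₜ b j)) =
      (derivTensor (derivOf Y₁ eA) (derivOf Y₂ eB)).map fun d => d (a i ⊗ₜ b j) := by
    intro i j
    have h2 : Finset.Icc (0 : ℤ) 1 = {0, 1} := rfl
    rw [derivOf_apply, applyY_twistY_vac h, conv_laurTensor_coeff (hA.regular _) (hB.regular _),
      h2, Finset.sum_pair (by norm_num), hA.lim, sub_zero, sub_self, hB.lim,
      ← derivOf_apply, ← derivOf_apply, conv_const_left fun _ => TensorProduct.zero_tmul _ _,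
      conv_const_right fun _ => TensorProduct.tmul_zero _ _, add_comm]
    rfl
  funext t
  exact (a.tensorProduct b).ext fun p => by
    rw [Module.Basis.tensorProduct_apply']
    exact congrFun (key p.1 p.2) t

theorem map_single_coeff_of_ne (x : HSer N) (n : ℤ) (hn : n ≠ 0) :
    (x.map fun x => HahnSeries.single (0 : ℤ) x).map (fun X => X.coeff n) = 0 :=
  funext fun _ => HahnSeries.coeff_single_of_ne hn

theorem map_single_coeff_zero (x : HSer N) :
    (x.map fun x => HahnSeries.single (0 : ℤ) x).map (fun X => X.coeff 0) = x :=
  funext fun _ => HahnSeries.coeff_single_same _ _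

theorem applyY_twistY_left (hA : ∀ v, applyY Y₁ eA v = v.map fun x => HahnSeries.single (0 : ℤ) x)
    (hB : ∀ v, applyY Y₂ eB v = v.map fun x => HahnSeries.single (0 : ℤ) x) (h : VacRight S eB)
    (v : HSer (A ⊗[ℂ] B)) :
    applyY (twistY Y₁ Y₂ S) (conv (fun a b => a ⊗ₜ[ℂ] b) eA eB) v =
      v.map fun x => HahnSeries.single (0 : ℤ) x := by
  let a := Basis.ofVectorSpace ℂ A
  let b := Basis.ofVectorSpace ℂ B
  rw [applyY_right (a.tensorProduct b)]
  have h1 : (v.map fun x => HahnSeries.single (0 : ℤ) x) =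
      vpr (a.tensorProduct b) v fun p =>
        (const (a p.1 ⊗ₜ[ℂ] b p.2)).map fun x => HahnSeries.single (0 : ℤ) x := by
    conv_lhs => rw [← vpr_self (a := a.tensorProduct b) v]
    simp only [Module.Basis.tensorProduct_apply']
    exact vpr_map (HahnSeries.single.linearMap (R := ℂ) (0 : ℤ)) v _
  rw [h1]
  refine vpr_apply_congr fun p => ?_
  rw [Module.Basis.tensorProduct_apply', applyY_twistY_vac_left h, hA, hB]
  refine hser_laurent_ext fun m => ?_
  rw [conv_laurTensor_coeff (fun n hn => map_single_coeff_of_ne _ n hn.ne) (fun n hn => map_single_coeff_of_ne _ n hn.ne)]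
  rcases lt_trichotomy m 0 with hm | rfl | hm
  · rw [Finset.Icc_eq_empty (by omega), map_single_coeff_of_ne _ m hm.ne]
    rfl
  · rw [Finset.Icc_self, Finset.sum_singleton, map_single_coeff_zero, sub_zero, map_single_coeff_zero, map_single_coeff_zero, const_tmul]
  · rw [map_single_coeff_of_ne _ m hm.ne']
    refine Finset.sum_eq_zero fun i _ => ?_
    rcases eq_or_ne i 0 with rfl | hi
    · rw [sub_zero, map_single_coeff_of_ne _ m hm.ne']
      funext t
      simp [conv, HSer.zero_apply]
    · rw [map_single_coeff_of_ne _ i hi]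
      funext t
      simp [conv, HSer.zero_apply]

end TwistVacuum

/-! ### Triples of expansions of functions of two variables -/

instance : NoZeroDivisors Lau := inferInstanceAs (NoZeroDivisors (LaurentSeries ℂ))
instance : NoZeroDivisors Lau₂ := inferInstanceAs (NoZeroDivisors (LaurentSeries Lau))

/-- The variable `z` of `ℂ((z))`. -/
def Lau.X : Lau := Lau.equiv.symm (HahnSeries.single (1 : ℤ) (1 : ℂ))

theorem Lau.coeff_X (n : ℤ) : Lau.X.coeff n = if n = 1 then 1 else 0 := by
  change (HahnSeries.single (1 : ℤ) (1 : ℂ)).coeff n = _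
  rw [HahnSeries.coeff_single]
  split_ifs <;> rfl

theorem Lau.coeff_X_mul (f : Lau) (n : ℤ) : (Lau.X * f).coeff n = f.coeff (n - 1) := by
  have := HahnSeries.coeff_single_mul_add (r := (1 : ℂ)) (x := Lau.equiv f) (a := n - 1) (b := (1 : ℤ))
  rw [sub_add_cancel, one_mul] at this
  exact this

theorem Lau.coeff_X_pow_mul (k : ℕ) (f : Lau) (n : ℤ) :
    (Lau.X ^ k * f).coeff n = f.coeff (n - k) := by
  induction k generalizing n with
  | zero => simp
  | succ k ih =>
    rw [pow_succ', mul_assoc, Lau.coeff_X_mul, ih]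
    congr 1
    push_cast
    ring

theorem Lau₂.coeff_outer_mul (f : Lau₂) (n m : ℤ) :
    (outerHom Lau.X * f).coeff n m = f.coeff (n - 1) m := by
  have h : Lau₂.equiv (outerHom Lau.X) = HahnSeries.single (1 : ℤ) (1 : Lau) := by
    refine HahnSeries.ext (funext fun n => Lau.ext fun m => ?_)
    change (outerHom Lau.X).coeff n m = _
    rw [outerHom_coeff, Lau.coeff_X, HahnSeries.coeff_single]
    by_cases hn : n = 1 <;> by_cases hm : m = 0 <;> simp [hn, hm, lau_one_coeff, Lau.coeff_zero]
  have h2 := HahnSeries.coeff_single_mul_add (r := (1 : Lau)) (x := Lau₂.equiv f) (a := n - 1)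
    (b := (1 : ℤ))
  rw [sub_add_cancel, one_mul] at h2
  change ((Lau₂.equiv (outerHom Lau.X) * Lau₂.equiv f).coeff n).coeff m = _
  rw [h, h2]
  rfl

theorem Lau₂.coeff_inner_mul (f : Lau₂) (n m : ℤ) :
    (innerHom Lau.X * f).coeff n m = f.coeff n (m - 1) := by
  have h2 := HahnSeries.coeff_single_mul_add (r := Lau.X) (x := Lau₂.equiv f) (a := n)
    (b := (0 : ℤ))
  rw [add_zero] at h2
  change (((HahnSeries.single (0 : ℤ) Lau.X) * Lau₂.equiv f).coeff n).coeff m = _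
  rw [h2, Lau.coeff_X_mul]
  rfl

theorem Lau₂.coeff_sub (f g : Lau₂) (n m : ℤ) : (f - g).coeff n m = f.coeff n m - g.coeff n m := rfl

theorem Lau₂.coeff_add (f g : Lau₂) (n m : ℤ) : (f + g).coeff n m = f.coeff n m + g.coeff n m := rfl

theorem Lau₂.coeff_smul (c : ℂ) (f : Lau₂) (n m : ℤ) : (c • f).coeff n m = c * f.coeff n m := rfl

theorem Lau₂.coeff_mul {f g : Lau₂} {L L' : ℤ} (hf : ∀ n < L, ∀ m, f.coeff n m = 0)
    (hg : ∀ n < L', ∀ m, g.coeff n m = 0) {l l' : ℤ → ℤ} (hf' : ∀ n, ∀ m < l n, f.coeff n m = 0)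
    (hg' : ∀ n, ∀ m < l' n, g.coeff n m = 0) (n m : ℤ) :
    (f * g).coeff n m = ∑ b ∈ Finset.Icc L (n - L'), ∑ a ∈ Finset.Icc (l b) (m - l' (n - b)),
      f.coeff b a * g.coeff (n - b) (m - a) := by
  change Lau.coeff ((Lau₂.equiv (f * g)).coeff n) m = _
  rw [Lau₂.coeff_mul_Icc (fun i hi => Lau.ext (hf i hi)) (fun i hi => Lau.ext (hg i hi)),
    Lau.coeff_sum]
  exact Finset.sum_congr rfl fun b _ => Lau.coeff_mul_Icc (hf' b) (hg' (n - b)) m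

/-- Triples of elements of `ℂ((z₁))((z₂))`, `ℂ((z₂))((z₁))` and `ℂ((z))((z₀))`. -/
abbrev Tri : Type := Lau₂ × Lau₂ × Lau₂

/-- The triple consists of the expansions of some `G(z₁, z₂) ∈ ℂ((z₁, z₂))`, with exponents bounded
below by `L`, and of the expansion of `G(z + z₀, z)`. -/
structure Expands (L : ℤ) (e : Tri) : Prop where
  lower_outer : ∀ n < L, ∀ m, e.1.coeff n m = 0
  lower_inner : ∀ n, ∀ m < L, e.1.coeff n m = 0
  swap : ∀ n m, e.2.1.coeff n m = e.1.coeff m n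
  shift : ∀ q p, e.2.2.coeff q p = if 0 ≤ q then
    ∑ a ∈ Finset.Icc L (p + q - L), (Ring.choose a q.toNat : ℤ) * e.1.coeff (p + q - a) a else 0

namespace Expands

variable {L L' : ℤ} {e e' : Tri}

theorem mono (h : Expands L e) (hL : L' ≤ L) : Expands L' e where
  lower_outer n hn m := h.lower_outer n (hn.trans_le hL) m
  lower_inner n m hm := h.lower_inner n m (hm.trans_le hL)
  swap := h.swap
  shift q p := by
    rw [h.shift]
    split_ifs
    · refine Finset.sum_subset (Finset.Icc_subset_Icc hL (by omega)) fun a _ ha => ?_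
      rw [Finset.mem_Icc, not_and_or, not_le, not_le] at ha
      rcases ha with ha | ha
      · rw [h.lower_inner _ _ ha, mul_zero]
      · rw [h.lower_outer _ (by omega), mul_zero]
    · rfl

theorem shift_neg (h : Expands L e) : ∀ q < 0, ∀ p, e.2.2.coeff q p = 0 := fun q hq p => by
  rw [h.shift, if_neg (by omega)]

theorem shift_lower (h : Expands L e) : ∀ q, ∀ p < L + L - q, e.2.2.coeff q p = 0 := fun q p hp => by
  rw [h.shift, Finset.Icc_eq_empty (by omega), Finset.sum_empty, ite_self]

theorem choose_add (a b q : ℤ) (hq : 0 ≤ q) : (Ring.choose (a + b) q.toNat : ℤ) =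
    ∑ i ∈ Finset.Icc 0 q, Ring.choose a i.toNat * Ring.choose b (q - i).toNat := by
  rw [Ring.add_choose_eq _ (Commute.all a b)]
  refine Finset.sum_bij' (fun x _ => (x.1 : ℤ)) (fun i _ => (i.toNat, (q - i).toNat)) ?_ ?_ ?_ ?_ ?_
  · rintro ⟨x, y⟩ h
    simp only [Finset.HasAntidiagonal.mem_antidiagonal] at h
    simp only [Finset.mem_Icc]
    omega
  · intro i h
    simp only [Finset.mem_Icc] at h
    simp only [Finset.HasAntidiagonal.mem_antidiagonal]
    omega
  · rintro ⟨x, y⟩ h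
    simp only [Finset.HasAntidiagonal.mem_antidiagonal] at h
    simp only [Prod.mk.injEq]
    omega
  · intro i h
    simp only [Finset.mem_Icc] at h
    simp only
    omega
  · rintro ⟨x, y⟩ h
    simp only [Finset.HasAntidiagonal.mem_antidiagonal] at h
    have : (q - (x : ℤ)).toNat = y := by omega
    simp [this]

/-- Multiplicativity of `G ↦ G(z + z₀, z)`, by the Vandermonde identity. -/
theorem mul (h : Expands L e) (h' : Expands L e') : Expands (L + L) (e * e') where
  lower_outer n hn m := by
    change (e.1 * e'.1).coeff n m = 0
    rw [Lau₂.coeff_mul h.lower_outer h'.lower_outer h.lower_inner h'.lower_inner,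
      Finset.Icc_eq_empty (by omega), Finset.sum_empty]
  lower_inner n m hm := by
    change (e.1 * e'.1).coeff n m = 0
    rw [Lau₂.coeff_mul h.lower_outer h'.lower_outer h.lower_inner h'.lower_inner]
    refine Finset.sum_eq_zero fun b _ => ?_
    rw [Finset.Icc_eq_empty (by omega), Finset.sum_empty]
  swap n m := by
    change (e.2.1 * e'.2.1).coeff n m = (e.1 * e'.1).coeff m n
    rw [Lau₂.coeff_mul h.lower_outer h'.lower_outer h.lower_inner h'.lower_inner,
      Lau₂.coeff_mul (L := L) (L' := L) (l := fun _ => L) (l' := fun _ => L)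
        (fun n hn m => by rw [h.swap, h.lower_inner _ _ hn])
        (fun n hn m => by rw [h'.swap, h'.lower_inner _ _ hn])
        (fun n m hm => by rw [h.swap, h.lower_outer _ hm])
        (fun n m hm => by rw [h'.swap, h'.lower_outer _ hm]), Finset.sum_comm]
    simp only [h.swap, h'.swap]
  shift q p := by
    change (e.2.2 * e'.2.2).coeff q p = if 0 ≤ q then
      ∑ a ∈ Finset.Icc (L + L) (p + q - (L + L)), (Ring.choose a q.toNat : ℤ) *
        (e.1 * e'.1).coeff (p + q - a) a else 0
    rw [Lau₂.coeff_mul h.shift_neg h'.shift_neg h.shift_lower h'.shift_lower, sub_zero]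
    split_ifs with hq
    swap
    · rw [Finset.Icc_eq_empty (by omega), Finset.sum_empty]
    simp only [Lau₂.coeff_mul h.lower_outer h'.lower_outer h.lower_inner h'.lower_inner]
    have h1 : ∀ c ∈ Finset.Icc (L + L) (p + q - (L + L)),
        ((Ring.choose c q.toNat : ℤ) : ℂ) * ∑ b ∈ Finset.Icc L (p + q - c - L),
          ∑ a ∈ Finset.Icc L (c - L), e.1.coeff b a * e'.1.coeff (p + q - c - b) (c - a) =
        ∑ i ∈ Finset.Icc 0 q, ∑ b ∈ Finset.Icc L (p + q - c - L), ∑ a ∈ Finset.Icc L (c - L),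
          ((Ring.choose a i.toNat : ℤ) * e.1.coeff b a) *
            ((Ring.choose (c - a) (q - i).toNat : ℤ) * e'.1.coeff (p + q - c - b) (c - a)) := by
      intro c _
      rw [Finset.mul_sum]
      refine Eq.trans (Finset.sum_congr rfl fun b _ => ?_) Finset.sum_comm
      rw [Finset.mul_sum]
      refine Eq.trans ?_ Finset.sum_comm
      refine Finset.sum_congr rfl fun a _ => ?_
      have := choose_add a (c - a) q hq
      rw [add_sub_cancel] at this
      rw [this]
      push_cast
      rw [Finset.sum_mul]
      exact Finset.sum_congr rfl fun i _ => by ring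
    rw [Finset.sum_congr rfl h1, Finset.sum_comm]
    refine Finset.sum_congr rfl fun i hi => ?_
    rw [Finset.mem_Icc] at hi
    simp only [h.shift, h'.shift, if_pos hi.1, if_pos (sub_nonneg.2 hi.2), Finset.sum_mul_sum]
    simp only [Finset.sum_sigma']
    refine Finset.sum_bij' (fun x _ => ⟨x.2.1 + x.2.2, ⟨x.1 + i - x.2.1, x.2.1⟩⟩)
      (fun y _ => ⟨y.2.1 + y.2.2 - i, ⟨y.2.2, y.1 - y.2.2⟩⟩) ?_ ?_ ?_ ?_ ?_
    · rintro ⟨p₁, a, a'⟩ hx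
      simp only [Finset.mem_sigma, Finset.mem_Icc] at hx ⊢
      omega
    · rintro ⟨c, b, a⟩ hx
      simp only [Finset.mem_sigma, Finset.mem_Icc] at hx ⊢
      omega
    · rintro ⟨p₁, a, a'⟩ -
      change (⟨p₁ + i - a + a - i, a, a + a' - a⟩ : (_ : ℤ) × (_ : ℤ) × ℤ) = ⟨p₁, a, a'⟩
      rw [show p₁ + i - a + a - i = p₁ by ring, show a + a' - a = a' by ring]
    · rintro ⟨c, b, a⟩ -
      change (⟨a + (c - a), b + a - i + i - a, a⟩ : (_ : ℤ) × (_ : ℤ) × ℤ) = ⟨c, b, a⟩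
      rw [show b + a - i + i - a = b by ring, show a + (c - a) = c by ring]
    · rintro ⟨p₁, a, a'⟩ hx
      simp only
      rw [show p - p₁ + (q - i) - a' = p + q - (a + a') - (p₁ + i - a) by ring,
        show a + a' - a = a' by ring]

theorem add (h : Expands L e) (h' : Expands L e') : Expands L (e + e') where
  lower_outer n hn m := by
    change e.1.coeff n m + e'.1.coeff n m = 0
    rw [h.lower_outer n hn, h'.lower_outer n hn, add_zero]
  lower_inner n m hm := by
    change e.1.coeff n m + e'.1.coeff n m = 0
    rw [h.lower_inner n m hm, h'.lower_inner n m hm, add_zero]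
  swap n m := congrArg₂ (· + ·) (h.swap n m) (h'.swap n m)
  shift q p := by
    change e.2.2.coeff q p + e'.2.2.coeff q p = _
    rw [h.shift, h'.shift]
    split_ifs
    · rw [← Finset.sum_add_distrib]
      exact Finset.sum_congr rfl fun a _ => (mul_add _ _ _).symm
    · rw [add_zero]

theorem unique (h : Expands L e) (h' : Expands L' e') (h1 : e.1 = e'.1) : e = e' := by
  have g := h.mono (min_le_left L L')
  have g' := h'.mono (min_le_right L L')
  refine Prod.ext h1 (Prod.ext (Lau₂.ext fun n m => ?_) (Lau₂.ext fun n m => ?_))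
  · rw [g.swap, g'.swap, h1]
  · rw [g.shift, g'.shift, h1]

end Expands

/-- `f(z) ↦ f(z₁)`. -/
def triFst : Lau →ₐ[ℂ] Tri := innerHom.prod (outerHom.prod (addHom 1))

/-- `f(z) ↦ f(z₂)`. -/
def triSnd : Lau →ₐ[ℂ] Tri := outerHom.prod (innerHom.prod innerHom)

/-- `f(z) ↦ f(z₂ - z₁)`. -/
def triDiff : Lau →ₐ[ℂ] Tri :=
  (inNegHom.comp (addHom 1)).prod ((addHom (-1)).prod (outerHom.comp negHom))

theorem expands_triFst (f : Lau) : ∃ L, Expands L (triFst f) := by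
  obtain ⟨L', hL'⟩ := f.exists_bound
  obtain ⟨L, hL0, hL⟩ : ∃ L ≤ 0, ∀ i < L, f.coeff i = 0 :=
    ⟨min L' 0, min_le_right _ _, fun i hi => hL' i (hi.trans_le (min_le_left _ _))⟩
  refine ⟨L, fun n hn m => ?_, fun n m hm => ?_, fun n m => ?_, fun q p => ?_⟩
  · exact (innerHom_coeff f n m).trans (if_neg (by omega))
  · refine (innerHom_coeff f n m).trans ?_
    rw [hL m hm, ite_self]
  · exact (outerHom_coeff f n m).trans (innerHom_coeff f m n).symm
  · refine (addHom_coeff 1 f q p).trans ?_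
    change _ = if 0 ≤ q then ∑ a ∈ Finset.Icc L (p + q - L), ((Ring.choose a q.toNat : ℤ) : ℂ) *
      (innerHom f).coeff (p + q - a) a else 0
    simp only [innerHom_coeff]
    split_ifs
    · rw [one_pow, one_mul]
      rcases lt_or_ge (p + q) L with h | h
      · rw [hL _ h, mul_zero]
        exact (Finset.sum_eq_zero fun a ha => by
          rw [Finset.mem_Icc] at ha
          rw [if_neg (by omega), mul_zero]).symm
      · rw [Finset.sum_eq_single (p + q)]
        · rw [if_pos (by ring)]
        · intro a _ ha
          rw [if_neg (by omega), mul_zero]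
        · intro h'
          rw [Finset.mem_Icc] at h'
          omega
    · rfl

theorem choose_zero_left (n : ℕ) : (Ring.choose (0 : ℤ) n : ℤ) = if n = 0 then 1 else 0 := by
  rcases n with _ | n
  · simp
  · rw [Ring.choose_zero_succ, if_neg (Nat.succ_ne_zero n)]

theorem expands_triSnd (f : Lau) : ∃ L, Expands L (triSnd f) := by
  obtain ⟨L', hL'⟩ := f.exists_bound
  obtain ⟨L, hL0, hL⟩ : ∃ L ≤ 0, ∀ i < L, f.coeff i = 0 :=
    ⟨min L' 0, min_le_right _ _, fun i hi => hL' i (hi.trans_le (min_le_left _ _))⟩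
  refine ⟨L, fun n hn m => ?_, fun n m hm => ?_, fun n m => ?_, fun q p => ?_⟩
  · refine (outerHom_coeff f n m).trans ?_
    rw [hL n hn, ite_self]
  · exact (outerHom_coeff f n m).trans (if_neg (by omega))
  · exact (innerHom_coeff f n m).trans (outerHom_coeff f m n).symm
  · refine (innerHom_coeff f q p).trans ?_
    change _ = if 0 ≤ q then ∑ a ∈ Finset.Icc L (p + q - L), ((Ring.choose a q.toNat : ℤ) : ℂ) *
      (outerHom f).coeff (p + q - a) a else 0
    simp only [outerHom_coeff]
    rcases lt_or_ge (p + q) L with h | h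
    · rw [Finset.sum_eq_zero fun a ha => ?_, ite_self]
      · split_ifs with hq
        · rw [hL p (by omega)]
        · rfl
      · rw [Finset.mem_Icc] at ha
        split_ifs with h0
        · rw [hL _ (by omega), mul_zero]
        · rw [mul_zero]
    · rw [Finset.sum_eq_single 0]
      · rw [if_pos rfl, choose_zero_left]
        by_cases hq : q = 0
        · subst hq
          simp
        · by_cases hq' : 0 ≤ q
          · have : q.toNat ≠ 0 := by omega
            simp [hq, this]
          · simp [hq, hq']
      · intro a _ ha
        rw [if_neg ha, mul_zero]
      · intro h'
        rw [Finset.mem_Icc] at h'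
        split_ifs
        · rw [hL _ (by omega), mul_zero]
        · omega

/-- The triples of expansions of the elements of `ℂ((z₁, z₂))`. -/
def expansions : Subalgebra ℂ Tri where
  carrier := {e | ∃ L, Expands L e}
  mul_mem' := by
    rintro e e' ⟨L, h⟩ ⟨L', h'⟩
    exact ⟨_, (h.mono (min_le_left L L')).mul (h'.mono (min_le_right L L'))⟩
  add_mem' := by
    rintro e e' ⟨L, h⟩ ⟨L', h'⟩
    exact ⟨_, (h.mono (min_le_left L L')).add (h'.mono (min_le_right L L'))⟩
  algebraMap_mem' c := by
    rw [← triFst.commutes c]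
    exact expands_triFst _

theorem triFst_mem (f : Lau) : triFst f ∈ expansions := expands_triFst f

theorem triSnd_mem (f : Lau) : triSnd f ∈ expansions := expands_triSnd f

/-- The triple of expansions of `z₁ - z₂`. -/
def triSub : Tri := triFst Lau.X - triSnd Lau.X

theorem triSub_mem : triSub ∈ expansions := sub_mem (triFst_mem _) (triSnd_mem _)

theorem addHom_X (c : ℂ) : addHom c Lau.X = innerHom Lau.X + c • outerHom Lau.X := by
  refine Lau₂.ext fun n m => ?_
  rw [addHom_coeff, Lau₂.coeff_add, Lau₂.coeff_smul, innerHom_coeff, outerHom_coeff, Lau.coeff_X,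
    Lau.coeff_X, Lau.coeff_X]
  rcases lt_trichotomy n 0 with hn | rfl | hn
  · have h1 : ¬ 0 ≤ n := by omega
    have h2 : n ≠ 0 := by omega
    have h3 : n ≠ 1 := by omega
    simp [h1, h2, h3]
  · simp
  · have h2 : n ≠ 0 := by omega
    rw [if_pos hn.le, if_neg h2, zero_add]
    by_cases h1 : m + n = 1
    · rw [if_pos h1, h1, mul_one]
      have : Ring.choose (1 : ℤ) n.toNat = if n = 1 then 1 else 0 := by
        have := Ring.choose_natCast (R := ℤ) 1 n.toNat
        rw [Nat.cast_one] at this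
        rw [this]
        split_ifs with h
        · subst h; rfl
        · rw [Nat.choose_eq_zero_of_lt (by omega)]
          rfl
      rw [this]
      by_cases h : n = 1
      · subst h
        have : m = 0 := by omega
        simp [this]
      · have : m ≠ 0 := by omega
        simp [h, this]
    · rw [if_neg h1]
      by_cases h : m = 0
      · have : n ≠ 1 := by omega
        simp [h, this]
      · simp [h]

theorem triSub_eq : triSub = (innerHom Lau.X - outerHom Lau.X, outerHom Lau.X - innerHom Lau.X,
    outerHom Lau.X) := by
  refine Prod.ext rfl (Prod.ext rfl ?_)
  change addHom 1 Lau.X - innerHom Lau.X = _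
  rw [addHom_X, one_smul]
  exact add_sub_cancel_left _ _

theorem triSub_mul_fst (e : Tri) (n m : ℤ) :
    (triSub * e).1.coeff n m = e.1.coeff n (m - 1) - e.1.coeff (n - 1) m := by
  rw [triSub_eq]
  change ((innerHom Lau.X - outerHom Lau.X) * e.1).coeff n m = _
  rw [sub_mul, Lau₂.coeff_sub, Lau₂.coeff_inner_mul, Lau₂.coeff_outer_mul]

theorem triSub_mul_snd (e : Tri) (n m : ℤ) :
    (triSub * e).2.1.coeff n m = e.2.1.coeff (n - 1) m - e.2.1.coeff n (m - 1) := by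
  rw [triSub_eq]
  change ((outerHom Lau.X - innerHom Lau.X) * e.2.1).coeff n m = _
  rw [sub_mul, Lau₂.coeff_sub, Lau₂.coeff_inner_mul, Lau₂.coeff_outer_mul]

theorem triSub_mul_thd (e : Tri) (q p : ℤ) :
    (triSub * e).2.2.coeff q p = e.2.2.coeff (q - 1) p := by
  rw [triSub_eq]
  exact Lau₂.coeff_outer_mul _ _ _

theorem triSub_pow_mul_thd (k : ℕ) (e : Tri) (q p : ℤ) :
    (triSub ^ k * e).2.2.coeff q p = e.2.2.coeff (q - k) p := by
  induction k generalizing q with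
  | zero => simp
  | succ k ih =>
    rw [pow_succ', mul_assoc, triSub_mul_thd, ih]
    congr 1
    push_cast
    ring

theorem innerHom_X_coeff (n m : ℤ) :
    (innerHom Lau.X).coeff n m = if n = 0 ∧ m = 1 then 1 else 0 := by
  rw [innerHom_coeff, Lau.coeff_X]
  by_cases hn : n = 0 <;> simp [hn]

theorem outerHom_X_coeff (n m : ℤ) :
    (outerHom Lau.X).coeff n m = if n = 1 ∧ m = 0 then 1 else 0 := by
  rw [outerHom_coeff, Lau.coeff_X]
  by_cases hn : n = 1 <;> simp [hn]

theorem triSub_mul_cancel {e e' : Tri} (h : triSub * e = triSub * e') : e = e' := by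
  have key : ∀ x y y' : Lau₂, (∃ n m, x.coeff n m ≠ 0) → x * y = x * y' → y = y' := by
    intro x y y' ⟨n, m, hx⟩ hxy
    have h0 : x * (y - y') = 0 := by rw [mul_sub, hxy, sub_self]
    rcases mul_eq_zero.1 h0 with h1 | h1
    · exact absurd (by rw [h1]; rfl) hx
    · exact sub_eq_zero.1 h1
  rw [triSub_eq] at h
  refine Prod.ext (key _ _ _ ⟨1, 0, ?_⟩ (congrArg Prod.fst h))
    (Prod.ext (key _ _ _ ⟨1, 0, ?_⟩ (congrArg (fun x => x.2.1) h))
      (key _ _ _ ⟨1, 0, ?_⟩ (congrArg (fun x => x.2.2) h)))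
  all_goals simp [Lau₂.coeff_sub, innerHom_X_coeff, outerHom_X_coeff]

/-- The triples of expansions of the elements of `ℂ((z₁, z₂))[(z₁ - z₂)⁻¹]`. -/
def mero : Subalgebra ℂ Tri where
  carrier := {e | ∃ k : ℕ, triSub ^ k * e ∈ expansions}
  mul_mem' := by
    rintro e e' ⟨k, h⟩ ⟨k', h'⟩
    refine ⟨k + k', ?_⟩
    rw [pow_add, mul_mul_mul_comm]
    exact mul_mem h h'
  add_mem' := by
    rintro e e' ⟨k, h⟩ ⟨k', h'⟩
    refine ⟨k + k', ?_⟩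
    rw [mul_add]
    refine add_mem ?_ ?_
    · rw [pow_add, mul_right_comm]
      exact mul_mem h (pow_mem triSub_mem _)
    · rw [pow_add, mul_assoc]
      exact mul_mem (pow_mem triSub_mem _) h'
  algebraMap_mem' c := ⟨0, by
    rw [pow_zero, one_mul]
    exact expansions.algebraMap_mem c⟩

theorem expansions_le_mero : expansions ≤ mero := fun e he => ⟨0, by rwa [pow_zero, one_mul]⟩

theorem sum_choose_mul_neg_one_pow (N q : ℕ) : ∑ a ∈ Finset.range (N + 1),
    (-1 : ℂ) ^ (N - a) * (a.choose q * N.choose (N - a)) = if N = q then 1 else 0 := by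
  rcases lt_or_ge N q with h | h
  · rw [if_neg h.ne]
    refine Finset.sum_eq_zero fun a ha => ?_
    rw [Finset.mem_range] at ha
    rw [Nat.choose_eq_zero_of_lt (by omega : a < q)]
    simp
  obtain ⟨d, rfl⟩ := Nat.exists_eq_add_of_le h
  have h1 : ∑ a ∈ Finset.range (q + d + 1), (-1 : ℂ) ^ (q + d - a) *
      (a.choose q * (q + d).choose (q + d - a)) =
      ∑ b ∈ Finset.range (d + 1), (-1 : ℂ) ^ (d - b) * ((q + b).choose q * (q + d).choose (d - b)) := by
    rw [add_assoc, Finset.sum_range_add, Finset.sum_eq_zero, zero_add]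
    · refine Finset.sum_congr rfl fun b _ => ?_
      rw [Nat.add_sub_add_left]
    · intro a ha
      rw [Nat.choose_eq_zero_of_lt (Finset.mem_range.1 ha)]
      simp
  rw [h1]
  have h2 : ∀ b ∈ Finset.range (d + 1), (-1 : ℂ) ^ (d - b) *
      ((q + b).choose q * (q + d).choose (d - b)) =
      ((q + d).choose q : ℂ) * ((-1 : ℂ) ^ (d - b) * d.choose (d - b)) := by
    intro b hb
    have hb' : b ≤ d := Nat.lt_succ_iff.1 (Finset.mem_range.1 hb)
    have h3 := Nat.choose_mul (n := q + d) (k := q + b) (s := q) (by omega)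
    rw [← Nat.choose_symm (by omega : q + b ≤ q + d), Nat.add_sub_add_left, Nat.add_sub_cancel_left,
      Nat.add_sub_cancel_left, ← Nat.choose_symm hb'] at h3
    have h4 : ((q + d).choose (d - b) : ℂ) * (q + b).choose q = (q + d).choose q * d.choose (d - b) := by
      exact_mod_cast h3
    linear_combination (-1 : ℂ) ^ (d - b) * h4
  rw [Finset.sum_congr rfl h2, ← Finset.mul_sum,
    Finset.sum_range_reflect (fun b => (-1 : ℂ) ^ b * d.choose b) (d + 1) |>.symm.trans
      (Finset.sum_congr rfl fun b _ => by simp) |>.symm]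
  have h5 : (∑ b ∈ Finset.range (d + 1), (-1 : ℂ) ^ b * d.choose b) = if d = 0 then 1 else 0 := by
    exact_mod_cast Int.alternating_sum_range_choose (n := d)
  rw [h5]
  by_cases hd : d = 0
  · simp [hd]
  · simp [hd]

theorem choose_of_neg {m n : ℤ} (hm : m < 0) (h : 0 ≤ m + n) :
    (Ring.choose (m + n) n.toNat : ℤ) = 0 := by
  obtain ⟨N, hN⟩ := Int.eq_ofNat_of_zero_le h
  rw [hN]
  rw [Ring.choose_natCast, Nat.choose_eq_zero_of_lt (by omega)]
  rfl

theorem choose_toNat {m n : ℤ} (h : 0 ≤ m) :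
    (Ring.choose m n.toNat : ℤ) = (m.toNat.choose n.toNat : ℕ) := by
  conv_lhs => rw [← Int.toNat_of_nonneg h]
  rw [Ring.choose_natCast]

theorem addHom_coeff_of_regular (c : ℂ) {f : Lau} (hf : ∀ n < 0, f.coeff n = 0) (n m : ℤ) :
    (addHom c f).coeff n m = if 0 ≤ n ∧ 0 ≤ m then
      c ^ n.toNat * (((m + n).toNat.choose n.toNat : ℕ) * f.coeff (m + n)) else 0 := by
  rw [addHom_coeff]
  by_cases hn : 0 ≤ n
  · rw [if_pos hn]
    by_cases hm : 0 ≤ m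
    · rw [if_pos ⟨hn, hm⟩, choose_toNat (by omega)]
      push_cast
      rfl
    · rw [if_neg (by tauto)]
      rcases lt_or_ge (m + n) 0 with h | h
      · rw [hf _ h, mul_zero, mul_zero]
      · rw [choose_of_neg (by omega) h]
        simp
  · rw [if_neg hn, if_neg (by tauto)]

theorem expands_triDiff {f : Lau} (hf : ∀ n < 0, f.coeff n = 0) : Expands 0 (triDiff f) := by
  have hc : ∀ n m, (triDiff f).1.coeff n m = if 0 ≤ n ∧ 0 ≤ m then
      (-1) ^ m.toNat * (((m + n).toNat.choose n.toNat : ℕ) * f.coeff (m + n)) else 0 := by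
    intro n m
    change (inNegHom (addHom 1 f)).coeff n m = _
    rw [inNegHom_coeff, addHom_coeff_of_regular _ hf, one_pow, one_mul]
    split_ifs with h
    · rw [neg_one_zpow_of_nonneg h.2]
    · rw [mul_zero]
  refine ⟨fun n hn m => ?_, fun n m hm => ?_, fun n m => ?_, fun q p => ?_⟩
  · rw [hc, if_neg (by omega)]
  · rw [hc, if_neg (by omega)]
  · rw [hc]
    change (addHom (-1) f).coeff n m = _
    rw [addHom_coeff_of_regular _ hf, add_comm n m]
    by_cases h : 0 ≤ n ∧ 0 ≤ m
    · rw [if_pos h, if_pos h.symm,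
        Nat.choose_symm_of_eq_add (by omega : (m + n).toNat = n.toNat + m.toNat)]
    · rw [if_neg h, if_neg fun h' => h h'.symm]
  · change (outerHom (negHom f)).coeff q p = _
    rw [outerHom_coeff, negHom_coeff, sub_zero]
    by_cases hq : 0 ≤ q
    swap
    · rw [if_neg hq, hf q (by omega), mul_zero, ite_self]
    rw [if_pos hq]
    rcases lt_or_ge (p + q) 0 with hN | hN
    · rw [Finset.Icc_eq_empty (by omega), Finset.sum_empty, if_neg (by omega)]
    obtain ⟨N, hN'⟩ := Int.eq_ofNat_of_zero_le hN
    obtain ⟨q', rfl⟩ := Int.eq_ofNat_of_zero_le hq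
    have h1 : ∑ a ∈ Finset.Icc 0 (p + q'), ((Ring.choose a (q' : ℤ).toNat : ℤ) : ℂ) *
        (triDiff f).1.coeff (p + q' - a) a = ∑ a ∈ Finset.range (N + 1),
          (-1) ^ N * f.coeff N * ((-1 : ℂ) ^ (N - a) * (a.choose q' * N.choose (N - a))) := by
      rw [hN']
      refine Finset.sum_bij' (fun a _ => a.toNat) (fun a _ => (a : ℤ)) ?_ ?_ ?_ ?_ ?_
      · intro a ha
        rw [Finset.mem_Icc] at ha
        rw [Finset.mem_range]
        omega
      · intro a ha
        rw [Finset.mem_range] at ha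
        rw [Finset.mem_Icc]
        omega
      · intro a ha
        rw [Finset.mem_Icc] at ha
        omega
      · intro a _
        simp
      · intro a ha
        rw [Finset.mem_Icc] at ha
        obtain ⟨a, rfl⟩ := Int.eq_ofNat_of_zero_le ha.1
        rw [hc, if_pos ⟨by omega, ha.1⟩, choose_toNat ha.1]
        have h2 : (a + (N - a : ℤ)).toNat = N := by omega
        have h3 : ((N : ℤ) - a).toNat = N - a := by omega
        have h4 : (-1 : ℂ) ^ N * (-1) ^ (N - a) = (-1) ^ a := by
          have : (-1 : ℂ) ^ N = (-1) ^ a * (-1) ^ (N - a) := by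
            rw [← pow_add]
            congr 1
            omega
          rw [this, mul_assoc, ← mul_pow]
          simp
        have h5 : (a : ℤ) + (N - a) = N := by ring
        rw [h2, h3, h5]
        simp only [Int.toNat_natCast, Int.cast_natCast]
        linear_combination -((a.choose q' : ℂ) * N.choose (N - a) * f.coeff N) * h4
    rw [h1, ← Finset.mul_sum, sum_choose_mul_neg_one_pow]
    by_cases hp : p = 0
    · have : N = q' := by omega
      rw [if_pos hp, if_pos this, this, mul_one, zpow_natCast]
    · rw [if_neg hp, if_neg (by omega), mul_zero]

theorem triDiff_mem (f : Lau) : triDiff f ∈ mero := by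
  obtain ⟨L, hL⟩ := f.exists_bound
  refine ⟨(-L).toNat, ?_⟩
  have hX : triDiff Lau.X = - triSub := by
    rw [triSub_eq]
    refine Prod.ext ?_ (Prod.ext ?_ ?_)
    · change inNegHom (addHom 1 Lau.X) = -(innerHom Lau.X - outerHom Lau.X)
      refine Lau₂.ext fun n m => ?_
      rw [inNegHom_coeff, addHom_X, one_smul, neg_sub, Lau₂.coeff_sub, Lau₂.coeff_add,
        innerHom_X_coeff, outerHom_X_coeff]
      by_cases h1 : m = 1
      · by_cases hn : n = 0 <;> simp [h1, hn]
      · by_cases h0 : m = 0 <;> simp [h1, h0]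
    · change addHom (-1) Lau.X = -(outerHom Lau.X - innerHom Lau.X)
      rw [addHom_X, neg_one_smul, neg_sub, sub_eq_add_neg]
    · change outerHom (negHom Lau.X) = - outerHom Lau.X
      have : negHom Lau.X = - Lau.X := by
        refine Lau.ext fun n => ?_
        rw [negHom_coeff]
        change _ = - Lau.X.coeff n
        rw [Lau.coeff_X]
        by_cases h : n = 1 <;> simp [h]
      rw [this, map_neg]
  have h1 : triSub ^ (-L).toNat * triDiff f =
      (-1) ^ (-L).toNat * triDiff (Lau.X ^ (-L).toNat * f) := by
    rw [map_mul, map_pow, hX, ← mul_assoc, ← mul_pow, neg_one_mul, neg_neg]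
  rw [h1]
  refine mul_mem (pow_mem (neg_mem (one_mem _)) _) ⟨0, expands_triDiff fun n hn => ?_⟩
  rw [Lau.coeff_X_pow_mul, hL _ (by omega)]

/-- The element of `ℂ((x))((y))` with given coefficients. -/
def Lau₂.ofCoeff (G : ℤ → ℤ → ℂ) (L : ℤ) (l : ℤ → ℤ) (hG : ∀ n < L, ∀ m, G n m = 0)
    (hG' : ∀ n, ∀ m < l n, G n m = 0) : Lau₂ :=
  Lau₂.equiv.symm (HahnSeries.ofSuppBddBelow (fun n : ℤ => (Lau.equiv.symm
    (HahnSeries.ofSuppBddBelow (G n) ⟨l n, fun m hm => by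
      by_contra hlt
      exact hm (hG' n m (not_le.1 hlt))⟩) : Lau)) ⟨L, fun n hn => by
      by_contra hlt
      exact hn (Lau.ext (hG n (not_le.1 hlt)))⟩)

theorem exists_expands (G : ℤ → ℤ → ℂ) (L : ℤ) (hG : ∀ n < L, ∀ m, G n m = 0)
    (hG' : ∀ n, ∀ m < L, G n m = 0) : ∃ e, Expands L e ∧ ∀ n m, e.1.coeff n m = G n m := by
  refine ⟨(Lau₂.ofCoeff G L (fun _ => L) hG hG',
    Lau₂.ofCoeff (fun n m => G m n) L (fun _ => L) (fun n hn m => hG' m n hn) (fun n m hm => hG m hm n),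
    Lau₂.ofCoeff (fun q p => if 0 ≤ q then ∑ a ∈ Finset.Icc L (p + q - L),
      (Ring.choose a q.toNat : ℤ) * G (p + q - a) a else 0) 0 (fun q => L + L - q)
      (fun q hq p => if_neg (by omega)) (fun q p hp => ?_)), ⟨hG, hG', fun _ _ => rfl, fun _ _ => rfl⟩,
      fun _ _ => rfl⟩
  rw [Finset.Icc_eq_empty (by omega), Finset.sum_empty, ite_self]

/-- If `G(z, z) = 0`, then `G(z₁, z₂)` is divisible by `z₁ - z₂`. -/
theorem exists_triSub_mul {e : Tri} (he : e ∈ expansions) (h0 : ∀ p, e.2.2.coeff 0 p = 0) :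
    ∃ e' ∈ expansions, triSub * e' = e := by
  obtain ⟨L, h⟩ := he
  obtain ⟨e', h', hc⟩ := exists_expands
    (fun n m => - ∑ a ∈ Finset.Icc L m, e.1.coeff (n + m + 1 - a) a) L
    (fun n hn m => by
      have h1 := h0 (n + m + 1)
      rw [h.shift, if_pos le_rfl] at h1
      rw [neg_eq_zero, ← h1]
      refine (Finset.sum_subset (Finset.Icc_subset_Icc le_rfl (by omega)) fun a ha ha' => ?_).symm.trans
        (Finset.sum_congr rfl fun a _ => ?_)
      · rw [Finset.mem_Icc] at ha ha'
        exact h.lower_outer _ (by omega) _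
      · rw [Int.toNat_zero, Ring.choose_zero_right]
        simp)
    (fun n m hm => by rw [Finset.Icc_eq_empty (by omega), Finset.sum_empty, neg_zero])
  refine ⟨e', ⟨L, h'⟩, ?_⟩
  obtain ⟨L', h''⟩ := mul_mem triSub_mem (⟨L, h'⟩ : e' ∈ expansions)
  refine h''.unique h (Lau₂.ext fun n m => ?_)
  rw [triSub_mul_fst, hc, hc]
  rw [show n + (m - 1) + 1 = n + m by ring, show n - 1 + m + 1 = n + m by ring]
  rcases lt_or_ge m L with hm | hm
  · rw [Finset.Icc_eq_empty (by omega), Finset.Icc_eq_empty (by omega), h.lower_inner _ _ hm]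
    simp
  · have : Finset.Icc L m = insert m (Finset.Icc L (m - 1)) := by
      ext a
      simp only [Finset.mem_insert, Finset.mem_Icc]
      omega
    rw [this, Finset.sum_insert (by simp), add_sub_cancel_right]
    ring

/-- The order of the pole along `z₁ = z₂` can be read off the third expansion. -/
theorem triSub_pow_mul_mem {e : Tri} (he : e ∈ mero) (k : ℕ)
    (hk : ∀ q < -(k : ℤ), ∀ p, e.2.2.coeff q p = 0) : triSub ^ k * e ∈ expansions := by
  have key : ∀ j : ℕ, triSub ^ (k + j) * e ∈ expansions → triSub ^ k * e ∈ expansions := by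
    intro j
    induction j with
    | zero => exact id
    | succ j ih =>
      intro h
      obtain ⟨e', he', h'⟩ := exists_triSub_mul h fun p => by
        rw [triSub_pow_mul_thd]
        exact hk _ (by push_cast; omega) p
      rw [← add_assoc, pow_succ', mul_assoc] at h'
      exact ih (by rwa [← triSub_mul_cancel h'])
  obtain ⟨K, hK⟩ := he
  refine key K ?_
  rw [pow_add, mul_assoc]
  exact mul_mem (pow_mem triSub_mem _) hK

/-! ### Correlators of a twisted tensor product -/

section Semilinear

variable {A B : Type*} [AddCommGroup A] [Module ℂ A] [AddCommGroup B] [Module ℂ B]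
  {I J : Type*} {a : Basis I ℂ A} {b : Basis J ℂ B}
  {R R' : Type} [CommRing R] [Algebra ℂ R] [CommRing R'] [Algebra ℂ R']
  {N N' : Type*} [AddCommGroup N] [Module ℂ N] [Module R N] [IsScalarTower ℂ R N]
  [AddCommGroup N'] [Module ℂ N'] [Module R' N'] [IsScalarTower ℂ R' N']
  (S : Op Lau (A ⊗[ℂ] B) (A ⊗[ℂ] B)) (f : I → J → HSer N) (i : I) (j : J)

theorem tr_semilinear (g : N →ₗ[ℂ] N') {φ : Lau →ₐ[ℂ] R} {ψ : Lau →ₐ[ℂ] R'}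
    (hg : ∀ r n, g (φ r • n) = ψ r • g n) :
    (tr a b φ S f i j).map g = tr a b ψ S (fun i j => (f i j).map g) i j := by
  have hl : lin (a.tensorProduct b) (fun p => (f p.1 p.2).map g) =
      (lin (a.tensorProduct b) fun p => f p.1 p.2).map fun h => g ∘ₗ h := by
    funext t
    refine (a.tensorProduct b).ext fun j => ?_
    simp [lin_basis, map_apply]
  unfold tr Op.act2 Op.act pr
  rw [hl, map_conv]
  refine conv_congr fun m n => ?_
  simp only [map_apply, Op.mapScalars, LinearMap.comp_apply]
  generalize (S m) _ = y
  induction y with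
  | zero => simp
  | add x y hx hy => simp only [map_add, hx, hy]
  | tmul r x => simp [hg]

theorem lin_mem (F : Submodule ℂ N) {f : I → HSer N} (hf : ∀ i t, f i t ∈ F) (t : ℕ) (x : A) :
    lin a f t x ∈ F := by
  have : lin a f t x = Finsupp.linearCombination ℂ (fun i => f i t) (a.repr x) := by
    conv_lhs => rw [← a.linearCombination_repr x]
    rw [Finsupp.apply_linearCombination]
    exact congrArg (fun g => Finsupp.linearCombination ℂ g (a.repr x))
      (funext fun i => lin_basis _ f t i)
  rw [this, Finsupp.linearCombination_apply]
  exact Submodule.sum_mem _ fun i _ => F.smul_mem _ (hf i t)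

theorem vpr_mem (F : Submodule ℂ N) {f : I → HSer N} (hf : ∀ i t, f i t ∈ F) (x : HSer A) (t : ℕ) :
    vpr a x f t ∈ F := by
  rw [vpr, conv_apply]
  exact Submodule.sum_mem _ fun _ _ => lin_mem F hf _ _

variable {f} in
theorem tr_mem (F : Submodule ℂ N) {φ : Lau →ₐ[ℂ] R} (hF : ∀ r, ∀ n ∈ F, φ r • n ∈ F)
    (hf : ∀ i j t, f i j t ∈ F) (t : ℕ) : tr a b φ S f i j t ∈ F := by
  unfold tr Op.act2 Op.act pr
  rw [conv_apply]
  refine Submodule.sum_mem _ fun p _ => ?_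
  simp only [map_apply, Op.mapScalars, LinearMap.comp_apply]
  generalize (S p.1) _ = y
  induction y with
  | zero => simp only [map_zero]; exact F.zero_mem
  | add x y hx hy => simp only [map_add]; exact F.add_mem hx hy
  | tmul r x =>
    rw [LinearMap.rTensor_tmul, LinearMap.liftBaseChange_tmul]
    have h := lin_mem (a := a.tensorProduct b) (f := fun q => f q.1 q.2) F
      (fun q t => hf q.1 q.2 t) p.2 x
    exact hF r _ h

end Semilinear

section Correlators

variable {A B : Type*} [AddCommGroup A] [Module ℂ A] [AddCommGroup B] [Module ℂ B]
  {I J : Type*} (a : Basis I ℂ A) {b : Basis J ℂ B}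

/-- The matrix coefficient of `Y(u, z₁) Y(v, z₂) w` with respect to a functional `φ`, for vectors
`u`, `v`, `w` of the basis, as an element of `ℂ((z₁))((z₂))[[ħ]]`. -/
def corr (Y : HSer (A ⊗[ℂ] A →ₗ[ℂ] LaurentSeries A)) (φ : I → ℂ) (i i' i'' : I) :
    HSer (LaurentSeries Lau) :=
  lpr a (yAt a Y i' i'') fun k => (lpr a (yAt a Y i k) fun l => const (φ l)).map Lau.equiv.symm

/-- The matrix coefficient of `Y(z₂)(1 ⊗ Y(z₁)) S(z₂ - z₁)(v ⊗ u ⊗ w)`, as an element of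
`ℂ((z₂))((z₁))[[ħ]]`. -/
def corrOpp (Y : HSer (A ⊗[ℂ] A →ₗ[ℂ] LaurentSeries A)) (S : Op Lau (A ⊗[ℂ] A) (A ⊗[ℂ] A))
    (φ : I → ℂ) (i i' i'' : I) : HSer (LaurentSeries Lau) :=
  tr a a (addHom (-1)) S (fun j j' => corr a Y φ j j' i'') i' i

/-- The matrix coefficient of `Y(Y(u, z₀) v, z) w`, as an element of `ℂ((z))((z₀))[[ħ]]`. -/
def corrIter (Y : HSer (A ⊗[ℂ] A →ₗ[ℂ] LaurentSeries A)) (φ : I → ℂ) (i i' i'' : I) :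
    HSer (LaurentSeries Lau) :=
  lpr a (yAt a Y i i') fun k => (lpr a (yAt a Y k i'') fun l => const (φ l)).map Lau.equiv.symm

variable {a} {YA : HSer (A ⊗[ℂ] A →ₗ[ℂ] LaurentSeries A)}
  {YB : HSer (B ⊗[ℂ] B →ₗ[ℂ] LaurentSeries B)} {SAB : Op Lau (A ⊗[ℂ] B) (A ⊗[ℂ] B)}

/-- The product of `ℂ((x))((y))[[ħ]]`. -/
def mulLL (x y : HSer (LaurentSeries Lau)) : HSer (LaurentSeries Lau) :=
  conv (fun X Z => cauchy (LinearMap.mul ℂ Lau) X Z) x y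

/-- The action on test functions of `S(-z₁)`, then `S(z₂ - z₁)`, then `S(-z₂)`, where
`φ₁`, `φ₂`, `φ₁₂` are the substitutions `f(z) ↦ f(-z₁), f(-z₂), f(z₂ - z₁)`. -/
def dress {R : Type} [CommRing R] [Algebra ℂ R] {N : Type*} [AddCommGroup N] [Module ℂ N]
    [Module R N] [IsScalarTower ℂ R N] (a : Basis I ℂ A) (b : Basis J ℂ B)
    (S : Op Lau (A ⊗[ℂ] B) (A ⊗[ℂ] B)) (φ₁ φ₂ φ₁₂ : Lau →ₐ[ℂ] R)
    (P : I → I → I → J → J → J → HSer N) (i i' i'' : I) (j j' j'' : J) : HSer N :=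
  tr a b φ₂ S (fun i'' j' => tr a b φ₁₂ S (fun i' j => tr a b φ₁ S (fun i'' j =>
    P i i' i'' j j' j'') i'' j) i' j) i'' j'

theorem lpr_twistY_prod (φ : I → ℂ) (ψ : J → ℂ) (i k : I) (j l : J) :
    (lpr (a.tensorProduct b) (yAt (a.tensorProduct b) (twistY YA YB SAB) (i, j) (k, l))
      fun p => const (φ p.1 * ψ p.2)).map Lau.equiv.symm =
      tr a b negHom SAB (fun k j => conv (fun x y : Lau => x * y)
        ((lpr a (yAt a YA i k) fun m => const (φ m)).map Lau.equiv.symm)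
        ((lpr b (yAt b YB j l) fun m => const (ψ m)).map Lau.equiv.symm)) k j := by
  rw [lpr_twistY_lau]
  refine tr_congr (fun k j => ?_) _ _
  have h1 : (fun (k : I) (l : J) => (const (φ k * ψ l) : HSer ℂ)) = fun k l =>
      conv (fun m n => LinearMap.mul ℂ ℂ m n) (const (φ k)) (const (ψ l)) := by
    funext k l
    rw [conv_const_left fun _ => by simp]
    funext t
    by_cases ht : t = 0 <;> simp [map_apply, const, ht]
  change (YYpr a b _ _ fun k l => (const (φ k * ψ l) : HSer ℂ)).map _ = _
  rw [h1, YYpr_conv]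
  refine (map_conv Lau.equiv.symm _ _ _).trans ?_
  rw [conv_map_left, conv_map_right]
  refine conv_congr fun m n => Lau.equiv.injective ?_
  rw [Lau.mul_def]
  rfl

theorem YYpr_mul (x : HSer (LaurentSeries A)) (z : HSer (LaurentSeries B)) (f : I → HSer Lau)
    (g : J → HSer Lau) :
    YYpr a b x z (fun k l => conv (fun x y : Lau => x * y) (f k) (g l)) =
      mulLL (lpr a x f) (lpr b z g) :=
  YYpr_conv (LinearMap.mul ℂ Lau) x z f g

theorem corr_twistY (hA : HexL YA SAB) (φ : I → ℂ) (ψ : J → ℂ) (i i' i'' : I) (j j' j'' : J) :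
    corr (a.tensorProduct b) (twistY YA YB SAB) (fun p => φ p.1 * ψ p.2) (i, j) (i', j') (i'', j'') =
      dress a b SAB (innerHom.comp negHom) (outerHom.comp negHom) (inNegHom.comp (addHom 1))
        (fun i i' i'' j j' j'' => mulLL (corr a YA φ i i' i'') (corr b YB ψ j j' j''))
        i i' i'' j j' j'' := by
  rw [corr, lpr_twistY_outer]
  simp only [lpr_twistY_prod]
  refine tr_congr (fun i'' j' => ?_) _ _
  rw [hA.YYpr_left negHom, ← inNegHom_inner]
  refine tr_congr (fun i' j => tr_congr (fun i'' j => ?_) _ _) _ _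
  exact YYpr_mul _ _ _ _

theorem corrIter_twistY (hB : HexR YB SAB) (φ : I → ℂ) (ψ : J → ℂ) (i i' i'' : I) (j j' j'' : J) :
    corrIter (a.tensorProduct b) (twistY YA YB SAB) (fun p => φ p.1 * ψ p.2)
        (i, j) (i', j') (i'', j'') =
      dress a b SAB ((addHom 1).comp negHom) (innerHom.comp negHom) (outerHom.comp negHom)
        (fun i i' i'' j j' j'' => mulLL (corrIter a YA φ i i' i'') (corrIter b YB ψ j j' j''))
        i i' i'' j j' j'' := by
  rw [corrIter, lpr_twistY_outer]
  simp only [lpr_twistY_prod]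
  unfold dress
  rw [tr_comm]
  refine tr_congr (fun i' j => ?_) _ _
  rw [hB.YYpr_right negHom, ← inNegHom_inner]
  have : (mapHom negHom).comp (addHom (-1)) = (addHom 1).comp negHom := by
    have := inNegHom_add (-1)
    rwa [neg_neg] at this
  rw [this]
  refine tr_congr (fun i'' j' => tr_congr (fun i'' j => ?_) _ _) _ _
  exact YYpr_mul _ _ _ _

end Correlators

section Product

variable {A B : Type*} [AddCommGroup A] [Module ℂ A] [AddCommGroup B] [Module ℂ B]
  {I J : Type*} {a : Basis I ℂ A} {b : Basis J ℂ B}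

theorem mulLL_comm (x y : HSer (LaurentSeries Lau)) : mulLL x y = mulLL y x := by
  unfold mulLL
  rw [conv_swap]
  refine conv_congr fun m n => ?_
  rw [cauchy_swap]
  refine congrArg (fun β => cauchy β (y m) (x n)) (LinearMap.ext fun r => LinearMap.ext fun s => ?_)
  exact mul_comm s r

theorem mulLL_tr_left (φ : Lau →ₐ[ℂ] Lau₂) (S : Op Lau (A ⊗[ℂ] B) (A ⊗[ℂ] B))
    (f : I → J → HSer (LaurentSeries Lau)) (y : HSer (LaurentSeries Lau)) (i : I) (j : J) :
    mulLL (tr a b φ S f i j) y = tr a b φ S (fun i j => mulLL (f i j) y) i j := by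
  have h : ∀ x, mulLL x y = hap (y.map (cauchyLeft (N := Lau) (N' := Lau) (LinearMap.mul ℂ Lau)
      fun r n b => mul_assoc r n b)) x := fun x => conv_swap _ _ _
  simp only [h]
  exact tr_natural _ _ _ _ _ _

theorem mulLL_tr_right (φ : Lau →ₐ[ℂ] Lau₂) (S : Op Lau (A ⊗[ℂ] B) (A ⊗[ℂ] B))
    (f : I → J → HSer (LaurentSeries Lau)) (x : HSer (LaurentSeries Lau)) (i : I) (j : J) :
    mulLL x (tr a b φ S f i j) = tr a b φ S (fun i j => mulLL x (f i j)) i j := by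
  simp only [mulLL_comm x]
  exact mulLL_tr_left _ _ _ _ _ _

variable {YA : HSer (A ⊗[ℂ] A →ₗ[ℂ] LaurentSeries A)}
  {YB : HSer (B ⊗[ℂ] B →ₗ[ℂ] LaurentSeries B)} {SAB : Op Lau (A ⊗[ℂ] B) (A ⊗[ℂ] B)}
  {SBA : Op Lau (B ⊗[ℂ] A) (B ⊗[ℂ] A)} {SAA : Op Lau (A ⊗[ℂ] A) (A ⊗[ℂ] A)}
  {SBB : Op Lau (B ⊗[ℂ] B) (B ⊗[ℂ] B)}

/-- In the opposite product, `S_{BA}(z₂ - z₁)` cancels by unitarity the factor `S_{AB}(z₁ - z₂)`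
of the product of the vertex operators, and the Yang–Baxter equation moves `S_{BB}(z₂ - z₁)` past
the remaining factors `S_{AB}`. -/
theorem corrOpp_twistY (hA : HexL YA SAB) (hAB : Unitary SAB SBA) (hBA : Unitary SBA SAB)
    (hYB : YangBaxter SBA SBB SAB) (φ : I → ℂ) (ψ : J → ℂ) (i i' i'' : I) (j j' j'' : J) :
    corrOpp (a.tensorProduct b) (twistY YA YB SAB)
        (Op.mergeLeft (Op.mergeRight SAA SAB) (Op.mergeRight SBA SBB)) (fun p => φ p.1 * ψ p.2)
        (i, j) (i', j') (i'', j'') =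
      dress a b SAB (outerHom.comp negHom) (innerHom.comp negHom) (addHom (-1))
        (fun i i' i'' j j' j'' => mulLL (corrOpp a YA SAA φ i i' i'') (corrOpp b YB SBB ψ j j' j''))
        i i' i'' j j' j'' := by
  let F := I → I → I → J → J → J → HSer (LaurentSeries Lau)
  let X1 : F → F := fun g i i' i'' j j' j'' =>
    tr a b (outerHom.comp negHom) SAB (fun i'' j => g i i' i'' j j' j'') i'' j
  let X2 : F → F := fun g i i' i'' j j' j'' =>
    tr a b (innerHom.comp negHom) SAB (fun i'' j' => g i i' i'' j j' j'') i'' j'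
  let U : F → F := fun g i i' i'' j j' j'' =>
    tr a b ((addHom (-1)).comp negHom) SAB (fun i j' => g i i' i'' j j' j'') i j'
  let AB : F → F := fun g i i' i'' j j' j'' =>
    tr a b (addHom (-1)) SAB (fun i' j => g i i' i'' j j' j'') i' j
  let BA : F → F := fun g i i' i'' j j' j'' =>
    tr b a (addHom (-1)) SBA (fun j' i => g i i' i'' j j' j'') j' i
  let BA2 : F → F := fun g i i' i'' j j' j'' =>
    tr b a innerHom SBA (fun j' i'' => g i i' i'' j j' j'') j' i''
  let AA : F → F := fun g i i' i'' j j' j'' =>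
    tr a a (addHom (-1)) SAA (fun i' i => g i i' i'' j j' j'') i' i
  let BB : F → F := fun g i i' i'' j j' j'' =>
    tr b b (addHom (-1)) SBB (fun j' j => g i i' i'' j j' j'') j' j
  let Q : F := fun i i' i'' j j' j'' => mulLL (corr a YA φ i' i i'') (corr b YB ψ j' j j'')
  have h1 : ∀ g, BA (X1 g) = X1 (BA g) := fun g => by
    funext i i' i'' j j' j''
    exact tr_comm _ _ _ _ (fun j' i i'' j => g i i' i'' j j' j'') j' i i'' j
  have h2 : ∀ g, BA (U g) = g := fun g => by
    funext i i' i'' j j' j''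
    exact hBA.test (addHom (-1)) (fun j' i => g i i' i'' j j' j'') j' i
  have h3 : ∀ g, BA2 (X2 g) = g := fun g => by
    funext i i' i'' j j' j''
    exact hBA.test innerHom (fun j' i'' => g i i' i'' j j' j'') j' i''
  have h4 : ∀ g, X2 (BA2 g) = g := fun g => by
    funext i i' i'' j j' j''
    have := hAB.test (a := a) (b := b) (innerHom.comp negHom) (fun i'' j' => g i i' i'' j j' j'') i'' j'
    rwa [AlgHom.comp_assoc, negHom_negHom, AlgHom.comp_id] at this
  have h5 : ∀ g, X1 (BB (BA2 g)) = BA2 (BB (X1 g)) := fun g => by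
    funext i i' i'' j j' j''
    have := hYB.test (a := b) (b := a) (c := b) outNegHom (fun j' i'' j => g i i' i'' j j' j'') j' i'' j
    rwa [outNegHom_outer, outNegHom_add, outNegHom_inner] at this
  have h6 : ∀ g, AA (X2 g) = X2 (AA g) := fun g => by
    funext i i' i'' j j' j''
    exact tr_comm _ _ _ _ (fun i' i i'' j' => g i i' i'' j j' j'') i' i i'' j'
  have h7 : ∀ g, AA (X1 g) = X1 (AA g) := fun g => by
    funext i i' i'' j j' j''
    exact tr_comm _ _ _ _ (fun i' i i'' j => g i i' i'' j j' j'') i' i i'' j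
  have h8 : ∀ g, AB (X2 g) = X2 (AB g) := fun g => by
    funext i i' i'' j j' j''
    exact tr_comm _ _ _ _ (fun i' j i'' j' => g i i' i'' j j' j'') i' j i'' j'
  have h9 : BB (X1 (X2 Q)) = X2 (X1 (BB Q)) := by
    rw [← h4 (BB (X1 (X2 Q))), ← h5, h3]
  have key : AB (AA (BB (BA (X1 (U (X2 Q)))))) = X2 (AB (X1 (AA (BB Q)))) := by
    rw [h1, h2, h9, h6, h7, h8]
  have h10 : AA (BB Q) = fun i i' i'' j j' j'' =>
      mulLL (corrOpp a YA SAA φ i i' i'') (corrOpp b YB SBB ψ j j' j'') := by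
    funext i i' i'' j j' j''
    refine ((mulLL_tr_left _ _ _ _ _ _).trans (tr_congr (fun i' i => ?_) _ _)).symm
    exact mulLL_tr_right _ _ _ _ _ _
  rw [h10] at key
  refine Eq.trans ?_ (congrFun (congrFun (congrFun (congrFun (congrFun (congrFun key i) i') i'')
    j) j') j'')
  rw [corrOpp, tr_mergeLeft]
  simp only [tr_mergeRight]
  refine tr_congr (fun i' j => tr_congr (fun i' i => tr_congr (fun j' j => tr_congr (fun j' i => ?_)
    _ _) _ _) _ _) _ _
  rw [corr_twistY hA]
  have := inNegHom_add 1
  rw [this]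
  rfl

/-- Three series with values in the three rings, as one series. -/
def triOf (x y z : HSer (LaurentSeries Lau)) : HSer Tri := fun t =>
  (Lau₂.equiv.symm (x t), Lau₂.equiv.symm (y t), Lau₂.equiv.symm (z t))

theorem conv_apply_map {C D E F : Type*} [AddCommMonoid E] [AddCommMonoid F] (g : E →+ F)
    (β : C → D → E) (x : HSer C) (y : HSer D) (t : ℕ) :
    g (conv β x y t) = conv (fun a b => g (β a b)) x y t := by
  rw [conv_apply, conv_apply, map_sum]

theorem triOf_mulLL (x y z x' y' z' : HSer (LaurentSeries Lau)) :
    triOf (mulLL x x') (mulLL y y') (mulLL z z') =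
      conv (fun e e' => e * e') (triOf x y z) (triOf x' y' z') := by
  have h : ∀ (x x' : HSer (LaurentSeries Lau)) t, Lau₂.equiv.symm (mulLL x x' t) =
      conv (fun X Z : LaurentSeries Lau => Lau₂.equiv.symm X * Lau₂.equiv.symm Z) x x' t := by
    intro x x' t
    rw [mulLL, conv_apply, conv_apply, map_sum]
    refine Finset.sum_congr rfl fun p _ => Lau₂.equiv.injective ?_
    rw [Lau₂.mul_def]
    rfl
  funext t
  refine Prod.ext ?_ (Prod.ext ?_ ?_)
  · exact (h x x' t).trans (conv_apply_map (AddMonoidHom.fst Lau₂ (Lau₂ × Lau₂)) (fun e e' : Tri => e * e')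
      (triOf x y z) (triOf x' y' z') t).symm
  · exact (h y y' t).trans (conv_apply_map ((AddMonoidHom.fst Lau₂ Lau₂).comp
      (AddMonoidHom.snd Lau₂ (Lau₂ × Lau₂))) (fun e e' : Tri => e * e')
      (triOf x y z) (triOf x' y' z') t).symm
  · exact (h z z' t).trans (conv_apply_map ((AddMonoidHom.snd Lau₂ Lau₂).comp
      (AddMonoidHom.snd Lau₂ (Lau₂ × Lau₂))) (fun e e' : Tri => e * e')
      (triOf x y z) (triOf x' y' z') t).symm

theorem dress_semilinear {R R' : Type} [CommRing R] [Algebra ℂ R] [CommRing R'] [Algebra ℂ R']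
    {N N' : Type*} [AddCommGroup N] [Module ℂ N] [Module R N] [IsScalarTower ℂ R N]
    [AddCommGroup N'] [Module ℂ N'] [Module R' N'] [IsScalarTower ℂ R' N'] (g : N →ₗ[ℂ] N')
    {S : Op Lau (A ⊗[ℂ] B) (A ⊗[ℂ] B)} {φ₁ φ₂ φ₁₂ : Lau →ₐ[ℂ] R} {ψ₁ ψ₂ ψ₁₂ : Lau →ₐ[ℂ] R'}
    (h₁ : ∀ r n, g (φ₁ r • n) = ψ₁ r • g n) (h₂ : ∀ r n, g (φ₂ r • n) = ψ₂ r • g n)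
    (h₁₂ : ∀ r n, g (φ₁₂ r • n) = ψ₁₂ r • g n) (P : I → I → I → J → J → J → HSer N)
    (i i' i'' : I) (j j' j'' : J) :
    (dress a b S φ₁ φ₂ φ₁₂ P i i' i'' j j' j'').map g =
      dress a b S ψ₁ ψ₂ ψ₁₂ (fun i i' i'' j j' j'' => (P i i' i'' j j' j'').map g)
        i i' i'' j j' j'' := by
  unfold dress
  rw [tr_semilinear S _ _ _ g h₂]
  refine tr_congr (fun i'' j' => ?_) _ _
  rw [tr_semilinear S _ _ _ g h₁₂]
  refine tr_congr (fun i' j => ?_) _ _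
  rw [tr_semilinear S _ _ _ g h₁]

theorem dress_mem {R : Type} [CommRing R] [Algebra ℂ R] {N : Type*} [AddCommGroup N] [Module ℂ N]
    [Module R N] [IsScalarTower ℂ R N] {S : Op Lau (A ⊗[ℂ] B) (A ⊗[ℂ] B)}
    {φ₁ φ₂ φ₁₂ : Lau →ₐ[ℂ] R} {F : Submodule ℂ N} (h₁ : ∀ r, ∀ n ∈ F, φ₁ r • n ∈ F)
    (h₂ : ∀ r, ∀ n ∈ F, φ₂ r • n ∈ F) (h₁₂ : ∀ r, ∀ n ∈ F, φ₁₂ r • n ∈ F)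
    {P : I → I → I → J → J → J → HSer N} (hP : ∀ i i' i'' j j' j'' t, P i i' i'' j j' j'' t ∈ F)
    (i i' i'' : I) (j j' j'' : J) (t : ℕ) :
    dress a b S φ₁ φ₂ φ₁₂ P i i' i'' j j' j'' t ∈ F :=
  tr_mem S _ _ F h₂ (fun _ _ t => tr_mem S _ _ F h₁₂ (fun _ _ t => tr_mem S _ _ F h₁
    (fun _ _ t => hP _ _ _ _ _ _ t) t) t) t

theorem triOf_dress (S : Op Lau (A ⊗[ℂ] B) (A ⊗[ℂ] B))
    (P P' P'' : I → I → I → J → J → J → HSer (LaurentSeries Lau))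
    (i i' i'' : I) (j j' j'' : J) :
    triOf
      (dress a b S (innerHom.comp negHom) (outerHom.comp negHom) (inNegHom.comp (addHom 1)) P
        i i' i'' j j' j'')
      (dress a b S (outerHom.comp negHom) (innerHom.comp negHom) (addHom (-1)) P'
        i i' i'' j j' j'')
      (dress a b S ((addHom 1).comp negHom) (innerHom.comp negHom) (outerHom.comp negHom) P''
        i i' i'' j j' j'') =
      dress a b S (triFst.comp negHom) (triSnd.comp negHom) triDiff
        (fun i i' i'' j j' j'' => triOf (P i i' i'' j j' j'') (P' i i' i'' j j' j'')
          (P'' i i' i'' j j' j'')) i i' i'' j j' j'' := by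
  let g : Tri →ₗ[ℂ] LaurentSeries Lau := Lau₂.equiv.toLinearMap ∘ₗ LinearMap.fst ℂ _ _
  let g' : Tri →ₗ[ℂ] LaurentSeries Lau :=
    Lau₂.equiv.toLinearMap ∘ₗ LinearMap.fst ℂ _ _ ∘ₗ LinearMap.snd ℂ _ _
  let g'' : Tri →ₗ[ℂ] LaurentSeries Lau :=
    Lau₂.equiv.toLinearMap ∘ₗ LinearMap.snd ℂ _ _ ∘ₗ LinearMap.snd ℂ _ _
  have hg : ∀ (r : Tri) n, g (r • n) = r.1 • g n := fun r n => (lau₂_smul_eq_mul _ _).symm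
  have hg' : ∀ (r : Tri) n, g' (r • n) = r.2.1 • g' n := fun r n => (lau₂_smul_eq_mul _ _).symm
  have hg'' : ∀ (r : Tri) n, g'' (r • n) = r.2.2 • g'' n := fun r n => (lau₂_smul_eq_mul _ _).symm
  have k := dress_semilinear (a := a) (b := b) g (S := S) (φ₁ := triFst.comp negHom)
    (φ₂ := triSnd.comp negHom) (φ₁₂ := triDiff) (ψ₁ := innerHom.comp negHom)
    (ψ₂ := outerHom.comp negHom) (ψ₁₂ := inNegHom.comp (addHom 1)) (fun _ _ => hg _ _)
    (fun _ _ => hg _ _) (fun _ _ => hg _ _) (fun i i' i'' j j' j'' =>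
      triOf (P i i' i'' j j' j'') (P' i i' i'' j j' j'') (P'' i i' i'' j j' j'')) i i' i'' j j' j''
  have k' := dress_semilinear (a := a) (b := b) g' (S := S) (φ₁ := triFst.comp negHom)
    (φ₂ := triSnd.comp negHom) (φ₁₂ := triDiff) (ψ₁ := outerHom.comp negHom)
    (ψ₂ := innerHom.comp negHom) (ψ₁₂ := addHom (-1)) (fun _ _ => hg' _ _)
    (fun _ _ => hg' _ _) (fun _ _ => hg' _ _) (fun i i' i'' j j' j'' =>
      triOf (P i i' i'' j j' j'') (P' i i' i'' j j' j'') (P'' i i' i'' j j' j'')) i i' i'' j j' j''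
  have k'' := dress_semilinear (a := a) (b := b) g'' (S := S) (φ₁ := triFst.comp negHom)
    (φ₂ := triSnd.comp negHom) (φ₁₂ := triDiff) (ψ₁ := (addHom 1).comp negHom)
    (ψ₂ := innerHom.comp negHom) (ψ₁₂ := outerHom.comp negHom) (fun _ _ => hg'' _ _)
    (fun _ _ => hg'' _ _) (fun _ _ => hg'' _ _) (fun i i' i'' j j' j'' =>
      triOf (P i i' i'' j j' j'') (P' i i' i'' j j' j'') (P'' i i' i'' j j' j'')) i i' i'' j j' j''
  funext t
  exact Prod.ext (Lau₂.equiv.injective (congrFun k t).symm)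
    (Prod.ext (Lau₂.equiv.injective (congrFun k' t).symm) (Lau₂.equiv.injective (congrFun k'' t).symm))

theorem dress_mem_mero (S : Op Lau (A ⊗[ℂ] B) (A ⊗[ℂ] B)) {P : I → I → I → J → J → J → HSer Tri}
    (hP : ∀ i i' i'' j j' j'' t, P i i' i'' j j' j'' t ∈ mero) (i i' i'' : I) (j j' j'' : J) (t : ℕ) :
    dress a b S (triFst.comp negHom) (triSnd.comp negHom) triDiff P i i' i'' j j' j'' t ∈ mero := by
  have hmul : ∀ x ∈ mero, ∀ n ∈ mero.toSubmodule, x • n ∈ mero.toSubmodule :=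
    fun x hx n hn => mero.mul_mem hx hn
  have h₁ : ∀ r, ∀ n ∈ mero.toSubmodule, (triFst.comp negHom) r • n ∈ mero.toSubmodule :=
    fun r => hmul _ (expansions_le_mero (triFst_mem _))
  have h₂ : ∀ r, ∀ n ∈ mero.toSubmodule, (triSnd.comp negHom) r • n ∈ mero.toSubmodule :=
    fun r => hmul _ (expansions_le_mero (triSnd_mem _))
  have h₁₂ : ∀ r, ∀ n ∈ mero.toSubmodule, triDiff r • n ∈ mero.toSubmodule :=
    fun r => hmul _ (triDiff_mem _)
  exact dress_mem (F := mero.toSubmodule) h₁ h₂ h₁₂ hP i i' i'' j j' j'' t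

/-- The three expansions of the matrix coefficients of two vertex operators. -/
def corrTri (a : Basis I ℂ A) (Y : HSer (A ⊗[ℂ] A →ₗ[ℂ] LaurentSeries A))
    (S : Op Lau (A ⊗[ℂ] A) (A ⊗[ℂ] A)) (φ : I → ℂ) (i i' i'' : I) : HSer Tri :=
  triOf (corr a Y φ i i' i'') (corrOpp a Y S φ i i' i'') (corrIter a Y φ i i' i'')

open Classical in
/-- The coordinate functionals of a basis. -/
def coordFn {I : Type*} (l : I) : I → ℂ := fun k => if k = l then 1 else 0

/-- All matrix coefficients of products, opposite products and iterates of two vertex operators are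
expansions of common functions in `ℂ((z₁, z₂))[(z₁ - z₂)⁻¹]`. -/
def MeroCorr (a : Basis I ℂ A) (Y : HSer (A ⊗[ℂ] A →ₗ[ℂ] LaurentSeries A))
    (S : Op Lau (A ⊗[ℂ] A) (A ⊗[ℂ] A)) : Prop :=
  ∀ l i i' i'' t, corrTri a Y S (coordFn l) i i' i'' t ∈ mero

theorem MeroCorr.twistY (mA : MeroCorr a YA SAA) (mB : MeroCorr b YB SBB) (hA : HexL YA SAB)
    (hB : HexR YB SAB) (hAB : Unitary SAB SBA) (hBA : Unitary SBA SAB)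
    (hYB : YangBaxter SBA SBB SAB) :
    MeroCorr (a.tensorProduct b) (twistY YA YB SAB)
      (Op.mergeLeft (Op.mergeRight SAA SAB) (Op.mergeRight SBA SBB)) := by
  rintro ⟨l, l'⟩ ⟨i, j⟩ ⟨i', j'⟩ ⟨i'', j''⟩ t
  have hl : (coordFn (l, l') : I × J → ℂ) = fun p => coordFn l p.1 * coordFn l' p.2 := by
    funext p
    obtain ⟨k, k'⟩ := p
    simp only [coordFn, Prod.mk.injEq]
    by_cases h : k = l <;> by_cases h' : k' = l' <;> simp [h, h']
  rw [hl, corrTri, corr_twistY hA, corrOpp_twistY hA hAB hBA hYB, corrIter_twistY hB, triOf_dress]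
  refine dress_mem_mero SAB (fun i i' i'' j j' j'' t => ?_) i i' i'' j j' j'' t
  rw [triOf_mulLL, conv_apply]
  exact sum_mem fun p _ => mero.mul_mem (mA _ _ _ _ _) (mB _ _ _ _ _)

end Product

/-! ### Products of polynomials and formal distributions -/

section PolyMul

variable {M M' : Type*} [AddCommGroup M] [Module ℂ M] [AddCommGroup M'] [Module ℂ M'] {r r' : ℕ}

theorem polyMul_eq_constr (p : MvPolynomial (Fin r) ℂ) (D : (Fin r → ℤ) → M) (m : Fin r → ℤ) :
    polyMul p D m = (MvPolynomial.basisMonomials (Fin r) ℂ).constr ℂ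
      (fun s : Fin r →₀ ℕ => D fun i => m i - (s i : ℤ)) p := by
  rw [Basis.constr_apply]
  rfl

theorem polyMul_monomial (s : Fin r →₀ ℕ) (c : ℂ) (D : (Fin r → ℤ) → M) (m : Fin r → ℤ) :
    polyMul (MvPolynomial.monomial s c) D m = c • D fun i => m i - (s i : ℤ) := by
  have h : MvPolynomial.monomial s c = c • MvPolynomial.basisMonomials (Fin r) ℂ s := by
    rw [MvPolynomial.coe_basisMonomials, MvPolynomial.smul_monomial, smul_eq_mul, mul_one]
  rw [polyMul_eq_constr, h, map_smul, Basis.constr_basis]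

theorem polyMul_add (p q : MvPolynomial (Fin r) ℂ) (D : (Fin r → ℤ) → M) (m : Fin r → ℤ) :
    polyMul (p + q) D m = polyMul p D m + polyMul q D m := by
  simp only [polyMul_eq_constr, map_add]

theorem polyMul_sub (p q : MvPolynomial (Fin r) ℂ) (D : (Fin r → ℤ) → M) (m : Fin r → ℤ) :
    polyMul (p - q) D m = polyMul p D m - polyMul q D m := by
  simp only [polyMul_eq_constr, map_sub]

theorem polyMul_map (g : M →ₗ[ℂ] M') (p : MvPolynomial (Fin r) ℂ) (D : (Fin r → ℤ) → M)
    (m : Fin r → ℤ) : g (polyMul p D m) = polyMul p (fun m => g (D m)) m := by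
  simp only [polyMul, map_sum, map_smul]

theorem polyMul_add_right (p : MvPolynomial (Fin r) ℂ) (D D' : (Fin r → ℤ) → M) (m : Fin r → ℤ) :
    polyMul p (fun m => D m + D' m) m = polyMul p D m + polyMul p D' m := by
  simp only [polyMul, smul_add, Finset.sum_add_distrib]

theorem polyMul_smul_right (c : ℂ) (p : MvPolynomial (Fin r) ℂ) (D : (Fin r → ℤ) → M)
    (m : Fin r → ℤ) : polyMul p (fun m => c • D m) m = c • polyMul p D m := by
  simp only [polyMul, Finset.smul_sum]
  exact Finset.sum_congr rfl fun s _ => smul_comm _ _ _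

theorem polyMul_one (D : (Fin r → ℤ) → M) (m : Fin r → ℤ) : polyMul 1 D m = D m := by
  have := polyMul_monomial 0 1 D m
  rw [one_smul] at this
  simpa using this

theorem polyMul_mul (p q : MvPolynomial (Fin r) ℂ) (D : (Fin r → ℤ) → M) (m : Fin r → ℤ) :
    polyMul (p * q) D m = polyMul p (polyMul q D) m := by
  induction p using MvPolynomial.induction_on' generalizing m with
  | add p p' hp hp' => rw [add_mul, polyMul_add, polyMul_add, hp, hp']
  | monomial s c =>
    induction q using MvPolynomial.induction_on' with
    | add q q' hq hq' =>
      have h : polyMul (q + q') D = fun m => polyMul q D m + polyMul q' D m :=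
        funext fun m => polyMul_add _ _ _ _
      rw [mul_add, polyMul_add, h, polyMul_add_right, hq, hq']
    | monomial s' c' =>
      rw [MvPolynomial.monomial_mul, polyMul_monomial, polyMul_monomial, polyMul_monomial, mul_smul]
      congr 3
      funext i
      rw [Finsupp.add_apply]
      push_cast
      ring

theorem polyMul_rename (f : Fin r → Fin r') (E : (Fin r → ℤ) → Fin r' → ℤ) (m : Fin r' → ℤ)
    (hE : ∀ s : Fin r →₀ ℕ,
      E (fun j => m (f j) - (s j : ℤ)) = fun i => m i - ((s.mapDomain f i : ℕ) : ℤ))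
    (p : MvPolynomial (Fin r) ℂ) (D : (Fin r' → ℤ) → M) :
    polyMul (MvPolynomial.rename f p) D m = polyMul p (fun x => D (E x)) fun j => m (f j) := by
  induction p using MvPolynomial.induction_on' with
  | add p p' hp hp' => rw [map_add, polyMul_add, polyMul_add, hp, hp']
  | monomial s c =>
    rw [MvPolynomial.rename_monomial, polyMul_monomial, polyMul_monomial, hE]

theorem polyMul_congr {D D' : (Fin r → ℤ) → M} (p : MvPolynomial (Fin r) ℂ) (m : Fin r → ℤ)
    (h : ∀ m, D m = D' m) : polyMul p D m = polyMul p D' m := by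
  rw [funext h]

/-- Multiplication by a polynomial does not lower the exponents of a variable. -/
theorem polyMul_eq_zero_of_lt {N : ℤ} {i : Fin r} {D : (Fin r → ℤ) → M}
    (h : ∀ m, m i < N → D m = 0) (p : MvPolynomial (Fin r) ℂ) (m : Fin r → ℤ) (hm : m i < N) :
    polyMul p D m = 0 :=
  Finset.sum_eq_zero fun s _ => by
    rw [h _ (by have := Int.natCast_nonneg (s i); omega), smul_zero]

theorem polyMul_X (i : Fin r) (D : (Fin r → ℤ) → M) (m : Fin r → ℤ) :
    polyMul (MvPolynomial.X i) D m = D (Function.update m i (m i - 1)) := by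
  rw [MvPolynomial.X, polyMul_monomial, one_smul]
  congr 1
  funext j
  by_cases h : j = i
  · subst h
    simp
  · simp [h]

theorem hser_polyMul_apply (p : MvPolynomial (Fin r) ℂ) (D : (Fin r → ℤ) → HSer M) (m : Fin r → ℤ)
    (t : ℕ) : polyMul p D m t = polyMul p (fun m => D m t) m :=
  polyMul_map (LinearMap.proj t : (ℕ → M) →ₗ[ℂ] M) p D m

theorem vandermondePow_two (k : ℕ) :
    vandermondePow 2 k = (MvPolynomial.X 0 - MvPolynomial.X 1) ^ k := by
  have h0 : Finset.Ioi (0 : Fin 2) = {1} := by decide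
  have h1 : Finset.Ioi (1 : Fin 2) = ∅ := by decide
  rw [vandermondePow, Fin.prod_univ_two, h0, h1]
  simp

theorem polyMul_X_sub_X (D : (Fin 2 → ℤ) → M) (m : Fin 2 → ℤ) :
    polyMul (MvPolynomial.X 0 - MvPolynomial.X 1) D m = D ![m 0 - 1, m 1] - D ![m 0, m 1 - 1] := by
  rw [polyMul_sub, polyMul_X, polyMul_X]
  congr 2 <;> (funext i; fin_cases i <;> simp)

theorem vandermondePow_succ_mul (k : ℕ) (D : (Fin 2 → ℤ) → M) (m : Fin 2 → ℤ) :
    polyMul (vandermondePow 2 (k + 1)) D m =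
      polyMul (vandermondePow 2 k) D ![m 0 - 1, m 1] -
        polyMul (vandermondePow 2 k) D ![m 0, m 1 - 1] := by
  rw [vandermondePow_two, vandermondePow_two, pow_succ', polyMul_mul, polyMul_X_sub_X]

theorem vandermondePow_mul_fst (k : ℕ) (e : Tri) (m : Fin 2 → ℤ) :
    polyMul (vandermondePow 2 k) (fun m => e.1.coeff (m 1) (m 0)) m =
      (triSub ^ k * e).1.coeff (m 1) (m 0) := by
  induction k generalizing m with
  | zero => rw [vandermondePow_two, pow_zero, polyMul_one, pow_zero, one_mul]
  | succ k ih =>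
    rw [vandermondePow_succ_mul, ih, ih, pow_succ' triSub, mul_assoc, triSub_mul_fst]
    rfl

theorem vandermondePow_mul_snd (k : ℕ) (e : Tri) (m : Fin 2 → ℤ) :
    polyMul (vandermondePow 2 k) (fun m => e.2.1.coeff (m 0) (m 1)) m =
      (triSub ^ k * e).2.1.coeff (m 0) (m 1) := by
  induction k generalizing m with
  | zero => rw [vandermondePow_two, pow_zero, polyMul_one, pow_zero, one_mul]
  | succ k ih =>
    rw [vandermondePow_succ_mul, ih, ih, pow_succ' triSub, mul_assoc, triSub_mul_snd]
    rfl

theorem shiftCoeff_eq_sum {G : (Fin 2 → ℤ) → M} {N : ℤ} (hG : ∀ m, (∃ i, m i < N) → G m = 0)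
    (q p : ℤ) : shiftCoeff G q p = if 0 ≤ q then
      ∑ a ∈ Finset.Icc N (p + q - N), (Ring.choose a q.toNat : ℤ) • G ![a, p + q - a] else 0 := by
  unfold shiftCoeff
  split_ifs
  · refine finsum_eq_finsetSum_of_support_subset _ fun a ha => ?_
    rw [Function.mem_support] at ha
    rw [Finset.coe_Icc]
    by_contra h
    rw [Set.mem_Icc, not_and_or, not_le, not_le] at h
    refine ha ?_
    rw [hG _ ?_, smul_zero]
    rcases h with h | h
    · exact ⟨0, h⟩
    · exact ⟨1, by simp only [Matrix.cons_val_one, Matrix.cons_val_fin_one]; omega⟩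
  · rfl

end PolyMul

/-! ### Coefficients of the correlators -/

section Coefficients

variable {A B : Type*} [AddCommGroup A] [Module ℂ A] [AddCommGroup B] [Module ℂ B]
  {I J : Type*} {a : Basis I ℂ A} {b : Basis J ℂ B} {N : Type*} [AddCommGroup N] [Module ℂ N]

theorem vpr_vpr (x : HSer A) (f : I → HSer B) (g : J → HSer N) :
    vpr b (vpr a x f) g = vpr a x fun i => vpr b (f i) g := by
  have h : ∀ y, vpr b y g = hap (lin b g) y := fun y => conv_swap _ _ _
  simp only [h]
  exact vpr_natural _ _ _

theorem vpr_const_fun (φ : I → ℂ) (x : HSer A) :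
    vpr a x (fun i => const (φ i)) = x.map (a.constr ℂ φ) := by
  have : lin a (fun i => const (φ i)) = const (a.constr ℂ φ) := by
    funext t
    refine a.ext fun i => ?_
    rw [lin_basis]
    by_cases ht : t = 0 <;> simp [const, ht]
  rw [vpr, this, conv_const_right (fun _ => rfl)]

variable {Y : HSer (A ⊗[ℂ] A →ₗ[ℂ] LaurentSeries A)}

theorem applyY_coeff (u w : HSer A) (m : ℤ) : (applyY Y u w).map (fun X => X.coeff m) =
    vpr a u fun i => vpr a w fun i' => (yAt a Y i i').map fun X => X.coeff m := by
  rw [applyY_eq_vpr a, vpr_map_coeff]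
  simp only [vpr_map_coeff]

variable {S : Op Lau (A ⊗[ℂ] A) (A ⊗[ℂ] A)} {φ : I → ℂ}

/-- The three expansions of the matrix coefficients of two vertex operators, for arbitrary
vectors. -/
def genTri (a : Basis I ℂ A) (Y : HSer (A ⊗[ℂ] A →ₗ[ℂ] LaurentSeries A))
    (S : Op Lau (A ⊗[ℂ] A) (A ⊗[ℂ] A)) (φ : I → ℂ) (u v w : HSer A) : HSer Tri :=
  vpr a u fun i => vpr a v fun i' => vpr a w fun i'' => corrTri a Y S φ i i' i''

theorem genTri_map (g : Tri →ₗ[ℂ] N) (u v w : HSer A) : (genTri a Y S φ u v w).map g =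
    vpr a u fun i => vpr a v fun i' => vpr a w fun i'' => (corrTri a Y S φ i i' i'').map g := by
  simp only [genTri, vpr_map]

theorem genTri_mem_mero (h : MeroCorr a Y S) (l : I) (u v w : HSer A) (t : ℕ) :
    genTri a Y S (coordFn l) u v w t ∈ mero :=
  vpr_mem mero.toSubmodule (fun _ _ => vpr_mem mero.toSubmodule
    (fun _ _ => vpr_mem mero.toSubmodule (fun _ _ => h _ _ _ _ _) _ _) _ _) _ _

theorem lpr_const_coeff (x : HSer (LaurentSeries A)) (m : ℤ) :
    (((lpr a x fun l => const (φ l)).map Lau.equiv.symm).map fun f => f.coeff m) =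
      vpr a (x.map fun X => X.coeff m) fun l => const (φ l) :=
  lpr_coeff x _ m

/-- The linear functional `f ↦ (coefficient of zᵐ)`. -/
def lauCoeff (m : ℤ) : Lau →ₗ[ℂ] ℂ :=
  HahnSeries.coeff.linearMap (R := ℂ) m ∘ₗ Lau.equiv.toLinearMap

theorem corr_coeff (i i' i'' : I) (n m : ℤ) :
    (corr a Y φ i i' i'').map (fun X => (X.coeff n).coeff m) =
      vpr a ((yAt a Y i' i'').map fun X => X.coeff n) fun k =>
        vpr a ((yAt a Y i k).map fun X => X.coeff m) fun l => const (φ l) := by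
  have h : (corr a Y φ i i' i'').map (fun X => (X.coeff n).coeff m) =
      ((corr a Y φ i i' i'').map fun X => X.coeff n).map (lauCoeff m) := rfl
  rw [h, corr, lpr_coeff, vpr_map]
  exact vpr_apply_congr fun k => lpr_const_coeff _ _

theorem corrIter_coeff (i i' i'' : I) (q p : ℤ) :
    (corrIter a Y φ i i' i'').map (fun X => (X.coeff q).coeff p) =
      vpr a ((yAt a Y i i').map fun X => X.coeff q) fun k =>
        vpr a ((yAt a Y k i'').map fun X => X.coeff p) fun l => const (φ l) := by
  have h : (corrIter a Y φ i i' i'').map (fun X => (X.coeff q).coeff p) =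
      ((corrIter a Y φ i i' i'').map fun X => X.coeff q).map (lauCoeff p) := rfl
  rw [h, corrIter, lpr_coeff, vpr_map]
  exact vpr_apply_congr fun k => lpr_const_coeff _ _

/-- The coefficients in the first component of a triple. -/
def fstCoeff (n m : ℤ) : Tri →ₗ[ℂ] ℂ :=
  lauCoeff m ∘ₗ HahnSeries.coeff.linearMap (R := ℂ) n ∘ₗ Lau₂.equiv.toLinearMap ∘ₗ
    LinearMap.fst ℂ _ _

/-- The coefficients in the third component of a triple. -/
def thdCoeff (q p : ℤ) : Tri →ₗ[ℂ] ℂ :=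
  lauCoeff p ∘ₗ HahnSeries.coeff.linearMap (R := ℂ) q ∘ₗ Lau₂.equiv.toLinearMap ∘ₗ
    LinearMap.snd ℂ _ _ ∘ₗ LinearMap.snd ℂ _ _

theorem genTri_fst (u v w : HSer A) (n m : ℤ) (t : ℕ) :
    (genTri a Y S φ u v w t).1.coeff n m = a.constr ℂ φ
      ((applyY Y u ((applyY Y v w).map fun X => X.coeff n)).map (fun X => X.coeff m) t) := by
  refine (congrFun (genTri_map (fstCoeff n m) u v w) t).trans
    (Eq.trans ?_ (congrFun (vpr_const_fun φ _) t))
  refine congrFun ?_ t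
  simp only [applyY_coeff (a := a), vpr_vpr]
  exact vpr_apply_congr fun i => vpr_apply_congr fun i' => vpr_apply_congr fun i'' =>
    corr_coeff i i' i'' n m

theorem genTri_thd (u v w : HSer A) (q p : ℤ) (t : ℕ) :
    (genTri a Y S φ u v w t).2.2.coeff q p = a.constr ℂ φ
      ((applyY Y ((applyY Y u v).map fun X => X.coeff q) w).map (fun X => X.coeff p) t) := by
  refine (congrFun (genTri_map (thdCoeff q p) u v w) t).trans
    (Eq.trans ?_ (congrFun (vpr_const_fun φ _) t))
  refine congrFun ?_ t
  simp only [applyY_coeff (a := a), vpr_vpr]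
  refine vpr_apply_congr fun i => vpr_apply_congr fun i' => ?_
  rw [vpr_comm (a := a) (b := a)]
  exact vpr_apply_congr fun i'' => corrIter_coeff i i' i'' q p

/-- The matrix coefficients of a Laurent series in two variables over `A`. -/
def coordLau₂ (ℓ : A →ₗ[ℂ] ℂ) : LaurentSeries (LaurentSeries A) →ₗ[ℂ] LaurentSeries Lau :=
  laurMap (Lau.equiv.symm.toLinearMap ∘ₗ laurMap ℓ)

theorem coordLau₂_laurSMul₂ (ℓ : A →ₗ[ℂ] ℂ) (yy : B →ₗ[ℂ] LaurentSeries (LaurentSeries A))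
    (x : Lau₂ ⊗[ℂ] B) : coordLau₂ ℓ (laurSMul₂ (yy.lTensor Lau₂ x)) =
      LinearMap.liftBaseChange Lau₂ (coordLau₂ ℓ ∘ₗ yy) x := by
  induction x with
  | zero => simp
  | add x y hx hy => simp only [map_add, hx, hy]
  | tmul r x =>
    rw [LinearMap.lTensor_tmul, LinearMap.liftBaseChange_tmul, lau₂_smul_def]
    refine (laurMap_cauchy _ _ _ _).trans (Eq.trans ?_ (cauchy_laurMap LinearMap.id
      (Lau.equiv.symm.toLinearMap ∘ₗ laurMap ℓ) (lauAct Lau) (Lau₂.equiv r) (yy x)).symm)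
    refine congrArg (fun β => cauchy β (Lau₂.equiv r) (yy x))
      (LinearMap.ext fun r => LinearMap.ext fun X => Lau.equiv.injective ?_)
    change laurMap ℓ (cauchy (LinearMap.lsmul ℂ A) (Lau.equiv r) X) =
      Lau.equiv (r * Lau.equiv.symm (laurMap ℓ X))
    rw [laurMap_cauchy, Lau.mul_def]
    refine Eq.trans ?_ (cauchy_laurMap LinearMap.id ℓ (LinearMap.mul ℂ ℂ) (Lau.equiv r) X).symm
    refine congrArg (fun β => cauchy β (Lau.equiv r) X)
      (LinearMap.ext fun c => LinearMap.ext fun x => ?_)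
    exact map_smul ℓ c x

/-- `Y(z₂)(1 ⊗ Y(z₁))`. -/
def compY (Y : HSer (A ⊗[ℂ] A →ₗ[ℂ] LaurentSeries A)) :
    HSer (A ⊗[ℂ] (A ⊗[ℂ] A) →ₗ[ℂ] LaurentSeries (LaurentSeries A)) :=
  conv (fun y y' => laurMap y ∘ₗ Y23 (A := A) y') Y Y

theorem compY_coord (i i' i'' : I) :
    (compY Y).map (fun yy => coordLau₂ (a.constr ℂ φ)
      (yy (a.tensorProduct (a.tensorProduct a) (i, i', i'')))) = corr a Y φ i i' i'' := by
  have hl : lin a (fun k => (lpr a (yAt a Y i k) fun l => const (φ l)).map Lau.equiv.symm) =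
      Y.map fun y => Lau.equiv.symm.toLinearMap ∘ₗ laurMap (a.constr ℂ φ) ∘ₗ y ∘ₗ
        TensorProduct.mk ℂ A A (a i) := by
    funext t
    refine a.ext fun k => ?_
    have : lin a (fun l => const (φ l)) = const (a.constr ℂ φ) := by
      funext t
      refine a.ext fun i => ?_
      rw [lin_basis]
      by_cases ht : t = 0 <;> simp [const, ht]
    rw [lin_basis, lpr, this, conv_const_right laurMap_lin_zero]
    rfl
  rw [corr, lpr, hl, conv_swap]
  funext t
  refine (map_sum (coordLau₂ (a.constr ℂ φ) ∘ₗ LinearMap.applyₗ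
    (a.tensorProduct (a.tensorProduct a) (i, i', i''))) _ _).trans ?_
  refine Finset.sum_congr rfl fun q _ => ?_
  simp only [LinearMap.comp_apply, LinearMap.applyₗ_apply_apply, Basis.tensorProduct_apply']
  change laurMap _ (laurMap (Y q.1) (cauchy (TensorProduct.mk ℂ A A)
    (HahnSeries.single (0 : ℤ) (a i)) (Y q.2 (a i' ⊗ₜ a i'')))) = _
  rw [cauchy_single_left]
  rfl

end Coefficients

section Opposite

variable {V : VAData.{u}} {S : Op Lau (V.carrier ⊗[ℂ] V.carrier) (V.carrier ⊗[ℂ] V.carrier)}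
  {I : Type*} {a : Basis I ℂ V.carrier} {φ : I → ℂ}

theorem oppositeProduct_coord (v u w : HSer V.carrier) :
    (oppositeProduct V S v u w).map (coordLau₂ (a.constr ℂ φ)) =
      vpr a v fun i' => vpr a u fun i => vpr a w fun i'' => corrOpp a V.Y S φ i i' i'' := by
  let e := a.tensorProduct (a.tensorProduct a)
  let ℓ := coordLau₂ (a.constr ℂ φ)
  let Z : HSer (V.carrier ⊗[ℂ] (V.carrier ⊗[ℂ] V.carrier) →ₗ[ℂ]
      LaurentSeries (LaurentSeries V.carrier)) :=
    conv (fun yy s => laurSMul₂ ∘ₗ yy.lTensor Lau₂ ∘ₗ s) (compY V.Y) (Op.leg12 V.carrier S.atDiff)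
  have hF : ∀ X : HSer (V.carrier ⊗[ℂ] (V.carrier ⊗[ℂ] V.carrier) →ₗ[ℂ]
      LaurentSeries (LaurentSeries V.carrier)),
      lin e (fun p => X.map fun z => ℓ (z (e p))) = X.map fun z => ℓ ∘ₗ z := by
    intro X
    funext t
    refine e.ext fun p => ?_
    rw [lin_basis]
    rfl
  have hZ : ∀ i' i i'', (Z.map fun z => ℓ (z (e (i', i, i'')))) =
      corrOpp a V.Y S φ i i' i'' := by
    intro i' i i''
    have h1 : (Z.map fun z => ℓ (z (e (i', i, i'')))) = Op.act e e (Op.leg12 V.carrier S.atDiff)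
        (fun p => (compY V.Y).map fun z => ℓ (z (e p))) (i', i, i'') := by
      rw [Op.act, pr, hF, conv_map_left, conv_map_right, conv_swap]
      funext t
      refine (map_sum (ℓ ∘ₗ LinearMap.applyₗ (e (i', i, i''))) _ _).trans
        (Finset.sum_congr rfl fun q _ => ?_)
      exact coordLau₂_laurSMul₂ _ _ _
    have h2 : S.atDiff = S.mapScalars (addHom (-1)).toLinearMap := rfl
    have h3 : (fun j j' => (compY V.Y).map fun z => ℓ (z (e (j, j', i'')))) =
        fun j j' => corr a V.Y φ j j' i'' := funext fun j => funext fun j' => compY_coord j j' i''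
    rw [h1, h2, act_leg12, h3, corrOpp, tr]
  have h2 : (oppositeProduct V S v u w).map ℓ = vpr e
      (conv (fun a b => a ⊗ₜ[ℂ] b) v (conv (fun a b => a ⊗ₜ[ℂ] b) u w))
      fun p => Z.map fun z => ℓ (z (e p)) := by
    rw [vpr, hF, conv_map_right, conv_swap]
    exact map_conv ℓ _ _ _
  rw [h2, vpr_tmul]
  refine vpr_apply_congr fun i' => ?_
  rw [vpr_tmul]
  exact vpr_apply_congr fun i => vpr_apply_congr fun i'' => hZ i' i i''

theorem genTri_snd (u v w : HSer V.carrier) (n m : ℤ) (t : ℕ) :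
    (genTri a V.Y S φ u v w t).2.1.coeff n m = a.constr ℂ φ
      (((oppositeProduct V S v u w t).coeff n).coeff m) := by
  let g : Tri →ₗ[ℂ] LaurentSeries Lau :=
    Lau₂.equiv.toLinearMap ∘ₗ LinearMap.fst ℂ _ _ ∘ₗ LinearMap.snd ℂ _ _
  have h : (genTri a V.Y S φ u v w).map g =
      (oppositeProduct V S v u w).map (coordLau₂ (a.constr ℂ φ)) := by
    rw [genTri_map, oppositeProduct_coord, vpr_comm (a := a) (b := a)]
    rfl
  exact congrArg (fun X : LaurentSeries Lau => (X.coeff n).coeff m) (congrFun h t)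

end Opposite

/-! ### Locality and associativity in terms of correlators -/

section LocalityAssoc

variable {V : VAData.{u}} {S : Op Lau (V.carrier ⊗[ℂ] V.carrier) (V.carrier ⊗[ℂ] V.carrier)}
  {I : Type*} {a : Basis I ℂ V.carrier} {u v w : HSer V.carrier}

theorem coord_eq_constr (l : I) : a.constr ℂ (coordFn l) = a.coord l := by
  classical
  refine a.ext fun i => ?_
  rw [Basis.constr_basis, Basis.coord_apply, a.repr_self, Finsupp.single_apply]
  simp [coordFn]

theorem ext_coord {x y : V.carrier} (h : ∀ l, a.constr ℂ (coordFn l) x = a.constr ℂ (coordFn l) y) :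
    x = y :=
  a.ext_elem fun l => by
    have := h l
    rwa [coord_eq_constr] at this

theorem product_two (m : Fin 2 → ℤ) :
    V.product ![u, v] w m = V.mode (m 0) u (V.mode (m 1) v w) := rfl

theorem mode_lower (u v : HSer V.carrier) (n : ℕ) : ∃ L : ℤ, ∀ m < L, CongMod n (V.mode m u v) 0 := by
  induction n with
  | zero => exact ⟨0, fun _ _ _ h => absurd h (Nat.not_lt_zero _)⟩
  | succ n ih =>
    obtain ⟨L, hL⟩ := ih
    obtain ⟨L', hL'⟩ := exists_lower_bound (V.app u v n)
    refine ⟨min L L', fun m hm t ht => ?_⟩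
    rcases Nat.lt_succ_iff_lt_or_eq.1 ht with h | rfl
    · exact hL m (hm.trans_le (min_le_left _ _)) t h
    · exact hL' m (hm.trans_le (min_le_right _ _))

theorem conv_congMod {C D E : Type*} [AddCommGroup D] [AddCommGroup E] {β : C → D → E}
    (h0 : ∀ c, β c 0 = 0) {n : ℕ} {y : HSer D} (hy : CongMod n y 0) (x : HSer C) :
    CongMod n (conv β x y) 0 := fun t ht => by
  refine Finset.sum_eq_zero fun q hq => ?_
  rw [Finset.HasAntidiagonal.mem_antidiagonal] at hq
  rw [hy q.2 (by omega)]
  exact h0 _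

theorem app_congMod {n : ℕ} (hw : CongMod n w 0) : CongMod n (V.app u w) 0 :=
  conv_congMod (fun y => map_zero y) (conv_congMod (fun _ => TensorProduct.tmul_zero _ _) hw _) _

theorem app_congMod_left {n : ℕ} (hu : CongMod n u 0) : CongMod n (V.app u w) 0 :=
  conv_congMod (fun y => map_zero y)
    (by rw [conv_swap]; exact conv_congMod (fun _ => TensorProduct.zero_tmul _ _) hu _) _

theorem mode_congMod {n : ℕ} (hw : CongMod n w 0) (m : ℤ) : CongMod n (V.mode m u w) 0 :=
  fun t ht => congrArg (fun X : LaurentSeries V.carrier => X.coeff m) (app_congMod hw t ht)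

theorem mode_congMod_left {n : ℕ} (hu : CongMod n u 0) (m : ℤ) : CongMod n (V.mode m u w) 0 :=
  fun t ht => congrArg (fun X : LaurentSeries V.carrier => X.coeff m) (app_congMod_left hu t ht)

/-- The coefficients of the opposite product. -/
def oppCoeff (V : VAData.{u}) (S : Op Lau (V.carrier ⊗[ℂ] V.carrier) (V.carrier ⊗[ℂ] V.carrier))
    (v u w : HSer V.carrier) (m : Fin 2 → ℤ) : HSer V.carrier :=
  (oppositeProduct V S v u w).map fun f => (f.coeff (m 0)).coeff (m 1)

theorem oppCoeff_lower (n : ℕ) : ∃ L : ℤ, ∀ m : Fin 2 → ℤ, m 0 < L → CongMod n (oppCoeff V S v u w m) 0 := by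
  induction n with
  | zero => exact ⟨0, fun _ _ _ h => absurd h (Nat.not_lt_zero _)⟩
  | succ n ih =>
    obtain ⟨L, hL⟩ := ih
    obtain ⟨L', hL'⟩ := exists_lower_bound (oppositeProduct V S v u w n)
    refine ⟨min L L', fun m hm t ht => ?_⟩
    rcases Nat.lt_succ_iff_lt_or_eq.1 ht with h | rfl
    · exact hL m (hm.trans_le (min_le_left _ _)) t h
    · exact congrArg (fun X : LaurentSeries V.carrier => X.coeff (m 1))
        (hL' (m 0) (hm.trans_le (min_le_right _ _)))

/-- If two distributions, one of them bounded below in `z₂` and the other in `z₁`, agree after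
multiplication by a power of `z₁ - z₂`, then the common product is bounded below in both
variables. -/
theorem isLaurentMod_of_local {n k : ℕ} (h : ∀ m : Fin 2 → ℤ, CongMod n
    (polyMul (vandermondePow 2 k) (V.product ![u, v] w) m)
    (polyMul (vandermondePow 2 k) (oppCoeff V S v u w) m)) :
    IsLaurentMod n (polyMul (vandermondePow 2 k) (V.product ![u, v] w)) := by
  obtain ⟨L, hL⟩ := mode_lower v w n
  obtain ⟨L', hL'⟩ := oppCoeff_lower (V := V) (S := S) (v := v) (u := u) (w := w) n
  refine ⟨min L L', fun m hm t ht => ?_⟩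
  have h1 : ∃ i, m i < min L L' := hm
  rw [Fin.exists_fin_two] at h1
  rcases h1 with h1 | h1
  · rw [h m t ht, hser_polyMul_apply]
    exact polyMul_eq_zero_of_lt (fun m hm => hL' m hm t ht) _ m (h1.trans_le (min_le_right _ _))
  · rw [hser_polyMul_apply]
    exact polyMul_eq_zero_of_lt (fun m hm => mode_congMod (hL _ hm) _ t ht) _ m
      (h1.trans_le (min_le_left _ _))

variable {φ : I → ℂ}

theorem triSub_pow_genTri_fst (k t : ℕ) (m : Fin 2 → ℤ) :
    (triSub ^ k * genTri a V.Y S φ u v w t).1.coeff (m 1) (m 0) =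
      a.constr ℂ φ (polyMul (vandermondePow 2 k) (V.product ![u, v] w) m t) := by
  rw [← vandermondePow_mul_fst, hser_polyMul_apply, polyMul_map]
  exact polyMul_congr _ _ fun m => genTri_fst _ _ _ _ _ _

theorem triSub_pow_genTri_snd (k t : ℕ) (m : Fin 2 → ℤ) :
    (triSub ^ k * genTri a V.Y S φ u v w t).2.1.coeff (m 0) (m 1) =
      a.constr ℂ φ (polyMul (vandermondePow 2 k) (oppCoeff V S v u w) m t) := by
  rw [← vandermondePow_mul_snd, hser_polyMul_apply, polyMul_map]
  exact polyMul_congr _ _ fun m => genTri_snd _ _ _ _ _ _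

theorem genTri_iter (q p : ℤ) (t : ℕ) :
    (genTri a V.Y S φ u v w t).2.2.coeff q p = a.constr ℂ φ (V.mode p (V.mode q u v) w t) :=
  genTri_thd _ _ _ _ _ _

theorem map_shiftCoeff {M : Type*} [AddCommGroup M] [Module ℂ M] (ℓ : M →ₗ[ℂ] ℂ)
    {G : (Fin 2 → ℤ) → M} {N : ℤ} (hG : ∀ m, (∃ i, m i < N) → G m = 0) (q p : ℤ) :
    ℓ (shiftCoeff G q p) = if 0 ≤ q then
      ∑ a ∈ Finset.Icc N (p + q - N), (Ring.choose a q.toNat : ℤ) * ℓ (G ![a, p + q - a]) else 0 := by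
  rw [shiftCoeff_eq_sum hG]
  split_ifs
  · rw [map_sum]
    exact Finset.sum_congr rfl fun a _ => by rw [map_zsmul, zsmul_eq_mul]
  · exact map_zero _

theorem MeroCorr.of_slocal (hV : V.IsNonlocal) (hS : SLocal V S) : MeroCorr a V.Y S := by
  intro l i i' i'' t
  have h0 : corrTri a V.Y S (coordFn l) i i' i'' =
      genTri a V.Y S (coordFn l) (const (a i)) (const (a i')) (const (a i'')) := by
    rw [genTri, vpr_const, vpr_const, vpr_const]
  rw [h0]
  obtain ⟨k, hk⟩ := hS (const (a i)) (const (a i')) (t + 1)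
  have hL := fun w => isLaurentMod_of_local (w := w) (hk w)
  obtain ⟨N, hN⟩ := hL (const (a i''))
  refine ⟨k, N, ?_, ?_, ?_, ?_⟩
  · intro n hn m
    refine (triSub_pow_genTri_fst k t ![m, n]).trans ?_
    rw [hN _ ⟨1, hn⟩ t (Nat.lt_succ_self t)]
    exact map_zero _
  · intro n m hm
    refine (triSub_pow_genTri_fst k t ![m, n]).trans ?_
    rw [hN _ ⟨0, hm⟩ t (Nat.lt_succ_self t)]
    exact map_zero _
  · intro n m
    refine (triSub_pow_genTri_snd k t ![n, m]).trans
      (Eq.trans ?_ (triSub_pow_genTri_fst k t ![n, m]).symm)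
    exact congrArg _ (hk _ _ t (Nat.lt_succ_self t)).symm
  · intro q p
    rw [triSub_pow_mul_thd, genTri_iter, ← hV.assoc _ _ _ k hL _ _ _ t (Nat.lt_succ_self t),
      map_shiftCoeff _ fun m hm => hN m hm t (Nat.lt_succ_self t), sub_add_cancel]
    refine if_congr Iff.rfl (Finset.sum_congr rfl fun b _ => ?_) rfl
    exact congrArg _ (triSub_pow_genTri_fst k t ![b, p + q - b]).symm

theorem MeroCorr.slocal (h : MeroCorr a V.Y S) : SLocal V S := by
  intro u v n
  obtain ⟨L, hL⟩ := mode_lower u v n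
  refine ⟨(-L).toNat, fun w m t ht => ext_coord (a := a) fun l => ?_⟩
  obtain ⟨N, hN⟩ := triSub_pow_mul_mem (genTri_mem_mero h l u v w t) (-L).toNat fun q hq p => by
    rw [genTri_iter, mode_congMod_left (hL q (by omega)) p t ht]
    exact map_zero _
  refine (triSub_pow_genTri_fst (S := S) _ t m).symm.trans
    ((hN.swap (m 0) (m 1)).symm.trans (triSub_pow_genTri_snd _ t m))

theorem triSub_pow_mul_cancel {e e' : Tri} (k : ℕ) (h : triSub ^ k * e = triSub ^ k * e') :
    e = e' := by
  induction k with
  | zero => simpa using h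
  | succ k ih => exact ih (triSub_mul_cancel (by rwa [pow_succ', mul_assoc, mul_assoc] at h))

/-- A triple in `mero` whose first component is bounded below consists of the expansions of a
Laurent series: the pole along `z₁ = z₂` cannot be absent from one of the components only. -/
theorem expands_of_mero {e : Tri} (he : e ∈ mero) {N : ℤ} (h : ∀ n < N, ∀ m, e.1.coeff n m = 0)
    (h' : ∀ n, ∀ m < N, e.1.coeff n m = 0) : Expands N e := by
  obtain ⟨e', hE, he'⟩ := exists_expands (fun n m => e.1.coeff n m) N h h'
  have h1 : e'.1 = e.1 := Lau₂.ext he'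
  obtain ⟨k, L, hk⟩ := he
  obtain ⟨L', hk'⟩ := expansions.mul_mem (pow_mem triSub_mem k) ⟨N, hE⟩
  have h2 : triSub ^ k * e' = triSub ^ k * e := hk'.unique hk (congrArg ((triSub ^ k).1 * ·) h1)
  rwa [← triSub_pow_mul_cancel k h2]

theorem MeroCorr.assoc (h : MeroCorr a V.Y S) (n k : ℕ)
    (hk : ∀ w, IsLaurentMod n (polyMul (vandermondePow 2 k) (V.product ![u, v] w)))
    (w : HSer V.carrier) (q p : ℤ) (t : ℕ) (ht : t < n) :
    shiftCoeff (fun m => polyMul (vandermondePow 2 k) (V.product ![u, v] w) m t) (q + k) p =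
      V.mode p (V.mode q u v) w t := by
  obtain ⟨N, hN⟩ := hk w
  refine ext_coord (a := a) fun l => ?_
  have hE : Expands N (triSub ^ k * genTri a V.Y S (coordFn l) u v w t) := by
    refine expands_of_mero (mero.mul_mem (expansions_le_mero (pow_mem triSub_mem k))
      (genTri_mem_mero h l u v w t)) (fun n hn m => ?_) fun n m hm => ?_
    · refine (triSub_pow_genTri_fst k t ![m, n]).trans ?_
      rw [hN _ ⟨1, hn⟩ t ht]
      exact map_zero _
    · refine (triSub_pow_genTri_fst k t ![m, n]).trans ?_
      rw [hN _ ⟨0, hm⟩ t ht]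
      exact map_zero _
  have h1 := hE.shift (q + k) p
  rw [triSub_pow_mul_thd, add_sub_cancel_right, genTri_iter] at h1
  rw [h1, map_shiftCoeff _ fun m hm => hN m hm t ht]
  refine if_congr Iff.rfl (Finset.sum_congr rfl fun b _ => ?_) rfl
  exact congrArg _ (triSub_pow_genTri_fst k t ![b, p + (q + k) - b]).symm

end LocalityAssoc

/-! ### Compatibility of several vertex operators -/

section FinitePoles

variable {M M' : Type*} [AddCommGroup M] [Module ℂ M] [AddCommGroup M'] [Module ℂ M'] {r r' l : ℕ}

theorem polyMul_rename_of_injective {f : Fin r → Fin r'} (hf : Function.Injective f)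
    (p : MvPolynomial (Fin r) ℂ) (D : (Fin r' → ℤ) → M) (m : Fin r' → ℤ) :
    polyMul (MvPolynomial.rename f p) D m =
      polyMul p (fun x => D (Function.extend f x m)) fun j => m (f j) := by
  refine polyMul_rename f (fun x => Function.extend f x m) m (fun s => funext fun i => ?_) p D
  by_cases hi : ∃ j, f j = i
  · obtain ⟨j, rfl⟩ := hi
    rw [hf.extend_apply, Finsupp.mapDomain_apply hf]
  · rw [Function.extend_apply' _ _ _ hi, Finsupp.mapDomain_of_notMem_range _ _ hi]
    simp

/-- `∏_{j > 0} (z₀ - z_j)^k`. -/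
def firstPow (l k : ℕ) : MvPolynomial (Fin (l + 1)) ℂ :=
  ∏ j : Fin l, (MvPolynomial.X 0 - MvPolynomial.X j.succ) ^ k

theorem firstPow_add (l k d : ℕ) : firstPow l (k + d) = firstPow l d * firstPow l k := by
  simp only [firstPow, ← Finset.prod_mul_distrib]
  exact Finset.prod_congr rfl fun j _ => by rw [add_comm k d, pow_add]

theorem polyMul_firstPow_of_le {k k' : ℕ} (hk : k ≤ k') {N : ℤ} {D : (Fin (l + 1) → ℤ) → M}
    (h : ∀ m, m 0 < N → polyMul (firstPow l k) D m = 0) (m : Fin (l + 1) → ℤ) (hm : m 0 < N) :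
    polyMul (firstPow l k') D m = 0 := by
  obtain ⟨d, rfl⟩ := Nat.exists_eq_add_of_le hk
  rw [firstPow_add, polyMul_mul]
  exact polyMul_eq_zero_of_lt h _ _ hm

/-- The families `G w` of distributions in `z₁, …, z_l` over `M((z₀))` for which
`∏_j (z₀ - z_j)^k G w`, with `k` independent of `w`, has exponents of `z₀` bounded below. -/
def finitePoles (l : ℕ) (W M : Type*) [AddCommGroup M] [Module ℂ M] :
    Submodule ℂ (W → (Fin l → ℤ) → LaurentSeries M) where
  carrier := {G | ∃ k : ℕ, ∀ w, ∃ N : ℤ, ∀ m, m 0 < N →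
    polyMul (firstPow l k) (fun m => (G w (Fin.tail m)).coeff (m 0)) m = 0}
  add_mem' := by
    rintro G G' ⟨k, hk⟩ ⟨k', hk'⟩
    refine ⟨max k k', fun w => ?_⟩
    obtain ⟨N, hN⟩ := hk w
    obtain ⟨N', hN'⟩ := hk' w
    refine ⟨min N N', fun m hm => (polyMul_add_right _ _ _ _).trans ?_⟩
    rw [polyMul_firstPow_of_le (le_max_left k k') hN m (hm.trans_le (min_le_left _ _)),
      polyMul_firstPow_of_le (le_max_right k k') hN' m (hm.trans_le (min_le_right _ _)), add_zero]
  zero_mem' := ⟨0, fun _ => ⟨0, fun _ _ => Finset.sum_eq_zero fun _ _ => smul_zero _⟩⟩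
  smul_mem' := by
    rintro c G ⟨k, hk⟩
    refine ⟨k, fun w => ?_⟩
    obtain ⟨N, hN⟩ := hk w
    refine ⟨N, fun m hm => (polyMul_smul_right _ _ _ _).trans ?_⟩
    rw [hN m hm, smul_zero]

variable {W : Type*}

theorem finitePoles_laurMap (g : M →ₗ[ℂ] M') {G : W → (Fin l → ℤ) → LaurentSeries M}
    (hG : G ∈ finitePoles l W M) : (fun w m => laurMap g (G w m)) ∈ finitePoles l W M' := by
  obtain ⟨k, hk⟩ := hG
  refine ⟨k, fun w => ?_⟩
  obtain ⟨N, hN⟩ := hk w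
  refine ⟨N, fun m hm => ?_⟩
  refine (polyMul_map g (firstPow l k) (fun m => (G w (Fin.tail m)).coeff (m 0)) m).symm.trans ?_
  rw [hN m hm, map_zero]

theorem finitePoles_cauchy {R : Type*} [AddCommGroup R] [Module ℂ R] (β : R →ₗ[ℂ] M →ₗ[ℂ] M')
    (r : LaurentSeries R) {G : W → (Fin l → ℤ) → LaurentSeries M}
    (hG : G ∈ finitePoles l W M) : (fun w m => cauchy β r (G w m)) ∈ finitePoles l W M' := by
  obtain ⟨k, hk⟩ := hG
  obtain ⟨L, hL⟩ := exists_lower_bound r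
  refine ⟨k, fun w => ?_⟩
  obtain ⟨N, hN⟩ := hk w
  refine ⟨N + L, fun m hm => ?_⟩
  -- A common lower bound for the finitely many series involved.
  obtain ⟨L', hL'⟩ : ∃ L' : ℤ, ∀ s ∈ (firstPow l k).support, ∀ i < L',
      (G w (Fin.tail fun i => m i - (s i : ℤ))).coeff i = 0 := by
    choose B hB using fun s : Fin (l + 1) →₀ ℕ =>
      exists_lower_bound (G w (Fin.tail fun i => m i - (s i : ℤ)))
    obtain ⟨L', hL'⟩ := ((firstPow l k).support.image B).bddBelow
    exact ⟨L', fun s hs i hi => hB s i (hi.trans_le (hL' (Finset.mem_image_of_mem B hs)))⟩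
  have h1 : ∀ s ∈ (firstPow l k).support,
      (cauchy β r (G w (Fin.tail fun i => m i - (s i : ℤ)))).coeff (m 0 - (s 0 : ℤ)) =
        ∑ b ∈ Finset.Icc L (m 0 - L'), β (r.coeff b)
          ((G w (Fin.tail fun i => m i - (s i : ℤ))).coeff (m 0 - (s 0 : ℤ) - b)) := by
    intro s hs
    rw [cauchy_coeff_Icc β hL (hL' s hs)]
    refine Finset.sum_subset (Finset.Icc_subset_Icc le_rfl (by omega)) fun b hb hb' => ?_
    rw [Finset.mem_Icc] at hb hb'
    rw [hL' s hs _ (by omega), map_zero]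
  have h2 : polyMul (firstPow l k) (fun m => (cauchy β r (G w (Fin.tail m))).coeff (m 0)) m =
      ∑ b ∈ Finset.Icc L (m 0 - L'), β (r.coeff b) (polyMul (firstPow l k)
        (fun m => (G w (Fin.tail m)).coeff (m 0)) (Function.update m 0 (m 0 - b))) := by
    simp only [polyMul, map_sum, map_smul]
    rw [Finset.sum_comm]
    refine Finset.sum_congr rfl fun s hs => ?_
    rw [h1 s hs, Finset.smul_sum]
    refine Finset.sum_congr rfl fun b _ => ?_
    have h3 : (Fin.tail fun i => Function.update m 0 (m 0 - b) i - (s i : ℤ)) =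
        Fin.tail fun i => m i - (s i : ℤ) := by
      funext i
      simp [Fin.tail]
    rw [h3, Function.update_self, sub_right_comm]
  rw [h2]
  refine Finset.sum_eq_zero fun b hb => ?_
  rw [Finset.mem_Icc] at hb
  rw [hN _ (by rw [Function.update_self]; omega), map_zero]

end FinitePoles

section OppositeFormula

variable {V : VAData.{u}} {S : Op Lau (V.carrier ⊗[ℂ] V.carrier) (V.carrier ⊗[ℂ] V.carrier)}

/-- The operator `v ⊗ u ↦ Y(v, z₂) Y(u, z₁) x`. -/
def compYAt (V : VAData.{u}) (x : HSer V.carrier) :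
    HSer (V.carrier ⊗[ℂ] V.carrier →ₗ[ℂ] LaurentSeries (LaurentSeries V.carrier)) :=
  conv (fun yy x => yy ∘ₗ (TensorProduct.assoc ℂ _ _ _).toLinearMap ∘ₗ
    (TensorProduct.mk ℂ (V.carrier ⊗[ℂ] V.carrier) V.carrier).flip x) (compY V.Y) x

theorem oppositeProduct_eq (v u x : HSer V.carrier) : oppositeProduct V S v u x =
    conv (fun y p => laurSMul₂ (p.lTensor Lau₂ y))
      (conv (fun s p => s p) S.atDiff (conv (fun a b => a ⊗ₜ[ℂ] b) v u)) (compYAt V x) := by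
  have h1 : oppositeProduct V S v u x = conv (fun yy Z => laurSMul₂ (yy.lTensor Lau₂ Z))
      (compY V.Y) (conv (fun l X => l X) (Op.leg12 V.carrier S.atDiff)
        (conv (fun a b => a ⊗ₜ[ℂ] b) v (conv (fun a b => a ⊗ₜ[ℂ] b) u x))) :=
    conv_assoc (γ := fun (z : V.carrier ⊗[ℂ] (V.carrier ⊗[ℂ] V.carrier) →ₗ[ℂ] _) x => z x)
      (δ := fun (l : V.carrier ⊗[ℂ] (V.carrier ⊗[ℂ] V.carrier) →ₗ[ℂ] _) X => l X)
      (fun _ => rfl) (fun _ _ _ => rfl) (fun _ => by rw [map_zero, map_zero])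
      (fun _ _ _ => by rw [map_add, map_add]) (fun _ _ _ => rfl) _ _ _
  have h2 : conv (fun a b => a ⊗ₜ[ℂ] b) v (conv (fun a b => a ⊗ₜ[ℂ] b) u x) =
      conv (fun p x => TensorProduct.assoc ℂ V.carrier V.carrier V.carrier (p ⊗ₜ[ℂ] x))
        (conv (fun a b => a ⊗ₜ[ℂ] b) v u) x :=
    (conv_assoc (γ := fun p x => TensorProduct.assoc ℂ V.carrier V.carrier V.carrier (p ⊗ₜ[ℂ] x))
      (fun _ => by rw [TensorProduct.zero_tmul, map_zero])
      (fun _ _ _ => by rw [TensorProduct.add_tmul, map_add]) (fun _ => TensorProduct.tmul_zero _ _)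
      (fun _ _ _ => TensorProduct.tmul_add _ _ _) (fun _ _ _ => rfl) _ _ _).symm
  have h3 : conv (fun l X => l X) (Op.leg12 V.carrier S.atDiff)
      (conv (fun p x => TensorProduct.assoc ℂ V.carrier V.carrier V.carrier (p ⊗ₜ[ℂ] x))
        (conv (fun a b => a ⊗ₜ[ℂ] b) v u) x) =
      conv (fun Z x => (TensorProduct.assoc ℂ V.carrier V.carrier V.carrier).toLinearMap.lTensor Lau₂
          (TensorProduct.assoc ℂ Lau₂ (V.carrier ⊗[ℂ] V.carrier) V.carrier (Z ⊗ₜ[ℂ] x)))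
        (conv (fun s p => s p) S.atDiff (conv (fun a b => a ⊗ₜ[ℂ] b) v u)) x :=
    (conv_assoc (γ := fun Z x =>
        (TensorProduct.assoc ℂ V.carrier V.carrier V.carrier).toLinearMap.lTensor Lau₂
          (TensorProduct.assoc ℂ Lau₂ (V.carrier ⊗[ℂ] V.carrier) V.carrier (Z ⊗ₜ[ℂ] x)))
      (ε := fun (s : V.carrier ⊗[ℂ] V.carrier →ₗ[ℂ] Lau₂ ⊗[ℂ] (V.carrier ⊗[ℂ] V.carrier)) X =>
        (TensorProduct.assoc ℂ V.carrier V.carrier V.carrier).toLinearMap.lTensor Lau₂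
          (TensorProduct.assoc ℂ Lau₂ (V.carrier ⊗[ℂ] V.carrier) V.carrier
            (s.rTensor V.carrier ((TensorProduct.assoc ℂ _ _ _).symm X))))
      (fun _ => by rw [TensorProduct.zero_tmul, map_zero, map_zero])
      (fun _ _ _ => by rw [TensorProduct.add_tmul, map_add, map_add])
      (fun _ => by simp only [map_zero]) (fun _ _ _ => by simp only [map_add])
      (fun s p x => by rw [LinearEquiv.symm_apply_apply, LinearMap.rTensor_tmul]) _ _ _).symm
  rw [h1, h2, h3]
  refine conv_left_comm (fun _ => by simp) (fun _ _ _ => by simp) (fun _ => by simp)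
    (fun _ _ _ => by simp [LinearMap.lTensor_add]) (fun yy Z x => ?_) _ _ _
  congr 1
  induction Z with
  | zero => simp
  | add Z Z' h h' => simp only [TensorProduct.add_tmul, map_add, h, h']
  | tmul r p => simp

theorem compYAt_tmul (x : HSer V.carrier) (v u : V.carrier) (t : ℕ) : compYAt V x t (v ⊗ₜ u) =
    ∑ q ∈ Finset.HasAntidiagonal.antidiagonal t,
      laurMap (V.Y q.1 ∘ₗ TensorProduct.mk ℂ _ _ v) (V.app (const u) x q.2) := by
  have h1 : (compYAt V x).map (fun p => p (v ⊗ₜ u)) =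
      conv (fun y X => laurMap (y ∘ₗ TensorProduct.mk ℂ _ _ v) X) V.Y (V.app (const u) x) := by
    have h2 : (compYAt V x).map (fun p => p (v ⊗ₜ u)) =
        conv (fun yy x => yy (v ⊗ₜ (u ⊗ₜ x))) (compY V.Y) x :=
      map_conv (LinearMap.applyₗ (v ⊗ₜ u)) _ _ _
    rw [h2, VAData.app, conv_const_left fun _ => TensorProduct.zero_tmul _ _]
    refine conv_assoc (γ := fun (yy : V.carrier ⊗[ℂ] (V.carrier ⊗[ℂ] V.carrier) →ₗ[ℂ] _) x =>
      yy (v ⊗ₜ (u ⊗ₜ x))) (δ := fun (y : V.carrier ⊗[ℂ] V.carrier →ₗ[ℂ] _) x => y (u ⊗ₜ x))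
      (ε := fun (y : V.carrier ⊗[ℂ] V.carrier →ₗ[ℂ] _) X =>
        laurMap (y ∘ₗ TensorProduct.mk ℂ _ _ v) X) (fun _ => rfl) (fun _ _ _ => rfl) (fun _ => map_zero _)
      (fun _ _ _ => map_add _ _ _) (fun y y' x => ?_) _ _ _
    change laurMap y (cauchy (TensorProduct.mk ℂ _ _) (HahnSeries.single (0 : ℤ) v)
      (y' (u ⊗ₜ x))) = _
    rw [cauchy_single_left]
    rfl
  exact congrFun h1 t

theorem oppositeProduct_mem_finitePoles {l : ℕ} {W : Type*} {X : W → (Fin l → ℤ) → HSer V.carrier}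
    (h : ∀ u t, (fun w m => V.app u (X w m) t) ∈ finitePoles l W V.carrier) (v u : HSer V.carrier)
    (t : ℕ) : (fun w m => oppositeProduct V S v u (X w m) t) ∈
      finitePoles l W (LaurentSeries V.carrier) := by
  have h1 : (fun w m => oppositeProduct V S v u (X w m) t) =
      ∑ q ∈ Finset.HasAntidiagonal.antidiagonal t, fun w m =>
        laurSMul₂ ((compYAt V (X w m) q.2).lTensor Lau₂
          (conv (fun s p => s p) S.atDiff (conv (fun a b => a ⊗ₜ[ℂ] b) v u) q.1)) := by
    funext w m
    rw [oppositeProduct_eq, conv_apply, Finset.sum_apply, Finset.sum_apply]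
  rw [h1]
  refine Submodule.sum_mem _ fun q _ => ?_
  generalize conv (fun s p => s p) S.atDiff (conv (fun a b => a ⊗ₜ[ℂ] b) v u) q.1 = y
  induction y with
  | zero => simp only [map_zero]; exact (finitePoles l W (LaurentSeries V.carrier)).zero_mem
  | add y y' hy hy' => simp only [map_add]; exact Submodule.add_mem _ hy hy'
  | tmul r p =>
    have h2 : (fun w m => compYAt V (X w m) q.2 p) ∈ finitePoles l W (LaurentSeries V.carrier) := by
      induction p with
      | zero => simp only [map_zero]; exact (finitePoles l W (LaurentSeries V.carrier)).zero_mem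
      | add y y' hy hy' => simp only [map_add]; exact Submodule.add_mem _ hy hy'
      | tmul v' u' =>
        have h3 : (fun w m => compYAt V (X w m) q.2 (v' ⊗ₜ u')) =
            ∑ q ∈ Finset.HasAntidiagonal.antidiagonal q.2, fun w m =>
              laurMap (V.Y q.1 ∘ₗ TensorProduct.mk ℂ _ _ v') (V.app (const u') (X w m) q.2) := by
          funext w m
          rw [compYAt_tmul, Finset.sum_apply, Finset.sum_apply]
        rw [h3]
        exact Submodule.sum_mem _ fun q _ => finitePoles_laurMap _ (h _ _)
    exact finitePoles_cauchy _ _ h2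

theorem mode_eq_coeff (u x : HSer V.carrier) (m : ℤ) (t : ℕ) :
    V.mode m u x t = (V.app u x t).coeff m := rfl

/-- The map `w ↦ Y(u, z) w`. -/
def appL (V : VAData.{u}) (u : HSer V.carrier) :
    HSer V.carrier →ₗ[ℂ] HSer (LaurentSeries V.carrier) where
  toFun := V.app u
  map_add' w w' := by
    rw [VAData.app, conv_add_right fun _ _ _ => TensorProduct.tmul_add _ _ _,
      conv_add_right fun _ _ _ => map_add _ _ _]
    rfl
  map_smul' c w := by
    funext t
    change V.app u (c • w) t = c • V.app u w t
    simp only [VAData.app, conv_apply, Finset.smul_sum, ← map_smul, ← TensorProduct.tmul_smul]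
    rfl

/-- The map `w ↦ u_{-m-1} w`. -/
def modeL (V : VAData.{u}) (m : ℤ) (u : HSer V.carrier) : HSer V.carrier →ₗ[ℂ] HSer V.carrier where
  toFun := V.mode m u
  map_add' w w' := congrArg (fun f => f.map fun X : LaurentSeries V.carrier => X.coeff m)
    ((appL V u).map_add w w')
  map_smul' c w := congrArg (fun f => f.map fun X : LaurentSeries V.carrier => X.coeff m)
    ((appL V u).map_smul c w)

theorem product_cons {l : ℕ} (u : HSer V.carrier) (v : Fin l → HSer V.carrier) (w : HSer V.carrier)
    (m : Fin (l + 1) → ℤ) : V.product (Fin.cons u v : Fin (l + 1) → HSer V.carrier) w m =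
      V.mode (m 0) u (V.product v w (Fin.tail m)) := by
  rw [VAData.product, Fin.foldr_succ]
  rfl

theorem firstPow_succ (l k : ℕ) : firstPow (l + 1) k =
    MvPolynomial.rename (Fin.succAbove (1 : Fin (l + 2))) (firstPow l k) *
      MvPolynomial.rename ![0, 1] (vandermondePow 2 k) := by
  rw [vandermondePow_two, firstPow, firstPow, Fin.prod_univ_succ, mul_comm, map_prod, map_pow,
    map_sub, MvPolynomial.rename_X, MvPolynomial.rename_X]
  refine congrArg₂ _ (Finset.prod_congr rfl fun j _ => ?_) rfl
  rw [map_pow, map_sub, MvPolynomial.rename_X, MvPolynomial.rename_X]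
  rfl

theorem vandermondePow_two_add (k d : ℕ) :
    vandermondePow 2 (k + d) = vandermondePow 2 d * vandermondePow 2 k := by
  rw [vandermondePow_two, vandermondePow_two, vandermondePow_two, add_comm, pow_add]

/-- By `S`-locality, `Y(u, z₀)` can be moved past the first of the other vertex operators, so that
the finiteness of the poles in `z₀` follows by induction. -/
theorem product_mem_finitePoles (hS : SLocal V S) {l : ℕ} (v : Fin l → HSer V.carrier)
    (u : HSer V.carrier) (t : ℕ) :
    (fun w m => V.app u (V.product v w m) t) ∈ finitePoles l (HSer V.carrier) V.carrier := by
  induction l generalizing u t with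
  | zero =>
    refine ⟨0, fun w => ?_⟩
    obtain ⟨N, hN⟩ := exists_lower_bound (V.app u w t)
    exact ⟨N, fun m hm => polyMul_eq_zero_of_lt (fun m hm => hN (m 0) hm) _ m hm⟩
  | succ l ih =>
    obtain ⟨v0, v', rfl⟩ : ∃ v0 v', v = Fin.cons v0 v' := ⟨v 0, Fin.tail v, (Fin.cons_self_tail v).symm⟩
    obtain ⟨k₁, hk₁⟩ := hS u v0 (t + 1)
    obtain ⟨k₂, hk₂⟩ := oppositeProduct_mem_finitePoles (S := S) (fun u t => ih v' u t) v0 u t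
    have hinj : Function.Injective ![(0 : Fin (l + 2)), 1] := by
      intro i j h
      fin_cases i <;> fin_cases j <;> simp_all
    refine ⟨k₁ + k₂, fun w => ?_⟩
    obtain ⟨N, hN⟩ := hk₂ w
    refine ⟨N, fun m hm => ?_⟩
    have h1 : ∀ m : Fin (l + 2) → ℤ, polyMul (MvPolynomial.rename ![0, 1] (vandermondePow 2 (k₁ + k₂)))
        (fun m => (V.app u (V.product (Fin.cons v0 v' : Fin (l + 1) → HSer V.carrier) w
          (Fin.tail m)) t).coeff (m 0)) m =
        polyMul (MvPolynomial.rename ![0, 1] (vandermondePow 2 (k₁ + k₂))) (fun m =>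
          ((oppositeProduct V S v0 u (V.product v' w (Fin.tail (Fin.tail m))) t).coeff
            (m 0)).coeff (m 1)) m := by
      intro m
      have e0 : ∀ x : Fin 2 → ℤ, Function.extend ![(0 : Fin (l + 2)), 1] x m 0 = x 0 :=
        fun x => hinj.extend_apply x m 0
      have e1 : ∀ x : Fin 2 → ℤ, Function.extend ![(0 : Fin (l + 2)), 1] x m 1 = x 1 :=
        fun x => hinj.extend_apply x m 1
      have e2 : ∀ x : Fin 2 → ℤ, Fin.tail (Fin.tail (Function.extend ![(0 : Fin (l + 2)), 1] x m)) =
          Fin.tail (Fin.tail m) := fun x => funext fun i => by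
        refine Function.extend_apply' _ _ _ ?_
        rintro ⟨j, hj⟩
        fin_cases j
        · exact absurd hj (Fin.succ_ne_zero _).symm
        · have hj' : Fin.succ (0 : Fin (l + 1)) = i.succ.succ := hj
          exact absurd (Fin.succ_injective _ hj') (Fin.succ_ne_zero _).symm
      rw [polyMul_rename_of_injective hinj, polyMul_rename_of_injective hinj,
        vandermondePow_two_add, polyMul_mul, polyMul_mul]
      refine polyMul_congr _ _ fun x => ?_
      have h2 : CongMod (t + 1)
        (polyMul (vandermondePow 2 k₁) (V.product ![u, v0] (V.product v' w (Fin.tail (Fin.tail m)))) x)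
        (polyMul (vandermondePow 2 k₁) (oppCoeff V S v0 u (V.product v' w (Fin.tail (Fin.tail m)))) x) :=
        hk₁ _ x
      have h3 := h2 t (Nat.lt_succ_self t)
      rw [hser_polyMul_apply, hser_polyMul_apply] at h3
      have d1 : ∀ y : Fin 2 → ℤ, (V.app u (V.product (Fin.cons v0 v' : Fin (l + 1) → HSer V.carrier) w
          (Fin.tail (Function.extend ![(0 : Fin (l + 2)), 1] y m))) t).coeff
            (Function.extend ![(0 : Fin (l + 2)), 1] y m 0) =
          V.product ![u, v0] (V.product v' w (Fin.tail (Fin.tail m))) y t := fun y => by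
        rw [product_cons, e0, e2, product_two, mode_eq_coeff, ← e1 y]
        rfl
      have d2 : ∀ y : Fin 2 → ℤ, ((oppositeProduct V S v0 u (V.product v' w
          (Fin.tail (Fin.tail (Function.extend ![(0 : Fin (l + 2)), 1] y m)))) t).coeff
            (Function.extend ![(0 : Fin (l + 2)), 1] y m 0)).coeff
              (Function.extend ![(0 : Fin (l + 2)), 1] y m 1) =
          oppCoeff V S v0 u (V.product v' w (Fin.tail (Fin.tail m))) y t := fun y => by
        rw [e0, e1, e2]
        rfl
      rw [funext d1, funext d2, h3]
    rw [firstPow_succ, polyMul_mul, funext h1, ← polyMul_mul, mul_comm, polyMul_mul]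
    refine polyMul_eq_zero_of_lt (i := 0) (N := N) (fun m hm => ?_) _ m hm
    have e0 : ∀ x : Fin (l + 1) → ℤ,
        Function.extend (Fin.succAbove (1 : Fin (l + 2))) x m 0 = x 0 :=
      fun x => Fin.succAbove_right_injective.extend_apply x m 0
    have e1 : ∀ x : Fin (l + 1) → ℤ,
        Function.extend (Fin.succAbove (1 : Fin (l + 2))) x m 1 = m 1 :=
      fun x => Function.extend_apply' _ _ _ fun ⟨j, hj⟩ => Fin.succAbove_ne _ _ hj
    have e2 : ∀ x : Fin (l + 1) → ℤ,
        Fin.tail (Fin.tail (Function.extend (Fin.succAbove (1 : Fin (l + 2))) x m)) = Fin.tail x :=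
      fun x => funext fun i => Fin.succAbove_right_injective.extend_apply x m i.succ
    rw [polyMul_rename_of_injective Fin.succAbove_right_injective]
    simp only [e0, e1, e2]
    refine (polyMul_map (HahnSeries.coeff.linearMap (R := ℂ) (m 1)) _ (fun x : Fin (l + 1) → ℤ =>
      (oppositeProduct V S v0 u (V.product v' w (Fin.tail x)) t).coeff (x 0)) _).symm.trans ?_
    rw [polyMul_firstPow_of_le (Nat.le_add_left k₂ k₁) hN _ hm, map_zero]

theorem product_firstPow_lower (hS : SLocal V S) {l : ℕ} (v : Fin l → HSer V.carrier)
    (u : HSer V.carrier) (n : ℕ) : ∃ k : ℕ, ∀ w, ∃ N : ℤ, ∀ m, m 0 < N →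
      CongMod n (polyMul (firstPow l k)
        (V.product (Fin.cons u v : Fin (l + 1) → HSer V.carrier) w) m) 0 := by
  induction n with
  | zero => exact ⟨0, fun _ => ⟨0, fun _ _ _ h => absurd h (Nat.not_lt_zero _)⟩⟩
  | succ n ih =>
    obtain ⟨k, hk⟩ := ih
    obtain ⟨k', hk'⟩ := product_mem_finitePoles hS v u n
    refine ⟨max k k', fun w => ?_⟩
    obtain ⟨N, hN⟩ := hk w
    obtain ⟨N', hN'⟩ := hk' w
    refine ⟨min N N', fun m hm t ht => ?_⟩
    rw [hser_polyMul_apply]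
    rcases Nat.lt_succ_iff_lt_or_eq.1 ht with h | rfl
    · refine polyMul_firstPow_of_le (le_max_left k k') (fun m hm => ?_) m
        (hm.trans_le (min_le_left _ _))
      rw [← hser_polyMul_apply]
      exact hN m hm t h
    · refine polyMul_firstPow_of_le (le_max_right k k') (fun m hm => ?_) m
        (hm.trans_le (min_le_right _ _))
      refine Eq.trans (polyMul_congr _ _ fun m => ?_) (hN' m hm)
      rw [product_cons, mode_eq_coeff]

theorem vandermondePow_succ (r k : ℕ) : vandermondePow (r + 1) k =
    firstPow r k * MvPolynomial.rename Fin.succ (vandermondePow r k) := by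
  rw [vandermondePow, Fin.prod_univ_succ, firstPow, vandermondePow, map_prod]
  congr 1
  · rw [Fin.Ioi_zero_eq_map, Finset.prod_map]
    rfl
  · refine Finset.prod_congr rfl fun i _ => ?_
    rw [Fin.Ioi_succ, Finset.prod_map, map_prod]
    refine Finset.prod_congr rfl fun j _ => ?_
    rw [map_pow, map_sub, MvPolynomial.rename_X, MvPolynomial.rename_X]
    rfl

theorem vandermondePow_add (r k d : ℕ) :
    vandermondePow r (k + d) = vandermondePow r d * vandermondePow r k := by
  simp only [vandermondePow, ← Finset.prod_mul_distrib]
  exact Finset.prod_congr rfl fun i _ => Finset.prod_congr rfl fun j _ => by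
    rw [add_comm k d, pow_add]

theorem SLocal.compatible (hS : SLocal V S) (r : ℕ) (u : Fin r → HSer V.carrier) (n : ℕ) :
    ∃ k : ℕ, ∀ w, IsLaurentMod n (polyMul (vandermondePow r k) (V.product u w)) := by
  induction r with
  | zero => exact ⟨0, fun w => ⟨0, fun m ⟨i, _⟩ => i.elim0⟩⟩
  | succ r ih =>
    obtain ⟨u, v, rfl⟩ : ∃ u' v', u = Fin.cons u' v' := ⟨u 0, Fin.tail u, (Fin.cons_self_tail u).symm⟩
    obtain ⟨k₁, hk₁⟩ := ih v
    obtain ⟨k₂, hk₂⟩ := product_firstPow_lower hS v u n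
    refine ⟨k₁ + k₂, fun w => ?_⟩
    obtain ⟨N, hN⟩ := hk₁ w
    obtain ⟨N', hN'⟩ := hk₂ w
    refine ⟨min N N', fun m hm t ht => ?_⟩
    obtain ⟨i, hi⟩ := hm
    rw [hser_polyMul_apply, vandermondePow_succ]
    refine Fin.cases (fun hi => ?_) (fun i hi => ?_) i hi
    · rw [mul_comm, polyMul_mul]
      refine polyMul_eq_zero_of_lt (fun m hm => polyMul_firstPow_of_le (Nat.le_add_left k₂ k₁)
        (fun m hm => ?_) m hm) _ m (hi.trans_le (min_le_right _ _))
      rw [← hser_polyMul_apply]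
      exact hN' m hm t ht
    · rw [polyMul_mul]
      refine polyMul_eq_zero_of_lt (i := i.succ) (N := N) (fun m hm => ?_) _ m
        (hi.trans_le (min_le_left _ _))
      have e0 : ∀ x : Fin r → ℤ, Function.extend (Fin.succ : Fin r → Fin (r + 1)) x m 0 = m 0 :=
        fun x => Function.extend_apply' _ _ _ fun ⟨j, hj⟩ => Fin.succ_ne_zero j hj
      have e1 : ∀ x : Fin r → ℤ, Fin.tail (Function.extend (Fin.succ : Fin r → Fin (r + 1)) x m) = x :=
        fun x => funext fun i => (Fin.succ_injective r).extend_apply x m i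
      rw [← hser_polyMul_apply, polyMul_rename_of_injective (Fin.succ_injective r)]
      simp only [product_cons, e0, e1]
      have h1 := polyMul_map (modeL V (m 0) u) (vandermondePow r (k₁ + k₂)) (V.product v w)
        fun j => m j.succ
      refine (congrFun h1.symm t).trans (mode_congMod (fun t ht => ?_) _ t ht)
      rw [vandermondePow_add, polyMul_mul, hser_polyMul_apply]
      refine polyMul_eq_zero_of_lt (i := i) (N := N) (fun m hm => ?_) _ _ hm
      exact hN m ⟨i, hm⟩ t ht

end OppositeFormula

/-! ### Iterated twisted tensor products -/

/-- `MeroCorr` with respect to some basis. -/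
def HasMeroCorr (V : VAData.{u}) (S : Op Lau (V.carrier ⊗[ℂ] V.carrier) (V.carrier ⊗[ℂ] V.carrier)) :
    Prop :=
  ∃ (I : Type u) (a : Basis I ℂ V.carrier), MeroCorr a V.Y S

theorem HasMeroCorr.of_slocal {V : VAData.{u}}
    {S : Op Lau (V.carrier ⊗[ℂ] V.carrier) (V.carrier ⊗[ℂ] V.carrier)} (hV : V.IsNonlocal)
    (hS : SLocal V S) : HasMeroCorr V S :=
  ⟨_, Basis.ofVectorSpace ℂ V.carrier, MeroCorr.of_slocal hV hS⟩

theorem HasMeroCorr.twistedTensor {V W : VAData.{u}}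
    {SVV : Op Lau (V.carrier ⊗[ℂ] V.carrier) (V.carrier ⊗[ℂ] V.carrier)}
    {SVW : Op Lau (V.carrier ⊗[ℂ] W.carrier) (V.carrier ⊗[ℂ] W.carrier)}
    {SWV : Op Lau (W.carrier ⊗[ℂ] V.carrier) (W.carrier ⊗[ℂ] V.carrier)}
    {SWW : Op Lau (W.carrier ⊗[ℂ] W.carrier) (W.carrier ⊗[ℂ] W.carrier)}
    (hV : HasMeroCorr V SVV) (hW : HasMeroCorr W SWW) (hL : HexL V.Y SVW) (hR : HexR W.Y SVW)
    (h : Unitary SVW SWV) (h' : Unitary SWV SVW) (hYB : YangBaxter SWV SWW SVW) :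
    HasMeroCorr (HQVA.twistedTensor V W SVW)
      (Op.mergeLeft (Op.mergeRight SVV SVW) (Op.mergeRight SWV SWW)) := by
  obtain ⟨I, a, ha⟩ := hV
  obtain ⟨J, b, hb⟩ := hW
  exact ⟨I × J, a.tensorProduct b, MeroCorr.twistY ha hb hL hR h h' hYB⟩

section Blocks

variable {ι : Type*} {V : ι → VAData.{u}} {S : OpFamily V}

/-- The twisted tensor product of the members of a nonempty list. -/
def listVA (V : ι → VAData.{u}) (S : OpFamily V) (X : ι × List ι) : VAData.{u} :=
  (block V S X.1 X.2).toVA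

/-- The operators between the twisted tensor products of nonempty lists. -/
def listOp (V : ι → VAData.{u}) (S : OpFamily V) : OpFamily (listVA V S) := fun X Y =>
  blockOp V S Y.1 Y.2 X.1 X.2

theorem listOp_cons_left (i i' : ι) (K : List ι) (Y : ι × List ι) :
    listOp V S (i, i' :: K) Y = Op.mergeLeft (listOp V S (i, []) Y) (listOp V S (i', K) Y) := rfl

theorem listOp_cons_right (X : ι × List ι) (j j' : ι) (L : List ι) :
    listOp V S X (j, j' :: L) = Op.mergeRight (listOp V S X (j, [])) (listOp V S X (j', L)) := by
  obtain ⟨i, K⟩ := X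
  induction K generalizing i with
  | nil => rfl
  | cons i' K ih =>
    rw [listOp_cons_left, ih]
    exact mergeLeft_mergeRight _ _ _ _

theorem list_induction {P : ι × List ι → Prop} (base : ∀ i, P (i, []))
    (step : ∀ i i' K, P (i, []) → P (i', K) → P (i, i' :: K)) (X : ι × List ι) : P X := by
  obtain ⟨i, K⟩ := X
  induction K generalizing i with
  | nil => exact base i
  | cons i' K ih => exact step _ _ _ (base i) (ih i')

theorem list_induction₂ {P : ι × List ι → ι × List ι → Prop} (base : ∀ i j, P (i, []) (j, []))
    (left : ∀ i i' K Y, P (i, []) Y → P (i', K) Y → P (i, i' :: K) Y)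
    (right : ∀ X j j' L, P X (j, []) → P X (j', L) → P X (j, j' :: L)) (X Y : ι × List ι) : P X Y :=
  list_induction (P := fun X => P X Y)
    (fun i => list_induction (base i) (fun _ _ _ => right _ _ _ _) Y) (fun _ _ _ => left _ _ _ _) X

theorem list_unitary (hV : IsQuantumVA V S) (X Y : ι × List ι) : Unitary (listOp V S X Y) (listOp V S Y X) := by
  refine list_induction₂ (P := fun X Y => Unitary (listOp V S X Y) (listOp V S Y X))
    hV.unitarity (fun i i' K Y h h' => ?_) (fun X j j' L h h' => ?_) X Y
  · rw [listOp_cons_right]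
    exact Unitary.mergeLeft h h'
  · rw [listOp_cons_right]
    exact Unitary.mergeRight h h'

theorem list_yangBaxter (hV : IsQuantumVA V S) (X Y Z : ι × List ι) :
    YangBaxter (listOp V S X Y) (listOp V S X Z) (listOp V S Y Z) := by
  revert Y Z
  refine list_induction (P := fun X => ∀ Y Z,
    YangBaxter (listOp V S X Y) (listOp V S X Z) (listOp V S Y Z)) (fun i Y => ?_)
    (fun i i' K h h' Y Z => ?_) X
  · refine list_induction (P := fun Y => ∀ Z,
      YangBaxter (listOp V S (i, []) Y) (listOp V S (i, []) Z) (listOp V S Y Z)) (fun j Z => ?_)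
      (fun j j' L h h' Z => ?_) Y
    · refine list_induction (P := fun Z =>
        YangBaxter (listOp V S (i, []) (j, [])) (listOp V S (i, []) Z) (listOp V S (j, []) Z))
        (fun k => hV.yangBaxter i j k) (fun k k' M h h' => ?_) Z
      rw [listOp_cons_right, listOp_cons_right]
      exact YangBaxter.merge_third h h'
    · rw [listOp_cons_right]
      exact YangBaxter.merge_second (h Z) (h' Z)
  · exact YangBaxter.merge_first (h Y Z) (h' Y Z)

theorem list_vacRight (hV : IsQuantumVA V S) (X Y : ι × List ι) : VacRight (listOp V S X Y) (listVA V S Y).vac := by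
  refine list_induction₂ (P := fun X Y => VacRight (listOp V S X Y) (listVA V S Y).vac)
    hV.vac_right (fun i i' K Y h h' => VacRight.mergeLeft h h') (fun X j j' L h h' => ?_) X Y
  rw [listOp_cons_right]
  exact VacRight.mergeRight h h'

theorem list_vacLeft (hV : IsQuantumVA V S) (X Y : ι × List ι) : VacLeft (listOp V S X Y) (listVA V S X).vac := by
  refine list_induction₂ (P := fun X Y => VacLeft (listOp V S X Y) (listVA V S X).vac)
    hV.vac_left (fun i i' K Y h h' => VacLeft.mergeLeft h h') (fun X j j' L h h' => ?_) X Y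
  rw [listOp_cons_right]
  exact VacLeft.mergeRight h h'

theorem list_creates (hV : IsQuantumVA V S) (X : ι × List ι) : Creates (listVA V S X).Y (listVA V S X).vac :=
  list_induction (P := fun X => Creates (listVA V S X).Y (listVA V S X).vac)
    (fun i => ⟨fun u m => (hV.nonlocal i).vac_right_regular u m, (hV.nonlocal i).vac_right⟩)
    (fun i i' K h h' => Creates.twistY h h' (list_vacLeft hV (i, []) (i', K))) X

theorem list_vac_left (hV : IsQuantumVA V S) (X : ι × List ι) (v : HSer (listVA V S X).carrier) :
    (listVA V S X).app (listVA V S X).vac v = v.map fun x => HahnSeries.single (0 : ℤ) x :=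
  list_induction (P := fun X => ∀ v, (listVA V S X).app (listVA V S X).vac v =
      v.map fun x => HahnSeries.single (0 : ℤ) x)
    (fun i => (hV.nonlocal i).vac_left)
    (fun i i' K h h' => applyY_twistY_left h h' (list_vacRight hV (i, []) (i', K))) X v

theorem list_deriv_cons (hV : IsQuantumVA V S) (i i' : ι) (K : List ι) : (listVA V S (i, i' :: K)).deriv =
    derivTensor (listVA V S (i, [])).deriv (listVA V S (i', K)).deriv :=
  derivOf_twistY (list_creates hV (i, [])) (list_creates hV (i', K)) (list_vacLeft hV (i, []) (i', K))

theorem list_shiftLeft (hV : IsQuantumVA V S) (X Y : ι × List ι) : ShiftLeft (listOp V S X Y) (listVA V S X).deriv := by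
  refine list_induction₂ (P := fun X Y => ShiftLeft (listOp V S X Y) (listVA V S X).deriv)
    hV.shift_left (fun i i' K Y h h' => ?_) (fun X j j' L h h' => ?_) X Y
  · rw [list_deriv_cons hV]
    exact ShiftLeft.mergeLeft h h'
  · rw [listOp_cons_right]
    exact ShiftLeft.mergeRight h h'

theorem list_shiftRight (hV : IsQuantumVA V S) (X Y : ι × List ι) : ShiftRight (listOp V S X Y) (listVA V S Y).deriv := by
  refine list_induction₂ (P := fun X Y => ShiftRight (listOp V S X Y) (listVA V S Y).deriv)
    hV.shift_right (fun i i' K Y h h' => ShiftRight.mergeLeft h h') (fun X j j' L h h' => ?_) X Y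
  rw [list_deriv_cons hV, listOp_cons_right]
  exact ShiftRight.mergeRight h h'

theorem list_hexL (hV : IsQuantumVA V S) (X Y : ι × List ι) : HexL (listVA V S X).Y (listOp V S X Y) := by
  refine list_induction₂ (P := fun X Y => HexL (listVA V S X).Y (listOp V S X Y))
    hV.hexagon_left (fun i i' K Y h h' => ?_) (fun X j j' L h h' => ?_) X Y
  · exact HexL.mergeLeft (SAC := listOp V S (i, []) Y) (SBC := listOp V S (i', K) Y)
      (SCA := listOp V S Y (i, [])) (SCB := listOp V S Y (i', K))
      (SAB := listOp V S (i, []) (i', K)) h h' (list_unitary hV _ _) (list_unitary hV _ _) (list_unitary hV _ _)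
      (list_unitary hV _ _) (list_yangBaxter hV Y (i, []) (i', K))
  · rw [listOp_cons_right]
    exact HexL.mergeRight h h'

theorem list_hexR (hV : IsQuantumVA V S) (X Y : ι × List ι) : HexR (listVA V S Y).Y (listOp V S X Y) := by
  refine list_induction₂ (P := fun X Y => HexR (listVA V S Y).Y (listOp V S X Y))
    hV.hexagon_right (fun i i' K Y h h' => HexR.mergeLeft h h') (fun X j j' L h h' => ?_) X Y
  rw [listOp_cons_right]
  exact HexR.mergeRight h h' (list_yangBaxter hV X (j, []) (j', L))

theorem list_hasMeroCorr (hV : IsQuantumVA V S) (X : ι × List ι) :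
    HasMeroCorr (listVA V S X) (listOp V S X X) := by
  refine list_induction (P := fun X => HasMeroCorr (listVA V S X) (listOp V S X X))
    (fun i => .of_slocal (hV.nonlocal i) (hV.locality i)) (fun i i' K h h' => ?_) X
  rw [listOp_cons_left, listOp_cons_right, listOp_cons_right]
  exact HasMeroCorr.twistedTensor h h' (list_hexL hV (i, []) (i', K))
    (list_hexR hV (i, []) (i', K)) (list_unitary hV (i, []) (i', K)) (list_unitary hV (i', K) (i, []))
    (list_yangBaxter hV (i', K) (i, []) (i', K))

theorem list_isQuantumVA (hV : IsQuantumVA V S) : IsQuantumVA (listVA V S) (listOp V S) where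
  nonlocal X := by
    obtain ⟨I, a, ha⟩ := list_hasMeroCorr hV X
    exact {
      vac_left := list_vac_left hV X
      vac_right_regular := (list_creates hV X).regular
      vac_right := (list_creates hV X).lim
      compatible := ha.slocal.compatible
      assoc := fun u v n k hk w q p t ht => ha.assoc n k hk w q p t ht }
  vac_right := list_vacRight hV
  vac_left := list_vacLeft hV
  shift_left := list_shiftLeft hV
  shift_right := list_shiftRight hV
  unitarity := list_unitary hV
  locality X := by
    obtain ⟨I, a, ha⟩ := list_hasMeroCorr hV X
    exact ha.slocal
  hexagon_left := list_hexL hV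
  hexagon_right := list_hexR hV
  yangBaxter := list_yangBaxter hV

end Blocks

end

end HQVA

theorem proposition4p10 (n : ℕ) (V : Fin n → HQVA.VAData.{u}) (S : HQVA.OpFamily V)
    (hV : HQVA.IsQuantumVA V S)
    (k : ℕ) (K : Fin k → Finset (Fin n)) (hne : ∀ a, (K a).Nonempty)
    (hdisj : ∀ a b, a ≠ b → Disjoint (K a) (K b)) (hcover : ∀ i, ∃ a, i ∈ K a) :
    HQVA.IsQuantumVA (fun a => HQVA.blockVA V S (K a) (hne a))
      (fun a b => HQVA.blockS V S (K a) (K b) (hne a) (hne b)) := by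
  have h := HQVA.list_isQuantumVA hV
  let X : Fin k → Fin n × List (Fin n) := fun a =>
    ((K a).min' (hne a), ((K a).erase ((K a).min' (hne a))).sort (· ≤ ·))
  exact {
    nonlocal := fun a => h.nonlocal (X a)
    vac_right := fun a b => h.vac_right (X a) (X b)
    vac_left := fun a b => h.vac_left (X a) (X b)
    shift_left := fun a b => h.shift_left (X a) (X b)
    shift_right := fun a b => h.shift_right (X a) (X b)
    unitarity := fun a b => h.unitarity (X a) (X b)
    locality := fun a => h.locality (X a)
    hexagon_left := fun a b => h.hexagon_left (X a) (X b)
    hexagon_right := fun a b => h.hexagon_right (X a) (X b)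
    yangBaxter := fun a b c => h.yangBaxter (X a) (X b) (X c) }
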